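/- **Setting.** Let $\gamma\in(0,1]$, $\nu\in\{0,1\}$, $T>0$, $\varepsilon_0>0$, $M_x>\sqrt2$, $M_y>\sqrt{1+\gamma^{-1/2}}$, and consider $$\dot x=\big(\gamma(y^3-y)+X(t,x,y,\varepsilon)\varepsilon\big)\varepsilon^\nu,\qquad \dot y=\big(-(x^3-x)+Y(t,x,y,\varepsilon)\varepsilon\big)\varepsilon^\nu, \tag{1}$$ where $X,Y$ are $T$-periodic in $t$ and, together with their derivatives in $(x,y,\varepsilon)$ up to order $3$, continuous for $t\in\mathbb R$, $|x|<M_x$, $|y|<M_y$, $0\le\varepsilon<\varepsilon_0$. If $\nu=0$, assume in addition that $\partial_\varepsilon^jX$ and $\partial_\varepsilon^jY$ at $\varepsilon=0$, $j=0,1,2$, are real analytic in $(x,y)$ uniformly in $t$, i.e. extend to functions continuous in $(t,x,y)$ and holomorphic in $(x,y)$ on a complex neighbourhood, independent of $t$, of the rectangle $|x|<M_x$, $|y|<M_y$. **Generating orbit.** Let $k,l\in\{0,\pm1\}$, $(k,l)\ne(0,\pm1)$, and let $(C,S)$ be the solution of $C'=\gamma(S^3-S)$, $S'=-(C^3-C)$,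 $C(0)=b$, $S(0)=l$, which is periodic with least period $\omega$. Here, with $r_{i}=\sqrt{1-\sqrt{1-\gamma}}$, $r_{e}=\sqrt{1+\sqrt{1-\gamma}}$, $M=\min\{\gamma(M_y^2-1)^2,(M_x^2-1)^2\}$: $b\in(0,r_i)\cup(r_e,\sqrt{1+\sqrt{M-\gamma}})$ if $k=l=0$; $kb\in(1,r_e)$ if $k=\pm1$, $l=0$; $kb\in(1,\sqrt{1+\sqrt\gamma})$ if $k,l=\pm1$. Put $C_k=C-k$, $S_l=S-l$, $\alpha=C'S_l-C_kS'$. The change $x=C(\varphi)+C_k(\varphi)r$, $y=S(\varphi)+S_l(\varphi)r$, $|r|<1$, turns (1) into $$\alpha\dot r=C'\dot y-S'\dot x,\qquad (1+r)\alpha\dot\varphi=S_l\dot x-C_k\dot y, \tag{2}$$ with $\dot x,\dot y$ given by the right-hand sides of (1). **Notation.** Let $R(t,\varphi,r,\varepsilon)=C'Y-S'X$ with $X,Y$ taken at $(t,C+C_kr,S+S_lr,\varepsilon)$; let $R^o,R_r^o,R_\varepsilon^o$ be $R,\partial_rR,\partial_\varepsilon R$ at $r=\varepsilon=0$, and $\Phi^o=\alpha^{-1}(S_lX-C_kY)$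 with $X,Y$ at $(t,C,S,0)$. Let $p=3\gamma CS((S^2-1)C_k^2-(C^2-1)S_l^2)$, $q=\alpha^{-2}(C_k^3(2C+k)+\gamma S_l^3(2S+l))$, $\beta(\varphi)=\int_0^\varphi\alpha^{-1}(\alpha'q-\alpha^{-1}p)\,ds$, $Z=\alpha^{-1}R_r^o-2\beta R^o+\alpha^{-1}\alpha'\Phi^o$. For $v(t,\varphi)$ let $\overline v$ be its average over $[0,T]\times[0,\omega]$, $\hat v(\varphi)=\frac1T\int_0^Tv\,dt-\overline v$ and $\tilde v=v-\overline v-\hat v$; a dot is $\partial_t$ and a prime is $\partial_\varphi$. *For $\nu=0$*: $\tilde g^0,\tilde h^0,\tilde f^0,\tilde\delta^0$ are the $T$-periodic in $t$, $\omega$-periodic and real analytic in $\varphi$, $C^1$ solutions with zero average of $\dot{\tilde g}^0+\tilde g^{0\prime}=R^o-\overline{R^o}$, $\ \dot{\tilde h}^0+\tilde h^{0\prime}=Z-\tilde g^{0\prime}q-L^0$, $\ \dot{\tilde f}^0+\tilde f^{0\prime}=g^0Z+R^o_\varepsilon-\tilde g^{0\prime}(\Phi^o+g^0q)$, $\ \dot{\tilde\delta}^0+\tilde\delta^{0\prime}=\Theta^0-\overline{\Theta^0}$,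 where $L^0=\overline Z-\overline{\tilde g^{0\prime}q}$, $g^0=\overline{g^0}+\tilde g^0$, $\overline{g^0}=(\overline{\tilde g^{0\prime}\Phi^o}-\overline{R^o_\varepsilon}-\overline{\tilde g^0(Z-\tilde g^{0\prime}q)})/L^0$, $\Theta^0=\Phi^o+qg^0$. Put $G=g^0$, $H=\tilde h^0$, $F=\tilde f^0$, $\Delta=\tilde\delta^0$. *For $\nu=1$*: let $L^1=\overline Z-\overline{\widehat{R^o}q}$; let $\hat g^1,\hat h^1,\hat f^1,\hat\delta^1$ be the $\omega$-periodic functions of $\varphi$ with zero average, and $\tilde g^1,\tilde h^1,\tilde f^1,\tilde\delta^1$ the two-periodic functions with zero average in $t$, such that $\hat g^{1\prime}=\widehat{R^o}$, $\dot{\tilde g}^1=\widetilde{R^o}$; $\hat h^{1\prime}=\hat w_h$, $\dot{\tilde h}^1=\tilde w_h$; $\hat f^{1\prime}=\hat w_f$, $\dot{\tilde f}^1=\tilde w_f$; $\hat\delta^{1\prime}=\widehat{\Theta^1}$, $\dot{\tilde\delta}^1=\widetilde{\Theta^1}$, where $w_h=Z-\widehat{R^o}q$, $\overline{g^1}=(\overline{\widehat{R^o}\Phi^o}-\overline{R^o_\varepsilon}-\overline{\hat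 g^1(Z-\widehat{R^o}q)})/L^1$, $w_f=(\overline{g^1}+\hat g^1)Z+R^o_\varepsilon-\tilde g^{1\prime}-\widehat{R^o}(\Phi^o+(\overline{g^1}+\hat g^1)q)$, $\Theta^1=\Phi^o+q(\overline{g^1}+\hat g^1)$. Put $G=\overline{g^1}+\hat g^1+\tilde g^1\varepsilon$, $H=\hat h^1+\tilde h^1\varepsilon$, $F=\hat f^1+\tilde f^1\varepsilon$, $\Delta=\hat\delta^1+\tilde\delta^1\varepsilon$. **Admissibility.** Assume $\overline{R^o}=0$ and $L^\nu\ne0$; if $\nu=0$, assume also that for some $K>0$, $\tau\ge1$, $|mT-n\omega|>K(m+n)^{-\tau}$ for all positive integers $m,n$; if $|k|+|l|=1$, assume also $\gamma\le0.806$ and $kb\in(b^-,b^+)$, where $b^-=1.01$ for $\gamma\le0.2$, $0.2\gamma+0.97$ for $0.2\le\gamma\le0.75$, $0.6\gamma+0.67$ for $\gamma\ge0.75$, and $b^+=r_e$ for $\gamma\le0.5$, $b^+=\sqrt{1+\frac12\sqrt{3.25-\gamma-3\gamma^2}}$ for $\gamma\ge0.5$. **Corollary 2.** If $\nu=0$,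 the functions $\tilde g^0,\tilde h^0,\tilde f^0,\tilde\delta^0$ exist. For each $\nu\in\{0,1\}$ there are $\varepsilon_1\in(0,\varepsilon_0]$ and functions $\Gamma(t,\psi,\varepsilon)$, $\Omega(t,\varphi,\varepsilon)$ such that, for $0<\varepsilon<\varepsilon_1$: $\varphi\mapsto\varphi+\Omega\varepsilon$ is the inverse of $\psi\mapsto\psi+\Delta(t,\psi,\varepsilon)\varepsilon$; $\Gamma$ is continuous on $\mathbb R^2\times[0,\varepsilon_1)$ and, for fixed $\varepsilon>0$, is $C^1$, $T$-periodic in $t$ and $\omega$-periodic in $\psi$; $v=\Gamma\varepsilon^{1/2}$ is an invariant surface of (2) written in the variables $(v,\psi)$ defined by $\varphi=\psi+\Delta\varepsilon$, $u=v\varepsilon^{3/2}$, $z=u+G\varepsilon+Hu\varepsilon+F\varepsilon^2$, $r=\alpha^{-1}(z+\beta z^2)$; and, with $Q=G\varepsilon+\big(F+\Gamma(t,\varphi+\Omega\varepsilon,\varepsilon)(1+H\varepsilon)\big)\varepsilon^2$, the corresponding surface $r=\Upsilon^\nu(t,\varphi,\varepsilon)=\alpha^{-1}(Q+\beta Q^2)$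 is a $C^1$, $T$-periodic in $t$, $\omega$-periodic in $\varphi$ invariant surface of (2). Uniformly in $(t,\varphi)$, as $\varepsilon\to0^+$, $$\Upsilon^0=\alpha^{-1}\Big(g^0\varepsilon+\big(\tilde f^0+\Gamma(t,\varphi,0)+\beta\,(g^0)^2\big)\varepsilon^2\Big)+O(\varepsilon^3),$$ $$\Upsilon^1=\alpha^{-1}\Big((\overline{g^1}+\hat g^1)\varepsilon+\big(\tilde g^1+\hat f^1+\Gamma(t,\varphi,0)+\beta\,(\overline{g^1}+\hat g^1)^2\big)\varepsilon^2\Big)+O(\varepsilon^3).$$ -/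

import Mathlib

open Set

noncomputable section

/-! ### The perturbed system -/

/-- The phase-parameter domain `|x| < Mx`, `|y| < My`, `0 ≤ ε < ε₀`. -/
def phaseDomain (Mx My ε₀ : ℝ) : Set (ℝ × ℝ × ℝ) :=
  Ioo (-Mx) Mx ×ˢ Ioo (-My) My ×ˢ Ico 0 ε₀

/-- `f(t,x,y,ε)` is continuous and of class `C³` in `(x,y,ε)` on a domain `D`: all derivatives in
`(x,y,ε)` up to order three exist and are continuous jointly in `(t,x,y,ε)`. -/
def IsC3InPhase (D : Set (ℝ × ℝ × ℝ)) (f : ℝ → ℝ → ℝ → ℝ → ℝ) : Prop :=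
  (∀ t, ContDiffOn ℝ 3 (fun p : ℝ × ℝ × ℝ => f t p.1 p.2.1 p.2.2) D) ∧
  ∀ m : ℕ, m ≤ 3 →
    ContinuousOn (fun w : ℝ × (ℝ × ℝ × ℝ) =>
      iteratedFDerivWithin ℝ m (fun p : ℝ × ℝ × ℝ => f w.1 p.1 p.2.1 p.2.2) D w.2) (univ ×ˢ D)

/-- The time-periodic system
`ẋ = (γ(y³ - y) + X ε) ε^ν`, `ẏ = (-(x³ - x) + Y ε) ε^ν`. -/
structure PerturbedSystem where
  γ : ℝ
  T : ℝ
  Mx : ℝ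
  My : ℝ
  ε₀ : ℝ
  X : ℝ → ℝ → ℝ → ℝ → ℝ
  Y : ℝ → ℝ → ℝ → ℝ → ℝ
  γ_pos : 0 < γ
  γ_le_one : γ ≤ 1
  T_pos : 0 < T
  ε₀_pos : 0 < ε₀
  Mx_gt : √2 < Mx
  My_gt : √(1 + (√γ)⁻¹) < My
  X_C3 : IsC3InPhase (phaseDomain Mx My ε₀) X
  Y_C3 : IsC3InPhase (phaseDomain Mx My ε₀) Y
  X_periodic : ∀ t x y ε, (x, y, ε) ∈ phaseDomain Mx My ε₀ → X (t + T) x y ε = X t x y ε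
  Y_periodic : ∀ t x y ε, (x, y, ε) ∈ phaseDomain Mx My ε₀ → Y (t + T) x y ε = Y t x y ε

/-- `f(t,x,y)` is real analytic in `(x,y)` on the rectangle `|x| < Mx`, `|y| < My`, uniformly with
respect to `t`: it has an extension, holomorphic in `(x,y)` on a complex neighbourhood of the
rectangle independent of `t`, which is continuous in all its arguments. -/
def IsAnalyticInXY (Mx My : ℝ) (f : ℝ → ℝ → ℝ → ℝ) : Prop :=
  ∃ (U : Set (ℂ × ℂ)) (F : ℝ → ℂ × ℂ → ℂ), IsOpen U ∧
    ContinuousOn (fun w : ℝ × (ℂ × ℂ) => F w.1 w.2) (univ ×ˢ U) ∧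
    (∀ t, DifferentiableOn ℂ (F t) U) ∧
    ∀ x ∈ Ioo (-Mx) Mx, ∀ y ∈ Ioo (-My) My,
      ((x : ℂ), (y : ℂ)) ∈ U ∧ ∀ t, F t ((x : ℂ), (y : ℂ)) = (f t x y : ℂ)

namespace PerturbedSystem

variable (P : PerturbedSystem)

/-- The functions `X`, `Y` and their first two (one-sided) `ε`-derivatives at `ε = 0` are real
analytic in `(x,y)`. -/
def AnalyticInPhase : Prop :=
  ∀ j : ℕ, j ≤ 2 →
    IsAnalyticInXY P.Mx P.My
      (fun t x y => iteratedDerivWithin j (fun ε => P.X t x y ε) (Ici 0) 0) ∧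
    IsAnalyticInXY P.Mx P.My
      (fun t x y => iteratedDerivWithin j (fun ε => P.Y t x y ε) (Ici 0) 0)

/-- Right-hand side of the equation for `x`. -/
def xdot (ν : ℕ) (ε t x y : ℝ) : ℝ := (P.γ * (y ^ 3 - y) + P.X t x y ε * ε) * ε ^ ν

/-- Right-hand side of the equation for `y`. -/
def ydot (ν : ℕ) (ε t x y : ℝ) : ℝ := (-(x ^ 3 - x) + P.Y t x y ε * ε) * ε ^ ν

def rInner : ℝ := √(1 - √(1 - P.γ))

def rOuter : ℝ := √(1 + √(1 - P.γ))

def rGamma : ℝ := √(1 + √P.γ)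

/-- The bound on the energy `a` of the closed orbits that comes from the domain of the system. -/
def energyBound : ℝ := min (P.γ * (P.My ^ 2 - 1) ^ 2) ((P.Mx ^ 2 - 1) ^ 2)

def rMax : ℝ := √(1 + √(P.energyBound - P.γ))

/-- Lower end of the interval of parameters used in the class `|k| + |l| = 1`. -/
def bMinus : ℝ :=
  if P.γ ≤ 0.2 then 1.01 else if P.γ ≤ 0.75 then 0.2 * P.γ + 0.97 else 0.6 * P.γ + 0.67

/-- Upper end of the interval of parameters used in the class `|k| + |l| = 1`. -/
def bPlus : ℝ :=
  if P.γ ≤ 0.5 then √(1 + √(1 - P.γ)) else √(1 + √(3.25 - P.γ - 3 * P.γ ^ 2) / 2)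

end PerturbedSystem

/-! ### The generating closed orbit -/

/-- A closed orbit of the unperturbed system `C' = γ(S³ - S)`, `S' = -(C³ - C)`, parametrized by the
solution with `C(0) = b`, `S(0) = l`, together with its least positive period `ω`. -/
structure GeneratingOrbit (P : PerturbedSystem) where
  k : ℤ
  l : ℤ
  b : ℝ
  C : ℝ → ℝ
  S : ℝ → ℝ
  ω : ℝ
  b_range :
    (k = 0 ∧ l = 0 ∧ (b ∈ Ioo 0 P.rInner ∨ b ∈ Ioo P.rOuter P.rMax)) ∨
    ((k = 1 ∨ k = -1) ∧ l = 0 ∧ (k : ℝ) * b ∈ Ioo 1 P.rOuter) ∨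
    ((k = 1 ∨ k = -1) ∧ (l = 1 ∨ l = -1) ∧ (k : ℝ) * b ∈ Ioo 1 P.rGamma)
  C_deriv : ∀ φ, HasDerivAt C (P.γ * (S φ ^ 3 - S φ)) φ
  S_deriv : ∀ φ, HasDerivAt S (-(C φ ^ 3 - C φ)) φ
  C_zero : C 0 = b
  S_zero : S 0 = l
  ω_pos : 0 < ω
  C_periodic : Function.Periodic C ω
  S_periodic : Function.Periodic S ω
  ω_least : ∀ c, 0 < c → Function.Periodic C c → Function.Periodic S c → ω ≤ c

/-! ### Two-periodic functions -/

/-- The average of `v(t,φ)` over the periods `T` in `t` and `ω` in `φ`. -/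
def average (T ω : ℝ) (v : ℝ → ℝ → ℝ) : ℝ :=
  (1 / (ω * T)) * ∫ φ in (0 : ℝ)..ω, ∫ t in (0 : ℝ)..T, v t φ

/-- The `t`-average of `v`, minus its full average. -/
def hatPart (T ω : ℝ) (v : ℝ → ℝ → ℝ) (φ : ℝ) : ℝ :=
  (1 / T) * (∫ t in (0 : ℝ)..T, v t φ) - average T ω v

/-- The part of `v` with zero `t`-average. -/
def tildePart (T ω : ℝ) (v : ℝ → ℝ → ℝ) (t φ : ℝ) : ℝ :=
  v t φ - average T ω v - hatPart T ω v φ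

/-- The primitive in `t` of `v` with zero `t`-average. -/
def primitiveT (T : ℝ) (v : ℝ → ℝ → ℝ) (t φ : ℝ) : ℝ :=
  (∫ s in (0 : ℝ)..t, v s φ) - (1 / T) * ∫ τ in (0 : ℝ)..T, ∫ s in (0 : ℝ)..τ, v s φ

/-- The primitive of `v` with zero average over the period `ω`. -/
def primitiveφ (ω : ℝ) (v : ℝ → ℝ) (φ : ℝ) : ℝ :=
  (∫ s in (0 : ℝ)..φ, v s) - (1 / ω) * ∫ θ in (0 : ℝ)..ω, ∫ s in (0 : ℝ)..θ, v s

/-- `ζ` is a two-periodic solution with zero average, real analytic in `φ`, of the equation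
`∂ζ/∂t + ∂ζ/∂φ = v`. -/
structure IsTransportSolution (T ω : ℝ) (v ζ : ℝ → ℝ → ℝ) : Prop where
  contDiff : ContDiff ℝ 1 (fun p : ℝ × ℝ => ζ p.1 p.2)
  analytic : ∀ t, AnalyticOnNhd ℝ (ζ t) univ
  periodic_t : ∀ t φ, ζ (t + T) φ = ζ t φ
  periodic_φ : ∀ t φ, ζ t (φ + ω) = ζ t φ
  average_zero : average T ω ζ = 0
  equation : ∀ t φ, deriv (fun s => ζ s φ) t + deriv (fun θ => ζ t θ) φ = v t φ

/-- The two-periodic zero-average solution of `∂ζ/∂t + ∂ζ/∂φ = v` (it is unique when `T / ω` is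
irrational). -/
def transportSolution (T ω : ℝ) (v : ℝ → ℝ → ℝ) : ℝ → ℝ → ℝ :=
  Classical.epsilon (IsTransportSolution T ω v)

/-- The Siegel condition on the two periods. -/
def SiegelCondition (T ω : ℝ) : Prop :=
  ∃ K τ : ℝ, 0 < K ∧ 1 ≤ τ ∧ ∀ p q : ℕ, 0 < p → 0 < q →
    K * ((p : ℝ) + q) ^ (-τ) < |p * T - q * ω|

namespace GeneratingOrbit

variable {P : PerturbedSystem} (O : GeneratingOrbit P)

/-! ### Special polar coordinates `x = C + (C - k) r`, `y = S + (S - l) r` -/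

def Ck (φ : ℝ) : ℝ := O.C φ - O.k

def Sl (φ : ℝ) : ℝ := O.S φ - O.l

def xPolar (φ r : ℝ) : ℝ := O.C φ + O.Ck φ * r

def yPolar (φ r : ℝ) : ℝ := O.S φ + O.Sl φ * r

def α (φ : ℝ) : ℝ := deriv O.C φ * O.Sl φ - O.Ck φ * deriv O.S φ

/-- Right-hand side of the equation for `r` in polar coordinates. -/
def rdot (ν : ℕ) (ε t r φ : ℝ) : ℝ :=
  (O.α φ)⁻¹ * (deriv O.C φ * P.ydot ν ε t (O.xPolar φ r) (O.yPolar φ r)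
    - deriv O.S φ * P.xdot ν ε t (O.xPolar φ r) (O.yPolar φ r))

/-- Right-hand side of the equation for `φ` in polar coordinates. -/
def φdot (ν : ℕ) (ε t r φ : ℝ) : ℝ :=
  (O.α φ)⁻¹ * (1 + r)⁻¹ * (O.Sl φ * P.xdot ν ε t (O.xPolar φ r) (O.yPolar φ r)
    - O.Ck φ * P.ydot ν ε t (O.xPolar φ r) (O.yPolar φ r))

/-- `(r(t), φ(t))` is a solution, defined for all times, of the system in polar coordinates; it
stays in the region `|r| < 1` and in the domain of the perturbed system. -/
def IsPolarSolution (ν : ℕ) (ε : ℝ) (r φ : ℝ → ℝ) : Prop :=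
  ∀ t, |r t| < 1 ∧ |O.xPolar (φ t) (r t)| < P.Mx ∧ |O.yPolar (φ t) (r t)| < P.My ∧
    HasDerivAt r (O.rdot ν ε t (r t) (φ t)) t ∧ HasDerivAt φ (O.φdot ν ε t (r t) (φ t)) t

/-- `r = Υ(t,φ)` is an invariant surface of the system in polar coordinates: the solution through
each of its points exists for all times and stays on it. -/
def IsInvariantSurface (ν : ℕ) (ε : ℝ) (Υ : ℝ → ℝ → ℝ) : Prop :=
  ∀ t₀ φ₀, ∃ φ : ℝ → ℝ, φ t₀ = φ₀ ∧ O.IsPolarSolution ν ε (fun t => Υ t (φ t)) φ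

/-- `v(t,φ)` is continuous, continuously differentiable, `T`-periodic in `t`, `ω`-periodic in `φ`. -/
def IsC1TwoPeriodic (v : ℝ → ℝ → ℝ) : Prop :=
  ContDiff ℝ 1 (fun p : ℝ × ℝ => v p.1 p.2) ∧
    (∀ t φ, v (t + P.T) φ = v t φ) ∧ ∀ t φ, v t (φ + O.ω) = v t φ

def R (t φ r ε : ℝ) : ℝ :=
  deriv O.C φ * P.Y t (O.xPolar φ r) (O.yPolar φ r) ε
    - deriv O.S φ * P.X t (O.xPolar φ r) (O.yPolar φ r) ε

/-- `R` at `r = ε = 0`. -/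
def Ro (t φ : ℝ) : ℝ := O.R t φ 0 0

/-- `∂R/∂r` at `r = ε = 0`. -/
def RrO (t φ : ℝ) : ℝ := deriv (fun r => O.R t φ r 0) 0

/-- `∂R/∂ε` at `r = ε = 0` (one-sided, since `ε ≥ 0`). -/
def RεO (t φ : ℝ) : ℝ := derivWithin (fun ε => O.R t φ 0 ε) (Ici 0) 0

def Φo (t φ : ℝ) : ℝ :=
  (O.α φ)⁻¹ * (O.Sl φ * P.X t (O.C φ) (O.S φ) 0 - O.Ck φ * P.Y t (O.C φ) (O.S φ) 0)

def p (φ : ℝ) : ℝ :=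
  3 * P.γ * O.C φ * O.S φ *
    ((O.S φ ^ 2 - 1) * O.Ck φ ^ 2 - (O.C φ ^ 2 - 1) * O.Sl φ ^ 2)

def q (φ : ℝ) : ℝ :=
  (O.α φ ^ 2)⁻¹ *
    (O.Ck φ ^ 3 * (2 * O.C φ + O.k) + P.γ * O.Sl φ ^ 3 * (2 * O.S φ + O.l))

def ξ (φ : ℝ) : ℝ := (O.α φ)⁻¹ * (deriv O.α φ * O.q φ - (O.α φ)⁻¹ * O.p φ)

def β (φ : ℝ) : ℝ := ∫ s in (0 : ℝ)..φ, O.ξ s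

def Z (t φ : ℝ) : ℝ :=
  (O.α φ)⁻¹ * O.RrO t φ - 2 * O.β φ * O.Ro t φ + (O.α φ)⁻¹ * deriv O.α φ * O.Φo t φ

/-- The average over both periods. -/
def avg (v : ℝ → ℝ → ℝ) : ℝ := average P.T O.ω v

def hat (v : ℝ → ℝ → ℝ) : ℝ → ℝ := hatPart P.T O.ω v

def tilde (v : ℝ → ℝ → ℝ) : ℝ → ℝ → ℝ := tildePart P.T O.ω v

/-! ### Averaging functions for `ν = 0` -/

def rhsG0 (t φ : ℝ) : ℝ := O.Ro t φ - O.avg O.Ro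

def gTilde0 : ℝ → ℝ → ℝ := transportSolution P.T O.ω O.rhsG0

/-- The `φ`-derivative of `g⁰` (which differs from `gTilde0` by a constant). -/
def gPrime0 (t φ : ℝ) : ℝ := deriv (fun θ => O.gTilde0 t θ) φ

def L0 : ℝ := O.avg O.Z - O.avg (fun t φ => O.gPrime0 t φ * O.q φ)

def gBar0 : ℝ :=
  (O.avg (fun t φ => O.gPrime0 t φ * O.Φo t φ) - O.avg O.RεO
    - O.avg (fun t φ => O.gTilde0 t φ * (O.Z t φ - O.gPrime0 t φ * O.q φ))) / O.L0

def g0 (t φ : ℝ) : ℝ := O.gBar0 + O.gTilde0 t φ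

def rhsH0 (t φ : ℝ) : ℝ := O.Z t φ - O.gPrime0 t φ * O.q φ - O.L0

def hTilde0 : ℝ → ℝ → ℝ := transportSolution P.T O.ω O.rhsH0

def rhsF0 (t φ : ℝ) : ℝ :=
  O.g0 t φ * O.Z t φ + O.RεO t φ - O.gPrime0 t φ * (O.Φo t φ + O.g0 t φ * O.q φ)

def fTilde0 : ℝ → ℝ → ℝ := transportSolution P.T O.ω O.rhsF0

def Θ0 (t φ : ℝ) : ℝ := O.Φo t φ + O.q φ * O.g0 t φ

def rhsδ0 (t φ : ℝ) : ℝ := O.Θ0 t φ - O.avg O.Θ0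

def δTilde0 : ℝ → ℝ → ℝ := transportSolution P.T O.ω O.rhsδ0

/-! ### Averaging functions for `ν = 1` -/

def RHat (φ : ℝ) : ℝ := O.hat O.Ro φ

def L1 : ℝ := O.avg O.Z - O.avg (fun _ φ => O.RHat φ * O.q φ)

def gHat1 : ℝ → ℝ := primitiveφ O.ω O.RHat

def gBar1 : ℝ :=
  (O.avg (fun t φ => O.RHat φ * O.Φo t φ) - O.avg O.RεO
    - O.avg (fun t φ => O.gHat1 φ * (O.Z t φ - O.RHat φ * O.q φ))) / O.L1

def gTilde1 : ℝ → ℝ → ℝ := primitiveT P.T (O.tilde O.Ro)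

def rhsH1 (t φ : ℝ) : ℝ := O.Z t φ - O.RHat φ * O.q φ

def hHat1 : ℝ → ℝ := primitiveφ O.ω (O.hat O.rhsH1)

def hTilde1 : ℝ → ℝ → ℝ := primitiveT P.T (O.tilde O.rhsH1)

def rhsF1 (t φ : ℝ) : ℝ :=
  (O.gBar1 + O.gHat1 φ) * O.Z t φ + O.RεO t φ - deriv (fun θ => O.gTilde1 t θ) φ
    - O.RHat φ * (O.Φo t φ + (O.gBar1 + O.gHat1 φ) * O.q φ)

def fHat1 : ℝ → ℝ := primitiveφ O.ω (O.hat O.rhsF1)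

def fTilde1 : ℝ → ℝ → ℝ := primitiveT P.T (O.tilde O.rhsF1)

def Θ1 (t φ : ℝ) : ℝ := O.Φo t φ + O.q φ * (O.gBar1 + O.gHat1 φ)

def δHat1 : ℝ → ℝ := primitiveφ O.ω (O.hat O.Θ1)

def δTilde1 : ℝ → ℝ → ℝ := primitiveT P.T (O.tilde O.Θ1)

/-! ### The coefficients of the averaging changes, for both values of `ν` -/

def G (ν : ℕ) (t φ ε : ℝ) : ℝ :=
  if ν = 0 then O.g0 t φ else O.gBar1 + O.gHat1 φ + O.gTilde1 t φ * ε

def H (ν : ℕ) (t φ ε : ℝ) : ℝ :=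
  if ν = 0 then O.hTilde0 t φ else O.hHat1 φ + O.hTilde1 t φ * ε

def F (ν : ℕ) (t φ ε : ℝ) : ℝ :=
  if ν = 0 then O.fTilde0 t φ else O.fHat1 φ + O.fTilde1 t φ * ε

def Δ (ν : ℕ) (t ψ ε : ℝ) : ℝ :=
  if ν = 0 then O.δTilde0 t ψ else O.δHat1 ψ + O.δTilde1 t ψ * ε

/-! ### Admissibility -/

/-- The part of admissibility common to both values of `ν`: the generating equation, and the
restriction on the parameters in the class `|k| + |l| = 1`. -/
def GeneratingCondition : Prop :=
  O.avg O.Ro = 0 ∧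
    (|O.k| + |O.l| = 1 → P.γ ≤ 0.806 ∧ (O.k : ℝ) * O.b ∈ Ioo P.bMinus P.bPlus)

def Admissible0 : Prop :=
  O.GeneratingCondition ∧ SiegelCondition P.T O.ω ∧ O.L0 ≠ 0

def Admissible1 : Prop :=
  O.GeneratingCondition ∧ O.L1 ≠ 0

/-! ### The invariant surface -/

/-- The angle `φ` as a function of the averaged angle `ψ`. -/
def angleChange (ν : ℕ) (ε t ψ : ℝ) : ℝ := ψ + O.Δ ν t ψ ε * ε

/-- The composition of the changes `u = v ε^{3/2}`, `z = u + G ε + H u ε + F ε²`,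
`r = α⁻¹ (z + β z²)`, at the angle `φ`. -/
def radiusChange (ν : ℕ) (ε t v φ : ℝ) : ℝ :=
  let u := v * ε ^ (3 / 2 : ℝ)
  let z := u + O.G ν t φ ε * ε + O.H ν t φ ε * u * ε + O.F ν t φ ε * ε ^ 2
  (O.α φ)⁻¹ * (z + O.β φ * z ^ 2)

/-- `v = V(t,ψ)` is an invariant surface of the system in the averaged coordinates `(v,ψ)`: that
system is the polar one rewritten through `angleChange` and `radiusChange`, so that its solutions
are the curves whose images solve the polar system. -/
def IsAveragedInvariantSurface (ν : ℕ) (ε : ℝ) (V : ℝ → ℝ → ℝ) : Prop :=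
  ∀ t₀ ψ₀, ∃ ψ : ℝ → ℝ, ψ t₀ = ψ₀ ∧ Differentiable ℝ ψ ∧
    O.IsPolarSolution ν ε
      (fun t => O.radiusChange ν ε t (V t (ψ t)) (O.angleChange ν ε t (ψ t)))
      (fun t => O.angleChange ν ε t (ψ t))

def Q (ν : ℕ) (Γ Ω : ℝ → ℝ → ℝ → ℝ) (t φ ε : ℝ) : ℝ :=
  O.G ν t φ ε * ε +
    (O.F ν t φ ε + Γ t (φ + Ω t φ ε * ε) ε * (1 + O.H ν t φ ε * ε)) * ε ^ 2

def Υ (ν : ℕ) (Γ Ω : ℝ → ℝ → ℝ → ℝ) (t φ ε : ℝ) : ℝ :=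
  (O.α φ)⁻¹ * (O.Q ν Γ Ω t φ ε + O.β φ * O.Q ν Γ Ω t φ ε ^ 2)

/-- For `0 < ε < ε₁`, `φ ↦ φ + Ω(t,φ,ε) ε` is the inverse of the angular change, and
`v = Γ(t,ψ,ε) ε^{1/2}` is an invariant surface in the averaged coordinates; `Γ` is continuous up to
`ε = 0`, and continuously differentiable and two-periodic in `(t,ψ)`. -/
structure IsAveragedFamily (ν : ℕ) (ε₁ : ℝ) (Γ Ω : ℝ → ℝ → ℝ → ℝ) : Prop where
  leftInverse : ∀ ε ∈ Ioo 0 ε₁, ∀ t,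
    Function.LeftInverse (fun φ => φ + Ω t φ ε * ε) (O.angleChange ν ε t)
  rightInverse : ∀ ε ∈ Ioo 0 ε₁, ∀ t,
    Function.RightInverse (fun φ => φ + Ω t φ ε * ε) (O.angleChange ν ε t)
  continuous : ContinuousOn (fun w : ℝ × ℝ × ℝ => Γ w.1 w.2.1 w.2.2) (univ ×ˢ univ ×ˢ Ico 0 ε₁)
  regular : ∀ ε ∈ Ioo 0 ε₁, O.IsC1TwoPeriodic (fun t ψ => Γ t ψ ε)
  invariant : ∀ ε ∈ Ioo 0 ε₁,
    O.IsAveragedInvariantSurface ν ε (fun t ψ => Γ t ψ ε * ε ^ (1 / 2 : ℝ))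

end GeneratingOrbit

end

noncomputable section

open MeasureTheory Filter Topology

local notation "Plane" => ℝ × ℝ
local notation "Space" => ℝ × ℝ × ℝ

/-! ### Tempered solutions of hyperbolic integral equations -/

/-- `(χ, w)` solves `χ' = g`, `χ(0) = 0`, `w' = w + f`, both functions being of growth at most
`exp (|τ| / 2)`. -/
structure IsTemperedSolution (f g : ℝ → ℝ → ℝ → ℝ) (χ w : ℝ → ℝ) : Prop where
  continuous_χ : Continuous χ
  continuous_w : Continuous w
  growth : ∃ M, ∀ τ, |χ τ| ≤ M * Real.exp (|τ| / 2) ∧ |w τ| ≤ M * Real.exp (|τ| / 2)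
  eq_w : ∀ τ, w τ = -∫ σ in Ioi (0 : ℝ), Real.exp (-σ) * f (τ + σ) (χ (τ + σ)) (w (τ + σ))
  eq_χ : ∀ τ, χ τ = ∫ s in (0 : ℝ)..τ, g s (χ s) (w s)

lemma exp_half_abs_add_le (τ σ : ℝ) (hσ : 0 < σ) :
    Real.exp (-σ) * Real.exp (|τ + σ| / 2) ≤ Real.exp (|τ| / 2) * Real.exp (-(1 / 2) * σ) := by
  rw [← Real.exp_add, ← Real.exp_add]
  apply Real.exp_le_exp.2
  have := abs_add_le τ σ
  rw [abs_of_pos hσ] at this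
  linarith

lemma nonneg_of_growth {F : ℝ → ℝ} {N : ℝ} (hF : ∀ s, |F s| ≤ N * Real.exp (|s| / 2)) : 0 ≤ N := by
  simpa using (abs_nonneg _).trans (hF 0)

lemma integral_exp_half : ∫ σ in Ioi (0 : ℝ), Real.exp (-(1 / 2) * σ) = 2 := by
  rw [integral_exp_mul_Ioi (by norm_num)]
  norm_num

lemma integrableOn_const_mul_exp_half (c : ℝ) :
    IntegrableOn (fun σ : ℝ => c * Real.exp (-(1 / 2) * σ)) (Ioi 0) :=
  (integrableOn_exp_mul_Ioi (by norm_num) 0).const_mul _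

lemma norm_exp_neg_mul_le {F : ℝ → ℝ} {N : ℝ} (hF : ∀ s, |F s| ≤ N * Real.exp (|s| / 2))
    (τ : ℝ) {σ : ℝ} (hσ : 0 < σ) :
    ‖Real.exp (-σ) * F (τ + σ)‖ ≤ N * Real.exp (|τ| / 2) * Real.exp (-(1 / 2) * σ) := by
  rw [Real.norm_eq_abs, abs_mul, abs_of_pos (Real.exp_pos _)]
  calc Real.exp (-σ) * |F (τ + σ)| ≤ Real.exp (-σ) * (N * Real.exp (|τ + σ| / 2)) :=
        mul_le_mul_of_nonneg_left (hF _) (Real.exp_pos _).le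
    _ = N * (Real.exp (-σ) * Real.exp (|τ + σ| / 2)) := by ring
    _ ≤ N * (Real.exp (|τ| / 2) * Real.exp (-(1 / 2) * σ)) :=
        mul_le_mul_of_nonneg_left (exp_half_abs_add_le τ σ hσ) (nonneg_of_growth hF)
    _ = _ := by ring

lemma abs_integral_tail_le {F : ℝ → ℝ} {N : ℝ} (hF : ∀ s, |F s| ≤ N * Real.exp (|s| / 2)) (τ : ℝ) :
    |∫ σ in Ioi (0 : ℝ), Real.exp (-σ) * F (τ + σ)| ≤ 2 * N * Real.exp (|τ| / 2) := by
  have h : ∀ᵐ σ ∂volume.restrict (Ioi (0 : ℝ)), ‖Real.exp (-σ) * F (τ + σ)‖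
      ≤ N * Real.exp (|τ| / 2) * Real.exp (-(1 / 2) * σ) := by
    filter_upwards [ae_restrict_mem measurableSet_Ioi] with σ hσ
    exact norm_exp_neg_mul_le hF τ hσ
  have := norm_integral_le_of_norm_le (integrableOn_const_mul_exp_half _) h
  rw [integral_const_mul, integral_exp_half, Real.norm_eq_abs] at this
  linarith

lemma integrableOn_tail {F : ℝ → ℝ} (hc : Continuous F) {N : ℝ}
    (hF : ∀ s, |F s| ≤ N * Real.exp (|s| / 2)) (τ : ℝ) :
    IntegrableOn (fun σ => Real.exp (-σ) * F (τ + σ)) (Ioi 0) := by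
  refine (integrableOn_const_mul_exp_half (N * Real.exp (|τ| / 2))).mono' (by fun_prop) ?_
  filter_upwards [ae_restrict_mem measurableSet_Ioi] with σ hσ
  exact norm_exp_neg_mul_le hF τ hσ

lemma abs_integral_zero_le_of_nonneg {F : ℝ → ℝ} {N : ℝ}
    (hF : ∀ s, |F s| ≤ N * Real.exp (|s| / 2)) {τ : ℝ} (hτ : 0 ≤ τ) :
    |∫ s in (0 : ℝ)..τ, F s| ≤ 2 * N * Real.exp (|τ| / 2) := by
  have h := intervalIntegral.norm_integral_le_of_norm_le (μ := volume) hτ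
    (f := F) (g := fun s => N * Real.exp ((1 / 2) * s))
    (Eventually.of_forall fun s hs => by
      have := hF s
      rw [abs_of_pos hs.1] at this
      rw [Real.norm_eq_abs]
      convert this using 3; ring)
    (Continuous.intervalIntegrable (by fun_prop) _ _)
  rw [intervalIntegral.integral_const_mul,
    intervalIntegral.integral_comp_mul_left (fun x => Real.exp x) (by norm_num), integral_exp,
    Real.norm_eq_abs] at h
  refine h.trans ?_
  rw [abs_of_nonneg hτ]
  have h2 : Real.exp ((1 / 2) * τ) = Real.exp (τ / 2) := by congr 1; ring
  rw [h2, smul_eq_mul]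
  have h3 : 0 ≤ N * Real.exp (1 / 2 * 0) := mul_nonneg (nonneg_of_growth hF) (Real.exp_pos _).le
  norm_num at h3 ⊢
  nlinarith

lemma abs_integral_zero_le {F : ℝ → ℝ} {N : ℝ}
    (hF : ∀ s, |F s| ≤ N * Real.exp (|s| / 2)) (τ : ℝ) :
    |∫ s in (0 : ℝ)..τ, F s| ≤ 2 * N * Real.exp (|τ| / 2) := by
  rcases le_total 0 τ with hτ | hτ
  · exact abs_integral_zero_le_of_nonneg hF hτ
  · have h := abs_integral_zero_le_of_nonneg (F := fun s => F (-s)) (N := N)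
      (fun s => by simpa using hF (-s)) (neg_nonneg.2 hτ)
    rw [intervalIntegral.integral_comp_neg, intervalIntegral.integral_symm] at h
    simpa using h

section Uniqueness

variable {f g : ℝ → ℝ → ℝ → ℝ} {κ η : ℝ}

lemma growth_of_lipschitz {B M : ℝ} (hκ : 0 ≤ κ) (hη : 0 ≤ η)
    (hf : ∀ τ χ w χ' w', |f τ χ w - f τ χ' w'| ≤ κ * |χ - χ'| + η * |w - w'|)
    (hf0 : ∀ τ, |f τ 0 0| ≤ B) {χ w : ℝ → ℝ}
    (hM : ∀ τ, |χ τ| ≤ M * Real.exp (|τ| / 2) ∧ |w τ| ≤ M * Real.exp (|τ| / 2)) (s : ℝ) :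
    |f s (χ s) (w s)| ≤ (B + κ * M + η * M) * Real.exp (|s| / 2) := by
  have h1 := hf s (χ s) (w s) 0 0
  have h2 := hf0 s
  have h3 := abs_sub_abs_le_abs_sub (f s (χ s) (w s)) (f s 0 0)
  rw [sub_zero, sub_zero] at h1
  have h4 : 1 ≤ Real.exp (|s| / 2) := Real.one_le_exp (by positivity)
  have h5 : B ≤ B * Real.exp (|s| / 2) := le_mul_of_one_le_right ((abs_nonneg _).trans h2) h4
  have h6 := mul_le_mul_of_nonneg_left (hM s).1 hκ
  have h7 := mul_le_mul_of_nonneg_left (hM s).2 hη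
  linarith

lemma tempered_sub_halves (hκ : 1 ≤ κ) (hη : 0 ≤ η) (hηκ : η * (1 + 8 * κ) ≤ 1 / 8)
    (hf : ∀ τ χ w χ' w', |f τ χ w - f τ χ' w'| ≤ κ * |χ - χ'| + η * |w - w'|)
    (hg : ∀ τ χ w χ' w', |g τ χ w - g τ χ' w'| ≤ η * (|χ - χ'| + |w - w'|))
    {χ w χ' w' : ℝ → ℝ} {M : ℝ}
    (h1 : ∀ τ, 8 * κ * |χ τ - χ' τ| ≤ M * Real.exp (|τ| / 2))
    (h2 : ∀ τ, |w τ - w' τ| ≤ M * Real.exp (|τ| / 2)) :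
    (∀ s, |f s (χ s) (w s) - f s (χ' s) (w' s)| ≤ M / 4 * Real.exp (|s| / 2)) ∧
    (∀ s, |g s (χ s) (w s) - g s (χ' s) (w' s)| ≤ M / (32 * κ) * Real.exp (|s| / 2)) := by
  have hη8 : η ≤ 1 / 8 := by nlinarith
  constructor
  · intro s
    have a1 := hf s (χ s) (w s) (χ' s) (w' s)
    have a2 : η * |w s - w' s| ≤ 1 / 8 * (M * Real.exp (|s| / 2)) :=
      mul_le_mul hη8 (h2 s) (abs_nonneg _) (by norm_num)
    have := h1 s
    linarith
  · intro s
    have a1 := hg s (χ s) (w s) (χ' s) (w' s)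
    have hM := (abs_nonneg _).trans (h2 s)
    have a2 : 8 * κ * (|χ s - χ' s| + |w s - w' s|) ≤ (1 + 8 * κ) * (M * Real.exp (|s| / 2)) := by
      have := mul_le_mul_of_nonneg_left (h2 s) (show 0 ≤ 8 * κ by linarith)
      linarith [h1 s]
    have a3 := mul_le_mul_of_nonneg_left a2 hη
    have a4 := mul_le_mul_of_nonneg_right hηκ hM
    have a5 : 8 * κ * |g s (χ s) (w s) - g s (χ' s) (w' s)| ≤ 1 / 8 * (M * Real.exp (|s| / 2)) := by
      have := mul_le_mul_of_nonneg_left a1 (show 0 ≤ 8 * κ by linarith)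
      linarith
    have hκ0 : 0 < κ := by linarith
    rw [div_mul_eq_mul_div, le_div_iff₀ (by positivity)]
    linarith

theorem IsTemperedSolution.unique (hκ : 1 ≤ κ) (hη : 0 ≤ η) (hηκ : η * (1 + 8 * κ) ≤ 1 / 8)
    (hfc : Continuous fun q : Space => f q.1 q.2.1 q.2.2)
    (hgc : Continuous fun q : Space => g q.1 q.2.1 q.2.2)
    (hf : ∀ τ χ w χ' w', |f τ χ w - f τ χ' w'| ≤ κ * |χ - χ'| + η * |w - w'|)
    (hg : ∀ τ χ w χ' w', |g τ χ w - g τ χ' w'| ≤ η * (|χ - χ'| + |w - w'|))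
    {B : ℝ} (hf0 : ∀ τ, |f τ 0 0| ≤ B)
    {χ w χ' w' : ℝ → ℝ} (h : IsTemperedSolution f g χ w) (h' : IsTemperedSolution f g χ' w') :
    χ = χ' ∧ w = w' := by
  have hκ0 : 0 < κ := by linarith
  obtain ⟨M, hM⟩ := h.growth
  obtain ⟨M', hM'⟩ := h'.growth
  have cχ := h.continuous_χ
  have cw := h.continuous_w
  have cχ' := h'.continuous_χ
  have cw' := h'.continuous_w
  have step : ∀ N : ℝ, (∀ τ, 8 * κ * |χ τ - χ' τ| ≤ N * Real.exp (|τ| / 2)) →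
      (∀ τ, |w τ - w' τ| ≤ N * Real.exp (|τ| / 2)) →
      (∀ τ, 8 * κ * |χ τ - χ' τ| ≤ N / 2 * Real.exp (|τ| / 2)) ∧
      (∀ τ, |w τ - w' τ| ≤ N / 2 * Real.exp (|τ| / 2)) := by
    intro N h1 h2
    obtain ⟨b1, b2⟩ := tempered_sub_halves hκ hη hηκ hf hg h1 h2
    constructor
    · intro τ
      have e : χ τ - χ' τ = ∫ s in (0 : ℝ)..τ, (g s (χ s) (w s) - g s (χ' s) (w' s)) := by
        rw [intervalIntegral.integral_sub, ← h.eq_χ, ← h'.eq_χ]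
        · exact Continuous.intervalIntegrable (by fun_prop) _ _
        · exact Continuous.intervalIntegrable (by fun_prop) _ _
      have := abs_integral_zero_le b2 τ
      rw [← e] at this
      have h3 := mul_le_mul_of_nonneg_left this (show 0 ≤ 8 * κ by linarith)
      refine h3.trans (le_of_eq ?_)
      field_simp
      ring
    · intro τ
      have e : w τ - w' τ = -∫ σ in Ioi (0 : ℝ), Real.exp (-σ) *
          ((fun s => f s (χ s) (w s) - f s (χ' s) (w' s)) (τ + σ)) := by
        have i1 := integrableOn_tail (F := fun s => f s (χ s) (w s)) (by fun_prop)
          (growth_of_lipschitz hκ0.le hη hf hf0 hM) τ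
        have i2 := integrableOn_tail (F := fun s => f s (χ' s) (w' s)) (by fun_prop)
          (growth_of_lipschitz hκ0.le hη hf hf0 hM') τ
        simp only [mul_sub]
        rw [integral_sub i1 i2, h.eq_w, h'.eq_w]
        ring
      rw [e, abs_neg]
      refine (abs_integral_tail_le b1 τ).trans (le_of_eq ?_)
      ring
  have start : ∃ N : ℝ, (∀ τ, 8 * κ * |χ τ - χ' τ| ≤ N * Real.exp (|τ| / 2)) ∧
      (∀ τ, |w τ - w' τ| ≤ N * Real.exp (|τ| / 2)) := by
    refine ⟨8 * κ * (M + M'), fun τ => ?_, fun τ => ?_⟩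
    · have := abs_sub (χ τ) (χ' τ)
      have h3 : |χ τ - χ' τ| ≤ (M + M') * Real.exp (|τ| / 2) := by linarith [(hM τ).1, (hM' τ).1]
      have := mul_le_mul_of_nonneg_left h3 (show 0 ≤ 8 * κ by linarith)
      linarith
    · have := abs_sub (w τ) (w' τ)
      have h3 : |w τ - w' τ| ≤ (M + M') * Real.exp (|τ| / 2) := by linarith [(hM τ).2, (hM' τ).2]
      have h0 : 0 ≤ (M + M') * Real.exp (|τ| / 2) := (abs_nonneg _).trans h3
      nlinarith
  obtain ⟨N, hN1, hN2⟩ := start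
  have iter : ∀ n : ℕ, (∀ τ, 8 * κ * |χ τ - χ' τ| ≤ N * (1 / 2) ^ n * Real.exp (|τ| / 2)) ∧
      (∀ τ, |w τ - w' τ| ≤ N * (1 / 2) ^ n * Real.exp (|τ| / 2)) := by
    intro n
    induction n with
    | zero => simpa using ⟨hN1, hN2⟩
    | succ n ih =>
      have := step _ ih.1 ih.2
      have e : N * (1 / 2) ^ (n + 1) = N * (1 / 2) ^ n / 2 := by ring
      rw [e]; exact this
  have lim : ∀ τ, Tendsto (fun n : ℕ => N * (1 / 2 : ℝ) ^ n * Real.exp (|τ| / 2)) atTop (𝓝 0) := by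
    intro τ
    have := (tendsto_pow_atTop_nhds_zero_of_lt_one (r := (1 / 2 : ℝ)) (by norm_num) (by norm_num))
    simpa using (this.const_mul N).mul_const (Real.exp (|τ| / 2))
  constructor
  · funext τ
    have h0 := ge_of_tendsto' (lim τ) (fun n => (iter n).1 τ)
    have : |χ τ - χ' τ| ≤ 0 := by
      by_contra hh; push Not at hh
      nlinarith
    exact sub_eq_zero.1 (abs_nonpos_iff.1 this)
  · funext τ
    have h0 := ge_of_tendsto' (lim τ) (fun n => (iter n).2 τ)
    exact sub_eq_zero.1 (abs_nonpos_iff.1 h0)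

end Uniqueness

section Existence

variable {P : Type*} [TopologicalSpace P] [FirstCountableTopology P] {f g : P → ℝ → ℝ → ℝ → ℝ}
  {κ η : ℝ}

lemma continuous_weighted_tail {F : P → ℝ → ℝ} (hF : Continuous fun q : P × ℝ => F q.1 q.2) {N : ℝ}
    (hN : ∀ p s, |F p s| ≤ N * Real.exp (|s| / 2)) :
    Continuous fun q : P × ℝ => Real.exp (-(|q.2| / 2)) *
      ∫ σ in Ioi (0 : ℝ), Real.exp (-σ) * F q.1 (q.2 + σ) := by
  simp only [← integral_const_mul]
  refine continuous_of_dominated (bound := fun σ => N * Real.exp (-(1 / 2) * σ)) ?_ ?_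
    (integrableOn_const_mul_exp_half N) ?_
  · intro q
    refine Continuous.aestronglyMeasurable ?_
    have : Continuous fun σ : ℝ => F q.1 (q.2 + σ) :=
      hF.comp (by fun_prop : Continuous fun σ : ℝ => (q.1, q.2 + σ))
    fun_prop
  · intro q
    filter_upwards [ae_restrict_mem measurableSet_Ioi] with σ hσ
    rw [norm_mul, Real.norm_of_nonneg (Real.exp_pos _).le]
    calc Real.exp (-(|q.2| / 2)) * ‖Real.exp (-σ) * F q.1 (q.2 + σ)‖
        ≤ Real.exp (-(|q.2| / 2)) * (N * Real.exp (|q.2| / 2) * Real.exp (-(1 / 2) * σ)) :=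
          mul_le_mul_of_nonneg_left (norm_exp_neg_mul_le (hN q.1) q.2 hσ) (Real.exp_pos _).le
      _ = N * Real.exp (-(1 / 2) * σ) * (Real.exp (-(|q.2| / 2)) * Real.exp (|q.2| / 2)) := by ring
      _ = _ := by rw [← Real.exp_add]; simp
  · refine Eventually.of_forall fun σ => ?_
    have : Continuous fun q : P × ℝ => F q.1 (q.2 + σ) :=
      hF.comp (by fun_prop : Continuous fun q : P × ℝ => (q.1, q.2 + σ))
    fun_prop

/-- Existence, with continuous dependence on a parameter, of tempered solutions. -/
theorem exists_isTemperedSolution (hκ : 1 ≤ κ) (hη : 0 ≤ η) (hηκ : η * (1 + 8 * κ) ≤ 1 / 8)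
    (hfc : Continuous fun q : P × Space => f q.1 q.2.1 q.2.2.1 q.2.2.2)
    (hgc : Continuous fun q : P × Space => g q.1 q.2.1 q.2.2.1 q.2.2.2)
    (hf : ∀ p τ χ w χ' w', |f p τ χ w - f p τ χ' w'| ≤ κ * |χ - χ'| + η * |w - w'|)
    (hg : ∀ p τ χ w χ' w', |g p τ χ w - g p τ χ' w'| ≤ η * (|χ - χ'| + |w - w'|))
    {B : ℝ} (hf0 : ∀ p τ, |f p τ 0 0| ≤ B) (hg0 : ∀ p τ, |g p τ 0 0| ≤ B) :
    ∃ χ w : P → ℝ → ℝ, (Continuous fun q : P × ℝ => χ q.1 q.2) ∧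
      (Continuous fun q : P × ℝ => w q.1 q.2) ∧
      ∀ p, IsTemperedSolution (f p) (g p) (χ p) (w p) := by
  have hκ0 : 0 < κ := by linarith
  let X := BoundedContinuousFunction (P × ℝ) (Plane)
  let χ : X → P → ℝ → ℝ := fun u p τ => (8 * κ)⁻¹ * Real.exp (|τ| / 2) * (u (p, τ)).1
  let w : X → P → ℝ → ℝ := fun u p τ => Real.exp (|τ| / 2) * (u (p, τ)).2
  have hχc : ∀ u : X, Continuous fun q : P × ℝ => χ u q.1 q.2 := fun u => by
    have := u.continuous
    simp only [χ]; fun_prop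
  have hwc : ∀ u : X, Continuous fun q : P × ℝ => w u q.1 q.2 := fun u => by
    have := u.continuous
    simp only [w]; fun_prop
  have hFc : ∀ u : X, Continuous fun q : P × ℝ => f q.1 q.2 (χ u q.1 q.2) (w u q.1 q.2) :=
    fun u => hfc.comp (continuous_fst.prodMk (continuous_snd.prodMk ((hχc u).prodMk (hwc u))))
  have hGc : ∀ u : X, Continuous fun q : P × ℝ => g q.1 q.2 (χ u q.1 q.2) (w u q.1 q.2) :=
    fun u => hgc.comp (continuous_fst.prodMk (continuous_snd.prodMk ((hχc u).prodMk (hwc u))))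
  have hb : ∀ (u : X) p τ, |χ u p τ| ≤ ‖u‖ * Real.exp (|τ| / 2) ∧
      |w u p τ| ≤ ‖u‖ * Real.exp (|τ| / 2) := by
    intro u p τ
    have h1 := (norm_fst_le (u (p, τ))).trans (u.norm_coe_le_norm (p, τ))
    have h2 := (norm_snd_le (u (p, τ))).trans (u.norm_coe_le_norm (p, τ))
    rw [Real.norm_eq_abs] at h1 h2
    have he := Real.exp_pos (|τ| / 2)
    constructor
    · simp only [χ]
      rw [abs_mul, abs_mul, abs_of_pos he, abs_of_pos (by positivity : 0 < (8 * κ)⁻¹)]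
      have : (8 * κ)⁻¹ ≤ 1 := inv_le_one_of_one_le₀ (by linarith)
      calc _ ≤ 1 * Real.exp (|τ| / 2) * ‖u‖ := by gcongr
        _ = _ := by ring
    · simp only [w]
      rw [abs_mul, abs_of_pos he, mul_comm]
      gcongr
  have hfB : ∀ (u : X) p s, |f p s (χ u p s) (w u p s)|
      ≤ (B + κ * ‖u‖ + η * ‖u‖) * Real.exp (|s| / 2) := fun u p s =>
    growth_of_lipschitz hκ0.le hη (hf p) (hf0 p) (hb u p) s
  have hgB : ∀ (u : X) p s, |g p s (χ u p s) (w u p s)|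
      ≤ (B + η * ‖u‖ + η * ‖u‖) * Real.exp (|s| / 2) := fun u p s =>
    growth_of_lipschitz hη hη (f := g p)
      (fun τ a b c d => (hg p τ a b c d).trans (le_of_eq (mul_add _ _ _))) (hg0 p) (hb u p) s
  let W : X → P × ℝ → ℝ := fun u q =>
    ∫ σ in Ioi (0 : ℝ), Real.exp (-σ) * f q.1 (q.2 + σ) (χ u q.1 (q.2 + σ)) (w u q.1 (q.2 + σ))
  let V : X → P × ℝ → ℝ := fun u q => ∫ s in (0 : ℝ)..q.2, g q.1 s (χ u q.1 s) (w u q.1 s)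
  have cancel : ∀ τ : ℝ, Real.exp (-(|τ| / 2)) * Real.exp (|τ| / 2) = 1 := fun τ => by
    rw [← Real.exp_add]; simp
  have hWb : ∀ u q, |W u q| ≤ 2 * (B + κ * ‖u‖ + η * ‖u‖) * Real.exp (|q.2| / 2) := fun u q =>
    abs_integral_tail_le (F := fun s => f q.1 s (χ u q.1 s) (w u q.1 s)) (hfB u q.1) q.2
  have hVb : ∀ u q, |V u q| ≤ 2 * (B + η * ‖u‖ + η * ‖u‖) * Real.exp (|q.2| / 2) := fun u q =>
    abs_integral_zero_le (F := fun s => g q.1 s (χ u q.1 s) (w u q.1 s)) (hgB u q.1) q.2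
  have weight : ∀ (τ a c : ℝ), |a| ≤ c * Real.exp (|τ| / 2) → |Real.exp (-(|τ| / 2)) * a| ≤ c := by
    intro τ a c h
    rw [abs_mul, abs_of_pos (Real.exp_pos _)]
    calc _ ≤ Real.exp (-(|τ| / 2)) * (c * Real.exp (|τ| / 2)) :=
          mul_le_mul_of_nonneg_left h (Real.exp_pos _).le
      _ = c * (Real.exp (-(|τ| / 2)) * Real.exp (|τ| / 2)) := by ring
      _ = c := by rw [cancel, mul_one]
  have hVc : ∀ u, Continuous (V u) := fun u =>
    intervalIntegral.continuous_parametric_intervalIntegral_of_continuous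
      (f := fun (q : P × ℝ) s => g q.1 s (χ u q.1 s) (w u q.1 s))
      ((hGc u).comp (by fun_prop : Continuous fun z : (P × ℝ) × ℝ => (z.1.1, z.2))) continuous_snd
  let Φ : X → X := fun u => BoundedContinuousFunction.ofNormedAddCommGroup
    (fun q => (8 * κ * (Real.exp (-(|q.2| / 2)) * V u q), -(Real.exp (-(|q.2| / 2)) * W u q)))
    (by
      have h1 := continuous_weighted_tail (hFc u) (hfB u)
      have h2 := hVc u
      fun_prop)
    (max (8 * κ * (2 * (B + η * ‖u‖ + η * ‖u‖))) (2 * (B + κ * ‖u‖ + η * ‖u‖)))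
    (by
      intro q
      rw [Prod.norm_def]
      apply max_le_max
      · rw [Real.norm_eq_abs, abs_mul, abs_of_pos (by positivity : 0 < 8 * κ)]
        exact mul_le_mul_of_nonneg_left (weight _ _ _ (hVb u q)) (by positivity)
      · rw [norm_neg, Real.norm_eq_abs]
        exact weight _ _ _ (hWb u q))
  have hΦ : ContractingWith (1 / 2) Φ := by
    refine ⟨by norm_num, LipschitzWith.of_dist_le_mul fun u v => ?_⟩
    rw [BoundedContinuousFunction.dist_le (by positivity)]
    intro q
    have h1 : ∀ τ, 8 * κ * |χ u q.1 τ - χ v q.1 τ| ≤ dist u v * Real.exp (|τ| / 2) := by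
      intro τ
      have h3 := (norm_fst_le ((u - v) (q.1, τ))).trans ((u - v).norm_coe_le_norm (q.1, τ))
      rw [← dist_eq_norm, BoundedContinuousFunction.sub_apply, Prod.fst_sub, Real.norm_eq_abs] at h3
      have e : χ u q.1 τ - χ v q.1 τ
          = (8 * κ)⁻¹ * Real.exp (|τ| / 2) * ((u (q.1, τ)).1 - (v (q.1, τ)).1) := by
        simp only [χ]; ring
      rw [e, abs_mul, abs_mul, abs_of_pos (Real.exp_pos _),
        abs_of_pos (by positivity : 0 < (8 * κ)⁻¹)]
      calc _ = (8 * κ) * (8 * κ)⁻¹ * (|(u (q.1, τ)).1 - (v (q.1, τ)).1| * Real.exp (|τ| / 2)) := by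
            ring
        _ = |(u (q.1, τ)).1 - (v (q.1, τ)).1| * Real.exp (|τ| / 2) := by
            rw [mul_inv_cancel₀ (by positivity), one_mul]
        _ ≤ _ := by gcongr
    have h2 : ∀ τ, |w u q.1 τ - w v q.1 τ| ≤ dist u v * Real.exp (|τ| / 2) := by
      intro τ
      have h3 := (norm_snd_le ((u - v) (q.1, τ))).trans ((u - v).norm_coe_le_norm (q.1, τ))
      rw [← dist_eq_norm, BoundedContinuousFunction.sub_apply, Prod.snd_sub, Real.norm_eq_abs] at h3
      have e : w u q.1 τ - w v q.1 τ
          = Real.exp (|τ| / 2) * ((u (q.1, τ)).2 - (v (q.1, τ)).2) := by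
        simp only [w]; ring
      rw [e, abs_mul, abs_of_pos (Real.exp_pos _), mul_comm]
      gcongr
    obtain ⟨b1, b2⟩ := tempered_sub_halves hκ hη hηκ (hf q.1) (hg q.1) h1 h2
    have cF : ∀ u : X, Continuous fun s => f q.1 s (χ u q.1 s) (w u q.1 s) := fun u =>
      (hFc u).comp (by fun_prop : Continuous fun s : ℝ => (q.1, s))
    have cG : ∀ u : X, Continuous fun s => g q.1 s (χ u q.1 s) (w u q.1 s) := fun u =>
      (hGc u).comp (by fun_prop : Continuous fun s : ℝ => (q.1, s))
    have eV : V u q - V v q = ∫ s in (0 : ℝ)..q.2,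
        (g q.1 s (χ u q.1 s) (w u q.1 s) - g q.1 s (χ v q.1 s) (w v q.1 s)) :=
      (intervalIntegral.integral_sub ((cG u).intervalIntegrable _ _)
        ((cG v).intervalIntegrable _ _)).symm
    have eW : W u q - W v q = ∫ σ in Ioi (0 : ℝ), Real.exp (-σ) *
        ((fun s => f q.1 s (χ u q.1 s) (w u q.1 s) - f q.1 s (χ v q.1 s) (w v q.1 s)) (q.2 + σ)) := by
      simp only [mul_sub]
      exact (integral_sub (integrableOn_tail (cF u) (hfB u q.1) q.2)
        (integrableOn_tail (cF v) (hfB v q.1) q.2)).symm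
    have k1 := weight _ _ _ (abs_integral_zero_le b2 q.2)
    have k2 := weight _ _ _ (abs_integral_tail_le b1 q.2)
    rw [← eV] at k1
    rw [← eW] at k2
    rw [dist_eq_norm, Prod.norm_def]
    have hd : ((1 / 2 : NNReal) : ℝ) = 1 / 2 := by norm_num
    rw [hd]
    apply max_le
    · change |8 * κ * (Real.exp (-(|q.2| / 2)) * V u q) - 8 * κ * (Real.exp (-(|q.2| / 2)) * V v q)| ≤ _
      rw [← mul_sub, ← mul_sub, abs_mul, abs_of_pos (by positivity : 0 < 8 * κ)]
      calc _ ≤ 8 * κ * (2 * (dist u v / (32 * κ))) := mul_le_mul_of_nonneg_left k1 (by positivity)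
        _ = _ := by field_simp; ring
    · change |-(Real.exp (-(|q.2| / 2)) * W u q) - -(Real.exp (-(|q.2| / 2)) * W v q)| ≤ _
      rw [neg_sub_neg, abs_sub_comm, ← mul_sub]
      exact k2.trans (le_of_eq (by ring))
  have hu := hΦ.fixedPoint_isFixedPt
  set u : X := hΦ.fixedPoint Φ with hudef
  have hval : ∀ q : P × ℝ, u q =
      (8 * κ * (Real.exp (-(|q.2| / 2)) * V u q), -(Real.exp (-(|q.2| / 2)) * W u q)) := by
    intro q
    have : Φ u q = u q := by rw [hu]
    rw [← this]; rfl
  refine ⟨χ u, w u, hχc u, hwc u, fun p => ⟨?_, ?_, ⟨‖u‖, hb u p⟩, ?_, ?_⟩⟩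
  · exact (hχc u).comp (by fun_prop : Continuous fun s : ℝ => (p, s))
  · exact (hwc u).comp (by fun_prop : Continuous fun s : ℝ => (p, s))
  · intro τ
    change Real.exp (|τ| / 2) * (u (p, τ)).2 = -W u (p, τ)
    rw [hval]
    simp only
    linear_combination (-W u (p, τ)) * cancel τ
  · intro τ
    change (8 * κ)⁻¹ * Real.exp (|τ| / 2) * (u (p, τ)).1 = V u (p, τ)
    rw [hval]
    simp only
    have : (8 * κ)⁻¹ * (8 * κ) = 1 := inv_mul_cancel₀ (by positivity)
    linear_combination (V u (p, τ)) * cancel τ * ((8 * κ)⁻¹ * (8 * κ)) + V u (p, τ) * this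

end Existence

section Derivatives

variable {f g : ℝ → ℝ → ℝ → ℝ} {χ w : ℝ → ℝ}

lemma IsTemperedSolution.hasDerivAt_χ
    (hgc : Continuous fun q : Space => g q.1 q.2.1 q.2.2) (h : IsTemperedSolution f g χ w)
    (τ : ℝ) : HasDerivAt χ (g τ (χ τ) (w τ)) τ := by
  have c1 := h.continuous_χ
  have c2 := h.continuous_w
  have cg : Continuous fun s => g s (χ s) (w s) := by fun_prop
  have := intervalIntegral.integral_hasDerivAt_right (cg.intervalIntegrable 0 τ)
    (cg.stronglyMeasurableAtFilter _ _) cg.continuousAt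
  exact this.congr_of_eventuallyEq (Eventually.of_forall fun s => h.eq_χ s)

lemma IsTemperedSolution.hasDerivAt_w
    (hfc : Continuous fun q : Space => f q.1 q.2.1 q.2.2) (h : IsTemperedSolution f g χ w)
    {N : ℝ} (hN : ∀ s, |f s (χ s) (w s)| ≤ N * Real.exp (|s| / 2))
    (τ : ℝ) : HasDerivAt w (w τ + f τ (χ τ) (w τ)) τ := by
  have c1 := h.continuous_χ
  have c2 := h.continuous_w
  have cf : Continuous fun s => f s (χ s) (w s) := by fun_prop
  set F := fun s => f s (χ s) (w s) with hF
  have ce : Continuous fun s => Real.exp (-s) * F s := by fun_prop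
  have key : ∀ s, w s = Real.exp s * (w 0 + ∫ x in (0 : ℝ)..s, Real.exp (-x) * F x) := by
    intro s
    have shift : ∀ s, (∫ σ in Ioi (0 : ℝ), Real.exp (-σ) * F (s + σ))
        = Real.exp s * ∫ x in Ioi s, Real.exp (-x) * F x := by
      intro s
      have := (measurePreserving_add_left volume s).setIntegral_preimage_emb
        (measurableEmbedding_addLeft s) (fun x => Real.exp (-x) * F x) (Ioi s)
      rw [Set.preimage_const_add_Ioi, sub_self] at this
      rw [← this, ← integral_const_mul]
      congr 1; funext σ
      rw [← mul_assoc, ← Real.exp_add]; congr 2; ring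
    have hi : ∀ a, IntegrableOn (fun x => Real.exp (-x) * F x) (Ioi a) := by
      intro a
      have h0 := integrableOn_tail cf hN 0
      simp only [zero_add] at h0
      rcases le_total 0 a with ha | ha
      · exact h0.mono_set (Ioi_subset_Ioi ha)
      · rw [← Ioc_union_Ioi_eq_Ioi ha]
        exact (ce.integrableOn_Ioc).union h0
    have e0 : w 0 = -∫ x in Ioi (0 : ℝ), Real.exp (-x) * F x := by
      rw [h.eq_w 0]; simp only [zero_add]; rfl
    rw [h.eq_w s, e0]
    have h1 := shift s
    have h2 := intervalIntegral.integral_Ioi_sub_Ioi' (hi 0) (hi s)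
    change -(∫ σ in Ioi (0 : ℝ), Real.exp (-σ) * F (s + σ)) = _
    rw [h1]
    linear_combination Real.exp s * h2
  have hd : HasDerivAt (fun s => Real.exp s * (w 0 + ∫ x in (0 : ℝ)..s, Real.exp (-x) * F x))
      (Real.exp τ * (w 0 + ∫ x in (0 : ℝ)..τ, Real.exp (-x) * F x)
        + Real.exp τ * (Real.exp (-τ) * F τ)) τ :=
    (Real.hasDerivAt_exp τ).mul ((intervalIntegral.integral_hasDerivAt_right
      (ce.intervalIntegrable 0 τ) (ce.stronglyMeasurableAtFilter _ _) ce.continuousAt).const_add _)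
  have e2 : Real.exp τ * (Real.exp (-τ) * F τ) = F τ := by
    rw [← mul_assoc, ← Real.exp_add]; simp
  rw [e2, ← key] at hd
  exact hd.congr_of_eventuallyEq (Eventually.of_forall key)

end Derivatives

/-! ### Calculus preliminaries -/

lemma sub_eq_integral_mul {u u' : ℝ → ℝ} (hu : ∀ x, HasDerivAt u (u' x) x) (hc : Continuous u')
    (x y : ℝ) : u y - u x = (∫ θ in (0 : ℝ)..1, u' (x + θ * (y - x))) * (y - x) := by
  have h : ∀ θ ∈ uIcc (0 : ℝ) 1,
      HasDerivAt (fun θ : ℝ => u (x + θ * (y - x))) (u' (x + θ * (y - x)) * (y - x)) θ := by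
    intro θ _
    have h1 : HasDerivAt (fun θ : ℝ => x + θ * (y - x)) (y - x) θ := by
      simpa using ((hasDerivAt_id θ).mul_const (y - x)).const_add x
    exact (hu _).comp θ h1
  have := intervalIntegral.integral_eq_sub_of_hasDerivAt h
    (Continuous.intervalIntegrable (by fun_prop) _ _)
  rw [intervalIntegral.integral_mul_const] at this
  rw [this]; simp

lemma abs_sub_le_of_hasDerivAt {u u' : ℝ → ℝ} (hu : ∀ x, HasDerivAt u (u' x) x) {K : ℝ}
    (hK : ∀ x, |u' x| ≤ K) (x y : ℝ) : |u y - u x| ≤ K * |y - x| := by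
  simpa using Convex.norm_image_sub_le_of_norm_hasDerivWithin_le (s := univ)
    (fun x _ => (hu x).hasDerivWithinAt) (fun x _ => hK x) convex_univ (mem_univ x) (mem_univ y)

lemma abs_integral_unit_le {u : ℝ → ℝ} {K : ℝ} (hK : ∀ x, |u x| ≤ K) :
    |∫ θ in (0 : ℝ)..1, u θ| ≤ K := by
  simpa using intervalIntegral.norm_integral_le_of_norm_le_const (a := 0) (b := 1) (f := u)
    (C := K) fun x _ => hK x

lemma HasDerivAt.mul_of_continuousAt_of_zero {k d : ℝ → ℝ} {d' x : ℝ} (hk : ContinuousAt k x)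
    (hd : HasDerivAt d d' x) (h0 : d x = 0) : HasDerivAt (fun t => k t * d t) (k x * d') x := by
  rw [hasDerivAt_iff_tendsto_slope] at hd ⊢
  have : slope (fun t => k t * d t) x = fun t => k t * slope d x t := by
    funext t
    simp only [slope_def_field, h0]; ring
  rw [this]
  exact (hk.tendsto.mono_left nhdsWithin_le_nhds).mul hd

/-- A function of two variables with continuous partial derivatives. -/
lemma hasStrictFDerivAt_of_hasDerivAt {v v₁ v₂ : ℝ → ℝ → ℝ}
    (h₁ : ∀ t φ, HasDerivAt (fun s => v s φ) (v₁ t φ) t)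
    (h₂ : ∀ t φ, HasDerivAt (fun θ => v t θ) (v₂ t φ) φ)
    (c₁ : Continuous fun p : Plane => v₁ p.1 p.2) (c₂ : Continuous fun p : Plane => v₂ p.1 p.2)
    (p : Plane) :
    HasStrictFDerivAt (fun p : Plane => v p.1 p.2)
      ((ContinuousLinearMap.toSpanSingleton ℝ (v₁ p.1 p.2)).coprod
        (ContinuousLinearMap.toSpanSingleton ℝ (v₂ p.1 p.2))) p := by
  have h := hasStrictFDerivAt_uncurry_coprod (f := v) (u := p) (𝕜 := ℝ)
    (f₁ := fun t φ => ContinuousLinearMap.toSpanSingleton ℝ (v₁ t φ))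
    (f₂ := fun t φ => ContinuousLinearMap.toSpanSingleton ℝ (v₂ t φ))
    (Eventually.of_forall fun q => (h₁ q.1 q.2).hasFDerivAt)
    (Eventually.of_forall fun q => (h₂ q.1 q.2).hasFDerivAt)
    ((ContinuousLinearMap.toSpanSingletonCLE (𝕜 := ℝ) (E := ℝ)).continuous.comp c₁).continuousAt
    ((ContinuousLinearMap.toSpanSingletonCLE (𝕜 := ℝ) (E := ℝ)).continuous.comp c₂).continuousAt
  exact h

lemma contDiff_one_of_hasDerivAt {v v₁ v₂ : ℝ → ℝ → ℝ}
    (h₁ : ∀ t φ, HasDerivAt (fun s => v s φ) (v₁ t φ) t)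
    (h₂ : ∀ t φ, HasDerivAt (fun θ => v t θ) (v₂ t φ) φ)
    (c₁ : Continuous fun p : Plane => v₁ p.1 p.2) (c₂ : Continuous fun p : Plane => v₂ p.1 p.2) :
    ContDiff ℝ 1 (fun p : Plane => v p.1 p.2) := by
  rw [contDiff_one_iff_hasFDerivAt]
  refine ⟨_, ?_, fun p => (hasStrictFDerivAt_of_hasDerivAt h₁ h₂ c₁ c₂ p).hasFDerivAt⟩
  have d₁ := (ContinuousLinearMap.toSpanSingletonCLE (𝕜 := ℝ) (E := ℝ)).continuous.comp c₁
  have d₂ := (ContinuousLinearMap.toSpanSingletonCLE (𝕜 := ℝ) (E := ℝ)).continuous.comp c₂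
  exact (ContinuousLinearMap.coprodEquivL ℝ (𝕜 := ℝ) (E := ℝ) (F := ℝ) (G := ℝ)).continuous.comp (d₁.prodMk d₂)

/-- Chain rule along a curve `(t, φ(t))`. -/
lemma hasDerivAt_along {v v₁ v₂ : ℝ → ℝ → ℝ}
    (h₁ : ∀ t φ, HasDerivAt (fun s => v s φ) (v₁ t φ) t)
    (h₂ : ∀ t φ, HasDerivAt (fun θ => v t θ) (v₂ t φ) φ)
    (c₁ : Continuous fun p : Plane => v₁ p.1 p.2) (c₂ : Continuous fun p : Plane => v₂ p.1 p.2)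
    {φ : ℝ → ℝ} {φ' t : ℝ} (hφ : HasDerivAt φ φ' t) :
    HasDerivAt (fun s => v s (φ s)) (v₁ t (φ t) + v₂ t (φ t) * φ') t := by
  have h := (hasStrictFDerivAt_of_hasDerivAt h₁ h₂ c₁ c₂ (t, φ t)).hasFDerivAt.comp_hasDerivAt t
    ((hasDerivAt_id t).prodMk hφ)
  refine h.congr_deriv ?_
  simp [mul_comm]

/-! ### Invariant tori of slowly-varying hyperbolic systems -/

/-- A function `f(ε,t,ψ,w)` with continuous partial derivatives in `ψ` and `w`. -/
structure HasPartials {E : Type*} [TopologicalSpace E] (f fψ fw : E → ℝ → ℝ → ℝ → ℝ) : Prop where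
  cont : Continuous fun q : E × Space => f q.1 q.2.1 q.2.2.1 q.2.2.2
  cont_ψ : Continuous fun q : E × Space => fψ q.1 q.2.1 q.2.2.1 q.2.2.2
  cont_w : Continuous fun q : E × Space => fw q.1 q.2.1 q.2.2.1 q.2.2.2
  deriv_ψ : ∀ ε t ψ w, HasDerivAt (fun θ => f ε t θ w) (fψ ε t ψ w) ψ
  deriv_w : ∀ ε t ψ w, HasDerivAt (fun v => f ε t ψ v) (fw ε t ψ w) w

section Torus

variable {E : Type*} [TopologicalSpace E]

lemma HasPartials.abs_sub_le {f fψ fw : E → ℝ → ℝ → ℝ → ℝ} (h : HasPartials f fψ fw) {κ η : ℝ}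
    (hψ : ∀ ε t ψ w, |fψ ε t ψ w| ≤ κ) (hw : ∀ ε t ψ w, |fw ε t ψ w| ≤ η) (ε : E)
    (t ψ w ψ' w' : ℝ) : |f ε t ψ w - f ε t ψ' w'| ≤ κ * |ψ - ψ'| + η * |w - w'| := by
  have h1 := abs_sub_le_of_hasDerivAt (fun x => h.deriv_ψ ε t x w) (fun x => hψ ε t x w) ψ' ψ
  have h2 := abs_sub_le_of_hasDerivAt (fun x => h.deriv_w ε t ψ' x) (fun x => hw ε t ψ' x) w' w
  have := _root_.abs_sub_le (f ε t ψ w) (f ε t ψ' w) (f ε t ψ' w')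
  linarith

lemma HasPartials.sub_eq {f fψ fw : E → ℝ → ℝ → ℝ → ℝ} (h : HasPartials f fψ fw) (ε : E)
    (t ψ w ψ' w' : ℝ) : f ε t ψ' w' - f ε t ψ w
      = (∫ θ in (0 : ℝ)..1, fψ ε t (ψ + θ * (ψ' - ψ)) w') * (ψ' - ψ)
        + (∫ θ in (0 : ℝ)..1, fw ε t ψ (w + θ * (w' - w))) * (w' - w) := by
  have h1 := sub_eq_integral_mul (fun x => h.deriv_ψ ε t x w')
    (h.cont_ψ.comp (by fun_prop : Continuous fun x : ℝ => (ε, t, x, w'))) ψ ψ'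
  have h2 := sub_eq_integral_mul (fun x => h.deriv_w ε t ψ x)
    (h.cont_w.comp (by fun_prop : Continuous fun x : ℝ => (ε, t, ψ, x))) w w'
  rw [← h1, ← h2]; ring

/-- Difference quotients of a function with continuous partials depend continuously on the
end points. -/
lemma HasPartials.continuous_quotients {f fψ fw : E → ℝ → ℝ → ℝ → ℝ} (h : HasPartials f fψ fw)
    {Y : Type*} [TopologicalSpace Y] [FirstCountableTopology Y] {ε : Y → E} {t ψ w ψ' w' : Y → ℝ}
    (hε : Continuous ε) (ht : Continuous t) (hψ : Continuous ψ) (hw : Continuous w)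
    (hψ' : Continuous ψ') (hw' : Continuous w') :
    (Continuous fun y => ∫ θ in (0 : ℝ)..1, fψ (ε y) (t y) (ψ y + θ * (ψ' y - ψ y)) (w' y)) ∧
    (Continuous fun y => ∫ θ in (0 : ℝ)..1, fw (ε y) (t y) (ψ y) (w y + θ * (w' y - w y))) := by
  constructor
  · apply intervalIntegral.continuous_parametric_intervalIntegral_of_continuous'
    exact h.cont_ψ.comp (by fun_prop : Continuous fun z : Y × ℝ =>
      (ε z.1, t z.1, ψ z.1 + z.2 * (ψ' z.1 - ψ z.1), w' z.1))
  · apply intervalIntegral.continuous_parametric_intervalIntegral_of_continuous'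
    exact h.cont_w.comp (by fun_prop : Continuous fun z : Y × ℝ =>
      (ε z.1, t z.1, ψ z.1, w z.1 + z.2 * (w' z.1 - w z.1)))

lemma abs_tail_le_of_bounded {F : ℝ → ℝ} {B : ℝ} (hF : ∀ s, |F s| ≤ B) (τ : ℝ) :
    |∫ σ in Ioi (0 : ℝ), Real.exp (-σ) * F (τ + σ)| ≤ B := by
  have h : ∀ᵐ σ ∂volume.restrict (Ioi (0 : ℝ)), ‖Real.exp (-σ) * F (τ + σ)‖
      ≤ B * Real.exp (-σ) := by
    refine Eventually.of_forall fun σ => ?_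
    rw [Real.norm_eq_abs, abs_mul, abs_of_pos (Real.exp_pos _), mul_comm]
    exact mul_le_mul_of_nonneg_right (hF _) (Real.exp_pos _).le
  have := norm_integral_le_of_norm_le ((integrableOn_exp_neg_Ioi 0).const_mul B) h
  rwa [integral_const_mul, integral_exp_neg_Ioi_zero, mul_one] at this

lemma continuous_fst_section {P : Type*} [TopologicalSpace P] {f : P → ℝ → ℝ → ℝ → ℝ}
    (h : Continuous fun q : P × Space => f q.1 q.2.1 q.2.2.1 q.2.2.2) (p : P) :
    Continuous fun q : Space => f p q.1 q.2.1 q.2.2 :=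
  h.comp (by fun_prop : Continuous fun q : Space => (p, q.1, q.2.1, q.2.2))

/-- The system `w' = μ (w + U)`, `ψ' = μ (c + V)` has an invariant surface `w = s(t,ψ)`. -/
structure IsInvariantTorus (U V : E → ℝ → ℝ → ℝ → ℝ) (μ c : E → ℝ) (s s₁ s₂ : E → ℝ → ℝ → ℝ) :
    Prop where
  cont : Continuous fun q : E × Plane => s q.1 q.2.1 q.2.2
  cont₁ : Continuous fun q : E × Plane => s₁ q.1 q.2.1 q.2.2
  cont₂ : Continuous fun q : E × Plane => s₂ q.1 q.2.1 q.2.2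
  deriv₁ : ∀ ε t ψ, HasDerivAt (fun t => s ε t ψ) (s₁ ε t ψ) t
  deriv₂ : ∀ ε t ψ, HasDerivAt (fun ψ => s ε t ψ) (s₂ ε t ψ) ψ
  invariant : ∀ ε t₀ ψ₀, ∃ ψ : ℝ → ℝ, ψ t₀ = ψ₀ ∧ ∀ t,
    HasDerivAt ψ (μ ε * (c ε + V ε t (ψ t) (s ε t (ψ t)))) t ∧
    HasDerivAt (fun t => s ε t (ψ t)) (μ ε * (s ε t (ψ t) + U ε t (ψ t) (s ε t (ψ t)))) t

theorem exists_isInvariantTorus [FirstCountableTopology E]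
    {U Uψ Uw V Vψ Vw : E → ℝ → ℝ → ℝ → ℝ} (hU : HasPartials U Uψ Uw)
    (hV : HasPartials V Vψ Vw) {μ c : E → ℝ} (hμc : Continuous μ) (hμ : ∀ ε, μ ε ≠ 0)
    (hc : Continuous c) {κ η B : ℝ} (hκ : 1 ≤ κ) (hη : 0 ≤ η) (hηκ : η * (1 + 8 * κ) ≤ 1 / 8)
    (bU : ∀ ε t ψ w, |U ε t ψ w| ≤ B) (bUψ : ∀ ε t ψ w, |Uψ ε t ψ w| ≤ κ)
    (bUw : ∀ ε t ψ w, |Uw ε t ψ w| ≤ η)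
    (bV : ∀ ε t ψ w, |V ε t ψ w| ≤ B) (bVψ : ∀ ε t ψ w, |Vψ ε t ψ w| ≤ η)
    (bVw : ∀ ε t ψ w, |Vw ε t ψ w| ≤ η) {T ω : ℝ}
    (pU : ∀ ε t ψ w, U ε (t + T) ψ w = U ε t ψ w ∧ U ε t (ψ + ω) w = U ε t ψ w)
    (pV : ∀ ε t ψ w, V ε (t + T) ψ w = V ε t ψ w ∧ V ε t (ψ + ω) w = V ε t ψ w) :
    ∃ s s₁ s₂ : E → ℝ → ℝ → ℝ, IsInvariantTorus U V μ c s s₁ s₂ ∧ (∀ ε t ψ, |s ε t ψ| ≤ B) ∧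
      ∀ ε t ψ, s ε (t + T) ψ = s ε t ψ ∧ s ε t (ψ + ω) = s ε t ψ := by
  have hκ0 : 0 < κ := by linarith
  obtain ⟨m, hm, hmc⟩ : ∃ m : E → ℝ, (∀ ε, μ ε * m ε = 1) ∧ Continuous m :=
    ⟨fun ε => (μ ε)⁻¹, fun ε => mul_inv_cancel₀ (hμ ε), hμc.inv₀ hμ⟩
  have lU := hU.abs_sub_le bUψ bUw
  have lV := hV.abs_sub_le bVψ bVw
  let sf : (E → ℝ → ℝ → ℝ → ℝ) → E × Plane → ℝ → ℝ → ℝ → ℝ := fun F p τ χ w =>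
    F p.1 (p.2.1 + τ * m p.1) (p.2.2 + c p.1 * τ + χ) w
  have csf : ∀ {F Fψ Fw : E → ℝ → ℝ → ℝ → ℝ}, HasPartials F Fψ Fw →
      Continuous fun q : (E × Plane) × Space => sf F q.1 q.2.1 q.2.2.1 q.2.2.2 := fun hF =>
    hF.cont.comp (by fun_prop : Continuous fun q : (E × Plane) × Space =>
      (q.1.1, q.1.2.1 + q.2.1 * m q.1.1, q.1.2.2 + c q.1.1 * q.2.1 + q.2.2.1, q.2.2.2))
  have hfc := csf hU
  have hgc := csf hV
  have hf : ∀ p τ χ w χ' w', |sf U p τ χ w - sf U p τ χ' w'| ≤ κ * |χ - χ'| + η * |w - w'| := by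
    intro p τ χ w χ' w'
    have := lU p.1 (p.2.1 + τ * m p.1) (p.2.2 + c p.1 * τ + χ) w (p.2.2 + c p.1 * τ + χ') w'
    rwa [add_sub_add_left_eq_sub] at this
  have hg : ∀ p τ χ w χ' w', |sf V p τ χ w - sf V p τ χ' w'| ≤ η * (|χ - χ'| + |w - w'|) := by
    intro p τ χ w χ' w'
    have := lV p.1 (p.2.1 + τ * m p.1) (p.2.2 + c p.1 * τ + χ) w (p.2.2 + c p.1 * τ + χ') w'
    rw [add_sub_add_left_eq_sub, ← mul_add] at this
    exact this
  have hf0 : ∀ p τ, |sf U p τ 0 0| ≤ B := fun p τ => bU _ _ _ _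
  have hg0 : ∀ p τ, |sf V p τ 0 0| ≤ B := fun p τ => bV _ _ _ _
  obtain ⟨χ, w, cχ, cw, sol⟩ := exists_isTemperedSolution hκ hη hηκ hfc hgc hf hg hf0 hg0
  have uniq : ∀ p χ' w', IsTemperedSolution (sf U p) (sf V p) χ' w' → χ p = χ' ∧ w p = w' := fun p χ' w' h =>
    (sol p).unique hκ hη hηκ (continuous_fst_section hfc p) (continuous_fst_section hgc p)
      (hf p) (hg p) (hf0 p) h
  -- the solution through a later point of a trajectory
  have shift : ∀ (p : E × Plane) (τ₀ τ : ℝ),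
      w (p.1, p.2.1 + τ₀ * m p.1, p.2.2 + c p.1 * τ₀ + χ p τ₀) τ = w p (τ₀ + τ) := by
    intro p τ₀ τ
    set p' : E × Plane := (p.1, p.2.1 + τ₀ * m p.1, p.2.2 + c p.1 * τ₀ + χ p τ₀) with hp'
    obtain ⟨M, hM⟩ := (sol p).growth
    have c1 := (sol p).continuous_χ
    have c2 := (sol p).continuous_w
    have eF : ∀ F s b, sf F p' s (χ p (τ₀ + s) - χ p τ₀) b = sf F p (τ₀ + s) (χ p (τ₀ + s)) b := by
      intro F s b
      simp only [sf, hp']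
      congr 1 <;> ring
    have hw2 := (uniq p' (fun s => χ p (τ₀ + s) - χ p τ₀) (fun s => w p (τ₀ + s)) ?_).2
    · rw [hw2]
    refine ⟨by fun_prop, by fun_prop, ⟨2 * (M * Real.exp (|τ₀| / 2)), fun s => ?_⟩, ?_, ?_⟩
    · have hexp : Real.exp (|τ₀ + s| / 2) ≤ Real.exp (|τ₀| / 2) * Real.exp (|s| / 2) := by
        rw [← Real.exp_add]
        apply Real.exp_le_exp.2
        linarith [abs_add_le τ₀ s]
      have hM0 : 0 ≤ M := nonneg_of_growth fun s => (hM s).1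
      have h1 : M * Real.exp (|τ₀ + s| / 2) ≤ M * Real.exp (|τ₀| / 2) * Real.exp (|s| / 2) := by
        rw [mul_assoc]; exact mul_le_mul_of_nonneg_left hexp hM0
      have h2 : M * Real.exp (|τ₀| / 2) ≤ M * Real.exp (|τ₀| / 2) * Real.exp (|s| / 2) :=
        le_mul_of_one_le_right (by positivity) (Real.one_le_exp (by positivity))
      have h3 : 0 ≤ M * Real.exp (|τ₀| / 2) * Real.exp (|s| / 2) := by positivity
      constructor
      · have := abs_sub (χ p (τ₀ + s)) (χ p τ₀)
        linarith [(hM (τ₀ + s)).1, (hM τ₀).1]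
      · linarith [(hM (τ₀ + s)).2]
    · intro s
      rw [(sol p).eq_w]
      congr 2; funext σ
      rw [eF, add_assoc]
    · intro s
      simp only [eF]
      have cg : Continuous fun s => sf V p s (χ p s) (w p s) := by
        have := continuous_fst_section hgc p
        fun_prop
      rw [intervalIntegral.integral_comp_add_left (fun s => sf V p s (χ p s) (w p s)), add_zero,
        (sol p).eq_χ (τ₀ + s), (sol p).eq_χ τ₀]
      have := intervalIntegral.integral_add_adjacent_intervals
        (cg.intervalIntegrable (μ := volume) 0 τ₀) (cg.intervalIntegrable τ₀ (τ₀ + s))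
      linarith
  -- the linearized equations
  let ψ₁ : (E × Plane) × ℝ → ℝ → ℝ := fun y τ => y.1.2.2 + c y.1.1 * τ + χ y.1 τ
  let sh : (E × Plane) × ℝ → E × Plane := fun y => (y.1.1, y.1.2.1, y.1.2.2 + y.2)
  let ψ₂ : (E × Plane) × ℝ → ℝ → ℝ := fun y τ => y.1.2.2 + y.2 + c y.1.1 * τ + χ (sh y) τ
  let aψ : (E → ℝ → ℝ → ℝ → ℝ) → (E × Plane) × ℝ → ℝ → ℝ := fun F y τ =>
    ∫ θ in (0 : ℝ)..1, F y.1.1 (y.1.2.1 + τ * m y.1.1) (ψ₁ y τ + θ * (ψ₂ y τ - ψ₁ y τ))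
      (w (sh y) τ)
  let aw : (E → ℝ → ℝ → ℝ → ℝ) → (E × Plane) × ℝ → ℝ → ℝ := fun F y τ =>
    ∫ θ in (0 : ℝ)..1, F y.1.1 (y.1.2.1 + τ * m y.1.1) (ψ₁ y τ)
      (w y.1 τ + θ * (w (sh y) τ - w y.1 τ))
  have csh : Continuous sh := by simp only [sh]; fun_prop
  have cψ₁ : Continuous fun z : ((E × Plane) × ℝ) × ℝ => ψ₁ z.1 z.2 := by
    have := cχ.comp (by fun_prop : Continuous fun z : ((E × Plane) × ℝ) × ℝ => (z.1.1, z.2))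
    simp only [Function.comp_def] at this
    simp only [ψ₁]; fun_prop
  have cψ₂ : Continuous fun z : ((E × Plane) × ℝ) × ℝ => ψ₂ z.1 z.2 := by
    have := cχ.comp (by fun_prop : Continuous fun z : ((E × Plane) × ℝ) × ℝ => (sh z.1, z.2))
    simp only [Function.comp_def] at this
    simp only [ψ₂]; fun_prop
  have cw₁ : Continuous fun z : ((E × Plane) × ℝ) × ℝ => w z.1.1 z.2 :=
    cw.comp (by fun_prop : Continuous fun z : ((E × Plane) × ℝ) × ℝ => (z.1.1, z.2))
  have cw₂ : Continuous fun z : ((E × Plane) × ℝ) × ℝ => w (sh z.1) z.2 :=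
    cw.comp (by fun_prop : Continuous fun z : ((E × Plane) × ℝ) × ℝ => (sh z.1, z.2))
  have cquot : ∀ {F Fψ Fw : E → ℝ → ℝ → ℝ → ℝ}, HasPartials F Fψ Fw →
      (Continuous fun z : ((E × Plane) × ℝ) × ℝ => aψ Fψ z.1 z.2) ∧
      (Continuous fun z : ((E × Plane) × ℝ) × ℝ => aw Fw z.1 z.2) := fun hF =>
    hF.continuous_quotients (by fun_prop) (by fun_prop) cψ₁ cw₁ cψ₂ cw₂
  let fl : (E × Plane) × ℝ → ℝ → ℝ → ℝ → ℝ := fun y τ a b => aψ Uψ y τ * (1 + a) + aw Uw y τ * b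
  let gl : (E × Plane) × ℝ → ℝ → ℝ → ℝ → ℝ := fun y τ a b => aψ Vψ y τ * (1 + a) + aw Vw y τ * b
  have b1 : ∀ y τ, |aψ Uψ y τ| ≤ κ := fun y τ => abs_integral_unit_le fun θ => bUψ _ _ _ _
  have b2 : ∀ y τ, |aw Uw y τ| ≤ η := fun y τ => abs_integral_unit_le fun θ => bUw _ _ _ _
  have b3 : ∀ y τ, |aψ Vψ y τ| ≤ η := fun y τ => abs_integral_unit_le fun θ => bVψ _ _ _ _
  have b4 : ∀ y τ, |aw Vw y τ| ≤ η := fun y τ => abs_integral_unit_le fun θ => bVw _ _ _ _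
  have lin : ∀ {A A' k k' : ℝ}, |A| ≤ k → |A'| ≤ k' → ∀ a b a' b' : ℝ,
      |(A * (1 + a) + A' * b) - (A * (1 + a') + A' * b')| ≤ k * |a - a'| + k' * |b - b'| := by
    intro A A' k k' h h' a b a' b'
    have e : (A * (1 + a) + A' * b) - (A * (1 + a') + A' * b') = A * (a - a') + A' * (b - b') := by
      ring
    rw [e]
    refine (abs_add_le _ _).trans ?_
    rw [abs_mul, abs_mul]
    gcongr
  have clin : ∀ {F Fψ Fw : E → ℝ → ℝ → ℝ → ℝ}, HasPartials F Fψ Fw →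
      Continuous fun q : ((E × Plane) × ℝ) × Space =>
        aψ Fψ q.1 q.2.1 * (1 + q.2.2.1) + aw Fw q.1 q.2.1 * q.2.2.2 := by
    intro F Fψ Fw hF
    have h1 := (cquot hF).1.comp (by fun_prop :
      Continuous fun q : ((E × Plane) × ℝ) × Space => (q.1, q.2.1))
    have h2 := (cquot hF).2.comp (by fun_prop :
      Continuous fun q : ((E × Plane) × ℝ) × Space => (q.1, q.2.1))
    exact (h1.mul (by fun_prop)).add (h2.mul (by fun_prop))
  have hηκ' : η ≤ κ := by nlinarith
  have hfl0 : ∀ y τ, |fl y τ 0 0| ≤ κ := fun y τ => by simpa [fl] using b1 y τ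
  obtain ⟨a, b, -, cb, solab⟩ := exists_isTemperedSolution (f := fl) (g := gl) (B := κ) hκ hη hηκ
    (clin hU) (clin hV) (fun y τ a b a' b' => lin (b1 y τ) (b2 y τ) a b a' b')
    (fun y τ a b a' b' => by
      rw [mul_add]; exact lin (b3 y τ) (b4 y τ) a b a' b')
    hfl0 (fun y τ => by simpa [gl] using (b3 y τ).trans hηκ')
  have quot : ∀ (p : E × Plane) (h : ℝ), w (p.1, p.2.1, p.2.2 + h) 0 - w p 0 = b (p, h) 0 * h := by
    intro p h
    by_cases hh : h = 0
    · subst hh; simp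
    set y : (E × Plane) × ℝ := (p, h) with hy
    have c1 := (sol p).continuous_χ
    have c2 := (sol p).continuous_w
    have c1' := (sol (sh y)).continuous_χ
    have c2' := (sol (sh y)).continuous_w
    obtain ⟨M, hM⟩ := (sol p).growth
    obtain ⟨M', hM'⟩ := (sol (sh y)).growth
    have eψ : ∀ τ, ψ₂ y τ - ψ₁ y τ = h * (1 + h⁻¹ * (χ (sh y) τ - χ p τ)) := by
      intro τ
      simp only [ψ₁, ψ₂, hy]; field_simp; ring
    have eF : ∀ {F Fψ Fw : E → ℝ → ℝ → ℝ → ℝ}, HasPartials F Fψ Fw → ∀ τ,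
        aψ Fψ y τ * (1 + h⁻¹ * (χ (sh y) τ - χ p τ)) + aw Fw y τ * (h⁻¹ * (w (sh y) τ - w p τ))
        = h⁻¹ * (F p.1 (p.2.1 + τ * m p.1) (ψ₂ y τ) (w (sh y) τ)
          - F p.1 (p.2.1 + τ * m p.1) (ψ₁ y τ) (w p τ)) := by
      intro F Fψ Fw hF τ
      rw [hF.sub_eq p.1 (p.2.1 + τ * m p.1) (ψ₁ y τ) (w p τ) (ψ₂ y τ) (w (sh y) τ)]
      have : ∀ A A' x z : ℝ, A * x + A' * (h⁻¹ * z) = h⁻¹ * (A * (h * x) + A' * z) := by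
        intro A A' x z; field_simp
      rw [this, ← eψ]
    have hsol : IsTemperedSolution (fl y) (gl y) (fun τ => h⁻¹ * (χ (sh y) τ - χ p τ))
        (fun τ => h⁻¹ * (w (sh y) τ - w p τ)) := by
      refine ⟨by fun_prop, by fun_prop, ⟨|h⁻¹| * (M' + M), fun τ => ?_⟩, fun τ => ?_, fun τ => ?_⟩
      · rw [abs_mul, abs_mul, mul_assoc]
        constructor <;> apply mul_le_mul_of_nonneg_left _ (abs_nonneg _)
        · have := abs_sub (χ (sh y) τ) (χ p τ)
          linarith [(hM τ).1, (hM' τ).1]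
        · have := abs_sub (w (sh y) τ) (w p τ)
          linarith [(hM τ).2, (hM' τ).2]
      · have i1 := integrableOn_tail (F := fun s => sf U p s (χ p s) (w p s))
          (by have := continuous_fst_section hfc p; fun_prop)
          (growth_of_lipschitz hκ0.le hη (hf p) (hf0 p) hM) τ
        have i2 := integrableOn_tail (F := fun s => sf U (sh y) s (χ (sh y) s) (w (sh y) s))
          (by have := continuous_fst_section hfc (sh y); fun_prop)
          (growth_of_lipschitz hκ0.le hη (hf (sh y)) (hf0 (sh y)) hM') τ
        simp only [fl, eF hU]
        rw [(sol p).eq_w, (sol (sh y)).eq_w, neg_sub_neg, ← neg_sub, ← integral_sub i2 i1,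
          mul_neg, ← integral_const_mul]
        congr 2; funext σ
        simp only [sf, ψ₁, ψ₂, sh, hy]; ring
      · simp only [gl, eF hV]
        rw [intervalIntegral.integral_const_mul, (sol p).eq_χ, (sol (sh y)).eq_χ,
          ← intervalIntegral.integral_sub]
        · exact Continuous.intervalIntegrable
            (by have := continuous_fst_section hgc (sh y); fun_prop) _ _
        · exact Continuous.intervalIntegrable
            (by have := continuous_fst_section hgc p; fun_prop) _ _
    have hb := ((solab y).unique hκ hη hηκ (continuous_fst_section (clin hU) y)
      (continuous_fst_section (clin hV) y) (fun τ a b a' b' => lin (b1 y τ) (b2 y τ) a b a' b')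
      (fun τ a b a' b' => by rw [mul_add]; exact lin (b3 y τ) (b4 y τ) a b a' b')
      (hfl0 y) hsol).2
    rw [hb]
    simp only [sh, hy]
    field_simp
  let s : E → ℝ → ℝ → ℝ := fun ε t ψ => w (ε, t, ψ) 0
  let s₂ : E → ℝ → ℝ → ℝ := fun ε t ψ => b ((ε, t, ψ), 0) 0
  have cs : Continuous fun q : E × Plane => s q.1 q.2.1 q.2.2 :=
    cw.comp (by fun_prop : Continuous fun q : E × Plane => (q, (0 : ℝ)))
  have cs₂ : Continuous fun q : E × Plane => s₂ q.1 q.2.1 q.2.2 :=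
    cb.comp (by fun_prop : Continuous fun q : E × Plane => ((q, (0 : ℝ)), (0 : ℝ)))
  have ds₂ : ∀ ε t ψ, HasDerivAt (fun ψ => s ε t ψ) (s₂ ε t ψ) ψ := by
    intro ε t ψ
    have hcb : ContinuousAt (fun x => b ((ε, t, ψ), x - ψ) 0) ψ :=
      (cb.comp (by fun_prop : Continuous fun x : ℝ => (((ε, t, ψ), x - ψ), (0 : ℝ)))).continuousAt
    have h1 := HasDerivAt.mul_of_continuousAt_of_zero hcb ((hasDerivAt_id ψ).sub_const ψ)
      (by simp)
    simp only [sub_self, mul_one, id] at h1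
    refine (h1.add_const (s ε t ψ)).congr_of_eventuallyEq (Eventually.of_forall fun x => ?_)
    have := quot (ε, t, ψ) (x - ψ)
    simp only [add_sub_cancel] at this
    simp only [s]
    linarith
  have inv : ∀ ε t₀ ψ₀, ∃ ψ : ℝ → ℝ, ψ t₀ = ψ₀ ∧ ∀ t,
      HasDerivAt ψ (μ ε * (c ε + V ε t (ψ t) (s ε t (ψ t)))) t ∧
      HasDerivAt (fun t => s ε t (ψ t)) (μ ε * (s ε t (ψ t) + U ε t (ψ t) (s ε t (ψ t)))) t := by
    intro ε t₀ ψ₀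
    set p : E × Plane := (ε, t₀, ψ₀) with hp
    have hτ : ∀ t : ℝ, t₀ + (μ ε * (t - t₀)) * m ε = t := by
      intro t
      linear_combination (t - t₀) * hm ε
    have hs : ∀ t, s ε t (ψ₀ + c ε * (μ ε * (t - t₀)) + χ p (μ ε * (t - t₀)))
        = w p (μ ε * (t - t₀)) := by
      intro t
      have := shift p (μ ε * (t - t₀)) 0
      simp only [hp, hτ, add_zero] at this
      simpa [s, hp] using this
    obtain ⟨M, hM⟩ := (sol p).growth
    have hd : ∀ t, HasDerivAt (fun t => μ ε * (t - t₀)) (μ ε) t := fun t => by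
      simpa using ((hasDerivAt_id t).sub_const t₀).const_mul (μ ε)
    refine ⟨fun t => ψ₀ + c ε * (μ ε * (t - t₀)) + χ p (μ ε * (t - t₀)), ?_, fun t => ⟨?_, ?_⟩⟩
    · simp [(sol p).eq_χ 0]
    · simp only [hs]
      have h1 := ((sol p).hasDerivAt_χ (continuous_fst_section hgc p)
        (μ ε * (t - t₀))).comp t (hd t)
      have h2 := (((hd t).const_mul (c ε)).const_add ψ₀).add h1
      refine h2.congr_deriv ?_
      simp only [sf, hp, hτ]; ring
    · simp only [hs]
      have h1 := ((sol p).hasDerivAt_w (continuous_fst_section hfc p)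
        (growth_of_lipschitz hκ0.le hη (hf p) (hf0 p) hM) (μ ε * (t - t₀))).comp t (hd t)
      refine h1.congr_deriv ?_
      simp only [sf, hp, hτ]; ring
  let s₁ : E → ℝ → ℝ → ℝ := fun ε t ψ => μ ε * (s ε t ψ + U ε t ψ (s ε t ψ))
    - s₂ ε t ψ * (μ ε * (c ε + V ε t ψ (s ε t ψ)))
  refine ⟨s, s₁, s₂, ⟨cs, ?_, cs₂, ?_, ds₂, inv⟩, ?_, ?_⟩
  · have h1 := hU.cont.comp (by fun_prop : Continuous fun q : E × Plane =>
      (q.1, q.2.1, q.2.2, s q.1 q.2.1 q.2.2))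
    have h2 := hV.cont.comp (by fun_prop : Continuous fun q : E × Plane =>
      (q.1, q.2.1, q.2.2, s q.1 q.2.1 q.2.2))
    have h3 : Continuous fun q : E × Plane => μ q.1 := by fun_prop
    have h4 : Continuous fun q : E × Plane => c q.1 := by fun_prop
    exact (h3.mul (cs.add h1)).sub (cs₂.mul (h3.mul (h4.add h2)))
  · intro ε t₀ ψ₀
    obtain ⟨ψ, h0, hψ⟩ := inv ε t₀ ψ₀
    obtain ⟨d1, d2⟩ := hψ t₀
    have cψ : Continuous ψ := continuous_iff_continuousAt.2 fun t => (hψ t).1.continuousAt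
    let k : ℝ → ℝ := fun t => ∫ θ in (0 : ℝ)..1, s₂ ε t (ψ₀ + θ * (ψ t - ψ₀))
    have ck : Continuous k := by
      apply intervalIntegral.continuous_parametric_intervalIntegral_of_continuous'
      exact cs₂.comp (by fun_prop : Continuous fun z : Plane =>
        (ε, z.1, ψ₀ + z.2 * (ψ z.1 - ψ₀)))
    have hk : k t₀ = s₂ ε t₀ ψ₀ := by simp [k, h0]
    have h3 := d2.sub (HasDerivAt.mul_of_continuousAt_of_zero ck.continuousAt (d1.sub_const ψ₀)
      (by simp [h0]))
    rw [hk, h0] at h3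
    refine h3.congr_of_eventuallyEq (Eventually.of_forall fun t => ?_)
    have := sub_eq_integral_mul (ds₂ ε t)
      (cs₂.comp (by fun_prop : Continuous fun x : ℝ => (ε, t, x))) ψ₀ (ψ t)
    simp only [Pi.sub_apply, k]
    rw [← this]; ring
  · intro ε t ψ
    simp only [s]
    rw [(sol _).eq_w, abs_neg]
    exact abs_tail_le_of_bounded
      (F := fun s => sf U (ε, t, ψ) s (χ (ε, t, ψ) s) (w (ε, t, ψ) s)) (fun s => bU _ _ _ _) 0
  · intro ε t ψ
    have e : ∀ {F : E → ℝ → ℝ → ℝ → ℝ}, (∀ ε t ψ w, F ε (t + T) ψ w = F ε t ψ w ∧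
        F ε t (ψ + ω) w = F ε t ψ w) → sf F (ε, t + T, ψ) = sf F (ε, t, ψ) ∧
        sf F (ε, t, ψ + ω) = sf F (ε, t, ψ) := by
      intro F pF
      constructor <;> funext τ χ w <;> simp only [sf]
      · rw [add_right_comm, (pF _ _ _ _).1]
      · rw [show ψ + ω + c ε * τ + χ = ψ + c ε * τ + χ + ω by ring, (pF _ _ _ _).2]
    have h1 := sol (ε, t + T, ψ)
    have h2 := sol (ε, t, ψ + ω)
    rw [(e pU).1, (e pV).1] at h1
    rw [(e pU).2, (e pV).2] at h2
    exact ⟨(congrFun (uniq _ _ _ h1).2 0).symm, (congrFun (uniq _ _ _ h2).2 0).symm⟩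

end Torus

/-! ### A polynomial inequality for the orbits that surround three equilibria -/

/-- The polynomial `(P - D)² - γ (s P - D)`, with `P = s² (2 - s)`. -/
def starPoly (γ D s : ℝ) : ℝ := (s ^ 2 * (2 - s) - D) ^ 2 - γ * (s * (s ^ 2 * (2 - s)) - D)

/-- A certificate of positivity on `[0,1]`, from the expansion of
`starPoly γ D s - (s² (2 - s) - D - p - b (s - c))²` at `s = c`, where `p = c² (2 - c) - D`. -/
def StarCert (γ D c b κ : ℝ) : Prop :=
  let p := c ^ 2 * (2 - c) - D
  let p₁ := 4 * c - 3 * c ^ 2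
  let p₂ := 2 - 3 * c
  let k₂ := 2 * p * p₂ + 2 * b * p₁ - b ^ 2 - γ * (c * p₂ + p₁)
  let k₃ := -2 * p + 2 * b * p₂ - γ * (p₂ - c)
  γ ≤ 2 * b ∧ κ ≤ k₂ - k₃ * c + (γ - 2 * b) * c ^ 2 ∧
    κ ≤ k₂ + k₃ * (1 - c) + (γ - 2 * b) * (1 - c) ^ 2 ∧ 0 < κ ∧
    (2 * p * p₁ - γ * (c * p₁ + p + D)) ^ 2 < 4 * κ * (p ^ 2 - γ * (c * (p + D) - D))

lemma StarCert.pos {γ D c b κ s : ℝ} (h : StarCert γ D c b κ) (hs0 : 0 ≤ s) (hs1 : s ≤ 1) :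
    0 < starPoly γ D s := by
  obtain ⟨hb, h0, h1, hκ, hd⟩ := h
  set p := c ^ 2 * (2 - c) - D with hp
  set p₁ := 4 * c - 3 * c ^ 2 with hp₁
  set p₂ := 2 - 3 * c with hp₂
  set k₂ := 2 * p * p₂ + 2 * b * p₁ - b ^ 2 - γ * (c * p₂ + p₁) with hk₂
  set k₃ := -2 * p + 2 * b * p₂ - γ * (p₂ - c) with hk₃
  set e := 2 * p * p₁ - γ * (c * p₁ + p + D) with he
  set R₀ := p ^ 2 - γ * (c * (p + D) - D) with hR₀
  clear_value R₀ e k₃ k₂ p₂ p₁ p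
  have hK : κ ≤ k₂ + k₃ * (s - c) + (γ - 2 * b) * (s - c) ^ 2 := by
    have e1 : k₂ + k₃ * (s - c) + (γ - 2 * b) * (s - c) ^ 2
        = (1 - s) * (k₂ - k₃ * c + (γ - 2 * b) * c ^ 2)
          + s * (k₂ + k₃ * (1 - c) + (γ - 2 * b) * (1 - c) ^ 2) + (2 * b - γ) * (s * (1 - s)) := by
      ring
    rw [e1]
    have i1 := mul_le_mul_of_nonneg_left h0 (sub_nonneg.2 hs1)
    have i2 := mul_le_mul_of_nonneg_left h1 hs0
    have i3 : 0 ≤ (2 * b - γ) * (s * (1 - s)) :=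
      mul_nonneg (by linarith) (mul_nonneg hs0 (by linarith))
    linarith
  have e2 : starPoly γ D s = (s ^ 2 * (2 - s) - D - p - b * (s - c)) ^ 2 + R₀ + e * (s - c)
      + (s - c) ^ 2 * (k₂ + k₃ * (s - c) + (γ - 2 * b) * (s - c) ^ 2) := by
    rw [hR₀, he, hk₂, hk₃, hp₁, hp₂, hp, starPoly]; ring
  have i4 := mul_le_mul_of_nonneg_left hK (sq_nonneg (s - c))
  have i5 : 0 < R₀ + e * (s - c) + (s - c) ^ 2 * κ := by
    have : 0 < 4 * κ * (R₀ + e * (s - c) + (s - c) ^ 2 * κ) := by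
      nlinarith [sq_nonneg (2 * κ * (s - c) + e)]
    exact pos_of_mul_pos_right this (by linarith)
  have i6 := sq_nonneg (s ^ 2 * (2 - s) - D - p - b * (s - c))
  rw [e2]; linarith

lemma starPoly_pos_of_le {γ γ' D D' D'' s : ℝ} (hγ : 0 < γ) (hγ' : γ ≤ γ') (hs0 : 0 < s) (hs1 : s < 1)
    (hD : D' ≤ D) (hD'' : D ≤ D'') (hlow : 0 < starPoly γ' D' s) (htop : 0 < starPoly γ D'' s)
    (hmid : γ / 2 + D' < s ^ 2 * (2 - s) → s ^ 2 * (2 - s) < γ / 2 + D'' →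
      γ / 4 < (1 - s) * (s ^ 2 * (2 - s))) : 0 < starPoly γ D s := by
  unfold starPoly at *
  set P := s ^ 2 * (2 - s) with hP
  have hP0 : 0 < P := by rw [hP]; exact mul_pos (by positivity) (by linarith)
  rcases le_or_gt P (γ / 2 + D') with h1 | h1
  · have h2 : 0 < (P - D') ^ 2 - γ * (s * P - D') := by
      rcases le_or_gt D' (s * P) with h3 | h3
      · have := mul_le_mul_of_nonneg_right hγ' (sub_nonneg.2 h3)
        linarith
      · have := mul_pos hγ (sub_pos.2 h3)
        nlinarith [sq_nonneg (P - D')]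
    nlinarith [mul_nonneg (sub_nonneg.2 hD) (show 0 ≤ γ - (P - D) - (P - D') by linarith)]
  rcases le_or_gt (γ / 2 + D'') P with h2 | h2
  · nlinarith [mul_nonneg (sub_nonneg.2 hD'') (show 0 ≤ (P - D) + (P - D'') - γ by linarith)]
  · have h3 := mul_pos hγ (sub_pos.2 (hmid h1 h2))
    nlinarith [sq_nonneg (P - D - γ / 2)]

lemma starPoly_top_pos_of_le_half {γ s : ℝ} (hγ' : γ ≤ 1 / 2) (hs0 : 0 < s)
    (hs1 : s < 1) : 0 < starPoly γ (1 - γ) s := by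
  obtain ⟨u, rfl⟩ : ∃ u, s = 1 - u := ⟨1 - s, by ring⟩
  have hu0 : 0 < u := by linarith
  have hu1 : u < 1 := by linarith
  have e : starPoly γ (1 - γ) (1 - u) = u ^ 2 * ((1 + u - u ^ 2) ^ 2 - γ * (2 - u ^ 2)) := by
    unfold starPoly; ring
  rw [e]
  apply mul_pos (by positivity)
  nlinarith [mul_pos hu0 (sub_pos.2 hu1), sq_nonneg (u - u ^ 2)]

/-- The polynomial `starPoly γ (1 - γ - 3/4 (γ - 1/2)²) (1 - u)`, in terms of `g = γ - 1/2`. -/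
def starTop (u g : ℝ) : ℝ := u ^ 3 * (2 - 1 / 2 * u - 2 * u ^ 2 + u ^ 3) - u ^ 2 * (2 - u ^ 2) * g
  + (3 / 8 - 3 / 2 * (u + u ^ 2 - u ^ 3)) * g ^ 2 + 3 / 4 * g ^ 3 + 9 / 16 * g ^ 4

lemma starTop_pos_small {u g : ℝ} (hu0 : 0 < u) (h : u ≤ 1 / 4) (hg0 : 0 ≤ g) :
    0 < starTop u g := by
  rw [starTop]
  have h1 := mul_nonneg hg0 (sq_nonneg (g - u))
  have h2 : 0 ≤ g ^ 4 := by positivity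
  -- quadratic polynomial in `g`
  have h3 : 0 < u ^ 3 * (2 - 1 / 2 * u - 2 * u ^ 2 + u ^ 3) - u ^ 2 * (11 / 4 - u ^ 2) * g
      + (3 / 8 - 3 / 2 * u ^ 2 + 3 / 2 * u ^ 3) * g ^ 2 := by
    set A := u * (2 - 1 / 2 * u - 2 * u ^ 2 + u ^ 3) with hA
    set c := 3 / 8 - 3 / 2 * u ^ 2 + 3 / 2 * u ^ 3 with hc
    have hu2 : u ^ 2 ≤ u * (1 / 4) := by rw [sq]; exact mul_le_mul_of_nonneg_left h hu0.le
    have hu2' : u ^ 2 ≤ 1 / 16 := by linarith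
    have hu3 : 0 < u ^ 3 := by positivity
    have hA1 : u * 1.75 ≤ A :=
      mul_le_mul_of_nonneg_left (by linarith) hu0.le
    have hc1 : 0.2995 ≤ c := by
      have : 0 ≤ (1 / 4 - u) * (1 / 16 - u ^ 2) := mul_nonneg (by linarith) (by linarith)
      rw [hc]; nlinarith
    have hc0 : 0 < c := by linarith
    have hd : u ^ 2 * (11 / 4 - u ^ 2) ^ 2 < 4 * A * c := by
      have i1 : (11 / 4 - u ^ 2) ^ 2 ≤ (11 / 4) ^ 2 :=
        pow_le_pow_left₀ (by linarith) (by linarith [sq_nonneg u]) 2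
      have i2 := mul_le_mul hu2 i1 (sq_nonneg _) (by positivity)
      have i3 := mul_le_mul hA1 hc1 (by norm_num) ((by positivity : (0:ℝ) ≤ u * 1.75).trans hA1)
      linarith
    have : 0 < 4 * c * (u ^ 2 * A - u ^ 2 * (11 / 4 - u ^ 2) * g + c * g ^ 2) := by
      nlinarith [sq_nonneg (2 * c * g - u ^ 2 * (11 / 4 - u ^ 2)),
        mul_pos (pow_pos hu0 2) (sub_pos.2 hd)]
    have h5 := pos_of_mul_pos_right this (by linarith)
    rw [hA] at h5
    linarith
  nlinarith

lemma starTop_pos_middle {u g : ℝ} (h : 1 / 4 < u) (h' : u ≤ 3 / 10) (hg0 : 0 ≤ g) :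
    0 < starTop u g := by
  rw [starTop]
  have h1 := mul_nonneg hg0 (sq_nonneg (g - 3 / 10))
  have h2 := sq_nonneg (g ^ 2 - 9 / 100)
  obtain ⟨w, rfl⟩ : ∃ w, u = 1 / 4 + w := ⟨u - 1 / 4, by ring⟩
  have hw0 : 0 < w := by linarith
  have hw1 : w ≤ 1 / 20 := by linarith
  have hw3 : w ^ 3 ≤ w ^ 2 * (1 / 20) := by
    rw [pow_succ]; exact mul_le_mul_of_nonneg_left hw1 (by positivity)
  have hw2 : w ^ 2 ≤ w * (1 / 20) := by
    rw [sq]; exact mul_le_mul_of_nonneg_left hw1 hw0.le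
  have hw4 : w ^ 4 ≤ w ^ 3 * (1 / 20) := by
    rw [pow_succ]; exact mul_le_mul_of_nonneg_left hw1 (by positivity)
  have p3 : 0 < w ^ 3 := by positivity
  have p2 : 0 < w ^ 2 := by positivity
  have p4 : 0 < w ^ 4 := by positivity
  have p5 : 0 < w ^ 5 := by positivity
  have p6 : 0 < w ^ 6 := by positivity
  have hw5 : w ^ 5 ≤ w ^ 4 * (1 / 20) := by
    rw [pow_succ]; exact mul_le_mul_of_nonneg_left hw1 (by positivity)
  obtain ⟨a, ha⟩ : ∃ a, a = (1 / 4 + w) ^ 3 * (2 - 1 / 2 * (1 / 4 + w) - 2 * (1 / 4 + w) ^ 2 + (1 / 4 + w) ^ 3)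
    - 9 / 16 * (81 / 10000) := ⟨_, rfl⟩
  obtain ⟨b, hb⟩ : ∃ b, b = (1 / 4 + w) ^ 2 * (2 - (1 / 4 + w) ^ 2) + 3 / 4 * (9 / 100) := ⟨_, rfl⟩
  obtain ⟨c, hc⟩ : ∃ c, c = 3 / 8 - 3 / 2 * ((1 / 4 + w) + (1 / 4 + w) ^ 2 - (1 / 4 + w) ^ 3) + 3 / 4 * (6 / 10)
    + 9 / 16 * (18 / 100) := ⟨_, rfl⟩
  have a1 : 0.0230 + 0.31 * w + 1.05 * w ^ 2 ≤ a := by rw [ha]; ring_nf; linarith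
  have b1 : b ≤ 0.1886 + 1.02 * w := by rw [hb]; ring_nf; linarith
  have b0 : 0 ≤ b := by rw [hb]; ring_nf; linarith
  have c1 : 0.4808 - 2 * w ≤ c := by rw [hc]; ring_nf; linarith
  have hd : b ^ 2 < 4 * a * c := by
    have i1 := pow_le_pow_left₀ b0 b1 2
    have i2 := mul_le_mul a1 c1 (by linarith) ((by positivity : (0:ℝ) ≤ _).trans a1)
    have i3 : (0.1886 + 1.02 * w) ^ 2 < 4 * ((0.0230 + 0.31 * w + 1.05 * w ^ 2) * (0.4808 - 2 * w)) := by
      ring_nf; linarith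
    linarith
  have hc0 : 0 < c := by linarith
  have : 0 < 4 * c * (a - b * g + c * g ^ 2) := by
    rw [show 4 * c * (a - b * g + c * g ^ 2) = (2 * c * g - b) ^ 2 + (4 * a * c - b ^ 2) by ring]
    linarith [sq_nonneg (2 * c * g - b)]
  have h5 := pos_of_mul_pos_right this (by linarith)
  rw [ha, hb, hc] at h5
  linarith

lemma starTop_pos_large {u g : ℝ} (h' : 3 / 10 < u) (hu1 : u < 1) (hg0 : 0 ≤ g)
    (hg1 : g ≤ 0.306) :
    0 < starTop u g := by
  rw [starTop]
  have hu2 : 0.09 ≤ u ^ 2 := by nlinarith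
  have hu4 : 0.1719 ≤ u ^ 2 * (2 - u ^ 2) := by
    have : u ^ 2 ≤ 1 := by nlinarith
    nlinarith
  have hv : 0.363 ≤ u + u ^ 2 - u ^ 3 := by
    have : 0 ≤ (u - 0.3) * (1 - u) * (u + 0.3) := by
      apply mul_nonneg (mul_nonneg _ _) <;> linarith
    nlinarith
  have h7 : 0 ≤ (0.306 - g) * (u ^ 2 * (2 - u ^ 2)
      - (3 / 8 - 3 / 2 * (u + u ^ 2 - u ^ 3)) * (g + 0.306)
      - 3 / 4 * (g ^ 2 + g * 0.306 + 0.306 ^ 2)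
      - 9 / 16 * ((g + 0.306) * (g ^ 2 + 0.306 ^ 2))) := by
    refine mul_nonneg (by linarith) ?_
    have i1 := mul_le_mul_of_nonneg_right hv (show 0 ≤ g + 0.306 by linarith)
    have i2 : g ^ 2 ≤ g * 0.306 := by rw [sq]; exact mul_le_mul_of_nonneg_left hg1 hg0
    have i3 : (g + 0.306) * (g ^ 2 + 0.306 ^ 2) ≤ 0.612 * (2 * 0.306 ^ 2) := by
      apply mul_le_mul <;> nlinarith
    nlinarith
  have h8 : 0 < starPoly 0.806 0.123773 (1 - u) :=
    StarCert.pos (c := 0.6277) (b := 0.8624) (κ := 0.29) (by norm_num [StarCert]) (by linarith)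
      (by linarith)
  rw [show starPoly 0.806 0.123773 (1 - u) = starTop u 0.306 by rw [starPoly, starTop]; ring,
    starTop] at h8
  linarith

lemma starPoly_top_pos {γ s : ℝ} (hγ : 1 / 2 ≤ γ) (hγ' : γ ≤ 0.806) (hs0 : 0 < s)
    (hs1 : s < 1) : 0 < starPoly γ (1 - γ - 3 / 4 * (γ - 1 / 2) ^ 2) s := by
  obtain ⟨u, rfl⟩ : ∃ u, s = 1 - u := ⟨1 - s, by ring⟩
  obtain ⟨g, rfl⟩ : ∃ g, γ = 1 / 2 + g := ⟨γ - 1 / 2, by ring⟩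
  have hu0 : 0 < u := by linarith
  have hu1 : u < 1 := by linarith
  have hg0 : 0 ≤ g := by linarith
  have hg1 : g ≤ 0.306 := by linarith
  rw [show starPoly (1 / 2 + g) (1 - (1 / 2 + g) - 3 / 4 * (1 / 2 + g - 1 / 2) ^ 2) (1 - u)
    = starTop u g by rw [starPoly, starTop]; ring]
  rcases le_or_gt u (1 / 4) with h | h
  · exact starTop_pos_small hu0 h hg0
  rcases le_or_gt u (3 / 10) with h' | h'
  · exact starTop_pos_middle h h' hg0
  · exact starTop_pos_large h' hu1 hg0 hg1

lemma quarter_lt_of_le {γ s : ℝ} (hγ' : γ ≤ 0.75) (hs0 : 0 < s) (hs1 : s < 1)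
    (h1 : γ / 2 < s ^ 2 * (2 - s)) (h2 : s ^ 2 * (2 - s) < 1 - γ / 2) :
    γ / 4 < (1 - s) * (s ^ 2 * (2 - s)) := by
  obtain ⟨u, rfl⟩ : ∃ u, s = 1 - u := ⟨1 - s, by ring⟩
  have hu0 : 0 < u := by linarith
  have hP : (1 - u) ^ 2 * (2 - (1 - u)) = 1 - u - u ^ 2 + u ^ 3 := by ring
  have hP0 : 0 < (1 - u) ^ 2 * (2 - (1 - u)) := mul_pos (by positivity) (by linarith)
  rw [hP] at *
  rw [show 1 - (1 - u) = u by ring]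
  rcases le_or_gt (1 / 2) u with h | h
  · have := mul_le_mul_of_nonneg_right h hP0.le
    linarith
  rcases le_or_gt u 0.3 with h' | h'
  · have i1 : u ^ 2 ≤ u * 0.3 := by rw [sq]; exact mul_le_mul_of_nonneg_left h' hu0.le
    have i2 : 0 < u ^ 3 := by positivity
    have i3 : 0 < u * (1 - 3 * u - u ^ 2 + 2 * u ^ 3) := mul_pos hu0 (by linarith)
    linarith
  · have i1 : 0 ≤ (1 / 2 - u) * (u - 0.3) * (1.8 + u * (1 - u) - 0.5) + 0 := by
      have := mul_nonneg hu0.le (show 0 ≤ 1 - u by linarith)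
      have := mul_nonneg (sub_nonneg.2 h.le) (sub_nonneg.2 h'.le)
      have := mul_nonneg this (show 0 ≤ 1.8 + u * (1 - u) - 0.5 by linarith)
      linarith
    nlinarith

lemma le_quartic_of_le {u u₁ u₂ m : ℝ} (h0 : 0 ≤ u₁) (h1 : u₁ ≤ u) (h2 : u ≤ u₂) (h12 : u₁ < u₂)
    (h3 : u₂ ≤ 1 / 2) (hm₁ : m ≤ u₁ * (1 - u₁ - u₁ ^ 2 + u₁ ^ 3))
    (hm₂ : m ≤ u₂ * (1 - u₂ - u₂ ^ 2 + u₂ ^ 3)) : m ≤ u * (1 - u - u ^ 2 + u ^ 3) := by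
  have e : (u₂ - u₁) * (u * (1 - u - u ^ 2 + u ^ 3))
      = (u₂ - u) * (u₁ * (1 - u₁ - u₁ ^ 2 + u₁ ^ 3)) + (u - u₁) * (u₂ * (1 - u₂ - u₂ ^ 2 + u₂ ^ 3))
        + (u₂ - u₁) * ((u - u₁) * (u₂ - u)) * (1 + (u₁ + u₂ + u)
          - (u₁ * u₁ + u₂ * u₂ + u * u + u₁ * u₂ + u₁ * u + u₂ * u)) := by ring
  have k : 0 ≤ 1 + (u₁ + u₂ + u) - (u₁ * u₁ + u₂ * u₂ + u * u + u₁ * u₂ + u₁ * u + u₂ * u) := by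
    have a1 : u₁ * u₁ ≤ 1 / 2 * (1 / 2) := by apply mul_le_mul <;> linarith
    have a2 : u₂ * u₂ ≤ 1 / 2 * (1 / 2) := by apply mul_le_mul <;> linarith
    have a3 : u * u ≤ 1 / 2 * (1 / 2) := by apply mul_le_mul <;> linarith
    have a4 : u₁ * u₂ ≤ u₁ * (1 / 2) := mul_le_mul_of_nonneg_left h3 h0
    have a5 : u₁ * u ≤ u * (1 / 2) := by
      rw [mul_comm]; exact mul_le_mul_of_nonneg_left (by linarith) (by linarith)
    have a6 : u₂ * u ≤ u₂ * (1 / 2) := mul_le_mul_of_nonneg_left (by linarith) (by linarith)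
    linarith
  have i1 := mul_le_mul_of_nonneg_left hm₁ (sub_nonneg.2 h2)
  have i2 := mul_le_mul_of_nonneg_left hm₂ (sub_nonneg.2 h1)
  have i3 := mul_nonneg (mul_nonneg (sub_nonneg.2 h12.le)
    (mul_nonneg (sub_nonneg.2 h1) (sub_nonneg.2 h2))) k
  have : (u₂ - u₁) * m ≤ (u₂ - u₁) * (u * (1 - u - u ^ 2 + u ^ 3)) := by rw [e]; linarith
  exact le_of_mul_le_mul_left this (sub_pos.2 h12)

lemma quarter_lt_of_bounds {γ γ₀ γ₁ D' D'' s : ℝ} (u₁ u₂ : ℝ) (hγ₀ : γ₀ ≤ γ) (hγ₁ : γ ≤ γ₁)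
    (hs0 : 0 < s) (hs1 : s < 1) (h0 : 0 ≤ u₁) (h12 : u₁ < u₂) (h3 : u₂ ≤ 1 / 2)
    (hm₁ : γ₁ / 4 < u₁ * (1 - u₁ - u₁ ^ 2 + u₁ ^ 3))
    (hm₂ : γ₁ / 4 < u₂ * (1 - u₂ - u₂ ^ 2 + u₂ ^ 3))
    (hD'' : γ / 2 + D'' ≤ 1 - u₁ - u₁ ^ 2 + u₁ ^ 3)
    (hD' : 1 - u₂ - u₂ ^ 2 + u₂ ^ 3 ≤ γ₀ / 2 + D')
    (h1 : γ / 2 + D' < s ^ 2 * (2 - s)) (h2 : s ^ 2 * (2 - s) < γ / 2 + D'') :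
    γ / 4 < (1 - s) * (s ^ 2 * (2 - s)) := by
  obtain ⟨u, rfl⟩ : ∃ u, s = 1 - u := ⟨1 - s, by ring⟩
  have hu0 : 0 < u := by linarith
  have hP : (1 - u) ^ 2 * (2 - (1 - u)) = 1 - u - u ^ 2 + u ^ 3 := by ring
  rw [hP] at *
  rw [show 1 - (1 - u) = u by ring]
  have mono : ∀ x y : ℝ, 0 ≤ x → x ≤ y → y ≤ 1 → 1 - y - y ^ 2 + y ^ 3 ≤ 1 - x - x ^ 2 + x ^ 3 := by
    intro x y hx hxy hy
    have e : 1 - x - x ^ 2 + x ^ 3 - (1 - y - y ^ 2 + y ^ 3)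
      = (y - x) * (1 + x + y - (x * x + x * y + y * y)) := by ring
    have : 0 ≤ (y - x) * (1 + x + y - (x * x + x * y + y * y)) := by
      apply mul_nonneg (by linarith)
      have a1 : x * x ≤ x * 1 := mul_le_mul_of_nonneg_left (by linarith) hx
      have a2 : x * y ≤ x * 1 := mul_le_mul_of_nonneg_left hy hx
      have a3 : y * y ≤ y * 1 := mul_le_mul_of_nonneg_left hy (by linarith)
      linarith
    linarith
  have hu1 : u₁ ≤ u := by
    by_contra! hc
    have := mono u u₁ hu0.le hc.le (by linarith)
    linarith
  have hu2 : u ≤ u₂ := by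
    by_contra! hc
    have := mono u₂ u (by linarith) hc.le (by linarith)
    linarith
  have := le_quartic_of_le h0 hu1 hu2 h12 h3 (m := min (u₁ * (1 - u₁ - u₁ ^ 2 + u₁ ^ 3))
    (u₂ * (1 - u₂ - u₂ ^ 2 + u₂ ^ 3))) (min_le_left _ _) (min_le_right _ _)
  have h5 : γ₁ / 4 < min (u₁ * (1 - u₁ - u₁ ^ 2 + u₁ ^ 3)) (u₂ * (1 - u₂ - u₂ ^ 2 + u₂ ^ 3)) :=
    lt_min hm₁ hm₂
  linarith

lemma starPoly_pos {γ D s : ℝ} (hγ0 : 0 < γ) (hγ1 : γ ≤ 0.806) (hs0 : 0 < s) (hs1 : s < 1)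
    (hD₁ : γ ≤ 0.2 → 0.0004 ≤ D)
    (hD₂ : 0.2 ≤ γ → γ ≤ 0.75 → ((0.2 * γ + 0.97) ^ 2 - 1) ^ 2 ≤ D)
    (hD₃ : 0.75 ≤ γ → ((0.6 * γ + 0.67) ^ 2 - 1) ^ 2 ≤ D)
    (hD₄ : γ ≤ 1 / 2 → D ≤ 1 - γ)
    (hD₅ : 1 / 2 ≤ γ → D ≤ 1 - γ - 3 / 4 * (γ - 1 / 2) ^ 2) : 0 < starPoly γ D s := by
  have key : ∀ γ₁ D' c b κ : ℝ, γ ≤ γ₁ → D' ≤ D → γ ≤ 0.75 → 0 ≤ D' ∧ StarCert γ₁ D' c b κ →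
      0 < starPoly γ D s := by
    intro γ₁ D' c b κ h1 h3 h4 ⟨h2, h6⟩
    have h6 := h6.pos hs0.le hs1.le
    rcases le_total γ (1 / 2) with h | h
    · exact starPoly_pos_of_le hγ0 h1 hs0 hs1 h3 (hD₄ h) h6 (starPoly_top_pos_of_le_half h hs0 hs1)
        fun i1 i2 => quarter_lt_of_le h4 hs0 hs1 (by linarith) (by linarith)
    · exact starPoly_pos_of_le hγ0 h1 hs0 hs1 h3 (hD₅ h) h6 (starPoly_top_pos h hγ1 hs0 hs1)
        fun i1 i2 => quarter_lt_of_le h4 hs0 hs1 (by linarith)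
          (by linarith [sq_nonneg (γ - 1 / 2)])
  have low : ∀ a c γ₀ : ℝ, 0 ≤ a → 1 ≤ a * γ₀ + c → γ₀ ≤ γ →
      ((a * γ₀ + c) ^ 2 - 1) ^ 2 ≤ ((a * γ + c) ^ 2 - 1) ^ 2 := by
    intro a c γ₀ ha h0 h1
    have : (a * γ₀ + c) ^ 2 ≤ (a * γ + c) ^ 2 := by gcongr
    have h3 := one_le_pow₀ h0 (n := 2)
    exact pow_le_pow_left₀ (by linarith) (by linarith) 2
  have middle : ∀ γ₀ γ₁ D' c b κ : ℝ, γ₀ < γ → γ ≤ γ₁ → 0.2 ≤ γ₀ ∧ γ₁ ≤ 0.75 ∧ 0 ≤ D' ∧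
      D' ≤ ((0.2 * γ₀ + 0.97) ^ 2 - 1) ^ 2 ∧ StarCert γ₁ D' c b κ → 0 < starPoly γ D s := by
    intro γ₀ γ₁ D' c b κ h h' ⟨h0, h1, h2, h3, h4⟩
    exact key γ₁ D' c b κ h' ((h3.trans (low _ _ _ (by norm_num) (by linarith) h.le)).trans
      (hD₂ (by linarith) (by linarith))) (by linarith) ⟨h2, h4⟩
  have large : ∀ γ₀ γ₁ D' u₁ u₂ c b κ : ℝ, γ₀ < γ → γ ≤ γ₁ → 0.75 ≤ γ₀ ∧
      D' ≤ ((0.6 * γ₀ + 0.67) ^ 2 - 1) ^ 2 ∧ StarCert γ₁ D' c b κ ∧ 0 ≤ u₁ ∧ u₁ < u₂ ∧ u₂ ≤ 1 / 2 ∧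
      γ₁ / 4 < u₁ * (1 - u₁ - u₁ ^ 2 + u₁ ^ 3) ∧ γ₁ / 4 < u₂ * (1 - u₂ - u₂ ^ 2 + u₂ ^ 3) ∧
      1 - γ₀ / 2 - 3 / 4 * (γ₀ - 1 / 2) ^ 2 ≤ 1 - u₁ - u₁ ^ 2 + u₁ ^ 3 ∧
      1 - u₂ - u₂ ^ 2 + u₂ ^ 3 ≤ γ₀ / 2 + D' → 0 < starPoly γ D s := by
    intro γ₀ γ₁ D' u₁ u₂ c b κ h1 h2 ⟨h0, h3, h4, h5, h6, h7, h8, h9, h10, h11⟩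
    have : (γ₀ - 1 / 2) ^ 2 ≤ (γ - 1 / 2) ^ 2 := pow_le_pow_left₀ (by linarith) (by linarith) 2
    exact starPoly_pos_of_le hγ0 h2 hs0 hs1 ((h3.trans (low _ _ _ (by norm_num) (by linarith)
      h1.le)).trans (hD₃ (by linarith))) (hD₅ (by linarith)) (h4.pos hs0.le hs1.le)
      (starPoly_top_pos (by linarith) hγ1 hs0 hs1)
      (quarter_lt_of_bounds u₁ u₂ h1.le h2 hs0 hs1 h5 h6 h7 h8 h9 (by linarith) h11)
  rcases le_or_gt γ 0.2 with h0 | h0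
  · exact key 0.2 0.0004 0.0813 0.156 0.0083 h0 (hD₁ h0) (by linarith) (by norm_num [StarCert])
  rcases le_or_gt γ 0.22 with h1 | h1
  · exact middle 0.2 0.22 0.0004 0.0894 0.1705 0.0099 h0 h1 (by norm_num [StarCert])
  rcases le_or_gt γ 0.26 with h2 | h2
  · exact middle 0.22 0.26 0.000795 0.108 0.2041 0.0144 h1 h2 (by norm_num [StarCert])
  rcases le_or_gt γ 0.34 with h3 | h3
  · exact middle 0.26 0.34 0.0019 0.1465 0.272 0.0257 h2 h3 (by norm_num [StarCert])
  rcases le_or_gt γ 0.46 with h4 | h4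
  · exact middle 0.34 0.46 0.00599 0.2129 0.3795 0.0517 h3 h4 (by norm_num [StarCert])
  rcases le_or_gt γ 0.6 with h5 | h5
  · exact middle 0.46 0.6 0.0163 0.3059 0.519 0.0977 h4 h5 (by norm_num [StarCert])
  rcases le_or_gt γ 0.7 with h6 | h6
  · exact middle 0.6 0.7 0.0353 0.3987 0.637 0.152 h5 h6 (by norm_num [StarCert])
  rcases le_or_gt γ 0.75 with h7 | h7
  · exact middle 0.7 0.75 0.0538 0.4633 0.7125 0.192 h6 h7 (by norm_num [StarCert])
  rcases le_or_gt γ 0.77 with h8 | h8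
  · exact large 0.75 0.77 0.0647 0.34 0.45 0.496 0.7469 0.212 h7 h8 (by norm_num [StarCert])
  rcases le_or_gt γ 0.785 with h9 | h9
  · exact large 0.77 0.785 0.0791 0.357 0.431 0.5321 0.7811 0.235 h8 h9 (by norm_num [StarCert])
  rcases le_or_gt γ 0.798 with h10 | h10
  · exact large 0.785 0.798 0.0911 0.367 0.416 0.5629 0.81 0.253 h9 h10 (by norm_num [StarCert])
  rcases le_or_gt γ 0.804 with h11 | h11
  · exact large 0.798 0.804 0.1022 0.376 0.403 0.5874 0.8281 0.267 h10 h11 (by norm_num [StarCert])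
  · exact large 0.804 0.806 0.1076 0.381 0.396 0.5987 0.8382 0.273 h11 hγ1 (by norm_num [StarCert])

/-! ### The generating orbit -/

lemma PerturbedSystem.one_lt_Mx (P : PerturbedSystem) : 1 < P.Mx ∧ 2 < P.Mx ^ 2 := by
  have h := P.Mx_gt
  have h2 : 1 < √(2 : ℝ) := by rw [Real.lt_sqrt] <;> norm_num
  refine ⟨by linarith, ?_⟩
  have := Real.sq_sqrt (show (0 : ℝ) ≤ 2 by norm_num)
  nlinarith

lemma PerturbedSystem.one_lt_My (P : PerturbedSystem) :
    1 < P.My ∧ 1 < P.γ * (P.My ^ 2 - 1) ^ 2 := by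
  have h := P.My_gt
  have hs : 0 < √P.γ := Real.sqrt_pos.2 P.γ_pos
  have hi : 0 < (√P.γ)⁻¹ := inv_pos.2 hs
  have h2 : 1 < √(1 + (√P.γ)⁻¹) := by rw [Real.lt_sqrt] <;> linarith
  have h1 : 1 < P.My := h2.trans h
  refine ⟨h1, ?_⟩
  have h3 := Real.sq_sqrt (show (0 : ℝ) ≤ 1 + (√P.γ)⁻¹ by linarith)
  have h4 : (√P.γ)⁻¹ < P.My ^ 2 - 1 := by nlinarith
  have h5 : 1 < √P.γ * (P.My ^ 2 - 1) := by
    calc 1 = √P.γ * (√P.γ)⁻¹ := (mul_inv_cancel₀ hs.ne').symm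
      _ < _ := by gcongr
  calc (1 : ℝ) < (√P.γ * (P.My ^ 2 - 1)) ^ 2 := one_lt_pow₀ h5 (by norm_num)
    _ = √P.γ ^ 2 * (P.My ^ 2 - 1) ^ 2 := by ring
    _ = _ := by rw [Real.sq_sqrt P.γ_pos.le]

lemma PerturbedSystem.one_lt_energyBound (P : PerturbedSystem) : 1 < P.energyBound := by
  refine lt_min P.one_lt_My.2 ?_
  have := P.one_lt_Mx.2
  exact one_lt_pow₀ (by linarith) (by norm_num)

lemma sq_lt_of_lt_sqrt_one_add {b x : ℝ} (hb : 1 < b) (hx : 0 ≤ x) (h : b < √(1 + √x)) :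
    (b ^ 2 - 1) ^ 2 < x := by
  have h1 : b ^ 2 < 1 + √x := by
    rw [← Real.sq_sqrt (show 0 ≤ 1 + √x by positivity)]
    exact pow_lt_pow_left₀ h (by linarith) (by norm_num)
  rw [← Real.sq_sqrt hx]
  have : 1 < b ^ 2 := one_lt_pow₀ hb (by norm_num)
  exact pow_lt_pow_left₀ (by linarith) (by linarith) (by norm_num)

namespace GeneratingOrbit

variable {P : PerturbedSystem} (O : GeneratingOrbit P)

lemma deriv_C (φ : ℝ) : deriv O.C φ = P.γ * (O.S φ ^ 3 - O.S φ) := (O.C_deriv φ).deriv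

lemma deriv_S (φ : ℝ) : deriv O.S φ = -(O.C φ ^ 3 - O.C φ) := (O.S_deriv φ).deriv

lemma deriv_C_fun : deriv O.C = fun φ => P.γ * (O.S φ ^ 3 - O.S φ) := funext O.deriv_C

lemma deriv_S_fun : deriv O.S = fun φ => -(O.C φ ^ 3 - O.C φ) := funext O.deriv_S

lemma differentiable_C : Differentiable ℝ O.C := fun φ => (O.C_deriv φ).differentiableAt

lemma differentiable_S : Differentiable ℝ O.S := fun φ => (O.S_deriv φ).differentiableAt

lemma continuous_C : Continuous O.C := O.differentiable_C.continuous

lemma continuous_S : Continuous O.S := O.differentiable_S.continuous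

lemma contDiff_C_S (n : ℕ) : ContDiff ℝ n O.C ∧ ContDiff ℝ n O.S := by
  induction n with
  | zero => exact ⟨contDiff_zero.2 O.continuous_C, contDiff_zero.2 O.continuous_S⟩
  | succ n ih =>
    push_cast
    rw [contDiff_succ_iff_deriv, contDiff_succ_iff_deriv, O.deriv_C_fun, O.deriv_S_fun]
    refine ⟨⟨O.differentiable_C, by simp, ?_⟩, ⟨O.differentiable_S, by simp, ?_⟩⟩
    · exact contDiff_const.mul ((ih.2.pow 3).sub ih.2)
    · exact ((ih.1.pow 3).sub ih.1).neg

/-- The energy of the orbit. -/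
def energy : ℝ := (O.C 0 ^ 2 - 1) ^ 2 + P.γ * (O.S 0 ^ 2 - 1) ^ 2

lemma energy_eq (φ : ℝ) : (O.C φ ^ 2 - 1) ^ 2 + P.γ * (O.S φ ^ 2 - 1) ^ 2 = O.energy := by
  have hd : ∀ x, HasDerivAt (fun φ => (O.C φ ^ 2 - 1) ^ 2 + P.γ * (O.S φ ^ 2 - 1) ^ 2) 0 x := by
    intro x
    have h := ((((O.C_deriv x).pow 2).sub_const 1).pow 2).add
      (((((O.S_deriv x).pow 2).sub_const 1).pow 2).const_mul P.γ)
    refine h.congr_deriv ?_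
    simp
    ring
  exact is_const_of_deriv_eq_zero (fun x => (hd x).differentiableAt) (fun x => (hd x).deriv) φ 0

lemma α_eq (φ : ℝ) : O.α φ = P.γ * (O.S φ ^ 3 - O.S φ) * (O.S φ - O.l)
    + (O.C φ - O.k) * (O.C φ ^ 3 - O.C φ) := by
  rw [α, O.deriv_C, O.deriv_S, Sl, Ck]; ring

/-- The three classes of orbits, with the corresponding bounds on the energy. -/
lemma energy_lt_or (hG : O.GeneratingCondition) :
    (O.k = 0 ∧ O.l = 0 ∧ 1 < O.energy ∧ ((O.energy < 1 + P.γ ∧ O.C 0 ^ 2 < 1 ∧ O.S 0 = 0)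
      ∨ (1 < O.C 0 ∧ O.energy < P.energyBound))) ∨
    ((O.k = 1 ∨ O.k = -1) ∧ O.l = 0 ∧ O.energy < 1 ∧ 0 < O.k * O.C 0 ∧
      (∀ s, s < 1 → 0 < starPoly P.γ (O.energy - P.γ) s)) ∨
    ((O.k = 1 ∨ O.k = -1) ∧ (O.l = 1 ∨ O.l = -1) ∧ 0 < O.energy ∧ O.energy < P.γ ∧
      0 < O.k * O.C 0 ∧ 0 < O.l * O.S 0) := by
  have hγ := P.γ_pos
  have hγ1 := P.γ_le_one
  have hE := P.one_lt_energyBound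
  have h1γ : 0 ≤ 1 - P.γ := by linarith
  have hsq1 : 0 ≤ √(1 - P.γ) := Real.sqrt_nonneg _
  have hsq := Real.sq_sqrt h1γ
  have hsq2 : √(1 - P.γ) < 1 := by rw [Real.sqrt_lt' one_pos]; linarith
  have ksq : (O.k = 1 ∨ O.k = -1) → O.b ^ 2 = ((O.k : ℝ) * O.b) ^ 2 := by
    rintro (h | h) <;> rw [h] <;> push_cast <;> ring
  rcases O.b_range with ⟨hk, hl, hb⟩ | ⟨hk, hl, hb⟩ | ⟨hk, hl, hb⟩
  · refine Or.inl ⟨hk, hl, ?_⟩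
    have he : O.energy = (O.b ^ 2 - 1) ^ 2 + P.γ := by
      rw [energy, O.C_zero, O.S_zero, hl]; push_cast; ring
    rw [he, O.C_zero, O.S_zero, hl]
    rcases hb with hb | hb
    · have h1 : O.b ^ 2 < 1 - √(1 - P.γ) := by
        rw [← Real.sq_sqrt (show 0 ≤ 1 - √(1 - P.γ) by linarith)]
        exact pow_lt_pow_left₀ hb.2 hb.1.le (by norm_num)
      have h2 : 0 < O.b ^ 2 := pow_pos hb.1 2
      have h3 : √(1 - P.γ) ^ 2 < (1 - O.b ^ 2) ^ 2 :=
        pow_lt_pow_left₀ (by linarith) hsq1 (by norm_num)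
      have h4 : (1 - O.b ^ 2) ^ 2 < 1 := pow_lt_one₀ (by linarith) (by linarith) (by norm_num)
      have h5 : (O.b ^ 2 - 1) ^ 2 = (1 - O.b ^ 2) ^ 2 := by ring
      exact ⟨by linarith, Or.inl ⟨by linarith, by linarith, by simp⟩⟩
    · have h0 : 1 ≤ P.rOuter := by
        rw [PerturbedSystem.rOuter, Real.one_le_sqrt]; linarith
      have hb1 : 1 < O.b := lt_of_le_of_lt h0 hb.1
      have h1 : 1 + √(1 - P.γ) < O.b ^ 2 := by
        rw [← Real.sq_sqrt (show 0 ≤ 1 + √(1 - P.γ) by linarith)]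
        exact pow_lt_pow_left₀ hb.1 (Real.sqrt_nonneg _) (by norm_num)
      have h3 : √(1 - P.γ) ^ 2 < (O.b ^ 2 - 1) ^ 2 :=
        pow_lt_pow_left₀ (by linarith) hsq1 (by norm_num)
      have h4 := sq_lt_of_lt_sqrt_one_add hb1 (by linarith) hb.2
      exact ⟨by linarith, Or.inr ⟨hb1, by linarith⟩⟩
  · refine Or.inr (Or.inl ⟨hk, hl, ?_⟩)
    have he : O.energy = (O.b ^ 2 - 1) ^ 2 + P.γ := by
      rw [energy, O.C_zero, O.S_zero, hl]; push_cast; ring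
    have hlt := sq_lt_of_lt_sqrt_one_add hb.1 h1γ hb.2
    obtain ⟨hγ8, hbb⟩ := hG.2 (by rcases hk with h | h <;> rw [h, hl] <;> rfl)
    rw [he, O.C_zero, ksq hk]
    obtain ⟨x, hx⟩ : ∃ x, (O.k : ℝ) * O.b = x := ⟨_, rfl⟩
    rw [hx] at hb hbb hlt ⊢
    have hx1 : 1 < x ^ 2 := one_lt_pow₀ hb.1 (by norm_num)
    have low : ∀ y, 1 ≤ y → y < x → (y ^ 2 - 1) ^ 2 ≤ (x ^ 2 - 1) ^ 2 := by
      intro y hy hyx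
      have h1 : 1 ≤ y ^ 2 := one_le_pow₀ hy
      have h2 : y ^ 2 ≤ x ^ 2 := pow_le_pow_left₀ (by linarith) hyx.le 2
      exact pow_le_pow_left₀ (by linarith) (by linarith) 2
    have hD0 : 0 < (x ^ 2 - 1) ^ 2 := pow_pos (by linarith) 2
    refine ⟨by linarith, by linarith [hb.1], fun s hs1 => ?_⟩
    rw [add_sub_cancel_right]
    rcases le_or_gt s 0 with hs0 | hs0
    · have h1 : 0 ≤ s ^ 2 * (2 - s) := mul_nonneg (sq_nonneg _) (by linarith)
      have h2 : s * (s ^ 2 * (2 - s)) ≤ 0 := mul_nonpos_of_nonpos_of_nonneg hs0 h1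
      have h3 := mul_pos hγ (show 0 < (x ^ 2 - 1) ^ 2 - s * (s ^ 2 * (2 - s)) by linarith)
      rw [starPoly]
      linarith [sq_nonneg (s ^ 2 * (2 - s) - (x ^ 2 - 1) ^ 2)]
    refine starPoly_pos hγ hγ8 hs0 hs1 ?_ ?_ ?_ ?_ ?_
    · intro h
      have h1 := hbb.1
      rw [PerturbedSystem.bMinus, if_pos h] at h1
      exact le_trans (by norm_num) (low 1.01 (by norm_num) h1)
    · intro h h'
      have h1 := hbb.1
      rcases h.eq_or_lt with h2 | h2
      · rw [PerturbedSystem.bMinus, if_pos h2.ge] at h1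
        rw [← h2]
        exact le_trans (by norm_num) (low 1.01 (by norm_num) h1)
      · rw [PerturbedSystem.bMinus, if_neg (not_le.2 h2), if_pos h'] at h1
        exact low _ (by linarith) h1
    · intro h
      have h1 := hbb.1
      rcases h.eq_or_lt with h2 | h2
      · rw [PerturbedSystem.bMinus, if_neg (by linarith), if_pos h2.ge] at h1
        rw [← h2] at h1 ⊢
        exact le_trans (by norm_num) (low _ (by norm_num) h1)
      · rw [PerturbedSystem.bMinus, if_neg (by linarith), if_neg (not_le.2 h2)] at h1
        exact low _ (by linarith) h1
    · exact fun _ => hlt.le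
    · intro h
      rcases h.eq_or_lt with h2 | h2
      · rw [← h2] at hlt ⊢; linarith
      · have h1 := hbb.2
        rw [PerturbedSystem.bPlus, if_neg (by linarith)] at h1
        have h3 : 0 ≤ (3.25 - P.γ - 3 * P.γ ^ 2) / 2 ^ 2 := by
          have : P.γ ^ 2 ≤ 0.806 ^ 2 := pow_le_pow_left₀ hγ.le hγ8 2
          linarith
        have h4 : √(3.25 - P.γ - 3 * P.γ ^ 2) / 2 = √((3.25 - P.γ - 3 * P.γ ^ 2) / 2 ^ 2) := by
          rw [Real.sqrt_div' _ (by positivity), Real.sqrt_sq (by norm_num)]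
        rw [h4] at h1
        have := sq_lt_of_lt_sqrt_one_add hb.1 h3 h1
        linarith
  · refine Or.inr (Or.inr ⟨hk, hl, ?_⟩)
    have he : O.energy = (O.b ^ 2 - 1) ^ 2 := by
      rw [energy, O.C_zero, O.S_zero]; rcases hl with h | h <;> rw [h] <;> push_cast <;> ring
    have hlt := sq_lt_of_lt_sqrt_one_add hb.1 hγ.le hb.2
    have hl2 : (O.l : ℝ) * O.l = 1 := by rcases hl with h | h <;> rw [h] <;> norm_num
    rw [he, O.C_zero, O.S_zero, hl2, ksq hk]
    have hx1 : 1 < ((O.k : ℝ) * O.b) ^ 2 := one_lt_pow₀ hb.1 (by norm_num)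
    exact ⟨pow_pos (by linarith) 2, hlt, by linarith [hb.1], one_pos⟩

lemma _root_.Continuous.pos_of_ne_zero {f : ℝ → ℝ} (hf : Continuous f) (h : ∀ x, f x ≠ 0) {a : ℝ}
    (ha : 0 < f a) (x : ℝ) : 0 < f x := by
  by_contra! hc
  obtain ⟨z, -, hz⟩ := isPreconnected_univ.intermediate_value (mem_univ x) (mem_univ a)
    hf.continuousOn (show (0 : ℝ) ∈ Icc _ _ from ⟨hc, ha.le⟩)
  exact h z hz

lemma k_mul_C_pos (hk : O.k = 1 ∨ O.k = -1) (he : O.energy < 1) (h0 : 0 < O.k * O.C 0) (φ : ℝ) :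
    0 < O.k * O.C φ := by
  refine (continuous_const.mul O.continuous_C).pos_of_ne_zero (fun z hz => ?_) h0 φ
  have hz' : O.C z = 0 := by rcases hk with h | h <;> rw [h] at hz <;> simpa using hz
  have h1 := O.energy_eq z
  have h2 := mul_nonneg P.γ_pos.le (sq_nonneg (O.S z ^ 2 - 1))
  rw [hz'] at h1
  linarith

lemma l_mul_S_pos (hl : O.l = 1 ∨ O.l = -1) (he : O.energy < P.γ) (h0 : 0 < O.l * O.S 0) (φ : ℝ) :
    0 < O.l * O.S φ := by
  refine (continuous_const.mul O.continuous_S).pos_of_ne_zero (fun z hz => ?_) h0 φ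
  have hz' : O.S z = 0 := by rcases hl with h | h <;> rw [h] at hz <;> simpa using hz
  have h1 := O.energy_eq z
  have h2 := sq_nonneg (O.C z ^ 2 - 1)
  rw [hz'] at h1
  linarith

lemma max_sq_lt_one (he : 1 < O.energy) {θ : ℝ} (hθ : max (O.C θ ^ 2) (O.S θ ^ 2) < 1) (φ : ℝ) :
    O.C φ ^ 2 < 1 ∧ O.S φ ^ 2 < 1 := by
  have hc : Continuous fun φ => 1 - max (O.C φ ^ 2) (O.S φ ^ 2) :=
    continuous_const.sub ((O.continuous_C.pow 2).max (O.continuous_S.pow 2))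
  refine max_lt_iff.1 (sub_pos.1 (hc.pos_of_ne_zero (fun z hz => ?_) (sub_pos.2 hθ) φ))
  have hz : max (O.C z ^ 2) (O.S z ^ 2) = 1 := (sub_eq_zero.1 hz).symm
  have i1 : O.C z ^ 2 ≤ 1 := hz ▸ le_max_left _ _
  have i2 : O.S z ^ 2 ≤ 1 := hz ▸ le_max_right _ _
  have i3 := O.energy_eq z
  have i4 := sq_nonneg (O.C z)
  have i5 := sq_nonneg (O.S z)
  rcases max_choice (O.C z ^ 2) (O.S z ^ 2) with h | h <;> rw [h] at hz <;> rw [hz] at i3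
  · have : (O.S z ^ 2 - 1) ^ 2 ≤ 1 := by nlinarith
    have := mul_le_mul P.γ_le_one this (sq_nonneg _) zero_le_one
    linarith
  · nlinarith

lemma _root_.exists_mul_eq_of_sign {k : ℤ} (hk : k = 1 ∨ k = -1) (x : ℝ) : ∃ c, k * x = c ∧
    x ^ 2 = c ^ 2 ∧ (x - k) * (x ^ 3 - x) = (c - 1) ^ 2 * (c * (c + 1)) := by
  refine ⟨_, rfl, ?_⟩
  rcases hk with rfl | rfl <;> constructor <;> push_cast <;> ring

lemma _root_.eq_one_of_sq_mul_eq_zero {c : ℝ} (hc : 0 < c) (h : (c - 1) ^ 2 * (c * (c + 1)) = 0) :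
    c = 1 := by
  have h1 := (mul_eq_zero.1 h).resolve_right (by positivity)
  linarith [pow_eq_zero_iff two_ne_zero |>.1 h1]

lemma α_ne_zero (hG : O.GeneratingCondition) (φ : ℝ) : O.α φ ≠ 0 := by
  intro hα
  rw [O.α_eq] at hα
  have hγ := P.γ_pos
  have hγ1 := P.γ_le_one
  have hE := O.energy_eq φ
  rcases O.energy_lt_or hG with ⟨hk, hl, h1, h2⟩ | ⟨hk, hl, h1, h2, h3⟩ | ⟨hk, hl, h0, h1, h2, h3⟩
  · rw [hk, hl] at hα
    push_cast at hα
    obtain ⟨x, hx⟩ : ∃ x, O.C φ ^ 2 = x := ⟨_, rfl⟩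
    obtain ⟨y, hy⟩ : ∃ y, O.S φ ^ 2 = y := ⟨_, rfl⟩
    have hx0 : 0 ≤ x := hx ▸ sq_nonneg _
    have hy0 : 0 ≤ y := hy ▸ sq_nonneg _
    have e1 : P.γ * (y * (y - 1)) + x * (x - 1) = 0 := by rw [← hα, ← hx, ← hy]; ring
    rw [hx, hy] at hE
    have e2 : x + P.γ * y < P.γ := by linarith
    have e3 : 0 ≤ P.γ * y := mul_nonneg hγ.le hy0
    have hy1 : y < 1 := by
      by_contra! hc
      have := mul_le_mul_of_nonneg_left hc hγ.le
      linarith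
    have hx1 : x < 1 := by linarith
    have e4 : 0 ≤ x * (1 - x) := mul_nonneg hx0 (by linarith)
    have e5 : 0 ≤ P.γ * (y * (1 - y)) := mul_nonneg hγ.le (mul_nonneg hy0 (by linarith))
    have ex : x = 0 := by
      have : x * (1 - x) = 0 := by linarith
      rcases mul_eq_zero.1 this with h | h <;> linarith
    have ey : y = 0 := by
      have : P.γ * (y * (1 - y)) = 0 := by linarith
      rcases mul_eq_zero.1 this with h | h
      · linarith
      · rcases mul_eq_zero.1 h with h | h <;> linarith
    rw [ex, ey] at hE
    rcases h2 with ⟨h2, -⟩ | ⟨h2, -⟩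
    · linarith
    · have := (O.max_sq_lt_one h1 (θ := φ) (by rw [hx, hy, ex, ey]; norm_num) 0).1
      linarith [one_lt_pow₀ h2 two_ne_zero]
  · have hc := O.k_mul_C_pos hk h1 h2 φ
    rw [hl] at hα
    push_cast at hα
    obtain ⟨c, hc', e2, e1⟩ := exists_mul_eq_of_sign hk (O.C φ)
    rw [hc'] at hc
    rw [e1] at hα
    rw [e2] at hE
    have h4 := h3 (1 - c) (by linarith)
    have h5 : starPoly P.γ (O.energy - P.γ) (1 - c)
        = (O.energy - (c - 1) ^ 2 * (c + 1)) ^ 2 - P.γ * (O.energy - (c ^ 2 - 1) ^ 2) := by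
      rw [starPoly]; ring
    have h6 : O.energy - (c - 1) ^ 2 * (c + 1) = -(P.γ * (O.S φ ^ 2 - 1)) := by
      rw [← hE]; linear_combination hα
    rw [h5, h6, ← hE] at h4
    have : (-(P.γ * (O.S φ ^ 2 - 1))) ^ 2 - P.γ * ((c ^ 2 - 1) ^ 2 + P.γ * (O.S φ ^ 2 - 1) ^ 2
      - (c ^ 2 - 1) ^ 2) = 0 := by ring
    linarith
  · have hc := O.k_mul_C_pos hk (by linarith) h2 φ
    have hs := O.l_mul_S_pos hl h1 h3 φ
    obtain ⟨c, hc', e1, e2⟩ := exists_mul_eq_of_sign hk (O.C φ)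
    obtain ⟨s, hs', e3, e4⟩ := exists_mul_eq_of_sign hl (O.S φ)
    rw [hc'] at hc
    rw [hs'] at hs
    rw [e2, mul_assoc, mul_comm (O.S φ ^ 3 - O.S φ), e4] at hα
    have i1 : 0 ≤ (c - 1) ^ 2 * (c * (c + 1)) := by positivity
    have i2 : 0 ≤ P.γ * ((s - 1) ^ 2 * (s * (s + 1))) := by positivity
    have j2 : P.γ * ((s - 1) ^ 2 * (s * (s + 1))) = 0 := by linarith
    rw [e1, e3, eq_one_of_sq_mul_eq_zero hc (by linarith),
      eq_one_of_sq_mul_eq_zero hs ((mul_eq_zero.1 j2).resolve_left hγ.ne')] at hE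
    linarith

lemma mem_rectangle (hG : O.GeneratingCondition) (φ : ℝ) :
    |O.C φ| < P.Mx ∧ |O.S φ| < P.My := by
  have hγ := P.γ_pos
  have hγ1 := P.γ_le_one
  have hMx := P.one_lt_Mx
  have hMy := P.one_lt_My
  have key : O.energy < P.energyBound → |O.C φ| < P.Mx ∧ |O.S φ| < P.My := by
    intro h
    have hE := O.energy_eq φ
    have h1 := h.trans_le (min_le_left _ _)
    have h2 := h.trans_le (min_le_right _ _)
    have i1 := mul_nonneg hγ.le (sq_nonneg (O.S φ ^ 2 - 1))
    have i2 := sq_nonneg (O.C φ ^ 2 - 1)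
    have hMy2 : 1 < P.My ^ 2 := one_lt_pow₀ hMy.1 (by norm_num)
    constructor
    · apply abs_lt_of_sq_lt_sq _ (by linarith)
      have : (O.C φ ^ 2 - 1) ^ 2 < (P.Mx ^ 2 - 1) ^ 2 := by linarith
      have := abs_lt_of_sq_lt_sq this (by linarith)
      linarith [(abs_lt.1 this).2]
    · apply abs_lt_of_sq_lt_sq _ (by linarith)
      have h3 : P.γ * (O.S φ ^ 2 - 1) ^ 2 < P.γ * (P.My ^ 2 - 1) ^ 2 := by linarith
      have := abs_lt_of_sq_lt_sq (lt_of_mul_lt_mul_left h3 hγ.le) (by linarith)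
      linarith [(abs_lt.1 this).2]
  have hE1 := P.one_lt_energyBound
  rcases O.energy_lt_or hG with ⟨hk, hl, h1, h2 | h2⟩ | ⟨hk, hl, h1, -⟩ | ⟨hk, hl, h0, h1, -⟩
  · have j := O.max_sq_lt_one h1 (θ := 0) (by rw [h2.2.2]; exact max_lt h2.2.1 (by norm_num)) φ
    exact ⟨(abs_lt_of_sq_lt_sq (by linarith) zero_le_one).trans hMx.1,
      (abs_lt_of_sq_lt_sq (by linarith) zero_le_one).trans hMy.1⟩
  · exact key h2.2
  · exact key (by linarith)
  · exact key (by linarith)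

lemma k_pow_three : (O.k : ℝ) ^ 3 = O.k := by
  rcases O.b_range with ⟨hk, -⟩ | ⟨hk | hk, -⟩ | ⟨hk | hk, -⟩ <;> rw [hk] <;> norm_num

lemma l_pow_three : (O.l : ℝ) ^ 3 = O.l := by
  rcases O.b_range with ⟨-, hl, -⟩ | ⟨-, hl, -⟩ | ⟨-, hl | hl, -⟩ <;> rw [hl] <;> norm_num

lemma Ck_hasDerivAt (φ : ℝ) : HasDerivAt O.Ck (P.γ * (O.S φ ^ 3 - O.S φ)) φ :=
  (O.C_deriv φ).sub_const _

lemma Sl_hasDerivAt (φ : ℝ) : HasDerivAt O.Sl (-(O.C φ ^ 3 - O.C φ)) φ :=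
  (O.S_deriv φ).sub_const _

lemma α_hasDerivAt (φ : ℝ) : HasDerivAt O.α
    (P.γ * (3 * O.S φ ^ 2 - 1) * (-(O.C φ ^ 3 - O.C φ)) * O.Sl φ
      + O.Ck φ * ((3 * O.C φ ^ 2 - 1) * (P.γ * (O.S φ ^ 3 - O.S φ)))) φ := by
  have e : O.α = fun φ => P.γ * (O.S φ ^ 3 - O.S φ) * O.Sl φ + O.Ck φ * (O.C φ ^ 3 - O.C φ) := by
    funext x; rw [O.α_eq, Sl, Ck]
  rw [e]
  have h1 := (((O.S_deriv φ).pow 3).sub (O.S_deriv φ)).const_mul P.γ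
  have h2 := ((O.C_deriv φ).pow 3).sub (O.C_deriv φ)
  refine ((h1.mul (O.Sl_hasDerivAt φ)).add ((O.Ck_hasDerivAt φ).mul h2)).congr_deriv ?_
  simp
  ring

lemma deriv_α (φ : ℝ) : deriv O.α φ = P.γ * (3 * O.S φ ^ 2 - 1) * deriv O.S φ * O.Sl φ
      + O.Ck φ * ((3 * O.C φ ^ 2 - 1) * deriv O.C φ) := by
  rw [(O.α_hasDerivAt φ).deriv, O.deriv_C, O.deriv_S]

/-- The second-order coefficient `(3 C² - 1) Ck² + γ (3 S² - 1) Sl²`. -/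
def ρ (φ : ℝ) : ℝ :=
  (3 * O.C φ ^ 2 - 1) * O.Ck φ ^ 2 + P.γ * (3 * O.S φ ^ 2 - 1) * O.Sl φ ^ 2

lemma q_eq (φ : ℝ) : O.q φ = (O.α φ ^ 2)⁻¹ * (O.ρ φ - O.α φ) := by
  rw [q, ρ, O.α_eq]
  congr 1
  have hk := O.k_pow_three
  have hl := O.l_pow_three
  rw [Ck, Sl]
  linear_combination (O.C φ - O.k) * hk + P.γ * (O.S φ - O.l) * hl

lemma ρ_eq (hG : O.GeneratingCondition) (φ : ℝ) : O.ρ φ = O.α φ * (O.α φ * O.q φ + 1) := by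
  have := O.α_ne_zero hG φ
  rw [O.q_eq]
  field_simp
  ring

lemma ρ_hasDerivAt (φ : ℝ) : HasDerivAt O.ρ (2 * O.p φ + 2 * deriv O.α φ) φ := by
  have h1 := ((((O.C_deriv φ).pow 2).const_mul 3).sub_const 1).mul ((O.Ck_hasDerivAt φ).pow 2)
  have h2 := ((((((O.S_deriv φ).pow 2).const_mul 3).sub_const 1).const_mul P.γ)).mul
    ((O.Sl_hasDerivAt φ).pow 2)
  refine (h1.add h2).congr_deriv ?_
  rw [O.deriv_α, O.deriv_C, O.deriv_S, p]
  simp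
  ring

lemma contDiff_Ck (n : ℕ) : ContDiff ℝ n O.Ck := (O.contDiff_C_S n).1.sub contDiff_const

lemma contDiff_Sl (n : ℕ) : ContDiff ℝ n O.Sl := (O.contDiff_C_S n).2.sub contDiff_const

lemma contDiff_deriv_C (n : ℕ) : ContDiff ℝ n (deriv O.C) := by
  rw [O.deriv_C_fun]
  exact contDiff_const.mul (((O.contDiff_C_S n).2.pow 3).sub (O.contDiff_C_S n).2)

lemma contDiff_deriv_S (n : ℕ) : ContDiff ℝ n (deriv O.S) := by
  rw [O.deriv_S_fun]
  exact (((O.contDiff_C_S n).1.pow 3).sub (O.contDiff_C_S n).1).neg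

lemma contDiff_α (n : ℕ) : ContDiff ℝ n O.α :=
  ((O.contDiff_deriv_C n).mul (O.contDiff_Sl n)).sub ((O.contDiff_Ck n).mul (O.contDiff_deriv_S n))

lemma contDiff_deriv_α (n : ℕ) : ContDiff ℝ n (deriv O.α) := by
  have h := O.contDiff_α (n + 1)
  push_cast at h
  exact (contDiff_succ_iff_deriv.1 h).2.2

lemma contDiff_inv_α (hG : O.GeneratingCondition) (n : ℕ) : ContDiff ℝ n (fun φ => (O.α φ)⁻¹) :=
  (O.contDiff_α n).inv (O.α_ne_zero hG)

lemma contDiff_q (hG : O.GeneratingCondition) (n : ℕ) : ContDiff ℝ n O.q := by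
  have hC := (O.contDiff_C_S n).1
  have hS := (O.contDiff_C_S n).2
  have h1 := O.contDiff_Ck n
  have h2 := O.contDiff_Sl n
  have h3 : ContDiff ℝ n (fun φ => (O.α φ ^ 2)⁻¹) :=
    ((O.contDiff_α n).pow 2).inv fun φ => pow_ne_zero 2 (O.α_ne_zero hG φ)
  unfold q
  fun_prop

lemma contDiff_p (n : ℕ) : ContDiff ℝ n O.p := by
  have hC := (O.contDiff_C_S n).1
  have hS := (O.contDiff_C_S n).2
  have h1 := O.contDiff_Ck n
  have h2 := O.contDiff_Sl n
  unfold p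
  fun_prop

lemma contDiff_ξ (hG : O.GeneratingCondition) (n : ℕ) : ContDiff ℝ n O.ξ := by
  have h1 := O.contDiff_inv_α hG n
  have h2 := O.contDiff_deriv_α n
  have h3 := O.contDiff_q hG n
  have h4 := O.contDiff_p n
  unfold ξ
  fun_prop

lemma β_hasDerivAt (hG : O.GeneratingCondition) (φ : ℝ) : HasDerivAt O.β (O.ξ φ) φ := by
  have hc : Continuous O.ξ := (O.contDiff_ξ hG 0).continuous
  exact intervalIntegral.integral_hasDerivAt_right (hc.intervalIntegrable _ _)
    (hc.stronglyMeasurableAtFilter _ _) hc.continuousAt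

lemma β_eq (hG : O.GeneratingCondition) (φ : ℝ) :
    O.β φ = (O.ρ 0 * ((O.α 0)⁻¹) ^ 2 - O.ρ φ * ((O.α φ)⁻¹) ^ 2) / 2 := by
  have hd : ∀ x, HasDerivAt (fun φ => -(O.ρ φ * ((O.α φ)⁻¹) ^ 2) / 2) (O.ξ x) x := by
    intro x
    have hα := O.α_ne_zero hG x
    have hα' : HasDerivAt O.α (deriv O.α x) x := (O.α_hasDerivAt x).differentiableAt.hasDerivAt
    refine ((((O.ρ_hasDerivAt x).mul ((hα'.inv hα).pow 2))).neg.div_const 2).congr_deriv ?_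
    have h2 := O.ρ_eq hG x
    simp only [Pi.inv_apply, Pi.pow_apply]
    rw [h2, ξ]
    generalize O.α x = a at *
    simp
    field_simp
    ring
  rw [β, intervalIntegral.integral_eq_sub_of_hasDerivAt (fun x _ => hd x)
    ((O.contDiff_ξ hG 0).continuous.intervalIntegrable _ _)]
  ring

lemma contDiff_β (hG : O.GeneratingCondition) (n : ℕ) : ContDiff ℝ n O.β := by
  have hC := (O.contDiff_C_S n).1
  have hS := (O.contDiff_C_S n).2
  have h1 := O.contDiff_Ck n
  have h2 := O.contDiff_Sl n
  have h3 := O.contDiff_inv_α hG n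
  have e : O.β = fun φ => (O.ρ 0 * ((O.α 0)⁻¹) ^ 2 - ((3 * O.C φ ^ 2 - 1) * O.Ck φ ^ 2
    + P.γ * (3 * O.S φ ^ 2 - 1) * O.Sl φ ^ 2) * ((O.α φ)⁻¹) ^ 2) / 2 := by
    funext φ; rw [O.β_eq hG, ρ, ρ]
  rw [e]
  fun_prop

lemma periodic_Ck : Function.Periodic O.Ck O.ω := fun φ => by rw [Ck, Ck, O.C_periodic]

lemma periodic_Sl : Function.Periodic O.Sl O.ω := fun φ => by rw [Sl, Sl, O.S_periodic]

lemma periodic_deriv_C : Function.Periodic (deriv O.C) O.ω := fun φ => by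
  rw [O.deriv_C, O.deriv_C, O.S_periodic]

lemma periodic_deriv_S : Function.Periodic (deriv O.S) O.ω := fun φ => by
  rw [O.deriv_S, O.deriv_S, O.C_periodic]

lemma periodic_α : Function.Periodic O.α O.ω := fun φ => by
  rw [α, α, O.periodic_deriv_C, O.periodic_Sl, O.periodic_deriv_S, O.periodic_Ck]

lemma periodic_β (hG : O.GeneratingCondition) : Function.Periodic O.β O.ω := fun φ => by
  rw [O.β_eq hG, O.β_eq hG φ, ρ, ρ, ρ, O.periodic_Sl, O.periodic_Ck, O.C_periodic, O.S_periodic,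
    O.periodic_α]

/-! ### The polar system -/

lemma rdot_eq (hG : O.GeneratingCondition) (ν : ℕ) (ε t r φ : ℝ) :
    O.α φ * O.rdot ν ε t r φ = ε ^ ν * (-(deriv O.α φ * r) - O.p φ * r ^ 2
      - (deriv O.C φ * O.Ck φ ^ 3 + P.γ * deriv O.S φ * O.Sl φ ^ 3) * r ^ 3 + ε * O.R t φ r ε) := by
  rw [rdot, mul_inv_cancel_left₀ (O.α_ne_zero hG φ), PerturbedSystem.xdot, PerturbedSystem.ydot, R,
    O.deriv_α]
  obtain ⟨X, hX⟩ : ∃ X, P.X t (O.xPolar φ r) (O.yPolar φ r) ε = X := ⟨_, rfl⟩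
  obtain ⟨Y, hY⟩ : ∃ Y, P.Y t (O.xPolar φ r) (O.yPolar φ r) ε = Y := ⟨_, rfl⟩
  rw [hX, hY, xPolar, yPolar, p, O.deriv_C, O.deriv_S]
  ring

lemma φdot_eq (hG : O.GeneratingCondition) (ν : ℕ) (ε t r φ : ℝ) (hr : 1 + r ≠ 0) :
    O.φdot ν ε t r φ = ε ^ ν * (1 + (1 + r)⁻¹ * (O.α φ * O.q φ * r
      + (O.α φ)⁻¹ * (3 * P.γ * O.S φ * O.Sl φ ^ 3 + 3 * O.C φ * O.Ck φ ^ 3) * r ^ 2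
      + (O.α φ)⁻¹ * (P.γ * O.Sl φ ^ 4 + O.Ck φ ^ 4) * r ^ 3
      + ε * ((O.α φ)⁻¹ * (O.Sl φ * P.X t (O.xPolar φ r) (O.yPolar φ r) ε
          - O.Ck φ * P.Y t (O.xPolar φ r) (O.yPolar φ r) ε)))) := by
  have hα := O.α_ne_zero hG φ
  rw [φdot, PerturbedSystem.xdot, PerturbedSystem.ydot]
  obtain ⟨X, hX⟩ : ∃ X, P.X t (O.xPolar φ r) (O.yPolar φ r) ε = X := ⟨_, rfl⟩
  obtain ⟨Y, hY⟩ : ∃ Y, P.Y t (O.xPolar φ r) (O.yPolar φ r) ε = Y := ⟨_, rfl⟩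
  have hρ := O.ρ_eq hG φ
  have hα1 : O.α φ = P.γ * (O.S φ ^ 3 - O.S φ) * O.Sl φ + O.Ck φ * (O.C φ ^ 3 - O.C φ) := by
    rw [O.α_eq, Sl, Ck]
  rw [hX, hY, xPolar, yPolar]
  rw [ρ] at hρ
  generalize O.α φ = a, O.q φ = qq at *
  field_simp
  linear_combination ε ^ ν * (r * hρ - hα1)

end GeneratingOrbit

/-! ### Bounded solutions of a scalar linear equation -/

lemma le_of_bounded_of_hasDerivAt {y f : ℝ → ℝ} {μ D B : ℝ} (hμ : 0 < μ)
    (hy : ∀ t, HasDerivAt y (μ * (y t + f t)) t) (hB : ∀ t, y t ≤ B) (hf : ∀ t, -D ≤ f t) (t : ℝ) :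
    y t ≤ D := by
  by_contra! hc
  have hd : ∀ s, HasDerivAt (fun s => Real.exp (-(μ * s)) * (y s - D))
      (Real.exp (-(μ * s)) * (μ * (f s + D))) s := by
    intro s
    have h1 : HasDerivAt (fun s => Real.exp (-(μ * s))) (Real.exp (-(μ * s)) * (-(μ * 1))) s :=
      ((hasDerivAt_id s).const_mul μ).neg.exp
    exact (h1.mul ((hy s).sub_const D)).congr_deriv (by ring)
  have hmono : Monotone (fun s => Real.exp (-(μ * s)) * (y s - D)) := by
    apply monotone_of_deriv_nonneg (fun s => (hd s).differentiableAt)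
    intro s
    rw [(hd s).deriv]
    exact mul_nonneg (Real.exp_pos _).le (mul_nonneg hμ.le (by linarith [hf s]))
  have h1 : ∀ s, t ≤ s → Real.exp (μ * (s - t)) * (y t - D) ≤ B - D := by
    intro s hs
    have h2 : Real.exp (-(μ * t)) * (y t - D) ≤ Real.exp (-(μ * s)) * (y s - D) := hmono hs
    have h3 := mul_le_mul_of_nonneg_left h2 (Real.exp_pos (μ * s)).le
    rw [← mul_assoc, ← mul_assoc, ← Real.exp_add, ← Real.exp_add] at h3
    simp only [add_neg_cancel, Real.exp_zero, one_mul] at h3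
    rw [show μ * (s - t) = μ * s + -(μ * t) by ring]
    linarith [hB s]
  have ht : Tendsto (fun s => Real.exp (μ * (s - t)) * (y t - D)) atTop atTop := by
    apply Tendsto.atTop_mul_const (by linarith)
    apply Real.tendsto_exp_atTop.comp
    exact (tendsto_atTop_add_const_right _ (-t) tendsto_id).const_mul_atTop hμ
  obtain ⟨s, hs1, hs2⟩ := ((ht.eventually_gt_atTop (B - D)).and (eventually_ge_atTop t)).exists
  linarith [h1 s hs2]

lemma abs_le_of_bounded_of_hasDerivAt_of_pos {y f : ℝ → ℝ} {μ D B : ℝ} (hμ : 0 < μ)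
    (hy : ∀ t, HasDerivAt y (μ * (y t + f t)) t) (hB : ∀ t, |y t| ≤ B) (hf : ∀ t, |f t| ≤ D) (t : ℝ) :
    |y t| ≤ D := by
  rw [abs_le]
  constructor
  · have := le_of_bounded_of_hasDerivAt (y := fun t => - y t) (f := fun t => - f t) (D := D) (B := B) hμ
      (fun t => (hy t).neg.congr_deriv (by ring)) (fun t => by linarith [(abs_le.1 (hB t)).1])
      (fun t => by linarith [(abs_le.1 (hf t)).2]) t
    linarith
  · exact le_of_bounded_of_hasDerivAt hμ hy (fun t => (abs_le.1 (hB t)).2)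
      (fun t => (abs_le.1 (hf t)).1) t

lemma abs_le_of_bounded_of_hasDerivAt {y f : ℝ → ℝ} {μ D B : ℝ} (hμ : μ ≠ 0)
    (hy : ∀ t, HasDerivAt y (μ * (y t + f t)) t) (hB : ∀ t, |y t| ≤ B) (hf : ∀ t, |f t| ≤ D) (t : ℝ) :
    |y t| ≤ D := by
  rcases lt_or_gt_of_ne hμ with h | h
  · have h1 : ∀ s, HasDerivAt (fun s => y (-s)) (-μ * (y (-s) + f (-s))) s := by
      intro s
      have := (hy (-s)).scomp s (hasDerivAt_neg s)
      exact this.congr_deriv (by simp)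
    have := abs_le_of_bounded_of_hasDerivAt_of_pos (y := fun s => y (-s)) (f := fun s => f (-s))
      (neg_pos.2 h) h1 (fun s => hB (-s)) (fun s => hf (-s)) (-t)
    simpa using this
  · exact abs_le_of_bounded_of_hasDerivAt_of_pos h hy hB hf t

/-! ### Functions of class `C^n` in the phase variables -/

/-- `f(t,p)` is of class `C^n` in `p` on `D`, with derivatives jointly continuous in `(t,p)`, and
`T`-periodic in `t`. -/
structure IsPeriodicCn (n : ℕ) (T : ℝ) (D : Set (Space)) (f : ℝ → Space → ℝ) : Prop where
  contDiffOn : ∀ t, ContDiffOn ℝ n (f t) D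
  continuousOn : ∀ m : ℕ, m ≤ n →
    ContinuousOn (fun w : ℝ × (Space) => iteratedFDerivWithin ℝ m (f w.1) D w.2) (univ ×ˢ D)
  periodic : ∀ t, ∀ p ∈ D, f (t + T) p = f t p

/-- The derivative of `f(t,p)` in the direction `v` of the space of `p`. -/
def partialDeriv (D : Set (Space)) (v : Space) (f : ℝ → Space → ℝ)
    (t : ℝ) (p : Space) : ℝ := fderivWithin ℝ (f t) D p v

namespace IsPeriodicCn

variable {n : ℕ} {T : ℝ} {D : Set (Space)} {f : ℝ → Space → ℝ}

lemma of_succ (h : IsPeriodicCn (n + 1) T D f) : IsPeriodicCn n T D f where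
  contDiffOn t := (h.contDiffOn t).of_le (by exact_mod_cast Nat.le_succ n)
  continuousOn m hm := h.continuousOn m (hm.trans (Nat.le_succ n))
  periodic := h.periodic

lemma continuousOn_uncurry (h : IsPeriodicCn n T D f) :
    ContinuousOn (fun w : ℝ × (Space) => f w.1 w.2) (univ ×ˢ D) := by
  have h0 := h.continuousOn 0 (Nat.zero_le n)
  have h1 := ((ContinuousMultilinearMap.apply ℝ (fun _ : Fin 0 => Space) ℝ
    (fun _ => 0)).continuous.comp_continuousOn h0)
  refine h1.congr fun w _ => ?_
  simp

lemma partialDeriv (hD : UniqueDiffOn ℝ D) (v : Space) (h : IsPeriodicCn (n + 1) T D f) :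
    IsPeriodicCn n T D (partialDeriv D v f) := by
  have hfd : ∀ t, ContDiffOn ℝ n (fderivWithin ℝ (f t) D) D := fun t =>
    (h.contDiffOn t).fderivWithin hD (by norm_cast)
  refine ⟨fun t => (hfd t).clm_apply contDiffOn_const, fun m hm => ?_, fun t p hp => ?_⟩
  · have h1 := h.continuousOn (m + 1) (by omega)
    let A : ((Space) →L[ℝ] ℝ) →L[ℝ] ℝ := ContinuousLinearMap.apply ℝ ℝ v
    let I := continuousMultilinearCurryRightEquiv' ℝ m (Space) ℝ
    have h2 : ContinuousOn (fun w : ℝ × (Space) =>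
        I (iteratedFDerivWithin ℝ (m + 1) (f w.1) D w.2)) (univ ×ˢ D) :=
      I.continuous.comp_continuousOn h1
    have h3 : ContinuousOn (fun w : ℝ × (Space) =>
        ContinuousLinearMap.compContinuousMultilinearMapL ℝ (fun _ : Fin m => Space)
          ((Space) →L[ℝ] ℝ) ℝ A (I (iteratedFDerivWithin ℝ (m + 1) (f w.1) D w.2))) (univ ×ˢ D) :=
      (ContinuousLinearMap.continuous _).comp_continuousOn h2
    refine h3.congr fun w hw => ?_
    have hw2 : w.2 ∈ D := hw.2
    have e1 : I (iteratedFDerivWithin ℝ (m + 1) (f w.1) D w.2)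
        = iteratedFDerivWithin ℝ m (fderivWithin ℝ (f w.1) D) D w.2 := by
      rw [iteratedFDerivWithin_succ_eq_comp_right hD hw2]
      exact I.apply_symm_apply _
    have e2 : _root_.partialDeriv D v f w.1 = A ∘ (fderivWithin ℝ (f w.1) D) := by
      funext p; rfl
    simp only
    rw [e1, e2, A.iteratedFDerivWithin_comp_left ((hfd w.1).contDiffWithinAt hw2) hD hw2
      (by exact_mod_cast hm)]
    rfl
  · have e : fderivWithin ℝ (f (t + T)) D p = fderivWithin ℝ (f t) D p :=
      fderivWithin_congr (fun q hq => h.periodic t q hq) (h.periodic t p hp)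
    rw [_root_.partialDeriv, _root_.partialDeriv, e]

lemma hasFDerivWithinAt (h : IsPeriodicCn (n + 1) T D f) (t : ℝ) {p : Space} (hp : p ∈ D) :
    HasFDerivWithinAt (f t) (fderivWithin ℝ (f t) D p) D p :=
  (((h.contDiffOn t).differentiableOn (by norm_cast)) _ hp).hasFDerivWithinAt

lemma fderivWithin_apply (t : ℝ) (p : Space) (x y z : ℝ) :
    fderivWithin ℝ (f t) D p (x, y, z) = _root_.partialDeriv D (1, 0, 0) f t p * x
      + _root_.partialDeriv D (0, 1, 0) f t p * y + _root_.partialDeriv D (0, 0, 1) f t p * z := by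
  have e : ((x, y, z) : Space) = x • (1, 0, 0) + y • (0, 1, 0) + z • (0, 0, 1) := by simp
  rw [e, map_add, map_add, map_smul, map_smul, map_smul]
  simp only [_root_.partialDeriv, smul_eq_mul]
  ring

lemma hasDerivAt_comp (h : IsPeriodicCn (n + 1) T D f) {x y z : ℝ → ℝ}
    {x' y' z' a : ℝ} (t : ℝ) (hx : HasDerivAt x x' a) (hy : HasDerivAt y y' a)
    (hz : HasDerivAt z z' a) (hs : ∀ᶠ b in 𝓝 a, (x b, y b, z b) ∈ D) :
    HasDerivAt (fun b => f t (x b, y b, z b))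
      (_root_.partialDeriv D (1, 0, 0) f t (x a, y a, z a) * x'
        + _root_.partialDeriv D (0, 1, 0) f t (x a, y a, z a) * y'
        + _root_.partialDeriv D (0, 0, 1) f t (x a, y a, z a) * z') a := by
  rw [← fderivWithin_apply]
  exact (h.hasFDerivWithinAt t hs.self_of_nhds).comp_hasDerivAt a (hx.prodMk (hy.prodMk hz)) hs

lemma hasDerivWithinAt_comp (h : IsPeriodicCn (n + 1) T D f) {x y z : ℝ → ℝ} {s : Set ℝ}
    {x' y' z' a : ℝ} (t : ℝ) (hx : HasDerivWithinAt x x' s a) (hy : HasDerivWithinAt y y' s a)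
    (hz : HasDerivWithinAt z z' s a) (hs : ∀ b ∈ s, (x b, y b, z b) ∈ D)
    (ha : a ∈ s) :
    HasDerivWithinAt (fun b => f t (x b, y b, z b))
      (_root_.partialDeriv D (1, 0, 0) f t (x a, y a, z a) * x'
        + _root_.partialDeriv D (0, 1, 0) f t (x a, y a, z a) * y'
        + _root_.partialDeriv D (0, 0, 1) f t (x a, y a, z a) * z') s a := by
  rw [← fderivWithin_apply]
  exact (h.hasFDerivWithinAt t (hs a ha)).comp_hasDerivWithinAt a (hx.prodMk (hy.prodMk hz)) hs

lemma exists_bound (h : IsPeriodicCn n T D f) (hT : 0 < T) {K : Set (Space)} (hK : IsCompact K)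
    (hKD : K ⊆ D) : ∃ B, 0 ≤ B ∧ ∀ t, ∀ p ∈ K, |f t p| ≤ B := by
  obtain ⟨B, hB⟩ := (isCompact_Icc.prod hK).exists_bound_of_continuousOn
    (h.continuousOn_uncurry.mono (prod_mono (subset_univ (Icc 0 T)) hKD))
  refine ⟨max B 0, le_max_right _ _, fun t p hp => ?_⟩
  have hper : Function.Periodic (fun t => f t p) T := fun t => h.periodic t p (hKD hp)
  obtain ⟨s, hs, hst⟩ := hper.exists_mem_Ico₀ hT t
  have := hB (s, p) ⟨⟨hs.1, hs.2.le⟩, hp⟩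
  rw [show f t p = f s p from hst]
  exact this.trans (le_max_left _ _)

end IsPeriodicCn

lemma uniqueDiffOn_phaseDomain (Mx My ε₀ : ℝ) : UniqueDiffOn ℝ (phaseDomain Mx My ε₀) :=
  (uniqueDiffOn_Ioo _ _).prod ((uniqueDiffOn_Ioo _ _).prod (uniqueDiffOn_Ico _ _))

/-- `X` as a function on the phase-parameter space. -/
def PerturbedSystem.XX (P : PerturbedSystem) (t : ℝ) (p : Space) : ℝ := P.X t p.1 p.2.1 p.2.2

/-- `Y` as a function on the phase-parameter space. -/
def PerturbedSystem.YY (P : PerturbedSystem) (t : ℝ) (p : Space) : ℝ := P.Y t p.1 p.2.1 p.2.2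

/-- The domain of the perturbed system. -/
def PerturbedSystem.dom (P : PerturbedSystem) : Set (Space) := phaseDomain P.Mx P.My P.ε₀

lemma PerturbedSystem.mem_dom (P : PerturbedSystem) {x y ε : ℝ} :
    (x, y, ε) ∈ P.dom ↔ |x| < P.Mx ∧ |y| < P.My ∧ 0 ≤ ε ∧ ε < P.ε₀ := by
  simp only [PerturbedSystem.dom, phaseDomain, mem_prod, mem_Ioo, mem_Ico, abs_lt]

lemma PerturbedSystem.uniqueDiffOn_dom (P : PerturbedSystem) : UniqueDiffOn ℝ P.dom :=
  uniqueDiffOn_phaseDomain _ _ _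

lemma PerturbedSystem.isPeriodicCn_XX (P : PerturbedSystem) : IsPeriodicCn 3 P.T P.dom P.XX where
  contDiffOn := P.X_C3.1
  continuousOn := P.X_C3.2
  periodic t p hp := P.X_periodic t p.1 p.2.1 p.2.2 hp

lemma PerturbedSystem.isPeriodicCn_YY (P : PerturbedSystem) : IsPeriodicCn 3 P.T P.dom P.YY where
  contDiffOn := P.Y_C3.1
  continuousOn := P.Y_C3.2
  periodic t p hp := P.Y_periodic t p.1 p.2.1 p.2.2 hp

lemma Function.Periodic.exists_abs_le {f : ℝ → ℝ} {ω : ℝ} (hf : Function.Periodic f ω)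
    (hω : 0 < ω) (hc : Continuous f) : ∃ K, 0 ≤ K ∧ (∀ x, |f x| ≤ K) ∧ ∃ c, |f c| = K := by
  obtain ⟨c, -, hmax⟩ := isCompact_Icc.exists_isMaxOn (nonempty_Icc.2 hω.le) hc.abs.continuousOn
  refine ⟨_, abs_nonneg _, fun x => ?_, c, rfl⟩
  obtain ⟨y, hy, hxy⟩ := hf.exists_mem_Ico₀ hω x
  rw [hxy]
  exact hmax ⟨hy.1, hy.2.le⟩

namespace GeneratingOrbit

variable {P : PerturbedSystem} (O : GeneratingOrbit P)

/-- The part of the phase-parameter space reached by polar coordinates with a small radius. -/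
lemma exists_box (hG : O.GeneratingCondition) : ∃ ρ > 0, ρ < 1 ∧ ∃ K : Set (Space), IsCompact K ∧
    K ⊆ P.dom ∧ ∀ φ r ε : ℝ, |r| ≤ ρ → ε ∈ Icc 0 (P.ε₀ / 2) → (O.xPolar φ r, O.yPolar φ r, ε) ∈ K := by
  obtain ⟨M₁, -, h₁, c₁, e₁⟩ := O.C_periodic.exists_abs_le O.ω_pos O.continuous_C
  obtain ⟨M₂, -, h₂, c₂, e₂⟩ := O.S_periodic.exists_abs_le O.ω_pos O.continuous_S
  obtain ⟨M₃, m₃, h₃, -⟩ := O.periodic_Ck.exists_abs_le O.ω_pos (O.contDiff_Ck 0).continuous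
  obtain ⟨M₄, m₄, h₄, -⟩ := O.periodic_Sl.exists_abs_le O.ω_pos (O.contDiff_Sl 0).continuous
  have d₁ : 0 < P.Mx - M₁ := sub_pos.2 (e₁ ▸ (O.mem_rectangle hG c₁).1)
  have d₂ : 0 < P.My - M₂ := sub_pos.2 (e₂ ▸ (O.mem_rectangle hG c₂).2)
  obtain ⟨δ, hδ0, hδ⟩ := exists_between (lt_min d₁ d₂)
  have hδ' := lt_min_iff.1 hδ
  refine ⟨min (1 / 2) (δ / (M₃ + M₄ + 1)), lt_min (by norm_num) (by positivity),
    (min_le_left _ _).trans_lt (by norm_num),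
    Icc (-(M₁ + δ)) (M₁ + δ) ×ˢ Icc (-(M₂ + δ)) (M₂ + δ) ×ˢ Icc 0 (P.ε₀ / 2),
    isCompact_Icc.prod (isCompact_Icc.prod isCompact_Icc), ?_, ?_⟩
  · rintro ⟨x, y, ε⟩ ⟨hx, hy, hε⟩
    have hx' : |x| ≤ M₁ + δ := abs_le.2 hx
    have hy' : |y| ≤ M₂ + δ := abs_le.2 hy
    have := P.ε₀_pos
    exact P.mem_dom.2 ⟨by linarith, by linarith, hε.1, by have := hε.2; simp only at this; linarith⟩
  · intro φ r ε hr hε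
    have k : ∀ a, |a| ≤ M₃ + M₄ + 1 → |a * r| ≤ δ := fun a ha => by
      rw [abs_mul]
      exact (mul_le_mul ha (hr.trans (min_le_right _ _)) (abs_nonneg _) (by positivity)).trans_eq
        (mul_div_cancel₀ _ (by positivity))
    exact ⟨abs_le.1 ((abs_add_le _ _).trans (add_le_add (h₁ φ) (k _ (by linarith [h₃ φ])))),
      abs_le.1 ((abs_add_le _ _).trans (add_le_add (h₂ φ) (k _ (by linarith [h₄ φ])))), hε⟩

lemma orbit_mem_dom (hG : O.GeneratingCondition) (φ : ℝ) : (O.C φ, O.S φ, (0 : ℝ)) ∈ P.dom :=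
  P.mem_dom.2 ⟨(O.mem_rectangle hG φ).1, (O.mem_rectangle hG φ).2, le_rfl, P.ε₀_pos⟩

/-- A function on the phase-parameter space along the generating orbit, at `ε = 0`. -/
def onOrbit (f : ℝ → Space → ℝ) (t φ : ℝ) : ℝ := f t (O.C φ, O.S φ, 0)

/-- The derivative in `r` of a function on the phase-parameter space. -/
def radialDeriv (f : ℝ → Space → ℝ) (t φ : ℝ) : ℝ :=
  O.onOrbit (partialDeriv P.dom (1, 0, 0) f) t φ * O.Ck φ
    + O.onOrbit (partialDeriv P.dom (0, 1, 0) f) t φ * O.Sl φ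

lemma xPolar_zero (φ : ℝ) : O.xPolar φ 0 = O.C φ := by rw [xPolar, mul_zero, add_zero]

lemma yPolar_zero (φ : ℝ) : O.yPolar φ 0 = O.S φ := by rw [yPolar, mul_zero, add_zero]

lemma Ro_eq (t φ : ℝ) :
    O.Ro t φ = deriv O.C φ * O.onOrbit P.YY t φ - deriv O.S φ * O.onOrbit P.XX t φ := by
  rw [Ro, R, xPolar_zero, yPolar_zero]; rfl

lemma hasDerivAt_radial (hG : O.GeneratingCondition) {n : ℕ} {f : ℝ → Space → ℝ}
    (hf : IsPeriodicCn (n + 1) P.T P.dom f) (t φ : ℝ) :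
    HasDerivAt (fun r => f t (O.xPolar φ r, O.yPolar φ r, 0)) (O.radialDeriv f t φ) 0 := by
  obtain ⟨ρ, hρ, -, K, -, hKD, hK⟩ := O.exists_box hG
  have hx : HasDerivAt (fun r => O.xPolar φ r) (O.Ck φ) 0 :=
    (((hasDerivAt_id (0 : ℝ)).const_mul (O.Ck φ)).const_add (O.C φ)).congr_deriv (mul_one _)
  have hy : HasDerivAt (fun r => O.yPolar φ r) (O.Sl φ) 0 :=
    (((hasDerivAt_id (0 : ℝ)).const_mul (O.Sl φ)).const_add (O.S φ)).congr_deriv (mul_one _)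
  have h := hf.hasDerivAt_comp t hx hy (hasDerivAt_const (0 : ℝ) (0 : ℝ)) (by
    filter_upwards [Metric.ball_mem_nhds (0 : ℝ) hρ] with r hr
    rw [mem_ball_zero_iff, Real.norm_eq_abs] at hr
    exact hKD (hK φ r 0 hr.le ⟨le_rfl, by linarith [P.ε₀_pos]⟩))
  refine h.congr_deriv ?_
  rw [xPolar_zero, yPolar_zero, radialDeriv, onOrbit, onOrbit]
  ring

lemma RrO_eq (hG : O.GeneratingCondition) (t φ : ℝ) :
    O.RrO t φ = deriv O.C φ * O.radialDeriv P.YY t φ - deriv O.S φ * O.radialDeriv P.XX t φ :=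
  (((O.hasDerivAt_radial hG P.isPeriodicCn_YY t φ).const_mul _).sub
    ((O.hasDerivAt_radial hG P.isPeriodicCn_XX t φ).const_mul _)).deriv

lemma hasDerivWithinAt_parameter {n : ℕ} {f : ℝ → Space → ℝ}
    (hf : IsPeriodicCn (n + 1) P.T P.dom f) (t : ℝ) {x y : ℝ} (hx : |x| < P.Mx) (hy : |y| < P.My)
    {ε : ℝ} (hε : ε ∈ Ico 0 P.ε₀) :
    HasDerivWithinAt (fun ε => f t (x, y, ε)) (partialDeriv P.dom (0, 0, 1) f t (x, y, ε))
      (Ici 0) ε := by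
  have h := hf.hasDerivWithinAt_comp (s := Ico 0 P.ε₀) (a := ε) t (hasDerivWithinAt_const _ _ x)
    (hasDerivWithinAt_const _ _ y) (hasDerivWithinAt_id _ _)
    (fun b hb => P.mem_dom.2 ⟨hx, hy, hb.1, hb.2⟩) hε
  have h2 : Ico 0 P.ε₀ =ᶠ[𝓝 ε] Ici 0 := by
    filter_upwards [Iio_mem_nhds hε.2] with b hb
    exact propext ⟨fun h => h.1, fun h => ⟨h, hb⟩⟩
  refine ((hasDerivWithinAt_congr_set h2).1 h).congr_deriv ?_
  simp

lemma RεO_eq (hG : O.GeneratingCondition) (t φ : ℝ) :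
    O.RεO t φ = deriv O.C φ * O.onOrbit (partialDeriv P.dom (0, 0, 1) P.YY) t φ
      - deriv O.S φ * O.onOrbit (partialDeriv P.dom (0, 0, 1) P.XX) t φ := by
  have hr := O.mem_rectangle hG φ
  have h0 : (0 : ℝ) ∈ Ico 0 P.ε₀ := ⟨le_rfl, P.ε₀_pos⟩
  have h := ((hasDerivWithinAt_parameter P.isPeriodicCn_YY t hr.1 hr.2 h0).const_mul
    (deriv O.C φ)).sub ((hasDerivWithinAt_parameter P.isPeriodicCn_XX t hr.1 hr.2 h0).const_mul
    (deriv O.S φ))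
  rw [RεO]
  simp only [R, xPolar_zero, yPolar_zero]
  exact h.derivWithin (uniqueDiffOn_Ici 0 0 self_mem_Ici)

lemma Φo_eq (t φ : ℝ) : O.Φo t φ =
    (O.α φ)⁻¹ * (O.Sl φ * O.onOrbit P.XX t φ - O.Ck φ * O.onOrbit P.YY t φ) := rfl

end GeneratingOrbit

/-! ### A calculus of functions of `(ε, t, φ, w)` with bounded derivatives -/

namespace HasPartials

variable {E : Type*} [TopologicalSpace E] {f fφ fw g gφ gw : E → ℝ → ℝ → ℝ → ℝ}

lemma of_base {v d : ℝ → ℝ → ℝ} (hv : Continuous fun p : Plane => v p.1 p.2)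
    (hd : Continuous fun p : Plane => d p.1 p.2) (h : ∀ t φ, HasDerivAt (v t) (d t φ) φ) :
    HasPartials (fun (_ : E) t φ _ => v t φ) (fun _ t φ _ => d t φ) (fun _ _ _ _ => 0) where
  cont := hv.comp (by fun_prop : Continuous fun q : E × Space => (q.2.1, q.2.2.1))
  cont_ψ := hd.comp (by fun_prop : Continuous fun q : E × Space => (q.2.1, q.2.2.1))
  cont_w := continuous_const
  deriv_ψ _ t φ _ := h t φ
  deriv_w _ _ _ _ := hasDerivAt_const _ _

lemma of_param {a : E → ℝ} (ha : Continuous a) :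
    HasPartials (fun ε _ _ _ => a ε) (fun _ _ _ _ => 0) (fun _ _ _ _ => 0) where
  cont := by fun_prop
  cont_ψ := continuous_const
  cont_w := continuous_const
  deriv_ψ _ _ _ _ := hasDerivAt_const _ _
  deriv_w _ _ _ _ := hasDerivAt_const _ _

lemma of_fiber {a a' : ℝ → ℝ} (ha : ∀ w, HasDerivAt a (a' w) w) (hc : Continuous a') :
    HasPartials (fun (_ : E) _ _ w => a w) (fun _ _ _ _ => 0) (fun _ _ _ w => a' w) where
  cont := by
    have : Continuous a := continuous_iff_continuousAt.2 fun w => (ha w).continuousAt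
    fun_prop
  cont_ψ := continuous_const
  cont_w := by fun_prop
  deriv_ψ _ _ _ _ := hasDerivAt_const _ _
  deriv_w _ _ _ w := ha w

lemma add (hf : HasPartials f fφ fw) (hg : HasPartials g gφ gw) :
    HasPartials (fun ε t φ w => f ε t φ w + g ε t φ w) (fun ε t φ w => fφ ε t φ w + gφ ε t φ w)
      (fun ε t φ w => fw ε t φ w + gw ε t φ w) where
  cont := hf.cont.add hg.cont
  cont_ψ := hf.cont_ψ.add hg.cont_ψ
  cont_w := hf.cont_w.add hg.cont_w
  deriv_ψ ε t φ w := (hf.deriv_ψ ε t φ w).add (hg.deriv_ψ ε t φ w)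
  deriv_w ε t φ w := (hf.deriv_w ε t φ w).add (hg.deriv_w ε t φ w)

lemma mul (hf : HasPartials f fφ fw) (hg : HasPartials g gφ gw) :
    HasPartials (fun ε t φ w => f ε t φ w * g ε t φ w)
      (fun ε t φ w => fφ ε t φ w * g ε t φ w + f ε t φ w * gφ ε t φ w)
      (fun ε t φ w => fw ε t φ w * g ε t φ w + f ε t φ w * gw ε t φ w) where
  cont := hf.cont.mul hg.cont
  cont_ψ := (hf.cont_ψ.mul hg.cont).add (hf.cont.mul hg.cont_ψ)
  cont_w := (hf.cont_w.mul hg.cont).add (hf.cont.mul hg.cont_w)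
  deriv_ψ ε t φ w := (hf.deriv_ψ ε t φ w).mul (hg.deriv_ψ ε t φ w)
  deriv_w ε t φ w := (hf.deriv_w ε t φ w).mul (hg.deriv_w ε t φ w)

lemma inv (hf : HasPartials f fφ fw) (h0 : ∀ ε t φ w, f ε t φ w ≠ 0) :
    HasPartials (fun ε t φ w => (f ε t φ w)⁻¹) (fun ε t φ w => -fφ ε t φ w * ((f ε t φ w)⁻¹) ^ 2)
      (fun ε t φ w => -fw ε t φ w * ((f ε t φ w)⁻¹) ^ 2) where
  cont := hf.cont.inv₀ fun q => h0 _ _ _ _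
  cont_ψ := hf.cont_ψ.neg.mul ((hf.cont.inv₀ fun q => h0 _ _ _ _).pow 2)
  cont_w := hf.cont_w.neg.mul ((hf.cont.inv₀ fun q => h0 _ _ _ _).pow 2)
  deriv_ψ ε t φ w := ((hf.deriv_ψ ε t φ w).inv (h0 ε t φ w)).congr_deriv (by
    rw [div_eq_mul_inv, inv_pow])
  deriv_w ε t φ w := ((hf.deriv_w ε t φ w).inv (h0 ε t φ w)).congr_deriv (by
    rw [div_eq_mul_inv, inv_pow])

lemma comp_shift (hf : HasPartials f fφ fw) (hg : HasPartials g gφ gw) :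
    HasPartials (fun ε t φ w => f ε t (φ + g ε t φ w) w)
      (fun ε t φ w => fφ ε t (φ + g ε t φ w) w * (1 + gφ ε t φ w))
      (fun ε t φ w => fw ε t (φ + g ε t φ w) w + fφ ε t (φ + g ε t φ w) w * gw ε t φ w) := by
  have hg' := hg.cont
  have hc : Continuous fun q : E × Space =>
      (q.1, q.2.1, q.2.2.1 + g q.1 q.2.1 q.2.2.1 q.2.2.2, q.2.2.2) := by fun_prop
  exact {
    cont := hf.cont.comp hc
    cont_ψ := (hf.cont_ψ.comp hc).mul (continuous_const.add hg.cont_ψ)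
    cont_w := (hf.cont_w.comp hc).add ((hf.cont_ψ.comp hc).mul hg.cont_w)
    deriv_ψ := fun ε t φ w => by
      have h : HasDerivAt (fun θ => θ + g ε t θ w) (1 + gφ ε t φ w) φ :=
        (hasDerivAt_id φ).add (hg.deriv_ψ ε t φ w)
      exact (hf.deriv_ψ ε t (φ + g ε t φ w) w).comp φ h
    deriv_w := fun ε t φ w => by
      have c₁ : Continuous fun p : Plane => fw ε t p.2 p.1 :=
        hf.cont_w.comp (by fun_prop : Continuous fun p : Plane => (ε, t, p.2, p.1))
      have c₂ : Continuous fun p : Plane => fφ ε t p.2 p.1 :=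
        hf.cont_ψ.comp (by fun_prop : Continuous fun p : Plane => (ε, t, p.2, p.1))
      exact hasDerivAt_along (v := fun w φ => f ε t φ w) (fun w φ => hf.deriv_w ε t φ w)
        (fun w φ => hf.deriv_ψ ε t φ w) c₁ c₂ ((hg.deriv_w ε t φ w).const_add φ) }

lemma comp_continuous {E' : Type*} [TopologicalSpace E'] (hf : HasPartials f fφ fw) {i : E' → E}
    (hi : Continuous i) : HasPartials (fun ε => f (i ε)) (fun ε => fφ (i ε)) (fun ε => fw (i ε)) := by
  have hc : Continuous fun q : E' × Space => (i q.1, q.2) := by fun_prop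
  exact {
    cont := hf.cont.comp hc
    cont_ψ := hf.cont_ψ.comp hc
    cont_w := hf.cont_w.comp hc
    deriv_ψ := fun ε => hf.deriv_ψ (i ε)
    deriv_w := fun ε => hf.deriv_w (i ε) }

end HasPartials

/-- `f(ε,t,φ,w)` is two-periodic in `(t,φ)`, and bounded by `K`, together with its derivatives
`fφ`, `fw`, for `0 < ε < ε₁`. -/
structure TameWith (T ω ε₁ K : ℝ) (f fφ fw : ℝ → ℝ → ℝ → ℝ → ℝ) : Prop where
  partials : HasPartials (fun ε : Ioo 0 ε₁ => f ε) (fun ε => fφ ε) (fun ε => fw ε)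
  nonneg : 0 ≤ K
  bound : ∀ ε ∈ Ioo 0 ε₁, ∀ t φ w, |f ε t φ w| ≤ K
  bound_φ : ∀ ε ∈ Ioo 0 ε₁, ∀ t φ w, |fφ ε t φ w| ≤ K
  bound_w : ∀ ε ∈ Ioo 0 ε₁, ∀ t φ w, |fw ε t φ w| ≤ K
  periodic_t : ∀ ε ∈ Ioo 0 ε₁, ∀ t φ w, f ε (t + T) φ w = f ε t φ w
  periodic_φ : ∀ ε ∈ Ioo 0 ε₁, ∀ t φ w, f ε t (φ + ω) w = f ε t φ w

/-- `f` is bounded with bounded derivatives for all small `ε`. -/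
def IsTame (T ω : ℝ) (f : ℝ → ℝ → ℝ → ℝ → ℝ) : Prop :=
  ∃ ε₁ > 0, ∃ K fφ fw, TameWith T ω ε₁ K f fφ fw

/-- `f` is tame, and at a distance `O(ε)` of a function of `(t,φ)` of the class `A`. -/
def IsTameNear (T ω : ℝ) (A : Set (ℝ → ℝ → ℝ)) (f : ℝ → ℝ → ℝ → ℝ → ℝ) : Prop :=
  ∃ f₀ ∈ A, ∃ ε₁ > 0, ∃ K fφ fw, TameWith T ω ε₁ K f fφ fw ∧
    ∀ ε ∈ Ioo 0 ε₁, ∀ t φ w, |fw ε t φ w| ≤ K * ε ∧ |f ε t φ w - f₀ t φ| ≤ K * ε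

section Tame

variable {T ω ε₁ K L : ℝ} {f fφ fw g gφ gw : ℝ → ℝ → ℝ → ℝ → ℝ} {A : Set (ℝ → ℝ → ℝ)}

namespace TameWith

lemma mono (hf : TameWith T ω ε₁ K f fφ fw) {ε₂ K₂ : ℝ} (hε : ε₂ ≤ ε₁) (hK : K ≤ K₂) :
    TameWith T ω ε₂ K₂ f fφ fw where
  partials := hf.partials.comp_continuous (E' := Ioo 0 ε₂)
    (i := fun ε => ⟨ε, ε.2.1, ε.2.2.trans_le hε⟩) (by fun_prop)
  nonneg := hf.nonneg.trans hK
  bound ε hε' t φ w := (hf.bound ε ⟨hε'.1, hε'.2.trans_le hε⟩ t φ w).trans hK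
  bound_φ ε hε' t φ w := (hf.bound_φ ε ⟨hε'.1, hε'.2.trans_le hε⟩ t φ w).trans hK
  bound_w ε hε' t φ w := (hf.bound_w ε ⟨hε'.1, hε'.2.trans_le hε⟩ t φ w).trans hK
  periodic_t ε hε' := hf.periodic_t ε ⟨hε'.1, hε'.2.trans_le hε⟩
  periodic_φ ε hε' := hf.periodic_φ ε ⟨hε'.1, hε'.2.trans_le hε⟩

lemma add (hf : TameWith T ω ε₁ K f fφ fw) (hg : TameWith T ω ε₁ L g gφ gw) :
    TameWith T ω ε₁ (K + L) (fun ε t φ w => f ε t φ w + g ε t φ w)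
      (fun ε t φ w => fφ ε t φ w + gφ ε t φ w) (fun ε t φ w => fw ε t φ w + gw ε t φ w) where
  partials := hf.partials.add hg.partials
  nonneg := add_nonneg hf.nonneg hg.nonneg
  bound ε hε t φ w := (abs_add_le _ _).trans (add_le_add (hf.bound ε hε t φ w) (hg.bound ε hε t φ w))
  bound_φ ε hε t φ w :=
    (abs_add_le _ _).trans (add_le_add (hf.bound_φ ε hε t φ w) (hg.bound_φ ε hε t φ w))
  bound_w ε hε t φ w :=
    (abs_add_le _ _).trans (add_le_add (hf.bound_w ε hε t φ w) (hg.bound_w ε hε t φ w))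
  periodic_t ε hε t φ w := by rw [hf.periodic_t ε hε, hg.periodic_t ε hε]
  periodic_φ ε hε t φ w := by rw [hf.periodic_φ ε hε, hg.periodic_φ ε hε]

lemma _root_.abs_mul_add_mul_le {a b c d K L : ℝ} (ha : |a| ≤ K) (hb : |b| ≤ L) (hc : |c| ≤ K)
    (hd : |d| ≤ L) : |a * b + c * d| ≤ 2 * (K * L) := by
  have hK := (abs_nonneg a).trans ha
  refine (abs_add_le _ _).trans ?_
  rw [abs_mul, abs_mul]
  have h1 := mul_le_mul ha hb (abs_nonneg _) hK
  have h2 := mul_le_mul hc hd (abs_nonneg _) hK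
  linarith

lemma mul (hf : TameWith T ω ε₁ K f fφ fw) (hg : TameWith T ω ε₁ L g gφ gw) :
    TameWith T ω ε₁ (2 * (K * L)) (fun ε t φ w => f ε t φ w * g ε t φ w)
      (fun ε t φ w => fφ ε t φ w * g ε t φ w + f ε t φ w * gφ ε t φ w)
      (fun ε t φ w => fw ε t φ w * g ε t φ w + f ε t φ w * gw ε t φ w) where
  partials := hf.partials.mul hg.partials
  nonneg := mul_nonneg zero_le_two (mul_nonneg hf.nonneg hg.nonneg)
  bound ε hε t φ w := by
    rw [abs_mul]
    have h1 := mul_le_mul (hf.bound ε hε t φ w) (hg.bound ε hε t φ w) (abs_nonneg _) hf.nonneg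
    linarith [mul_nonneg hf.nonneg hg.nonneg]
  bound_φ ε hε t φ w := abs_mul_add_mul_le (hf.bound_φ ε hε t φ w) (hg.bound ε hε t φ w)
    (hf.bound ε hε t φ w) (hg.bound_φ ε hε t φ w)
  bound_w ε hε t φ w := abs_mul_add_mul_le (hf.bound_w ε hε t φ w) (hg.bound ε hε t φ w)
    (hf.bound ε hε t φ w) (hg.bound_w ε hε t φ w)
  periodic_t ε hε t φ w := by rw [hf.periodic_t ε hε, hg.periodic_t ε hε]
  periodic_φ ε hε t φ w := by rw [hf.periodic_φ ε hε, hg.periodic_φ ε hε]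

lemma param : TameWith T ω 1 1 (fun ε _ _ _ => ε) (fun _ _ _ _ => 0) (fun _ _ _ _ => 0) where
  partials := HasPartials.of_param continuous_subtype_val
  nonneg := zero_le_one
  bound ε hε t φ w := by rw [abs_of_pos hε.1]; exact hε.2.le
  bound_φ ε hε t φ w := by simp
  bound_w ε hε t φ w := by simp
  periodic_t _ _ _ _ _ := rfl
  periodic_φ _ _ _ _ _ := rfl

lemma one_add_pos (hf : TameWith T ω ε₁ K f fφ fw) (h : ε₁ * K ≤ 1 / 2) {ε : ℝ} (hε : ε ∈ Ioo 0 ε₁)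
    (t φ w : ℝ) : 1 / 2 ≤ 1 + ε * f ε t φ w := by
  have h1 := (abs_le.1 (hf.bound ε hε t φ w)).1
  have h2 := mul_le_mul_of_nonneg_left h1 hε.1.le
  have h3 := mul_le_mul_of_nonneg_right hε.2.le hf.nonneg
  linarith

lemma inv (hf : TameWith T ω ε₁ K f fφ fw) (h : ε₁ * K ≤ 1 / 2) (h1 : ε₁ ≤ 1) :
    TameWith T ω ε₁ (2 + 4 * K) (fun ε t φ w => (1 + ε * f ε t φ w)⁻¹)
      (fun ε t φ w => -(ε * fφ ε t φ w) * ((1 + ε * f ε t φ w)⁻¹) ^ 2)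
      (fun ε t φ w => -(ε * fw ε t φ w) * ((1 + ε * f ε t φ w)⁻¹) ^ 2) ∧
    ∀ ε ∈ Ioo 0 ε₁, ∀ t φ w, |-(ε * fw ε t φ w) * ((1 + ε * f ε t φ w)⁻¹) ^ 2| ≤ (2 + 4 * K) * ε ∧
      |(1 + ε * f ε t φ w)⁻¹ - 1| ≤ (2 + 4 * K) * ε := by
  have hK := hf.nonneg
  have hp : ∀ ε ∈ Ioo 0 ε₁, ∀ t φ w, 0 < 1 + ε * f ε t φ w := fun ε hε t φ w => by
    have := hf.one_add_pos h hε t φ w; linarith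
  have hi : ∀ ε ∈ Ioo 0 ε₁, ∀ t φ w, |(1 + ε * f ε t φ w)⁻¹| ≤ 2 := fun ε hε t φ w => by
    have := hf.one_add_pos h hε t φ w
    rw [abs_of_pos (inv_pos.2 (hp ε hε t φ w))]
    exact inv_le_of_inv_le₀ (by norm_num) (by linarith)
  have hb : ∀ ε ∈ Ioo 0 ε₁, ∀ t φ w, ∀ a, |a| ≤ K →
      |-(ε * a) * ((1 + ε * f ε t φ w)⁻¹) ^ 2| ≤ 4 * K * ε := fun ε hε t φ w a ha => by
    rw [abs_mul, abs_neg, abs_mul, abs_of_pos hε.1, abs_pow]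
    have h2 := pow_le_pow_left₀ (abs_nonneg _) (hi ε hε t φ w) 2
    have h3 := mul_le_mul_of_nonneg_left ha hε.1.le
    have h4 := mul_le_mul h3 h2 (by positivity) (mul_nonneg hε.1.le hK)
    linarith
  have hP := ((HasPartials.of_param (E := Ioo 0 ε₁) (a := fun _ => 1) continuous_const).add
      ((HasPartials.of_param (a := fun ε : Ioo 0 ε₁ => (ε : ℝ)) continuous_subtype_val).mul
        hf.partials)).inv (fun ε t φ w => (hp ε ε.2 t φ w).ne')
  refine ⟨⟨?_, by positivity, fun ε hε t φ w => ?_, fun ε hε t φ w => ?_, fun ε hε t φ w => ?_,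
    fun ε hε t φ w => ?_, fun ε hε t φ w => ?_⟩, fun ε hε t φ w => ⟨?_, ?_⟩⟩
  · simpa using hP
  · linarith [hi ε hε t φ w]
  · refine (hb ε hε t φ w _ (hf.bound_φ ε hε t φ w)).trans ?_
    have := mul_le_mul_of_nonneg_left (hε.2.le.trans h1) (by positivity : 0 ≤ 4 * K)
    linarith
  · refine (hb ε hε t φ w _ (hf.bound_w ε hε t φ w)).trans ?_
    have := mul_le_mul_of_nonneg_left (hε.2.le.trans h1) (by positivity : 0 ≤ 4 * K)
    linarith
  · rw [hf.periodic_t ε hε]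
  · rw [hf.periodic_φ ε hε]
  · refine (hb ε hε t φ w _ (hf.bound_w ε hε t φ w)).trans ?_
    have := hε.1
    nlinarith
  · have e : (1 + ε * f ε t φ w)⁻¹ - 1 = -(ε * f ε t φ w) * (1 + ε * f ε t φ w)⁻¹ := by
      have := (hp ε hε t φ w).ne'
      field_simp
      ring
    rw [e, abs_mul, abs_neg, abs_mul, abs_of_pos hε.1]
    have h3 := mul_le_mul_of_nonneg_left (hf.bound ε hε t φ w) hε.1.le
    have h4 := mul_le_mul h3 (hi ε hε t φ w) (abs_nonneg _) (mul_nonneg hε.1.le hK)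
    have h5 := mul_nonneg hε.1.le hK
    have := hε.1
    linarith

lemma comp_shift (hf : TameWith T ω ε₁ K f fφ fw) (hg : TameWith T ω ε₁ L g gφ gw) (h1 : ε₁ ≤ 1) :
    TameWith T ω ε₁ (K * (1 + L)) (fun ε t φ w => f ε t (φ + ε * g ε t φ w) w)
      (fun ε t φ w => fφ ε t (φ + ε * g ε t φ w) w * (1 + ε * gφ ε t φ w))
      (fun ε t φ w => fw ε t (φ + ε * g ε t φ w) w
        + fφ ε t (φ + ε * g ε t φ w) w * (ε * gw ε t φ w)) := by
  have hK := hf.nonneg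
  have hL := hg.nonneg
  have hP := hf.partials.comp_shift
    ((HasPartials.of_param (a := fun ε : Ioo 0 ε₁ => (ε : ℝ)) continuous_subtype_val).mul hg.partials)
  have hb : ∀ ε ∈ Ioo 0 ε₁, ∀ a, |a| ≤ L → |ε * a| ≤ L := fun ε hε a ha => by
    rw [abs_mul, abs_of_pos hε.1]
    have := mul_le_mul (hε.2.le.trans h1) ha (abs_nonneg _) zero_le_one
    linarith
  refine ⟨?_, by positivity, fun ε hε t φ w => ?_, fun ε hε t φ w => ?_, fun ε hε t φ w => ?_,
    fun ε hε t φ w => ?_, fun ε hε t φ w => ?_⟩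
  · simpa using hP
  · refine (hf.bound ε hε _ _ _).trans ?_
    linarith [mul_nonneg hK hL]
  · rw [abs_mul]
    refine mul_le_mul (hf.bound_φ ε hε _ _ _) ?_ (abs_nonneg _) hK
    refine (abs_add_le _ _).trans ?_
    rw [abs_one]
    linarith [hb ε hε _ (hg.bound_φ ε hε t φ w)]
  · refine (abs_add_le _ _).trans ?_
    rw [abs_mul]
    have h2 := mul_le_mul (hf.bound_φ ε hε t (φ + ε * g ε t φ w) w)
      (hb ε hε _ (hg.bound_w ε hε t φ w)) (abs_nonneg _) hK
    linarith [hf.bound_w ε hε t (φ + ε * g ε t φ w) w]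
  · rw [hf.periodic_t ε hε, hg.periodic_t ε hε]
  · rw [hg.periodic_φ ε hε, add_right_comm, hf.periodic_φ ε hε]

end TameWith

namespace IsTame

lemma common (hf : IsTame T ω f) (hg : IsTame T ω g) : ∃ ε₁ > 0, ε₁ ≤ 1 ∧ ∃ K fφ fw L gφ gw,
    TameWith T ω ε₁ K f fφ fw ∧ TameWith T ω ε₁ L g gφ gw := by
  obtain ⟨e₁, he₁, K, fφ, fw, hf⟩ := hf
  obtain ⟨e₂, he₂, L, gφ, gw, hg⟩ := hg
  exact ⟨min 1 (min e₁ e₂), by positivity, min_le_left _ _, K, fφ, fw, L, gφ, gw,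
    hf.mono ((min_le_right _ _).trans (min_le_left _ _)) le_rfl,
    hg.mono ((min_le_right _ _).trans (min_le_right _ _)) le_rfl⟩

lemma add (hf : IsTame T ω f) (hg : IsTame T ω g) :
    IsTame T ω (fun ε t φ w => f ε t φ w + g ε t φ w) := by
  obtain ⟨ε₁, h0, -, K, fφ, fw, L, gφ, gw, hf, hg⟩ := hf.common hg
  exact ⟨ε₁, h0, _, _, _, hf.add hg⟩

lemma mul (hf : IsTame T ω f) (hg : IsTame T ω g) :
    IsTame T ω (fun ε t φ w => f ε t φ w * g ε t φ w) := by
  obtain ⟨ε₁, h0, -, K, fφ, fw, L, gφ, gw, hf, hg⟩ := hf.common hg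
  exact ⟨ε₁, h0, _, _, _, hf.mul hg⟩

lemma const (c : ℝ) : IsTame T ω (fun _ _ _ _ => c) :=
  ⟨1, one_pos, |c|, fun _ _ _ _ => 0, fun _ _ _ _ => 0,
    HasPartials.of_param continuous_const, abs_nonneg c, fun _ _ _ _ _ => le_rfl,
    fun _ _ _ _ _ => by simp, fun _ _ _ _ _ => by simp, fun _ _ _ _ _ => rfl, fun _ _ _ _ _ => rfl⟩

lemma neg (hf : IsTame T ω f) : IsTame T ω (fun ε t φ w => -f ε t φ w) := by
  simpa using (const (-1)).mul hf

lemma sub (hf : IsTame T ω f) (hg : IsTame T ω g) :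
    IsTame T ω (fun ε t φ w => f ε t φ w - g ε t φ w) := by
  simpa [sub_eq_add_neg] using hf.add hg.neg

end IsTame

/-- The properties of a class of two-periodic functions that make it possible to use its elements as
coefficients. -/
structure IsCoefficientClass (T ω : ℝ) (A : Subalgebra ℝ (ℝ → ℝ → ℝ)) : Prop where
  T_pos : 0 < T
  ω_pos : 0 < ω
  cont : ∀ v ∈ A, Continuous fun p : Plane => v p.1 p.2
  periodic_t : ∀ v ∈ A, ∀ t φ, v (t + T) φ = v t φ
  periodic_φ : ∀ v ∈ A, ∀ t φ, v t (φ + ω) = v t φ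
  deriv : ∀ v ∈ A, ∃ d : ℝ → ℝ → ℝ, (Continuous fun p : Plane => d p.1 p.2) ∧
    ∀ t φ, HasDerivAt (v t) (d t φ) φ

lemma exists_abs_le_of_two_periodic {T ω : ℝ} (hT : 0 < T) (hω : 0 < ω) {v : ℝ → ℝ → ℝ}
    (hc : Continuous fun p : Plane => v p.1 p.2) (pt : ∀ t φ, v (t + T) φ = v t φ)
    (pφ : ∀ t φ, v t (φ + ω) = v t φ) : ∃ K, 0 ≤ K ∧ ∀ t φ, |v t φ| ≤ K := by
  obtain ⟨K, hK⟩ := (isCompact_Icc.prod isCompact_Icc).exists_bound_of_continuousOn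
    (hc.continuousOn (s := Icc 0 T ×ˢ Icc 0 ω))
  refine ⟨max K 0, le_max_right _ _, fun t φ => ?_⟩
  obtain ⟨s, hs, hst⟩ := Function.Periodic.exists_mem_Ico₀ (f := fun t => v t φ) (fun t => pt t φ) hT t
  obtain ⟨θ, hθ, hθφ⟩ := Function.Periodic.exists_mem_Ico₀ (f := fun φ => v s φ) (fun φ => pφ s φ) hω φ
  have := hK (s, θ) ⟨⟨hs.1, hs.2.le⟩, ⟨hθ.1, hθ.2.le⟩⟩
  rw [show v t φ = v s φ from hst, show v s φ = v s θ from hθφ]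
  exact this.trans (le_max_left _ _)

lemma periodic_deriv_of_hasDerivAt {T ω : ℝ} {v d : ℝ → ℝ → ℝ} (pt : ∀ t φ, v (t + T) φ = v t φ)
    (pφ : ∀ t φ, v t (φ + ω) = v t φ) (hd : ∀ t φ, HasDerivAt (v t) (d t φ) φ) :
    (∀ t φ, d (t + T) φ = d t φ) ∧ ∀ t φ, d t (φ + ω) = d t φ := by
  refine ⟨fun t φ => ?_, fun t φ => ?_⟩
  · have h := hd (t + T) φ
    rw [show v (t + T) = v t from funext (pt t)] at h
    exact h.unique (hd t φ)
  · have h := (hd t (φ + ω)).comp_add_const φ ω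
    rw [show (fun x => v t (x + ω)) = v t from funext (pφ t)] at h
    exact h.unique (hd t φ)

section Near

variable {A : Subalgebra ℝ (ℝ → ℝ → ℝ)}

lemma IsCoefficientClass.tameWith (hA : IsCoefficientClass T ω A) {v : ℝ → ℝ → ℝ} (hv : v ∈ A) :
    ∃ (K : ℝ) (d : ℝ → ℝ → ℝ), (∀ t φ, HasDerivAt (v t) (d t φ) φ) ∧ (∀ t φ, |v t φ| ≤ K) ∧ (∀ t φ, |d t φ| ≤ K) ∧
      ∀ ε₁, TameWith T ω ε₁ K (fun _ t φ _ => v t φ) (fun _ t φ _ => d t φ) (fun _ _ _ _ => 0) := by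
  obtain ⟨d, hdc, hd⟩ := hA.deriv v hv
  have hp := periodic_deriv_of_hasDerivAt (hA.periodic_t v hv) (hA.periodic_φ v hv) hd
  obtain ⟨K, hK0, hK⟩ := exists_abs_le_of_two_periodic hA.T_pos hA.ω_pos (hA.cont v hv)
    (hA.periodic_t v hv) (hA.periodic_φ v hv)
  obtain ⟨K', hK0', hK'⟩ := exists_abs_le_of_two_periodic hA.T_pos hA.ω_pos hdc hp.1 hp.2
  have b1 : ∀ t φ, |v t φ| ≤ max K K' := fun t φ => (hK t φ).trans (le_max_left _ _)
  have b2 : ∀ t φ, |d t φ| ≤ max K K' := fun t φ => (hK' t φ).trans (le_max_right _ _)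
  have h0 : 0 ≤ max K K' := hK0.trans (le_max_left _ _)
  exact ⟨max K K', d, hd, b1, b2, fun ε₁ => ⟨HasPartials.of_base (hA.cont v hv) hdc hd, h0,
    fun _ _ t φ _ => b1 t φ, fun _ _ t φ _ => b2 t φ, fun _ _ _ _ _ => by simpa using h0,
    fun _ _ t φ _ => hA.periodic_t v hv t φ, fun _ _ t φ _ => hA.periodic_φ v hv t φ⟩⟩

lemma IsCoefficientClass.isTameNear (hA : IsCoefficientClass T ω A) {v : ℝ → ℝ → ℝ} (hv : v ∈ A) :
    IsTameNear T ω A (fun _ t φ _ => v t φ) := by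
  obtain ⟨K, d, -, -, -, h⟩ := hA.tameWith hv
  refine ⟨v, hv, 1, one_pos, K, _, _, h 1, fun ε hε t φ w => ?_⟩
  simpa using mul_nonneg (h 1).nonneg hε.1.le

lemma IsTameNear.isTame (hf : IsTameNear T ω A f) : IsTame T ω f := by
  obtain ⟨f₀, -, ε₁, h0, K, fφ, fw, h, -⟩ := hf
  exact ⟨ε₁, h0, K, fφ, fw, h⟩

namespace IsTameNear

lemma common (hf : IsTameNear T ω A f) (hg : IsTameNear T ω A g) : ∃ f₀ ∈ A, ∃ g₀ ∈ A,
    ∃ ε₁ > 0, ε₁ ≤ 1 ∧ ∃ K fφ fw L gφ gw, TameWith T ω ε₁ K f fφ fw ∧ TameWith T ω ε₁ L g gφ gw ∧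
    ∀ ε ∈ Ioo 0 ε₁, ∀ t φ w, (|fw ε t φ w| ≤ K * ε ∧ |f ε t φ w - f₀ t φ| ≤ K * ε) ∧
      (|gw ε t φ w| ≤ L * ε ∧ |g ε t φ w - g₀ t φ| ≤ L * ε) := by
  obtain ⟨f₀, hf₀, e₁, he₁, K, fφ, fw, hf, bf⟩ := hf
  obtain ⟨g₀, hg₀, e₂, he₂, L, gφ, gw, hg, bg⟩ := hg
  have l1 : min 1 (min e₁ e₂) ≤ e₁ := (min_le_right _ _).trans (min_le_left _ _)
  have l2 : min 1 (min e₁ e₂) ≤ e₂ := (min_le_right _ _).trans (min_le_right _ _)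
  exact ⟨f₀, hf₀, g₀, hg₀, min 1 (min e₁ e₂), by positivity, min_le_left _ _, K, fφ, fw, L, gφ, gw,
    hf.mono l1 le_rfl, hg.mono l2 le_rfl, fun ε hε t φ w =>
    ⟨bf ε ⟨hε.1, hε.2.trans_le l1⟩ t φ w, bg ε ⟨hε.1, hε.2.trans_le l2⟩ t φ w⟩⟩

lemma add (hf : IsTameNear T ω A f) (hg : IsTameNear T ω A g) :
    IsTameNear T ω A (fun ε t φ w => f ε t φ w + g ε t φ w) := by
  obtain ⟨f₀, hf₀, g₀, hg₀, ε₁, h0, -, K, fφ, fw, L, gφ, gw, hf, hg, b⟩ := hf.common hg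
  refine ⟨f₀ + g₀, A.add_mem hf₀ hg₀, ε₁, h0, _, _, _, hf.add hg, fun ε hε t φ w => ?_⟩
  obtain ⟨⟨a1, a2⟩, a3, a4⟩ := b ε hε t φ w
  constructor
  · refine (abs_add_le _ _).trans ?_
    linarith
  · have e : f ε t φ w + g ε t φ w - (f₀ + g₀) t φ
        = (f ε t φ w - f₀ t φ) + (g ε t φ w - g₀ t φ) := by simp only [Pi.add_apply]; ring
    rw [e]
    refine (abs_add_le _ _).trans ?_
    linarith

lemma mul (hA : IsCoefficientClass T ω A) (hf : IsTameNear T ω A f) (hg : IsTameNear T ω A g) :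
    IsTameNear T ω A (fun ε t φ w => f ε t φ w * g ε t φ w) := by
  obtain ⟨f₀, hf₀, g₀, hg₀, ε₁, h0, -, K, fφ, fw, L, gφ, gw, hf, hg, b⟩ := hf.common hg
  obtain ⟨M, -, -, hM, -⟩ := hA.tameWith hf₀
  have hM0 : 0 ≤ M := (abs_nonneg _).trans (hM 0 0)
  have hKL := mul_nonneg hf.nonneg hg.nonneg
  have hML := mul_nonneg hM0 hg.nonneg
  refine ⟨f₀ * g₀, A.mul_mem hf₀ hg₀, ε₁, h0, 2 * (K * L) + M * L, _, _,
    (hf.mul hg).mono le_rfl (by linarith), fun ε hε t φ w => ?_⟩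
  obtain ⟨⟨a1, a2⟩, a3, a4⟩ := b ε hε t φ w
  have hε0 := hε.1.le
  have hKε := mul_nonneg hf.nonneg hε0
  constructor
  · refine (abs_add_le _ _).trans ?_
    rw [abs_mul, abs_mul]
    have i1 := mul_le_mul a1 (hg.bound ε hε t φ w) (abs_nonneg _) hKε
    have i2 := mul_le_mul (hf.bound ε hε t φ w) a3 (abs_nonneg _) hf.nonneg
    linarith [mul_nonneg hML hε0]
  · have e : f ε t φ w * g ε t φ w - (f₀ * g₀) t φ
        = (f ε t φ w - f₀ t φ) * g ε t φ w + f₀ t φ * (g ε t φ w - g₀ t φ) := by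
      simp only [Pi.mul_apply]; ring
    rw [e]
    refine (abs_add_le _ _).trans ?_
    rw [abs_mul, abs_mul]
    have i1 := mul_le_mul a2 (hg.bound ε hε t φ w) (abs_nonneg _) hKε
    have i2 := mul_le_mul (hM t φ) a4 (abs_nonneg _) hM0
    linarith [mul_nonneg hKL hε0]

lemma const (hA : IsCoefficientClass T ω A) (c : ℝ) : IsTameNear T ω A (fun _ _ _ _ => c) :=
  hA.isTameNear (v := fun _ _ => c) (A.algebraMap_mem c)

lemma neg (hA : IsCoefficientClass T ω A) (hf : IsTameNear T ω A f) :
    IsTameNear T ω A (fun ε t φ w => -f ε t φ w) := by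
  simpa using (const hA (-1)).mul hA hf

lemma sub (hA : IsCoefficientClass T ω A) (hf : IsTameNear T ω A f) (hg : IsTameNear T ω A g) :
    IsTameNear T ω A (fun ε t φ w => f ε t φ w - g ε t φ w) := by
  simpa [sub_eq_add_neg] using hf.add (hg.neg hA)

lemma pow (hA : IsCoefficientClass T ω A) (hf : IsTameNear T ω A f) (n : ℕ) :
    IsTameNear T ω A (fun ε t φ w => f ε t φ w ^ n) := by
  induction n with
  | zero => simpa using const hA 1
  | succ n ih => simpa [pow_succ] using ih.mul hA hf

end IsTameNear

lemma IsTame.param_mul (hf : IsTame T ω f) :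
    IsTameNear T ω A (fun ε t φ w => ε * f ε t φ w) := by
  obtain ⟨ε₁, h0, h1, K, fφ, fw, -, -, -, hf, -⟩ := hf.common hf
  refine ⟨0, A.zero_mem, ε₁, h0, _, _, _, (TameWith.param.mono h1 le_rfl).mul hf, fun ε hε t φ w => ?_⟩
  have hε0 := hε.1.le
  have hKε := mul_nonneg hf.nonneg hε0
  constructor
  · rw [zero_mul, zero_add, abs_mul, abs_of_nonneg hε0]
    have := mul_le_mul_of_nonneg_left (hf.bound_w ε hε t φ w) hε0
    linarith
  · simp only [Pi.zero_apply, sub_zero]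
    rw [abs_mul, abs_of_nonneg hε0]
    have := mul_le_mul_of_nonneg_left (hf.bound ε hε t φ w) hε0
    linarith

lemma IsTame.inv_one_add (hf : IsTame T ω f) :
    IsTameNear T ω A (fun ε t φ w => (1 + ε * f ε t φ w)⁻¹) := by
  obtain ⟨e₁, he₁, K, fφ, fw, hf⟩ := hf
  have hK := hf.nonneg
  obtain ⟨ε₁, h0, h1, h2, h3⟩ : ∃ ε₁ > 0, ε₁ ≤ e₁ ∧ ε₁ ≤ 1 ∧ ε₁ * K ≤ 1 / 2 := by
    refine ⟨min e₁ (min 1 (1 / (2 * (K + 1)))), by positivity, min_le_left _ _,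
      (min_le_right _ _).trans (min_le_left _ _), ?_⟩
    calc _ ≤ 1 / (2 * (K + 1)) * (K + 1) :=
          mul_le_mul ((min_le_right _ _).trans (min_le_right _ _)) (by linarith) hK (by positivity)
      _ = 1 / 2 := by field_simp
  exact ⟨fun _ _ => 1, A.one_mem, ε₁, h0, _, _, _, (hf.mono h1 le_rfl).inv h3 h2⟩

lemma IsTameNear.comp_shift (hA : IsCoefficientClass T ω A) (hf : IsTameNear T ω A f)
    (hg : IsTame T ω g) : IsTameNear T ω A (fun ε t φ w => f ε t (φ + ε * g ε t φ w) w) := by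
  obtain ⟨f₀, hf₀, e₁, he₁, K, fφ, fw, hf, b⟩ := hf
  obtain ⟨e₂, he₂, L, gφ, gw, hg⟩ := hg
  obtain ⟨M, d, hd, -, hM, -⟩ := hA.tameWith hf₀
  have hM0 : 0 ≤ M := (abs_nonneg _).trans (hM 0 0)
  have l1 : min 1 (min e₁ e₂) ≤ e₁ := (min_le_right _ _).trans (min_le_left _ _)
  have l2 : min 1 (min e₁ e₂) ≤ e₂ := (min_le_right _ _).trans (min_le_right _ _)
  have hK := hf.nonneg
  have hL := hg.nonneg
  have hML := mul_nonneg hM0 hL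
  have hKL := mul_nonneg hK hL
  refine ⟨f₀, hf₀, min 1 (min e₁ e₂), by positivity, K * (1 + L) + M * L, _, _,
    ((hf.mono l1 le_rfl).comp_shift (hg.mono l2 le_rfl) (min_le_left _ _)).mono le_rfl (by linarith),
    fun ε hε t φ w => ?_⟩
  have hε1 : ε ∈ Ioo 0 e₁ := ⟨hε.1, hε.2.trans_le l1⟩
  have hε2 : ε ∈ Ioo 0 e₂ := ⟨hε.1, hε.2.trans_le l2⟩
  have hε0 := hε.1.le
  constructor
  · refine (abs_add_le _ _).trans ?_
    rw [abs_mul, abs_mul, abs_of_nonneg hε0]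
    have i1 := mul_le_mul (hf.bound_φ ε hε1 t (φ + ε * g ε t φ w) w)
      (mul_le_mul_of_nonneg_left (hg.bound_w ε hε2 t φ w) hε0) (by positivity) hK
    linarith [(b ε hε1 t (φ + ε * g ε t φ w) w).1, mul_nonneg hML hε0]
  · have i1 := (b ε hε1 t (φ + ε * g ε t φ w) w).2
    have i2 := abs_sub_le_of_hasDerivAt (hd t) (hM t) φ (φ + ε * g ε t φ w)
    rw [add_sub_cancel_left, abs_mul, abs_of_nonneg hε0] at i2
    have i3 := mul_le_mul_of_nonneg_left
      (mul_le_mul_of_nonneg_left (hg.bound ε hε2 t φ w) hε0) hM0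
    have i4 := abs_sub_le (f ε t (φ + ε * g ε t φ w) w) (f₀ t (φ + ε * g ε t φ w)) (f₀ t φ)
    linarith [mul_nonneg hKL hε0]

/-- The difference quotient of an element of the class along a tame shift is tame. -/
lemma IsCoefficientClass.isTame_quotient (hA : IsCoefficientClass T ω A) {v d : ℝ → ℝ → ℝ}
    (hv : v ∈ A) (hd : d ∈ A) (hvd : ∀ t φ, HasDerivAt (v t) (d t φ) φ) (hg : IsTame T ω g) :
    IsTame T ω (fun ε t φ w => ε⁻¹ * (v t (φ + ε * g ε t φ w) - v t φ)) := by
  obtain ⟨e, he, l1, L, gφ, gw, -, -, -, hg, -⟩ := hg.common hg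
  obtain ⟨M, d', hd', -, hM, -⟩ := hA.tameWith hd
  obtain ⟨N, d'', hd'', -, hN, hv'⟩ := hA.tameWith hv
  obtain rfl : d'' = d := funext fun t => funext fun φ => (hd'' t φ).unique (hvd t φ)
  have hM0 : 0 ≤ M := (abs_nonneg _).trans (hM 0 0)
  have hN0 : 0 ≤ N := (abs_nonneg _).trans (hN 0 0)
  have hL := hg.nonneg
  have hi : Continuous fun ε : Ioo 0 e => (ε : ℝ)⁻¹ :=
    continuous_subtype_val.inv₀ fun ε => ε.2.1.ne'
  have h1 := ((hv' e).comp_shift hg l1).partials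
  have h2 := (hv' e).partials
  have hP := (HasPartials.of_param hi).mul
    (h1.add ((HasPartials.of_param (a := fun _ => (-1 : ℝ)) continuous_const).mul h2))
  refine ⟨e, he, M * L + N * L, fun ε t φ w => ε⁻¹ * (d'' t (φ + ε * g ε t φ w)
    * (1 + ε * gφ ε t φ w) - d'' t φ), fun ε t φ w => ε⁻¹ * (d'' t (φ + ε * g ε t φ w)
    * (ε * gw ε t φ w)), ?_, by positivity, ?_, ?_, ?_, ?_, ?_⟩
  · simpa [sub_eq_add_neg] using hP
  · intro ε hε t φ w
    have i2 := abs_sub_le_of_hasDerivAt (hvd t) (hN t) φ (φ + ε * g ε t φ w)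
    rw [add_sub_cancel_left] at i2
    rw [abs_mul, abs_inv, abs_of_pos hε.1, inv_mul_le_iff₀ hε.1]
    refine i2.trans ?_
    rw [abs_mul, abs_of_pos hε.1]
    have := mul_le_mul_of_nonneg_left (hg.bound ε hε t φ w) (mul_nonneg hN0 hε.1.le)
    linarith [mul_nonneg (mul_nonneg hM0 hL) hε.1.le]
  · intro ε hε t φ w
    have i2 := abs_sub_le_of_hasDerivAt (hd' t) (hM t) φ (φ + ε * g ε t φ w)
    rw [add_sub_cancel_left, abs_mul, abs_of_pos hε.1] at i2
    rw [abs_mul, abs_inv, abs_of_pos hε.1, inv_mul_le_iff₀ hε.1, show d'' t (φ + ε * g ε t φ w) * (1 + ε * gφ ε t φ w) - d'' t φ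
      = (d'' t (φ + ε * g ε t φ w) - d'' t φ) + d'' t (φ + ε * g ε t φ w) * (ε * gφ ε t φ w) by ring]
    refine (abs_add_le _ _).trans ?_
    rw [abs_mul (d'' t (φ + ε * g ε t φ w)), abs_mul ε, abs_of_pos hε.1]
    have i3 := mul_le_mul_of_nonneg_left (hg.bound ε hε t φ w) (mul_nonneg hM0 hε.1.le)
    have i4 := mul_le_mul (hN t (φ + ε * g ε t φ w)) (mul_le_mul_of_nonneg_left
      (hg.bound_φ ε hε t φ w) hε.1.le) (mul_nonneg hε.1.le (abs_nonneg _)) hN0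
    linarith
  · intro ε hε t φ w
    rw [abs_mul, abs_inv, abs_of_pos hε.1, inv_mul_le_iff₀ hε.1, abs_mul, abs_mul, abs_of_pos hε.1]
    have i4 := mul_le_mul (hN t (φ + ε * g ε t φ w)) (mul_le_mul_of_nonneg_left
      (hg.bound_w ε hε t φ w) hε.1.le) (mul_nonneg hε.1.le (abs_nonneg _)) hN0
    linarith [mul_nonneg (mul_nonneg hM0 hL) hε.1.le]
  · intro ε hε t φ w
    rw [hg.periodic_t ε hε, hA.periodic_t v hv, hA.periodic_t v hv]
  · intro ε hε t φ w
    rw [hg.periodic_φ ε hε, add_right_comm, hA.periodic_φ v hv, hA.periodic_φ v hv]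

end Near

end Tame

/-! ### Remainders of Taylor expansions -/

lemma hasDerivAt_integral_of_continuous {F F' : ℝ → ℝ → ℝ} (hF : ∀ x, Continuous (F x))
    (hF' : Continuous fun p : Plane => F' p.1 p.2)
    (h : ∀ x θ, HasDerivAt (fun x => F x θ) (F' x θ) x) (a b x : ℝ) :
    HasDerivAt (fun x => ∫ θ in a..b, F x θ) (∫ θ in a..b, F' x θ) x := by
  obtain ⟨B, hB⟩ := ((isCompact_closedBall x 1).prod (isCompact_uIcc (a := a) (b := b))).exists_bound_of_continuousOn
    hF'.continuousOn
  refine (intervalIntegral.hasDerivAt_integral_of_dominated_loc_of_deriv_le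
    (bound := fun _ => B) (Metric.closedBall_mem_nhds x one_pos) ?_ ?_ ?_ ?_ ?_ ?_).2
  · exact Eventually.of_forall fun y => (hF y).aestronglyMeasurable
  · exact (hF x).intervalIntegrable _ _
  · exact (hF'.comp (by fun_prop : Continuous fun θ : ℝ => (x, θ))).aestronglyMeasurable
  · exact Eventually.of_forall fun θ hθ y hy => hB (y, θ) ⟨hy, uIoc_subset_uIcc hθ⟩
  · exact intervalIntegrable_const
  · exact Eventually.of_forall fun θ _ y _ => h y θ

/-- The nearest point of the unit interval. -/
def clampUnit (θ : ℝ) : ℝ := max 0 (min 1 θ)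

lemma clampUnit_mem (θ : ℝ) : clampUnit θ ∈ Icc (0 : ℝ) 1 :=
  ⟨le_max_left _ _, max_le zero_le_one (min_le_left _ _)⟩

lemma clampUnit_of_mem {θ : ℝ} (h : θ ∈ Icc (0 : ℝ) 1) : clampUnit θ = θ := by
  rw [clampUnit, min_eq_right h.2, max_eq_right h.1]

lemma continuous_clampUnit : Continuous clampUnit :=
  continuous_const.max (continuous_const.min continuous_id)

lemma exists_cutoff (N : ℝ) (hN : 0 < N) : ∃ (χ χ' : ℝ → ℝ) (M : ℝ), (∀ w, HasDerivAt χ (χ' w) w) ∧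
    Continuous χ' ∧ (∀ w, |χ w| ≤ M) ∧ (∀ w, |χ' w| ≤ M) ∧ ∀ w, |w| ≤ N → χ w = w := by
  let f : ContDiffBump (0 : ℝ) := ⟨N, N + 1, hN, by linarith⟩
  have hs : HasCompactSupport fun w => w * f w := f.hasCompactSupport.mul_left
  have hd : ContDiff ℝ 1 fun w => w * f w := contDiff_id.mul f.contDiff
  have hd' : Continuous (deriv fun w => w * f w) := hd.continuous_deriv le_rfl
  obtain ⟨M₁, h₁⟩ := hs.exists_bound_of_continuous hd.continuous
  obtain ⟨M₂, h₂⟩ := hs.deriv.exists_bound_of_continuous hd'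
  refine ⟨fun w => w * f w, deriv fun w => w * f w, max M₁ M₂,
    fun w => (hd.differentiable one_ne_zero w).hasDerivAt, hd', fun w => (h₁ w).trans (le_max_left _ _),
    fun w => (h₂ w).trans (le_max_right _ _), fun w hw => ?_⟩
  have : f w = 1 := f.one_of_mem_closedBall (by simpa using hw)
  simp only [this, mul_one]

namespace GeneratingOrbit

variable {P : PerturbedSystem} (O : GeneratingOrbit P)

/-- The weighted mean of `f` on the segment that joins the point of the generating orbit with the
parameter `0` to the point with the radius `ε s` and the parameter `ε`. -/
def segmentMean (f : ℝ → Space → ℝ) (s : ℝ → ℝ → ℝ → ℝ → ℝ) (ε t φ w : ℝ) : ℝ :=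
  ∫ θ in (0 : ℝ)..1, (1 - clampUnit θ) * f t (O.xPolar φ (clampUnit θ * (ε * s ε t φ w)),
    O.yPolar φ (clampUnit θ * (ε * s ε t φ w)), clampUnit θ * ε)

lemma integral_one_sub_clampUnit : ∫ θ in (0 : ℝ)..1, (1 - clampUnit θ) = 1 / 2 := by
  have : ∫ θ in (0 : ℝ)..1, (1 - clampUnit θ) = ∫ θ in (0 : ℝ)..1, (1 - θ) := by
    apply intervalIntegral.integral_congr
    intro θ hθ
    rw [uIcc_of_le zero_le_one] at hθ
    simp only [clampUnit_of_mem hθ]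
  have hc : Continuous fun θ : ℝ => θ := continuous_id
  rw [this, intervalIntegral.integral_sub intervalIntegrable_const (hc.intervalIntegrable _ _)]
  simp
  norm_num

/-- The three directions of the phase-parameter space. -/
def _root_.phaseDirection : Fin 3 → Space := ![(1, 0, 0), (0, 1, 0), (0, 0, 1)]

/-- The components of the direction of the segment used in Taylor's formula. -/
def segmentDirection (s φ : ℝ) : Fin 3 → ℝ := ![O.Ck φ * s, O.Sl φ * s, 1]

lemma hasDerivWithinAt_segment {n : ℕ} {f : ℝ → Space → ℝ}
    (hf : IsPeriodicCn (n + 1) P.T P.dom f) {ε t φ s : ℝ}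
    (hmem : ∀ σ ∈ Icc (0 : ℝ) 1, (O.xPolar φ (σ * (ε * s)), O.yPolar φ (σ * (ε * s)), σ * ε) ∈ P.dom)
    {σ : ℝ} (hσ : σ ∈ Icc (0 : ℝ) 1) :
    HasDerivWithinAt (fun σ => f t (O.xPolar φ (σ * (ε * s)), O.yPolar φ (σ * (ε * s)), σ * ε))
      (ε * ∑ i, O.segmentDirection s φ i * partialDeriv P.dom (phaseDirection i) f t
        (O.xPolar φ (σ * (ε * s)), O.yPolar φ (σ * (ε * s)), σ * ε)) (Icc 0 1) σ := by
  have d1 : HasDerivAt (fun σ : ℝ => σ * (ε * s)) (ε * s) σ := by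
    simpa using (hasDerivAt_id σ).mul_const (ε * s)
  have d2 : HasDerivAt (fun σ : ℝ => σ * ε) ε σ := by
    simpa using (hasDerivAt_id σ).mul_const ε
  refine (hf.hasDerivWithinAt_comp t ((d1.const_mul (O.Ck φ)).const_add (O.C φ)).hasDerivWithinAt
    ((d1.const_mul (O.Sl φ)).const_add (O.S φ)).hasDerivWithinAt d2.hasDerivWithinAt hmem hσ).congr_deriv ?_
  simp only [Fin.sum_univ_three, segmentDirection, phaseDirection, xPolar, yPolar]
  simp
  ring

lemma isTameNear_segmentMean (hG : O.GeneratingCondition) {A : Subalgebra ℝ (ℝ → ℝ → ℝ)}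
    {f : ℝ → Space → ℝ} (hf : IsPeriodicCn 1 P.T P.dom f) (hfA : O.onOrbit f ∈ A)
    {s : ℝ → ℝ → ℝ → ℝ → ℝ} (hs : IsTame P.T O.ω s) :
    IsTameNear P.T O.ω A (O.segmentMean f s) := by
  obtain ⟨ρ, hρ, -, K, hKc, hKD, hK⟩ := O.exists_box hG
  obtain ⟨e, he, L, sφ, sw, hs⟩ := hs
  have hL := hs.nonneg
  have hε₀ := P.ε₀_pos
  obtain ⟨ε₁, h0, h1, h2, h3, h4⟩ : ∃ ε₁ > 0, ε₁ ≤ e ∧ ε₁ ≤ 1 ∧ ε₁ ≤ P.ε₀ / 2 ∧ ε₁ * L ≤ ρ := by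
    refine ⟨min (min e 1) (min (P.ε₀ / 2) (ρ / (L + 1))), by positivity,
      (min_le_left _ _).trans (min_le_left _ _), (min_le_left _ _).trans (min_le_right _ _),
      (min_le_right _ _).trans (min_le_left _ _), ?_⟩
    calc _ ≤ ρ / (L + 1) * (L + 1) :=
          mul_le_mul ((min_le_right _ _).trans (min_le_right _ _)) (by linarith) hL (by positivity)
      _ = ρ := by field_simp
  replace hs := hs.mono h1 le_rfl
  set D := P.dom with hDdef
  have hD : UniqueDiffOn ℝ D := P.uniqueDiffOn_dom
  set f₁ := partialDeriv D (1, 0, 0) f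
  set f₂ := partialDeriv D (0, 1, 0) f
  set f₃ := partialDeriv D (0, 0, 1) f
  have hf₁ : IsPeriodicCn 0 P.T D f₁ := hf.partialDeriv hD _
  have hf₂ : IsPeriodicCn 0 P.T D f₂ := hf.partialDeriv hD _
  have hf₃ : IsPeriodicCn 0 P.T D f₃ := hf.partialDeriv hD _
  obtain ⟨B₀, hB₀, b₀⟩ := hf.exists_bound P.T_pos hKc hKD
  obtain ⟨B₁, hB₁, b₁⟩ := hf₁.exists_bound P.T_pos hKc hKD
  obtain ⟨B₂, hB₂, b₂⟩ := hf₂.exists_bound P.T_pos hKc hKD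
  obtain ⟨B₃, hB₃, b₃⟩ := hf₃.exists_bound P.T_pos hKc hKD
  obtain ⟨M₁, m₁, k₁, -⟩ := O.periodic_Ck.exists_abs_le O.ω_pos (O.contDiff_Ck 0).continuous
  obtain ⟨M₂, m₂, k₂, -⟩ := O.periodic_Sl.exists_abs_le O.ω_pos (O.contDiff_Sl 0).continuous
  obtain ⟨M₃, m₃, k₃, -⟩ := O.periodic_deriv_C.exists_abs_le O.ω_pos (O.contDiff_deriv_C 0).continuous
  obtain ⟨M₄, m₄, k₄, -⟩ := O.periodic_deriv_S.exists_abs_le O.ω_pos (O.contDiff_deriv_S 0).continuous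
  -- the point at which the integrand is taken
  let pt : ℝ → ℝ → ℝ → ℝ → ℝ → Space := fun ε t φ w θ =>
    (O.xPolar φ (clampUnit θ * (ε * s ε t φ w)), O.yPolar φ (clampUnit θ * (ε * s ε t φ w)),
      clampUnit θ * ε)
  have hc1 : ∀ θ x, |(1 - clampUnit θ) * x| ≤ |x| := fun θ x => by
    have h := clampUnit_mem θ
    rw [abs_mul, abs_of_nonneg (sub_nonneg.2 h.2)]
    exact mul_le_of_le_one_left (abs_nonneg _) (by linarith [h.1])
  have hsc : ∀ ε ∈ Ioo 0 ε₁, ∀ c ∈ Icc (0 : ℝ) 1, ∀ a, |a| ≤ L → |c * (ε * a)| ≤ L * ε := by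
    intro ε hε c hc a ha
    rw [abs_mul, abs_mul, abs_of_pos hε.1, abs_of_nonneg hc.1, mul_comm L]
    exact (mul_le_of_le_one_left (mul_nonneg hε.1.le (abs_nonneg _)) hc.2).trans
      (mul_le_mul_of_nonneg_left ha hε.1.le)
  have hmem : ∀ ε ∈ Ioo 0 ε₁, ∀ t φ w, ∀ c ∈ Icc (0 : ℝ) 1, (O.xPolar φ (c * (ε * s ε t φ w)),
      O.yPolar φ (c * (ε * s ε t φ w)), c * ε) ∈ K := by
    intro ε hε t φ w c hc
    refine hK _ _ _ ((hsc ε hε c hc _ (hs.bound ε hε t φ w)).trans ?_)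
      ⟨mul_nonneg hc.1 hε.1.le, (mul_le_of_le_one_left hε.1.le hc.2).trans (hε.2.le.trans h3)⟩
    rw [mul_comm]
    exact (mul_le_mul_of_nonneg_right hε.2.le hL).trans h4
  have hpt : ∀ ε ∈ Ioo 0 ε₁, ∀ t φ w θ, pt ε t φ w θ ∈ K := fun ε hε t φ w θ =>
    hmem ε hε t φ w _ (clampUnit_mem θ)
  have hzφ : Continuous fun z : (Ioo 0 ε₁ × Space) × ℝ => z.1.2.2.1 := by fun_prop
  have hzε : Continuous fun z : (Ioo 0 ε₁ × Space) × ℝ => (z.1.1 : ℝ) := by fun_prop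
  have hz₂ : Continuous fun z : (Ioo 0 ε₁ × Space) × ℝ => z.2 := continuous_snd
  have hptc : Continuous fun z : (Ioo 0 ε₁ × Space) × ℝ =>
      pt z.1.1 z.1.2.1 z.1.2.2.1 z.1.2.2.2 z.2 := by
    have r := (continuous_clampUnit.comp hz₂).mul (hzε.mul (hs.partials.cont.comp continuous_fst))
    exact ((O.continuous_C.comp hzφ).add (((O.contDiff_Ck 0).continuous.comp hzφ).mul r)).prodMk
      (((O.continuous_S.comp hzφ).add (((O.contDiff_Sl 0).continuous.comp hzφ).mul r)).prodMk
        ((continuous_clampUnit.comp hz₂).mul hzε))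
  have hcomp : ∀ {g : ℝ → Space → ℝ}, IsPeriodicCn 0 P.T D g →
      Continuous fun z : (Ioo 0 ε₁ × Space) × ℝ =>
        g z.1.2.1 (pt z.1.1 z.1.2.1 z.1.2.2.1 z.1.2.2.2 z.2) := by
    intro g hg
    exact hg.continuousOn_uncurry.comp_continuous
      (f := fun z : (Ioo 0 ε₁ × Space) × ℝ =>
        (z.1.2.1, pt z.1.1 z.1.2.1 z.1.2.2.1 z.1.2.2.2 z.2))
      (Continuous.prodMk (by fun_prop) hptc) (fun z => ⟨mem_univ _, hKD (hpt _ z.1.1.2 _ _ _ _)⟩)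
  -- the derivatives of the integrand
  let F : ℝ → ℝ → ℝ → ℝ → ℝ → ℝ := fun ε t φ w θ => (1 - clampUnit θ) * f t (pt ε t φ w θ)
  let Fφ : ℝ → ℝ → ℝ → ℝ → ℝ → ℝ := fun ε t φ w θ => (1 - clampUnit θ) *
    (f₁ t (pt ε t φ w θ) * (deriv O.C φ + (deriv O.C φ * (clampUnit θ * (ε * s ε t φ w))
        + O.Ck φ * (clampUnit θ * (ε * sφ ε t φ w))))
      + f₂ t (pt ε t φ w θ) * (deriv O.S φ + (deriv O.S φ * (clampUnit θ * (ε * s ε t φ w))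
        + O.Sl φ * (clampUnit θ * (ε * sφ ε t φ w)))) + f₃ t (pt ε t φ w θ) * 0)
  let Fw : ℝ → ℝ → ℝ → ℝ → ℝ → ℝ := fun ε t φ w θ => (1 - clampUnit θ) *
    (f₁ t (pt ε t φ w θ) * (O.Ck φ * (clampUnit θ * (ε * sw ε t φ w)))
      + f₂ t (pt ε t φ w θ) * (O.Sl φ * (clampUnit θ * (ε * sw ε t φ w))) + f₃ t (pt ε t φ w θ) * 0)
  have hcF : Continuous fun z : (Ioo 0 ε₁ × Space) × ℝ =>
      F z.1.1 z.1.2.1 z.1.2.2.1 z.1.2.2.2 z.2 := by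
    exact (continuous_const.sub (continuous_clampUnit.comp hz₂)).mul (hcomp hf.of_succ)
  have hcφ : Continuous fun z : (Ioo 0 ε₁ × Space) × ℝ =>
      Fφ z.1.1 z.1.2.1 z.1.2.2.1 z.1.2.2.2 z.2 := by
    have r := (continuous_clampUnit.comp hz₂).mul (hzε.mul (hs.partials.cont.comp continuous_fst))
    have r' := (continuous_clampUnit.comp hz₂).mul (hzε.mul (hs.partials.cont_ψ.comp continuous_fst))
    have e6 := (O.contDiff_deriv_C 0).continuous.comp hzφ
    have e7 := (O.contDiff_deriv_S 0).continuous.comp hzφ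
    have e8 := (O.contDiff_Ck 0).continuous.comp hzφ
    have e9 := (O.contDiff_Sl 0).continuous.comp hzφ
    exact (continuous_const.sub (continuous_clampUnit.comp hz₂)).mul
      ((((hcomp hf₁).mul (e6.add ((e6.mul r).add (e8.mul r')))).add
        ((hcomp hf₂).mul (e7.add ((e7.mul r).add (e9.mul r'))))).add ((hcomp hf₃).mul continuous_const))
  have hcw : Continuous fun z : (Ioo 0 ε₁ × Space) × ℝ =>
      Fw z.1.1 z.1.2.1 z.1.2.2.1 z.1.2.2.2 z.2 := by
    have r' := (continuous_clampUnit.comp hz₂).mul (hzε.mul (hs.partials.cont_w.comp continuous_fst))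
    have e8 := (O.contDiff_Ck 0).continuous.comp hzφ
    have e9 := (O.contDiff_Sl 0).continuous.comp hzφ
    exact (continuous_const.sub (continuous_clampUnit.comp hz₂)).mul
      ((((hcomp hf₁).mul (e8.mul r')).add
        ((hcomp hf₂).mul (e9.mul r'))).add ((hcomp hf₃).mul continuous_const))
  have hdφ : ∀ ε ∈ Ioo 0 ε₁, ∀ t φ w θ, HasDerivAt (fun φ => F ε t φ w θ) (Fφ ε t φ w θ) φ := by
    intro ε hε t φ w θ
    have d1 := ((hs.partials.deriv_ψ ⟨ε, hε⟩ t φ w).const_mul ε).const_mul (clampUnit θ)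
    have d2 : HasDerivAt O.C (deriv O.C φ) φ := (O.differentiable_C φ).hasDerivAt
    have d3 : HasDerivAt O.S (deriv O.S φ) φ := (O.differentiable_S φ).hasDerivAt
    have d4 : HasDerivAt O.Ck (deriv O.C φ) φ := d2.sub_const _
    have d5 : HasDerivAt O.Sl (deriv O.S φ) φ := d3.sub_const _
    exact (hf.hasDerivAt_comp t (d2.add (d4.mul d1)) (d3.add (d5.mul d1))
      (hasDerivAt_const φ (clampUnit θ * ε))
      (Eventually.of_forall fun φ => hKD (hpt ε hε t φ w θ))).const_mul _
  have hdw : ∀ ε ∈ Ioo 0 ε₁, ∀ t φ w θ, HasDerivAt (fun w => F ε t φ w θ) (Fw ε t φ w θ) w := by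
    intro ε hε t φ w θ
    have d1 := ((hs.partials.deriv_w ⟨ε, hε⟩ t φ w).const_mul ε).const_mul (clampUnit θ)
    exact (hf.hasDerivAt_comp t ((d1.const_mul (O.Ck φ)).const_add (O.C φ))
      ((d1.const_mul (O.Sl φ)).const_add (O.S φ)) (hasDerivAt_const w (clampUnit θ * ε))
      (Eventually.of_forall fun w => hKD (hpt ε hε t φ w θ))).const_mul _
  have hsc1 : ∀ ε ∈ Ioo 0 ε₁, ∀ θ a, |a| ≤ L → |clampUnit θ * (ε * a)| ≤ L := by
    intro ε hε θ a ha
    exact (hsc ε hε _ (clampUnit_mem θ) a ha).trans (mul_le_of_le_one_right hL (hε.2.le.trans h2))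
  have bF : ∀ ε ∈ Ioo 0 ε₁, ∀ t φ w θ, |F ε t φ w θ| ≤ B₀ := fun ε hε t φ w θ =>
    (hc1 _ _).trans (b₀ t _ (hpt ε hε t φ w θ))
  have bFφ : ∀ ε ∈ Ioo 0 ε₁, ∀ t φ w θ, |Fφ ε t φ w θ|
      ≤ B₁ * (M₃ + (M₃ * L + M₁ * L)) + B₂ * (M₄ + (M₄ * L + M₂ * L)) := by
    intro ε hε t φ w θ
    refine (hc1 _ _).trans ?_
    rw [mul_zero, add_zero]
    refine (abs_add_le _ _).trans ?_
    rw [abs_mul, abs_mul]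
    have s1 := hsc1 ε hε θ _ (hs.bound ε hε t φ w)
    have s2 := hsc1 ε hε θ _ (hs.bound_φ ε hε t φ w)
    gcongr
    · exact b₁ t _ (hpt ε hε t φ w θ)
    · refine (abs_add_le _ _).trans (add_le_add (k₃ φ) ((abs_add_le _ _).trans ?_))
      rw [abs_mul, abs_mul (O.Ck φ)]
      gcongr
      · exact k₃ φ
      · exact k₁ φ
    · exact b₂ t _ (hpt ε hε t φ w θ)
    · refine (abs_add_le _ _).trans (add_le_add (k₄ φ) ((abs_add_le _ _).trans ?_))
      rw [abs_mul, abs_mul (O.Sl φ)]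
      gcongr
      · exact k₄ φ
      · exact k₂ φ
  have bFw : ∀ ε ∈ Ioo 0 ε₁, ∀ t φ w θ, |Fw ε t φ w θ| ≤ (B₁ * (M₁ * L) + B₂ * (M₂ * L)) * ε := by
    intro ε hε t φ w θ
    refine (hc1 _ _).trans ?_
    rw [mul_zero, add_zero]
    refine (abs_add_le _ _).trans ?_
    have s2 := hsc ε hε _ (clampUnit_mem θ) _ (hs.bound_w ε hε t φ w)
    generalize clampUnit θ * (ε * sw ε t φ w) = a at s2 ⊢
    simp only [abs_mul]
    have := hε.1.le
    calc _ ≤ B₁ * (M₁ * (L * ε)) + B₂ * (M₂ * (L * ε)) := by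
          gcongr
          · exact b₁ t _ (hpt ε hε t φ w θ)
          · exact k₁ φ
          · exact b₂ t _ (hpt ε hε t φ w θ)
          · exact k₂ φ
      _ = _ := by ring
  have bdiff : ∀ ε ∈ Ioo 0 ε₁, ∀ t φ w θ, |F ε t φ w θ - (1 - clampUnit θ) * O.onOrbit f t φ|
      ≤ (B₁ * (M₁ * L) + B₂ * (M₂ * L) + B₃) * ε := by
    intro ε hε t φ w θ
    simp only [F]
    rw [← mul_sub]
    refine (hc1 _ _).trans ?_
    have hc := clampUnit_mem θ
    have hm : ∀ σ ∈ Icc (0 : ℝ) 1, (O.xPolar φ (σ * (clampUnit θ * ε * s ε t φ w)),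
        O.yPolar φ (σ * (clampUnit θ * ε * s ε t φ w)), σ * (clampUnit θ * ε)) ∈ K := fun σ hσ => by
      simpa only [mul_assoc] using hmem ε hε t φ w _ (unitInterval.mul_mem hσ hc)
    have hle := Convex.norm_image_sub_le_of_norm_hasDerivWithin_le
      (C := (B₁ * (M₁ * L) + B₂ * (M₂ * L) + B₃) * ε)
      (fun σ hσ => O.hasDerivWithinAt_segment (n := 0) hf (t := t) (fun σ hσ => hKD (hm σ hσ)) hσ)
      (fun σ hσ => by
        have g1 := b₁ t _ (hm σ hσ)
        have g2 := b₂ t _ (hm σ hσ)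
        have g3 := b₃ t _ (hm σ hσ)
        have g4 : |clampUnit θ * ε| ≤ ε := by
          rw [abs_of_nonneg (mul_nonneg hc.1 hε.1.le)]
          exact mul_le_of_le_one_left hε.1.le hc.2
        have g5 := k₁ φ
        have g6 := k₂ φ
        have g7 := hs.bound ε hε t φ w
        have := hε.1.le
        simp only [Real.norm_eq_abs, Fin.sum_univ_three, segmentDirection, phaseDirection, Matrix.cons_val]
        rw [abs_mul, mul_comm]
        refine mul_le_mul ((abs_add_three _ _ _).trans ?_) g4 (abs_nonneg _) (by positivity)
        rw [one_mul, mul_comm B₁, mul_comm B₂]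
        simp only [abs_mul]
        gcongr)
      (convex_Icc 0 1) (left_mem_Icc.2 zero_le_one) (right_mem_Icc.2 zero_le_one)
    simpa [xPolar_zero, yPolar_zero, onOrbit, pt, mul_assoc] using hle
  have hFeq : ∀ ε t φ w, O.segmentMean f s ε t φ w = ∫ θ in (0 : ℝ)..1, F ε t φ w θ :=
    fun ε t φ w => rfl
  have hP : HasPartials (fun ε : Ioo 0 ε₁ => O.segmentMean f s ε)
      (fun ε t φ w => ∫ θ in (0 : ℝ)..1, Fφ ε t φ w θ)
      (fun ε t φ w => ∫ θ in (0 : ℝ)..1, Fw ε t φ w θ) := by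
    refine ⟨?_, ?_, ?_, fun ε t φ w => ?_, fun ε t φ w => ?_⟩
    · exact intervalIntegral.continuous_parametric_intervalIntegral_of_continuous' hcF 0 1
    · exact intervalIntegral.continuous_parametric_intervalIntegral_of_continuous' hcφ 0 1
    · exact intervalIntegral.continuous_parametric_intervalIntegral_of_continuous' hcw 0 1
    · exact hasDerivAt_integral_of_continuous
        (fun φ => hcF.comp (by fun_prop : Continuous fun θ : ℝ => ((ε, t, φ, w), θ)))
        (hcφ.comp (by fun_prop : Continuous fun z : Plane => ((ε, t, z.1, w), z.2)))
        (fun φ θ => hdφ ε ε.2 t φ w θ) 0 1 φ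
    · exact hasDerivAt_integral_of_continuous
        (fun w => hcF.comp (by fun_prop : Continuous fun θ : ℝ => ((ε, t, φ, w), θ)))
        (hcw.comp (by fun_prop : Continuous fun z : Plane => ((ε, t, φ, z.1), z.2)))
        (fun w θ => hdw ε ε.2 t φ w θ) 0 1 w
  set K₁ := B₁ * (M₃ + (M₃ * L + M₁ * L)) + B₂ * (M₄ + (M₄ * L + M₂ * L)) with hK₁
  set K₂ := B₁ * (M₁ * L) + B₂ * (M₂ * L) with hK₂
  have p₁ : 0 ≤ K₁ := by positivity
  have p₂ : 0 ≤ K₂ := by positivity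
  refine ⟨fun t φ => (1 / 2) * O.onOrbit f t φ, A.smul_mem hfA (1 / 2 : ℝ), ε₁, h0,
    B₀ + K₁ + K₂ + B₃, fun ε t φ w => ∫ θ in (0 : ℝ)..1, Fφ ε t φ w θ,
    fun ε t φ w => ∫ θ in (0 : ℝ)..1, Fw ε t φ w θ,
    ⟨hP, by positivity, fun ε hε t φ w => ?_, fun ε hε t φ w => ?_, fun ε hε t φ w => ?_,
      fun ε hε t φ w => ?_, fun ε hε t φ w => ?_⟩, fun ε hε t φ w => ⟨?_, ?_⟩⟩
  · rw [hFeq]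
    exact (abs_integral_unit_le (bF ε hε t φ w)).trans (by linarith)
  · exact (abs_integral_unit_le (bFφ ε hε t φ w)).trans (by linarith)
  · refine (abs_integral_unit_le (bFw ε hε t φ w)).trans ?_
    have := mul_le_mul_of_nonneg_left (hε.2.le.trans h2) p₂
    linarith
  · rw [hFeq, hFeq]
    apply intervalIntegral.integral_congr
    intro θ _
    have i1 := hf.periodic t _ (hKD (hpt ε hε t φ w θ))
    simp only [F, pt] at i1 ⊢
    rw [hs.periodic_t ε hε, i1]
  · rw [hFeq, hFeq]
    apply intervalIntegral.integral_congr
    intro θ _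
    simp only [F, pt, xPolar, yPolar]
    rw [hs.periodic_φ ε hε, O.C_periodic, O.S_periodic, O.periodic_Ck, O.periodic_Sl]
  · refine (abs_integral_unit_le (bFw ε hε t φ w)).trans ?_
    have := hε.1.le
    gcongr
    linarith
  · have i1 : O.segmentMean f s ε t φ w - 1 / 2 * O.onOrbit f t φ
        = ∫ θ in (0 : ℝ)..1, (F ε t φ w θ - (1 - clampUnit θ) * O.onOrbit f t φ) := by
      rw [intervalIntegral.integral_sub, intervalIntegral.integral_mul_const,
        integral_one_sub_clampUnit, hFeq]
      · exact (hcF.comp (by fun_prop : Continuous fun θ : ℝ =>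
          (((⟨ε, hε⟩ : Ioo 0 ε₁), t, φ, w), θ))).intervalIntegrable _ _
      · have := continuous_clampUnit
        exact Continuous.intervalIntegrable (by fun_prop) _ _
    rw [i1]
    refine (abs_integral_unit_le (bdiff ε hε t φ w)).trans ?_
    have := hε.1.le
    gcongr
    linarith

/-- The second-order remainder in Taylor's formula. -/
def taylorRemainder (f : ℝ → Space → ℝ) (s : ℝ → ℝ → ℝ → ℝ → ℝ) (ε t φ w : ℝ) : ℝ :=
  ∑ i, ∑ j, O.segmentDirection (s ε t φ w) φ i * O.segmentDirection (s ε t φ w) φ j *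
    O.segmentMean (partialDeriv P.dom (phaseDirection j) (partialDeriv P.dom (phaseDirection i) f))
      s ε t φ w

lemma taylor_segment {f : ℝ → Space → ℝ} (hf : IsPeriodicCn 2 P.T P.dom f)
    (s : ℝ → ℝ → ℝ → ℝ → ℝ) {ε t φ w : ℝ}
    (hmem : ∀ σ ∈ Icc (0 : ℝ) 1, (O.xPolar φ (σ * (ε * s ε t φ w)),
      O.yPolar φ (σ * (ε * s ε t φ w)), σ * ε) ∈ P.dom) :
    f t (O.xPolar φ (ε * s ε t φ w), O.yPolar φ (ε * s ε t φ w), ε)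
      = O.onOrbit f t φ + ε * (s ε t φ w * O.radialDeriv f t φ
          + O.onOrbit (partialDeriv P.dom (0, 0, 1) f) t φ) + ε ^ 2 * O.taylorRemainder f s ε t φ w := by
  set r := s ε t φ w with hr
  let v := O.segmentDirection r φ
  let pt : ℝ → Space := fun σ => (O.xPolar φ (σ * (ε * r)), O.yPolar φ (σ * (ε * r)), σ * ε)
  let d : Fin 3 → ℝ → Space → ℝ := fun i => partialDeriv P.dom (phaseDirection i) f
  let dd : Fin 3 → Fin 3 → ℝ → Space → ℝ := fun i j =>
    partialDeriv P.dom (phaseDirection j) (d i)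
  have hd : ∀ i, IsPeriodicCn 1 P.T P.dom (d i) := fun i => hf.partialDeriv P.uniqueDiffOn_dom _
  have hdd : ∀ i j, IsPeriodicCn 0 P.T P.dom (dd i j) := fun i j =>
    (hd i).partialDeriv P.uniqueDiffOn_dom _
  have hptc : Continuous pt := by
    simp only [pt, xPolar, yPolar]
    fun_prop
  have h0 : ∀ σ ∈ Icc (0 : ℝ) 1, HasDerivWithinAt (fun σ => f t (pt σ))
      (ε * ∑ i, v i * d i t (pt σ)) (Icc 0 1) σ := fun σ hσ => O.hasDerivWithinAt_segment hf hmem hσ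
  have h1 : ∀ i, ∀ σ ∈ Icc (0 : ℝ) 1, HasDerivWithinAt (fun σ => d i t (pt σ))
      (ε * ∑ j, v j * dd i j t (pt σ)) (Icc 0 1) σ := fun i σ hσ =>
    O.hasDerivWithinAt_segment (hd i) hmem hσ
  have h2 : ∀ σ ∈ Icc (0 : ℝ) 1, HasDerivWithinAt
      (fun σ => f t (pt σ) + (1 - σ) * (ε * ∑ i, v i * d i t (pt σ)))
      ((1 - σ) * (ε ^ 2 * ∑ i, ∑ j, v i * v j * dd i j t (pt σ))) (Icc 0 1) σ := by
    intro σ hσ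
    have a1 := HasDerivWithinAt.fun_sum (u := Finset.univ)
      (fun i _ => (h1 i σ hσ).const_mul (v i))
    have a2 := ((hasDerivWithinAt_id σ (Icc (0 : ℝ) 1)).const_sub 1).mul (a1.const_mul ε)
    refine ((h0 σ hσ).add a2).congr_deriv ?_
    simp only [Fin.sum_univ_three, id]
    ring
  have hcont : ∀ {g : ℝ → Space → ℝ}, IsPeriodicCn 0 P.T P.dom g →
      ContinuousOn (fun σ => g t (pt σ)) (Icc 0 1) := by
    intro g hg
    exact hg.continuousOn_uncurry.comp (f := fun σ => (t, pt σ))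
      (by fun_prop) (fun σ hσ => ⟨mem_univ _, hmem σ hσ⟩)
  have hii : ∀ i j, IntervalIntegrable (fun σ => v i * v j * ((1 - σ) * dd i j t (pt σ))) volume 0 1 := by
    intro i j
    apply ContinuousOn.intervalIntegrable
    rw [uIcc_of_le zero_le_one]
    exact continuousOn_const.mul ((by fun_prop : ContinuousOn (fun σ : ℝ => 1 - σ) _).mul (hcont (hdd i j)))
  have e1 : ∀ σ, (1 - σ) * (ε ^ 2 * ∑ i, ∑ j, v i * v j * dd i j t (pt σ))
      = ε ^ 2 * ∑ i, ∑ j, v i * v j * ((1 - σ) * dd i j t (pt σ)) := by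
    intro σ
    simp only [Fin.sum_univ_three]
    ring
  have e2 : ∀ i j, ∫ σ in (0 : ℝ)..1, v i * v j * ((1 - σ) * dd i j t (pt σ))
      = v i * v j * O.segmentMean (dd i j) s ε t φ w := by
    intro i j
    rw [intervalIntegral.integral_const_mul, segmentMean]
    congr 1
    apply intervalIntegral.integral_congr
    intro σ hσ
    rw [uIcc_of_le zero_le_one] at hσ
    simp only [clampUnit_of_mem hσ, pt, hr]
  have h3 := intervalIntegral.integral_eq_sub_of_hasDerivAt_of_le zero_le_one
    (fun σ hσ => (h2 σ hσ).continuousWithinAt)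
    (fun σ hσ => (h2 σ ⟨hσ.1.le, hσ.2.le⟩).hasDerivAt (Icc_mem_nhds hσ.1 hσ.2))
    (by
      simp only [e1]
      refine IntervalIntegrable.const_mul ?_ _
      have := IntervalIntegrable.sum (f := fun i σ => ∑ j, v i * v j * ((1 - σ) * dd i j t (pt σ)))
        Finset.univ (fun i _ => by
          have := IntervalIntegrable.sum (f := fun j σ => v i * v j * ((1 - σ) * dd i j t (pt σ)))
            Finset.univ (fun j _ => hii i j)
          simpa [Finset.sum_fn] using this)
      simpa [Finset.sum_fn] using this)
  simp only [e1] at h3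
  rw [intervalIntegral.integral_const_mul, intervalIntegral.integral_finsetSum (fun i _ => by
      have := IntervalIntegrable.sum (f := fun j σ => v i * v j * ((1 - σ) * dd i j t (pt σ)))
            Finset.univ (fun j _ => hii i j)
      simpa [Finset.sum_fn] using this)] at h3
  simp only [intervalIntegral.integral_finsetSum (fun j _ => hii _ j), e2] at h3
  have e3 : pt 0 = (O.C φ, O.S φ, 0) := by simp [pt, xPolar, yPolar]
  have e4 : pt 1 = (O.xPolar φ (ε * r), O.yPolar φ (ε * r), ε) := by simp [pt]
  have e5 : O.taylorRemainder f s ε t φ w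
      = ∑ i, ∑ j, v i * v j * O.segmentMean (dd i j) s ε t φ w := rfl
  rw [e3, e4, ← e5] at h3
  have e6 : ∑ i, v i * d i t (O.C φ, O.S φ, 0) = r * O.radialDeriv f t φ
      + O.onOrbit (partialDeriv P.dom (0, 0, 1) f) t φ := by
    simp only [Fin.sum_univ_three, v, d, segmentDirection, phaseDirection, radialDeriv, onOrbit]
    simp
    ring
  rw [e6, show f t (O.C φ, O.S φ, 0) = O.onOrbit f t φ from rfl] at h3
  linear_combination -h3

lemma isTameNear_taylorRemainder (hG : O.GeneratingCondition) {A : Subalgebra ℝ (ℝ → ℝ → ℝ)}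
    (hA : IsCoefficientClass P.T O.ω A) {f : ℝ → Space → ℝ} (hf : IsPeriodicCn 3 P.T P.dom f)
    (hfA : ∀ i j, O.onOrbit (partialDeriv P.dom (phaseDirection j)
      (partialDeriv P.dom (phaseDirection i) f)) ∈ A)
    (hC : (fun _ φ => O.Ck φ) ∈ A) (hS : (fun _ φ => O.Sl φ) ∈ A)
    {s : ℝ → ℝ → ℝ → ℝ → ℝ} (hs : IsTameNear P.T O.ω A s) :
    IsTameNear P.T O.ω A (O.taylorRemainder f s) := by
  have hm : ∀ i j, IsTameNear P.T O.ω A (O.segmentMean (partialDeriv P.dom (phaseDirection j)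
      (partialDeriv P.dom (phaseDirection i) f)) s) := fun i j =>
    O.isTameNear_segmentMean hG ((hf.partialDeriv P.uniqueDiffOn_dom _).partialDeriv
      P.uniqueDiffOn_dom _) (hfA i j) hs.isTame
  have hv : ∀ i, IsTameNear P.T O.ω A (fun ε t φ w => O.segmentDirection (s ε t φ w) φ i) := by
    intro i
    fin_cases i
    · exact (hA.isTameNear hC).mul hA hs
    · exact (hA.isTameNear hS).mul hA hs
    · exact IsTameNear.const hA 1
  have h : ∀ i j, IsTameNear P.T O.ω A (fun ε t φ w => O.segmentDirection (s ε t φ w) φ i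
      * O.segmentDirection (s ε t φ w) φ j * O.segmentMean (partialDeriv P.dom (phaseDirection j)
      (partialDeriv P.dom (phaseDirection i) f)) s ε t φ w) := fun i j =>
    ((hv i).mul hA (hv j)).mul hA (hm i j)
  have e : O.taylorRemainder f s = fun ε t φ w => ∑ i, ∑ j, O.segmentDirection (s ε t φ w) φ i
      * O.segmentDirection (s ε t φ w) φ j * O.segmentMean (partialDeriv P.dom (phaseDirection j)
      (partialDeriv P.dom (phaseDirection i) f)) s ε t φ w := rfl
  rw [e]
  simp only [Fin.sum_univ_three]
  exact ((((h 0 0).add (h 0 1)).add (h 0 2)).add (((h 1 0).add (h 1 1)).add (h 1 2))).add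
    (((h 2 0).add (h 2 1)).add (h 2 2))

end GeneratingOrbit

/-! ### The averaged system -/

/-- `v₀ + ε v₁` solves, up to the order `ε^{ν+1}`, the equation `∂v/∂t + ε^ν ∂v/∂φ = ε^ν w`;
`d₀`, `d₁` are the `φ`-derivatives of `v₀`, `v₁`. -/
structure IsAveraging (ν : ℕ) (w v₀ v₁ d₀ d₁ : ℝ → ℝ → ℝ) : Prop where
  cont_w : Continuous fun p : Plane => w p.1 p.2
  cont₀ : Continuous fun p : Plane => d₀ p.1 p.2
  cont₁ : Continuous fun p : Plane => d₁ p.1 p.2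
  deriv₀ : ∀ t φ, HasDerivAt (v₀ t) (d₀ t φ) φ
  deriv₁ : ∀ t φ, HasDerivAt (v₁ t) (d₁ t φ) φ
  deriv_t : ∀ ε t φ, HasDerivAt (fun s => v₀ s φ + v₁ s φ * ε) (ε ^ ν * (w t φ - d₀ t φ)) t

namespace IsAveraging

variable {ν : ℕ} {w v₀ v₁ d₀ d₁ : ℝ → ℝ → ℝ}

lemma deriv_φ (h : IsAveraging ν w v₀ v₁ d₀ d₁) (ε t φ : ℝ) :
    HasDerivAt (fun φ => v₀ t φ + v₁ t φ * ε) (d₀ t φ + d₁ t φ * ε) φ :=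
  (h.deriv₀ t φ).add ((h.deriv₁ t φ).mul_const ε)

lemma cont_t (h : IsAveraging ν w v₀ v₁ d₀ d₁) (ε : ℝ) :
    Continuous fun p : Plane => ε ^ ν * (w p.1 p.2 - d₀ p.1 p.2) :=
  continuous_const.mul (h.cont_w.sub h.cont₀)

lemma cont_φ (h : IsAveraging ν w v₀ v₁ d₀ d₁) (ε : ℝ) :
    Continuous fun p : Plane => d₀ p.1 p.2 + d₁ p.1 p.2 * ε :=
  h.cont₀.add (h.cont₁.mul continuous_const)

lemma contDiff (h : IsAveraging ν w v₀ v₁ d₀ d₁) (ε : ℝ) :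
    ContDiff ℝ 1 fun p : Plane => v₀ p.1 p.2 + v₁ p.1 p.2 * ε :=
  contDiff_one_of_hasDerivAt (v := fun t φ => v₀ t φ + v₁ t φ * ε) (h.deriv_t ε) (h.deriv_φ ε)
    (h.cont_t ε) (h.cont_φ ε)

lemma hasDerivAt_along (h : IsAveraging ν w v₀ v₁ d₀ d₁) (ε : ℝ) {φ : ℝ → ℝ} {φ' t : ℝ}
    (hφ : HasDerivAt φ φ' t) : HasDerivAt (fun s => v₀ s (φ s) + v₁ s (φ s) * ε)
      (ε ^ ν * (w t (φ t) - d₀ t (φ t)) + (d₀ t (φ t) + d₁ t (φ t) * ε) * φ') t :=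
  _root_.hasDerivAt_along (v := fun t φ => v₀ t φ + v₁ t φ * ε) (h.deriv_t ε) (h.deriv_φ ε)
    (h.cont_t ε) (h.cont_φ ε) hφ

end IsAveraging

/-- The class `A` contains the functions on the generating orbit and the first-order coefficients of
the perturbation. -/
structure IsFieldClass {P : PerturbedSystem} (O : GeneratingOrbit P) (A : Subalgebra ℝ (ℝ → ℝ → ℝ)) :
    Prop where
  gen : O.GeneratingCondition
  isClass : IsCoefficientClass P.T O.ω A
  mem_orbit : ∀ v ∈ ({O.C, O.S, fun φ => (O.α φ)⁻¹, O.β} : Set (ℝ → ℝ)), (fun _ φ => v φ) ∈ A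
  mem_field : ∀ f ∈ ({P.XX, P.YY} : Set (ℝ → Space → ℝ)), O.onOrbit f ∈ A
  mem_field' : ∀ f ∈ ({P.XX, P.YY} : Set (ℝ → Space → ℝ)), ∀ i,
    O.onOrbit (partialDeriv P.dom (phaseDirection i) f) ∈ A

namespace IsFieldClass

variable {P : PerturbedSystem} {O : GeneratingOrbit P} {A : Subalgebra ℝ (ℝ → ℝ → ℝ)}

lemma mem_Ck (D : IsFieldClass O A) : (fun _ φ => O.Ck φ) ∈ A :=
  A.sub_mem (D.mem_orbit O.C (by simp)) (A.algebraMap_mem (O.k : ℝ))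

lemma mem_Sl (D : IsFieldClass O A) : (fun _ φ => O.Sl φ) ∈ A :=
  A.sub_mem (D.mem_orbit O.S (by simp)) (A.algebraMap_mem (O.l : ℝ))

lemma mem_C (D : IsFieldClass O A) : (fun _ φ => O.C φ) ∈ A := D.mem_orbit O.C (by simp)

lemma mem_S (D : IsFieldClass O A) : (fun _ φ => O.S φ) ∈ A := D.mem_orbit O.S (by simp)

lemma mem_inv_α (D : IsFieldClass O A) : (fun _ φ => (O.α φ)⁻¹) ∈ A := D.mem_orbit (fun φ => (O.α φ)⁻¹) (by simp)

lemma mem_β (D : IsFieldClass O A) : (fun _ φ => O.β φ) ∈ A := D.mem_orbit O.β (by simp)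

lemma mem_deriv_C (D : IsFieldClass O A) : (fun _ φ => deriv O.C φ) ∈ A := by
  rw [show (fun (_ : ℝ) φ => deriv O.C φ) = (fun _ _ => P.γ) * ((fun _ φ => O.S φ) ^ 3
    - fun _ φ => O.S φ) from funext fun t => funext fun φ => by
      simp [O.deriv_C]]
  exact A.mul_mem (A.algebraMap_mem P.γ) (A.sub_mem (A.pow_mem D.mem_S 3) D.mem_S)

lemma mem_deriv_S (D : IsFieldClass O A) : (fun _ φ => deriv O.S φ) ∈ A := by
  rw [show (fun (_ : ℝ) φ => deriv O.S φ) = -((fun _ φ => O.C φ) ^ 3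
    - fun _ φ => O.C φ) from funext fun t => funext fun φ => by
      simp [O.deriv_S]]
  exact A.neg_mem (A.sub_mem (A.pow_mem D.mem_C 3) D.mem_C)

lemma mem_deriv_α (D : IsFieldClass O A) : (fun _ φ => deriv O.α φ) ∈ A := by
  rw [show (fun (_ : ℝ) φ => deriv O.α φ) = (fun _ _ => P.γ) * ((fun _ _ => 3) * (fun _ φ => O.S φ) ^ 2
    - 1) * (fun _ φ => deriv O.S φ) * (fun _ φ => O.Sl φ) + (fun _ φ => O.Ck φ) *
      (((fun _ _ => 3) * (fun _ φ => O.C φ) ^ 2 - 1) * (fun _ φ => deriv O.C φ)) from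
    funext fun t => funext fun φ => by simp [O.deriv_α]]
  exact A.add_mem (A.mul_mem (A.mul_mem (A.mul_mem (A.algebraMap_mem P.γ) (A.sub_mem (A.mul_mem
    (A.algebraMap_mem 3) (A.pow_mem D.mem_S 2)) A.one_mem)) D.mem_deriv_S) D.mem_Sl)
    (A.mul_mem D.mem_Ck (A.mul_mem (A.sub_mem (A.mul_mem
    (A.algebraMap_mem 3) (A.pow_mem D.mem_C 2)) A.one_mem) D.mem_deriv_C))

lemma mem_p (D : IsFieldClass O A) : (fun _ φ => O.p φ) ∈ A := by
  rw [show (fun (_ : ℝ) φ => O.p φ) = (fun _ _ => 3 * P.γ) * (fun _ φ => O.C φ) * (fun _ φ => O.S φ) *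
    (((fun _ φ => O.S φ) ^ 2 - 1) * (fun _ φ => O.Ck φ) ^ 2
      - ((fun _ φ => O.C φ) ^ 2 - 1) * (fun _ φ => O.Sl φ) ^ 2) from
    funext fun t => funext fun φ => by simp [GeneratingOrbit.p]]
  exact A.mul_mem (A.mul_mem (A.mul_mem (A.algebraMap_mem (3 * P.γ)) D.mem_C) D.mem_S)
    (A.sub_mem (A.mul_mem (A.sub_mem (A.pow_mem D.mem_S 2) A.one_mem) (A.pow_mem D.mem_Ck 2))
      (A.mul_mem (A.sub_mem (A.pow_mem D.mem_C 2) A.one_mem) (A.pow_mem D.mem_Sl 2)))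

lemma mem_q (D : IsFieldClass O A) : (fun _ φ => O.q φ) ∈ A := by
  rw [show (fun (_ : ℝ) φ => O.q φ) = (fun _ φ => (O.α φ)⁻¹) ^ 2 *
    ((fun _ φ => O.Ck φ) ^ 3 * ((fun _ _ => 2) * (fun _ φ => O.C φ) + (fun _ _ => (O.k : ℝ)))
      + (fun _ _ => P.γ) * (fun _ φ => O.Sl φ) ^ 3 *
        ((fun _ _ => 2) * (fun _ φ => O.S φ) + (fun _ _ => (O.l : ℝ)))) from
    funext fun t => funext fun φ => by simp [GeneratingOrbit.q]]
  exact A.mul_mem (A.pow_mem D.mem_inv_α 2) (A.add_mem (A.mul_mem (A.pow_mem D.mem_Ck 3)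
    (A.add_mem (A.mul_mem (A.algebraMap_mem 2) D.mem_C) (A.algebraMap_mem (O.k : ℝ))))
    (A.mul_mem (A.mul_mem (A.algebraMap_mem P.γ) (A.pow_mem D.mem_Sl 3))
      (A.add_mem (A.mul_mem (A.algebraMap_mem 2) D.mem_S) (A.algebraMap_mem (O.l : ℝ)))))

lemma mem_ξ (D : IsFieldClass O A) : (fun _ φ => O.ξ φ) ∈ A :=
  A.mul_mem D.mem_inv_α (A.sub_mem (A.mul_mem D.mem_deriv_α D.mem_q) (A.mul_mem D.mem_inv_α D.mem_p))

lemma mem_radialDeriv (D : IsFieldClass O A) {f : ℝ → Space → ℝ} (hf : f = P.XX ∨ f = P.YY) :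
    O.radialDeriv f ∈ A :=
  A.add_mem (A.mul_mem (D.mem_field' f (by simpa using hf) 0) D.mem_Ck)
    (A.mul_mem (D.mem_field' f (by simpa using hf) 1) D.mem_Sl)

lemma mem_paramDeriv (D : IsFieldClass O A) {f : ℝ → Space → ℝ} (hf : f = P.XX ∨ f = P.YY) :
    O.onOrbit (partialDeriv P.dom (0, 0, 1) f) ∈ A :=
  D.mem_field' f (by simpa using hf) 2

lemma mem_Ro (D : IsFieldClass O A) : O.Ro ∈ A := by
  rw [show O.Ro = (fun _ φ => deriv O.C φ) * O.onOrbit P.YY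
    - (fun _ φ => deriv O.S φ) * O.onOrbit P.XX from funext fun t => funext fun φ => O.Ro_eq t φ]
  exact A.sub_mem (A.mul_mem D.mem_deriv_C (D.mem_field _ (by simp)))
    (A.mul_mem D.mem_deriv_S (D.mem_field _ (by simp)))

lemma mem_RrO (D : IsFieldClass O A) : O.RrO ∈ A := by
  rw [show O.RrO = (fun _ φ => deriv O.C φ) * O.radialDeriv P.YY
    - (fun _ φ => deriv O.S φ) * O.radialDeriv P.XX from
    funext fun t => funext fun φ => O.RrO_eq D.gen t φ]
  exact A.sub_mem (A.mul_mem D.mem_deriv_C (D.mem_radialDeriv (Or.inr rfl)))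
    (A.mul_mem D.mem_deriv_S (D.mem_radialDeriv (Or.inl rfl)))

lemma mem_RεO (D : IsFieldClass O A) : O.RεO ∈ A := by
  rw [show O.RεO = (fun _ φ => deriv O.C φ) * O.onOrbit (partialDeriv P.dom (0, 0, 1) P.YY)
    - (fun _ φ => deriv O.S φ) * O.onOrbit (partialDeriv P.dom (0, 0, 1) P.XX) from
    funext fun t => funext fun φ => O.RεO_eq D.gen t φ]
  exact A.sub_mem (A.mul_mem D.mem_deriv_C (D.mem_paramDeriv (Or.inr rfl)))
    (A.mul_mem D.mem_deriv_S (D.mem_paramDeriv (Or.inl rfl)))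

lemma mem_Φo (D : IsFieldClass O A) : O.Φo ∈ A := by
  rw [show O.Φo = (fun _ φ => (O.α φ)⁻¹) * ((fun _ φ => O.Sl φ) * O.onOrbit P.XX
    - (fun _ φ => O.Ck φ) * O.onOrbit P.YY) from funext fun t => funext fun φ => O.Φo_eq t φ]
  exact A.mul_mem D.mem_inv_α (A.sub_mem (A.mul_mem D.mem_Sl (D.mem_field _ (by simp)))
    (A.mul_mem D.mem_Ck (D.mem_field _ (by simp))))

lemma mem_Z (D : IsFieldClass O A) : O.Z ∈ A :=
  A.add_mem (A.sub_mem (A.mul_mem D.mem_inv_α D.mem_RrO) (A.mul_mem (A.mul_mem (A.algebraMap_mem 2)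
    D.mem_β) D.mem_Ro)) (A.mul_mem (A.mul_mem D.mem_inv_α D.mem_deriv_α) D.mem_Φo)

end IsFieldClass

/-- The functions that define the averaging changes, in a class of coefficients `A`. -/
structure AveragingSetup {P : PerturbedSystem} (O : GeneratingOrbit P) (ν : ℕ)
    (A : Subalgebra ℝ (ℝ → ℝ → ℝ)) extends IsFieldClass O A where
  (L Θbar : ℝ)
  (G₀ G₁ G₀' G₁' H₀ H₁ H₀' H₁' F₀ F₁ F₀' F₁' Δ₀ Δ₁ Δ₀' Δ₁' Θ' : ℝ → ℝ → ℝ)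
  L_ne : L ≠ 0
  mem_functions : ∀ v ∈ ({G₀, G₁, G₀', G₁', H₀, H₁, H₀', H₁', F₀, F₁, F₀', F₁', Δ₀, Δ₁, Δ₀', Δ₁',
    Θ'} : Set (ℝ → ℝ → ℝ)), v ∈ A
  mem_field'' : ∀ f ∈ ({P.XX, P.YY} : Set (ℝ → Space → ℝ)), ∀ i j,
    O.onOrbit (partialDeriv P.dom (phaseDirection j) (partialDeriv P.dom (phaseDirection i) f)) ∈ A
  avgG : IsAveraging ν O.Ro G₀ G₁ G₀' G₁'
  avgH : IsAveraging ν (fun t φ => O.Z t φ - G₀' t φ * O.q φ - L) H₀ H₁ H₀' H₁'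
  avgF : IsAveraging ν (fun t φ => G₀ t φ * O.Z t φ + O.RεO t φ - G₁' t φ
    - G₀' t φ * (O.Φo t φ + G₀ t φ * O.q φ)) F₀ F₁ F₀' F₁'
  avgΔ : IsAveraging ν (fun t φ => O.Φo t φ + O.q φ * G₀ t φ - Θbar) Δ₀ Δ₁ Δ₀' Δ₁'
  deriv_Θ : ∀ t φ, HasDerivAt (fun φ => O.Φo t φ + O.q φ * G₀ t φ) (Θ' t φ) φ
  eqG : ∀ t φ ε, O.G ν t φ ε = G₀ t φ + G₁ t φ * ε
  eqH : ∀ t φ ε, O.H ν t φ ε = H₀ t φ + H₁ t φ * ε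
  eqF : ∀ t φ ε, O.F ν t φ ε = F₀ t φ + F₁ t φ * ε
  eqΔ : ∀ t φ ε, O.Δ ν t φ ε = Δ₀ t φ + Δ₁ t φ * ε
  corrector : ∀ v ∈ A, average P.T O.ω v = 0 → ∃ (b₀ b₁ e₀ e₁ : ℝ → ℝ → ℝ) (K : ℝ),
    IsAveraging ν v b₀ b₁ e₀ e₁ ∧
      ∀ t φ, |b₀ t φ| ≤ K ∧ |b₁ t φ| ≤ K ∧ |e₀ t φ| ≤ K ∧ |e₁ t φ| ≤ K

namespace AveragingSetup

variable {P : PerturbedSystem} {O : GeneratingOrbit P} {ν : ℕ} {A : Subalgebra ℝ (ℝ → ℝ → ℝ)}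
  (D : AveragingSetup O ν A)

/-! The coefficients of the system for a bounded variable `χ w` in place of `Γ`. -/

def Gf (ε t φ : ℝ) : ℝ := D.G₀ t φ + D.G₁ t φ * ε

def Hf (ε t φ : ℝ) : ℝ := D.H₀ t φ + D.H₁ t φ * ε

def Ff (ε t φ : ℝ) : ℝ := D.F₀ t φ + D.F₁ t φ * ε

def Δf (ε t φ : ℝ) : ℝ := D.Δ₀ t φ + D.Δ₁ t φ * ε

/-- The quotient `z / ε`. -/
def zf (χ : ℝ → ℝ) (ε t φ w : ℝ) : ℝ :=
  D.Gf ε t φ + ε * D.Ff ε t φ + ε * χ w * (1 + ε * D.Hf ε t φ)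

/-- The quotient `r / ε`. -/
def sf (χ : ℝ → ℝ) (ε t φ w : ℝ) : ℝ :=
  (O.α φ)⁻¹ * (D.zf χ ε t φ w + ε * (O.β φ * D.zf χ ε t φ w ^ 2))

/-- The first-order remainder of a component of the perturbation. -/
def X₁ (f : ℝ → Space → ℝ) (χ : ℝ → ℝ) (ε t φ w : ℝ) : ℝ :=
  D.sf χ ε t φ w * O.radialDeriv f t φ + O.onOrbit (partialDeriv P.dom (0, 0, 1) f) t φ
    + ε * O.taylorRemainder f (D.sf χ) ε t φ w

/-- The second-order remainder of `R`. -/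
def Rm (χ : ℝ → ℝ) (ε t φ w : ℝ) : ℝ :=
  deriv O.C φ * O.taylorRemainder P.YY (D.sf χ) ε t φ w
    - deriv O.S φ * O.taylorRemainder P.XX (D.sf χ) ε t φ w

def Θs (χ : ℝ → ℝ) (ε t φ w : ℝ) : ℝ := O.Φo t φ + O.q φ * D.zf χ ε t φ w

/-- The second-order coefficient in the equation for `φ`. -/
def V₂ (χ : ℝ → ℝ) (ε t φ w : ℝ) : ℝ :=
  (1 + ε * D.sf χ ε t φ w)⁻¹ * (O.q φ * (O.β φ * D.zf χ ε t φ w ^ 2)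
    + (O.α φ)⁻¹ * (3 * P.γ * O.S φ * O.Sl φ ^ 3 + 3 * O.C φ * O.Ck φ ^ 3) * D.sf χ ε t φ w ^ 2
    + ε * ((O.α φ)⁻¹ * (P.γ * O.Sl φ ^ 4 + O.Ck φ ^ 4) * D.sf χ ε t φ w ^ 3)
    + (O.α φ)⁻¹ * (O.Sl φ * D.X₁ P.XX χ ε t φ w - O.Ck φ * D.X₁ P.YY χ ε t φ w)
    - D.sf χ ε t φ w * D.Θs χ ε t φ w)

/-- The third-order coefficient in the equation for `z`. -/
def N₂ (χ : ℝ → ℝ) (ε t φ w : ℝ) : ℝ :=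
  let ζ := D.zf χ ε t φ w
  let s := D.sf χ ε t φ w
  let V := D.V₂ χ ε t φ w
  let Θ := D.Θs χ ε t φ w
  let i := (O.α φ)⁻¹
  let a' := deriv O.α φ
  let b := O.β φ
  (1 + ε * (2 * b * ζ))⁻¹ * (D.Rm χ ε t φ w + a' * i * (b * ζ ^ 2 * Θ + ζ * V + ε * (b * ζ ^ 2 * V))
    - (deriv O.C φ * O.Ck φ ^ 3 + P.γ * deriv O.S φ * O.Sl φ ^ 3) * s ^ 3
    - O.ξ φ * ζ ^ 2 * (Θ + ε * V) + i * b * ζ ^ 2 * O.RrO t φ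
    - O.p φ * i ^ 2 * ζ ^ 2 * (2 * b * ζ + ε * (b ^ 2 * ζ ^ 2))
    - 2 * b * ζ * (i * ζ * O.RrO t φ + O.RεO t φ + a' * i * ζ * O.Φo t φ - 2 * b * ζ * O.Ro t φ))

/-- The perturbation in the equation for `Γ`, at the angle `φ`. -/
def Uf (χ : ℝ → ℝ) (ε t φ w : ℝ) : ℝ :=
  (1 + ε * D.Hf ε t φ)⁻¹ * ((O.Z t φ - D.G₀' t φ * O.q φ) * (D.G₁ t φ + D.Ff ε t φ
      + ε * (χ w * D.Hf ε t φ)) + D.N₂ χ ε t φ w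
    - (D.G₁' t φ * D.Θs χ ε t φ w + (D.G₀' t φ + D.G₁' t φ * ε) * D.V₂ χ ε t φ w)
    - (D.F₁' t φ + (D.F₀' t φ + D.F₁' t φ * ε) * (D.Θs χ ε t φ w + ε * D.V₂ χ ε t φ w))
    - ε * (χ w * (D.H₁' t φ + (D.H₀' t φ + D.H₁' t φ * ε) * (D.Θs χ ε t φ w + ε * D.V₂ χ ε t φ w)))
    - D.L * (ε * (χ w * D.Hf ε t φ)))

/-- The second-order coefficient in the equation for `ψ`. -/
def Vf (χ : ℝ → ℝ) (ε t ψ w : ℝ) : ℝ :=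
  (1 + ε * (D.Δ₀' t ψ + D.Δ₁' t ψ * ε))⁻¹ *
    (ε⁻¹ * ((O.Φo t (ψ + ε * D.Δf ε t ψ) + O.q (ψ + ε * D.Δf ε t ψ) * D.G₀ t (ψ + ε * D.Δf ε t ψ))
        - (O.Φo t ψ + O.q ψ * D.G₀ t ψ))
      + O.q (ψ + ε * D.Δf ε t ψ) * (D.G₁ t (ψ + ε * D.Δf ε t ψ) + D.Ff ε t (ψ + ε * D.Δf ε t ψ)
        + χ w * (1 + ε * D.Hf ε t (ψ + ε * D.Δf ε t ψ)))
      + D.V₂ χ ε t (ψ + ε * D.Δf ε t ψ) w - D.Δ₁' t ψ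
      - D.Θbar * (D.Δ₀' t ψ + D.Δ₁' t ψ * ε))

end AveragingSetup

namespace AveragingSetup

variable {P : PerturbedSystem} {O : GeneratingOrbit P} {ν : ℕ} {A : Subalgebra ℝ (ℝ → ℝ → ℝ)}
  (D : AveragingSetup O ν A)

/-! ### Regularity of the coefficients -/

lemma near (D : AveragingSetup O ν A) {v : ℝ → ℝ → ℝ} (hv : v ∈ A) :
    IsTameNear P.T O.ω A (fun _ t φ _ => v t φ) :=
  D.isClass.isTameNear hv

lemma near_param (_ : AveragingSetup O ν A) : IsTameNear P.T O.ω A (fun ε _ _ _ => ε) := by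
  simpa using (IsTame.const (T := P.T) (ω := O.ω) 1).param_mul (A := A)

lemma near_orbit (D : AveragingSetup O ν A) {v : ℝ → ℝ}
    (hv : v ∈ ({O.C, O.S, fun φ => (O.α φ)⁻¹, O.β, O.Ck, O.Sl, deriv O.C, deriv O.S, deriv O.α, O.p,
      O.q, O.ξ} : Set (ℝ → ℝ))) : IsTameNear P.T O.ω A (fun _ _ φ _ => v φ) := by
  simp only [mem_insert_iff, mem_singleton_iff] at hv
  rcases hv with rfl | rfl | rfl | rfl | rfl | rfl | rfl | rfl | rfl | rfl | rfl | rfl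
  exacts [D.near D.mem_C, D.near D.mem_S, D.near D.mem_inv_α, D.near D.mem_β, D.near D.mem_Ck,
    D.near D.mem_Sl, D.near D.mem_deriv_C, D.near D.mem_deriv_S, D.near D.mem_deriv_α, D.near D.mem_p,
    D.near D.mem_q, D.near D.mem_ξ]

lemma near_function {v : ℝ → ℝ → ℝ} (hv : v ∈ ({D.G₀, D.G₁, D.G₀', D.G₁',
    D.H₀, D.H₁, D.H₀', D.H₁', D.F₀, D.F₁, D.F₀', D.F₁', D.Δ₀, D.Δ₁, D.Δ₀', D.Δ₁',
    D.Θ'} : Set (ℝ → ℝ → ℝ))) : IsTameNear P.T O.ω A (fun _ t φ _ => v t φ) :=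
  D.near (D.mem_functions v hv)

variable {χ : ℝ → ℝ}

lemma near_Gf : IsTameNear P.T O.ω A (fun ε t φ _ => D.Gf ε t φ) :=
  (D.near_function (by simp)).add (.mul D.isClass (D.near_function (by simp)) D.near_param)

lemma near_Hf : IsTameNear P.T O.ω A (fun ε t φ _ => D.Hf ε t φ) :=
  (D.near_function (by simp)).add (.mul D.isClass (D.near_function (by simp)) D.near_param)

lemma near_Ff : IsTameNear P.T O.ω A (fun ε t φ _ => D.Ff ε t φ) :=
  (D.near_function (by simp)).add (.mul D.isClass (D.near_function (by simp)) D.near_param)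

lemma near_Δf : IsTameNear P.T O.ω A (fun ε t φ _ => D.Δf ε t φ) :=
  (D.near_function (by simp)).add (.mul D.isClass (D.near_function (by simp)) D.near_param)

lemma near_zf (hχ : IsTame P.T O.ω (fun _ _ _ w => χ w)) :
    IsTameNear P.T O.ω A (D.zf χ) :=
  (D.near_Gf.add (D.near_param.mul D.isClass D.near_Ff)).add
    (hχ.param_mul.mul D.isClass ((IsTameNear.const D.isClass 1).add (D.near_param.mul D.isClass D.near_Hf)))

lemma near_sf (hχ : IsTame P.T O.ω (fun _ _ _ w => χ w)) :
    IsTameNear P.T O.ω A (D.sf χ) :=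
  (D.near_orbit (v := fun φ => (O.α φ)⁻¹) (by simp)).mul D.isClass ((D.near_zf hχ).add
    (D.near_param.mul D.isClass ((D.near_orbit (v := O.β) (by simp)).mul D.isClass
      ((D.near_zf hχ).pow D.isClass 2))))

lemma near_taylorRemainder (hχ : IsTame P.T O.ω (fun _ _ _ w => χ w))
    {f : ℝ → Space → ℝ} (hf : f = P.XX ∨ f = P.YY) :
    IsTameNear P.T O.ω A (O.taylorRemainder f (D.sf χ)) := by
  refine O.isTameNear_taylorRemainder D.gen D.isClass ?_ (D.mem_field'' f (by simpa using hf)) D.mem_Ck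
    D.mem_Sl (D.near_sf hχ)
  rcases hf with rfl | rfl
  exacts [P.isPeriodicCn_XX, P.isPeriodicCn_YY]

lemma near_X₁ (hχ : IsTame P.T O.ω (fun _ _ _ w => χ w))
    {f : ℝ → Space → ℝ} (hf : f = P.XX ∨ f = P.YY) : IsTameNear P.T O.ω A (D.X₁ f χ) :=
  (((D.near_sf hχ).mul D.isClass (D.near (D.mem_radialDeriv hf))).add
    (D.near (D.mem_paramDeriv hf))).add (D.near_param.mul D.isClass (D.near_taylorRemainder hχ hf))

lemma near_Rm (hχ : IsTame P.T O.ω (fun _ _ _ w => χ w)) :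
    IsTameNear P.T O.ω A (D.Rm χ) :=
  ((D.near_orbit (v := deriv O.C) (by simp)).mul D.isClass (D.near_taylorRemainder hχ (Or.inr rfl))).sub
    D.isClass
    ((D.near_orbit (v := deriv O.S) (by simp)).mul D.isClass (D.near_taylorRemainder hχ (Or.inl rfl)))

lemma near_Θs (hχ : IsTame P.T O.ω (fun _ _ _ w => χ w)) :
    IsTameNear P.T O.ω A (D.Θs χ) :=
  (D.near D.mem_Φo).add ((D.near_orbit (v := O.q) (by simp)).mul D.isClass (D.near_zf hχ))

lemma near_V₂ (hχ : IsTame P.T O.ω (fun _ _ _ w => χ w)) :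
    IsTameNear P.T O.ω A (D.V₂ χ) := by
  have hA := D.isClass
  have h1 := D.near_sf hχ
  have h2 := D.near_zf hχ
  have h3 := D.near_Θs hχ
  have h4 := D.near_X₁ hχ (f := P.XX) (Or.inl rfl)
  have h5 := D.near_X₁ hχ (f := P.YY) (Or.inr rfl)
  have h6 := D.near_param
  have h7 := h1.isTame.inv_one_add (A := A)
  have i1 := D.near_orbit (v := fun φ => (O.α φ)⁻¹) (by simp)
  unfold V₂
  repeat' first
    | exact h7
    | with_reducible apply IsTameNear.add
    | with_reducible apply IsTameNear.sub hA
    | with_reducible apply IsTameNear.mul hA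
    | with_reducible apply IsTameNear.pow hA
    | exact h1 | exact h2 | exact h3 | exact h4 | exact h5 | exact h6 | exact i1
    | exact IsTameNear.const hA _
    | exact D.near_orbit (by simp)

lemma near_N₂ (hχ : IsTame P.T O.ω (fun _ _ _ w => χ w)) :
    IsTameNear P.T O.ω A (D.N₂ χ) := by
  have hA := D.isClass
  have h1 := D.near_sf hχ
  have h2 := D.near_zf hχ
  have h3 := D.near_Θs hχ
  have h4 := D.near_V₂ hχ
  have h5 := D.near_Rm hχ
  have h6 := D.near_param
  have i1 := D.near_orbit (v := fun φ => (O.α φ)⁻¹) (by simp)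
  have i2 := D.near D.mem_Ro
  have i3 := D.near D.mem_RrO
  have i4 := D.near D.mem_RεO
  have i5 := D.near D.mem_Φo
  have h7 : IsTameNear P.T O.ω A (fun ε t φ w => (1 + ε * (2 * O.β φ * D.zf χ ε t φ w))⁻¹) := by
    apply IsTame.inv_one_add
    exact (((IsTame.const 2).mul (D.near_orbit (v := O.β) (by simp)).isTame).mul h2.isTame)
  unfold N₂
  dsimp only
  repeat' first
    | exact h7
    | with_reducible apply IsTameNear.add
    | with_reducible apply IsTameNear.sub hA
    | with_reducible apply IsTameNear.mul hA
    | with_reducible apply IsTameNear.pow hA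
    | exact h1 | exact h2 | exact h3 | exact h4 | exact h5 | exact h6 | exact i1 | exact i2 | exact i3
    | exact i4 | exact i5
    | exact IsTameNear.const hA _
    | exact D.near_orbit (by simp)

lemma near_Uf (hχ : IsTame P.T O.ω (fun _ _ _ w => χ w)) :
    IsTameNear P.T O.ω A (D.Uf χ) := by
  have hA := D.isClass
  have h3 := D.near_Θs hχ
  have h4 := D.near_V₂ hχ
  have h5 := D.near_N₂ hχ
  have h6 := D.near_param
  have h8 := D.near_Hf
  have h9 := D.near_Ff
  have i1 := D.near D.mem_Z
  have h7 := D.near_Hf.isTame.inv_one_add (A := A)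
  have e1 : IsTameNear P.T O.ω A (fun ε t φ w => ε * (χ w * D.Hf ε t φ)) := (hχ.mul h8.isTame).param_mul
  have e2 : IsTameNear P.T O.ω A (fun ε t φ w => ε * (χ w * (D.H₁' t φ + (D.H₀' t φ + D.H₁' t φ * ε) *
      (D.Θs χ ε t φ w + ε * D.V₂ χ ε t φ w)))) := by
    apply IsTame.param_mul
    apply hχ.mul
    apply IsTameNear.isTame (A := A)
    repeat' first
      | with_reducible apply IsTameNear.add
      | with_reducible apply IsTameNear.mul hA
      | exact h3 | exact h4 | exact h6
      | exact D.near_function (by simp)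
  unfold Uf
  repeat' first
    | exact h7 | exact e1 | exact e2
    | with_reducible apply IsTameNear.add
    | with_reducible apply IsTameNear.sub hA
    | with_reducible apply IsTameNear.mul hA
    | exact h3 | exact h4 | exact h5 | exact h6 | exact h8 | exact h9 | exact i1
    | exact IsTameNear.const hA _
    | exact D.near_orbit (by simp)
    | exact D.near_function (by simp)

lemma isTame_Vf (hχ : IsTame P.T O.ω (fun _ _ _ w => χ w)) :
    IsTame P.T O.ω (D.Vf χ) := by
  have hA := D.isClass
  have hΔ := D.near_Δf.isTame
  have h4 := ((D.near_V₂ hχ).comp_shift hA hΔ).isTame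
  have hq := ((D.near_orbit (v := O.q) (by simp)).comp_shift hA hΔ).isTame
  have hG := ((D.near_function (v := D.G₁) (by simp)).comp_shift hA hΔ).isTame
  have hF := (D.near_Ff.comp_shift hA hΔ).isTame
  have hH := (D.near_Hf.comp_shift hA hΔ).isTame
  have h6 := D.near_param.isTame
  have d0 := (D.near_function (v := D.Δ₀') (by simp)).isTame
  have d1 := (D.near_function (v := D.Δ₁') (by simp)).isTame
  have d2 : IsTame P.T O.ω (fun ε t ψ _ => D.Δ₀' t ψ + D.Δ₁' t ψ * ε) := d0.add (d1.mul h6)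
  have h7 := (d2.inv_one_add (A := A)).isTame
  have hQ := hA.isTame_quotient (v := fun t φ => O.Φo t φ + O.q φ * D.G₀ t φ) (d := D.Θ')
    (A.add_mem D.mem_Φo (A.mul_mem D.mem_q (D.mem_functions _ (by simp)))) (D.mem_functions _ (by simp))
    D.deriv_Θ hΔ
  unfold Vf
  exact h7.mul ((((hQ.add (hq.mul ((hG.add hF).add (hχ.mul ((IsTame.const 1).add (h6.mul hH)))))).add
    h4).sub d1).sub ((IsTame.const D.Θbar).mul d2))

end AveragingSetup

namespace AveragingSetup

variable {P : PerturbedSystem} {O : GeneratingOrbit P} {ν : ℕ} {A : Subalgebra ℝ (ℝ → ℝ → ℝ)}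
  (D : AveragingSetup O ν A)
  {χ : ℝ → ℝ}

/-! ### The equations of motion in the averaged variables -/

lemma field_eq {f : ℝ → Space → ℝ} (hf : IsPeriodicCn 3 P.T P.dom f)
    {ε t φ w : ℝ} (hmem : ∀ σ ∈ Icc (0 : ℝ) 1, (O.xPolar φ (σ * (ε * D.sf χ ε t φ w)),
      O.yPolar φ (σ * (ε * D.sf χ ε t φ w)), σ * ε) ∈ P.dom) :
    f t (O.xPolar φ (ε * D.sf χ ε t φ w), O.yPolar φ (ε * D.sf χ ε t φ w), ε)
      = O.onOrbit f t φ + ε * D.X₁ f χ ε t φ w := by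
  rw [O.taylor_segment hf.of_succ (D.sf χ) hmem, X₁]
  ring

lemma α_mul_sf (ε t φ w : ℝ) :
    O.α φ * D.sf χ ε t φ w = D.zf χ ε t φ w + ε * (O.β φ * D.zf χ ε t φ w ^ 2) := by
  rw [sf, mul_inv_cancel_left₀ (O.α_ne_zero D.gen φ)]

lemma φdot_sf {ε t φ w : ℝ} (hs : 1 + ε * D.sf χ ε t φ w ≠ 0)
    (hmem : ∀ σ ∈ Icc (0 : ℝ) 1, (O.xPolar φ (σ * (ε * D.sf χ ε t φ w)),
      O.yPolar φ (σ * (ε * D.sf χ ε t φ w)), σ * ε) ∈ P.dom) :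
    O.φdot ν ε t (ε * D.sf χ ε t φ w) φ
      = ε ^ ν * (1 + ε * (D.Θs χ ε t φ w + ε * D.V₂ χ ε t φ w)) := by
  have hX := D.field_eq P.isPeriodicCn_XX hmem
  have hY := D.field_eq P.isPeriodicCn_YY hmem
  have hα := D.α_mul_sf (χ := χ) ε t φ w
  rw [O.φdot_eq D.gen ν ε t _ φ hs]
  simp only [PerturbedSystem.XX, PerturbedSystem.YY] at hX hY
  rw [hX, hY, V₂, Θs, O.Φo_eq]
  generalize D.X₁ P.XX χ ε t φ w = X, D.X₁ P.YY χ ε t φ w = Y, O.onOrbit P.XX t φ = Xo at *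
  generalize O.onOrbit P.YY t φ = Yo, D.zf χ ε t φ w = z, D.sf χ ε t φ w = s at *
  obtain ⟨J, hJ⟩ : ∃ J, (1 + ε * s)⁻¹ = J := ⟨_, rfl⟩
  have hJ1 : J * (1 + ε * s) = 1 := by rw [← hJ, inv_mul_cancel₀ hs]
  rw [hJ]
  generalize O.α φ = a at *
  generalize (a : ℝ)⁻¹ = i at *
  linear_combination (ε ^ ν * J * O.q φ * ε) * hα
    + ε ^ ν * ε * (i * (O.Sl φ * Xo - O.Ck φ * Yo) + O.q φ * z) * hJ1

/-- The equation for `r` in terms of the equation for `z = ε ζ`. -/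
lemma rdot_sf {ε t φ w : ℝ}
    (hb : 1 + ε * (2 * O.β φ * D.zf χ ε t φ w) ≠ 0)
    (hmem : ∀ σ ∈ Icc (0 : ℝ) 1, (O.xPolar φ (σ * (ε * D.sf χ ε t φ w)),
      O.yPolar φ (σ * (ε * D.sf χ ε t φ w)), σ * ε) ∈ P.dom) :
    O.rdot ν ε t (ε * D.sf χ ε t φ w) φ = (O.α φ)⁻¹ *
      ((1 + ε * (2 * O.β φ * D.zf χ ε t φ w)) * (ε ^ ν * (ε * O.Ro t φ
          + ε ^ 2 * (O.RεO t φ + O.Z t φ * D.zf χ ε t φ w) + ε ^ 3 * D.N₂ χ ε t φ w))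
        + (O.ξ φ * (ε * D.zf χ ε t φ w) ^ 2 - deriv O.α φ * (ε * D.sf χ ε t φ w)) *
          (ε ^ ν * (1 + ε * (D.Θs χ ε t φ w + ε * D.V₂ χ ε t φ w)))) := by
  have hα0 := O.α_ne_zero D.gen φ
  have hX := O.taylor_segment (P.isPeriodicCn_XX.of_succ) (D.sf χ) hmem
  have hY := O.taylor_segment (P.isPeriodicCn_YY.of_succ) (D.sf χ) hmem
  have hR : O.R t φ (ε * D.sf χ ε t φ w) ε = O.Ro t φ + ε * (D.sf χ ε t φ w * O.RrO t φ + O.RεO t φ)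
      + ε ^ 2 * D.Rm χ ε t φ w := by
    rw [O.Ro_eq, O.RrO_eq D.gen, O.RεO_eq D.gen, Rm, GeneratingOrbit.R]
    simp only [PerturbedSystem.XX, PerturbedSystem.YY] at hX hY
    rw [hX, hY]
    ring
  have hr := O.rdot_eq D.gen ν ε t (ε * D.sf χ ε t φ w) φ
  rw [hR] at hr
  rw [← inv_mul_cancel_left₀ hα0 (O.rdot ν ε t (ε * D.sf χ ε t φ w) φ), hr]
  congr 1
  have hs : D.sf χ ε t φ w = (O.α φ)⁻¹ * (D.zf χ ε t φ w + ε * (O.β φ * D.zf χ ε t φ w ^ 2)) := rfl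
  rw [N₂, GeneratingOrbit.Z, GeneratingOrbit.ξ, Θs]
  generalize D.Rm χ ε t φ w = Rm, D.V₂ χ ε t φ w = V, D.sf χ ε t φ w = s, D.zf χ ε t φ w = z at *
  obtain ⟨J, hJ⟩ : ∃ J, (1 + ε * (2 * O.β φ * z))⁻¹ = J := ⟨_, rfl⟩
  have hJ1 : (1 + ε * (2 * O.β φ * z)) * J = 1 := by rw [← hJ, mul_inv_cancel₀ hb]
  rw [hJ]
  generalize (O.α φ)⁻¹ = i, O.p φ = p, O.q φ = q, O.β φ = b, deriv O.α φ = a at *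
  generalize deriv O.C φ * O.Ck φ ^ 3 + P.γ * deriv O.S φ * O.Sl φ ^ 3 = c, O.Ro t φ = Ro at *
  generalize O.RrO t φ = Rr, O.RεO t φ = Re, O.Φo t φ = Φ, ε ^ ν = E at *
  obtain ⟨N, hN⟩ : ∃ N, Rm + a * i * (b * z ^ 2 * (Φ + q * z) + z * V + ε * (b * z ^ 2 * V)) - c * s ^ 3
      - i * (a * q - i * p) * z ^ 2 * (Φ + q * z + ε * V) + i * b * z ^ 2 * Rr
      - p * i ^ 2 * z ^ 2 * (2 * b * z + ε * (b ^ 2 * z ^ 2))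
      - 2 * b * z * (i * z * Rr + Re + a * i * z * Φ - 2 * b * z * Ro) = N := ⟨_, rfl⟩
  rw [hN]
  have e : E * (-(a * (ε * s)) - p * (ε * s) ^ 2 - c * (ε * s) ^ 3 + ε * (Ro + ε * (s * Rr + Re) + ε ^ 2 * Rm))
      = E * ((1 + ε * (2 * b * z)) * (ε * Ro + ε ^ 2 * (Re + (i * Rr - 2 * b * Ro + i * a * Φ) * z)) + ε ^ 3 * N)
        + (i * (a * q - i * p) * (ε * z) ^ 2 - a * (ε * s)) * (E * (1 + ε * (Φ + q * z + ε * V))) := by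
    rw [← hN, hs]
    ring
  rw [e]
  linear_combination (-(E * ε ^ 3 * N)) * hJ1

/-- The equation for `z / ε`. -/
lemma hasDerivAt_zf {ε t : ℝ} {Γ φ : ℝ → ℝ} (hχ : ∀ s, χ (Γ s) = Γ s)
    (hH : 1 + ε * D.Hf ε t (φ t) ≠ 0)
    (hφ : HasDerivAt φ (ε ^ ν * (1 + ε * (D.Θs χ ε t (φ t) (Γ t) + ε * D.V₂ χ ε t (φ t) (Γ t)))) t)
    (hΓ : HasDerivAt Γ (ε ^ (ν + 1) * (D.L * Γ t + D.Uf χ ε t (φ t) (Γ t))) t) :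
    HasDerivAt (fun s => D.zf χ ε s (φ s) (Γ s)) (ε ^ ν * (O.Ro t (φ t)
      + ε * (O.RεO t (φ t) + O.Z t (φ t) * D.zf χ ε t (φ t) (Γ t)) + ε ^ 2 * D.N₂ χ ε t (φ t) (Γ t))) t := by
  have hG := D.avgG.hasDerivAt_along ε hφ
  have hHd := D.avgH.hasDerivAt_along ε hφ
  have hF := D.avgF.hasDerivAt_along ε hφ
  have h := (hG.add (hF.const_mul ε)).add ((hΓ.const_mul ε).mul ((hHd.const_mul ε).const_add 1))
  refine (h.congr_deriv ?_).congr_of_eventuallyEq (Eventually.of_forall fun s => ?_)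
  · have ez : D.zf χ ε t (φ t) (Γ t) = D.G₀ t (φ t) + D.G₁ t (φ t) * ε + ε * D.Ff ε t (φ t)
      + ε * Γ t * (1 + ε * D.Hf ε t (φ t)) := by rw [zf, hχ, Gf]
    have eΘ : D.Θs χ ε t (φ t) (Γ t) = O.Φo t (φ t) + O.q (φ t) * D.zf χ ε t (φ t) (Γ t) := rfl
    rw [Uf, hχ]
    rw [show D.H₀ t (φ t) + D.H₁ t (φ t) * ε = D.Hf ε t (φ t) from rfl]
    generalize D.N₂ χ ε t (φ t) (Γ t) = N, D.V₂ χ ε t (φ t) (Γ t) = V at *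
    generalize D.Θs χ ε t (φ t) (Γ t) = Θ, D.zf χ ε t (φ t) (Γ t) = z, D.Hf ε t (φ t) = H at *
    generalize D.Ff ε t (φ t) = F at *
    obtain ⟨J, hJ⟩ : ∃ J, (1 + ε * H)⁻¹ = J := ⟨_, rfl⟩
    have hJ1 : (1 + ε * H) * J = 1 := by rw [← hJ, mul_inv_cancel₀ hH]
    rw [hJ]
    subst eΘ ez
    generalize Γ t = g, D.G₀ t (φ t) = G0, D.G₁ t (φ t) = G1, D.G₀' t (φ t) = G0' at *
    generalize D.G₁' t (φ t) = G1', D.F₀' t (φ t) = F0', D.F₁' t (φ t) = F1' at *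
    generalize D.H₀' t (φ t) = H0', D.H₁' t (φ t) = H1', O.Z t (φ t) = Z, O.q (φ t) = q at *
    generalize O.Φo t (φ t) = Φ at *
    rw [pow_succ]
    generalize ε ^ ν = E, hz : G0 + G1 * ε + ε * F + ε * g * (1 + ε * H) = z at *
    obtain ⟨U, hU⟩ : ∃ U, (Z - G0' * q) * (G1 + F + ε * (g * H)) + N - (G1' * (Φ + q * z) + (G0' + G1' * ε) * V)
      - (F1' + (F0' + F1' * ε) * (Φ + q * z + ε * V)) - ε * (g * (H1' + (H0' + H1' * ε) * (Φ + q * z + ε * V)))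
      - D.L * (ε * (g * H)) = U := ⟨_, rfl⟩
    rw [hU]
    have e : ε * (E * ε * (D.L * g + J * U)) * (1 + ε * H) = ε * (E * ε * (D.L * g * (1 + ε * H) + U)) := by
      linear_combination (ε * E * ε * U) * hJ1
    rw [e, ← hU]
    linear_combination (E * ε * (Z - G0' * q)) * hz
  · simp only [zf, hχ, Gf, Ff, Hf, Pi.add_apply, Pi.mul_apply]

/-- The equation for `φ = ψ + ε Δ`. -/
lemma hasDerivAt_angle {ε t w : ℝ} {ψ : ℝ → ℝ} (hε : ε ≠ 0)
    (hΔ : 1 + ε * (D.Δ₀' t (ψ t) + D.Δ₁' t (ψ t) * ε) ≠ 0)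
    (hψ : HasDerivAt ψ (ε ^ ν * (1 + ε * D.Θbar + ε ^ 2 * D.Vf χ ε t (ψ t) w)) t) :
    HasDerivAt (fun s => ψ s + ε * D.Δf ε s (ψ s)) (ε ^ ν * (1 + ε *
      (D.Θs χ ε t (ψ t + ε * D.Δf ε t (ψ t)) w + ε * D.V₂ χ ε t (ψ t + ε * D.Δf ε t (ψ t)) w))) t := by
  have hda := D.avgΔ.hasDerivAt_along ε hψ
  refine (hψ.add (hda.const_mul ε)).congr_deriv ?_
  rw [Vf, Θs, zf, Gf]
  generalize ψ t + ε * D.Δf ε t (ψ t) = θ at *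
  generalize D.V₂ χ ε t θ w = V at *
  generalize hd : D.Δ₀' t (ψ t) + D.Δ₁' t (ψ t) * ε = d at *
  obtain ⟨J, hJ⟩ : ∃ J, (1 + ε * d)⁻¹ = J := ⟨_, rfl⟩
  have hJ1 : (1 + ε * d) * J = 1 := by rw [← hJ, mul_inv_cancel₀ hΔ]
  rw [hJ]
  have hi : ε * ε⁻¹ = 1 := mul_inv_cancel₀ hε
  generalize D.Hf ε t θ = H, D.Ff ε t θ = F, O.Φo t θ = a at *
  generalize O.Φo t (ψ t) + O.q (ψ t) * D.G₀ t (ψ t) = b at *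
  obtain ⟨U, hU⟩ : ∃ U, ε⁻¹ * (a + O.q θ * D.G₀ t θ - b) + O.q θ * (D.G₁ t θ + F + χ w * (1 + ε * H)) + V
    - D.Δ₁' t (ψ t) - D.Θbar * d = U := ⟨_, rfl⟩
  rw [hU]
  have e : (1 + ε * d) * (1 + ε * D.Θbar + ε ^ 2 * (J * U))
      = (1 + ε * d) * (1 + ε * D.Θbar) + ε ^ 2 * U := by
    linear_combination (ε ^ 2 * U) * hJ1
  linear_combination ε ^ ν * e - ε ^ ν * ε ^ 2 * hU - ε ^ ν * ε * hd
    + ε ^ ν * ε * (a + O.q θ * D.G₀ t θ - b) * hi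

end AveragingSetup

/-! ### Averages -/

section Average

variable {T ω : ℝ} {v w : ℝ → ℝ → ℝ}

lemma continuous_integral_period (hv : Continuous fun p : Plane => v p.1 p.2) :
    Continuous fun φ => ∫ t in (0 : ℝ)..T, v t φ :=
  intervalIntegral.continuous_parametric_intervalIntegral_of_continuous' (f := fun φ t => v t φ)
    (hv.comp continuous_swap) 0 T

lemma average_add (hv : Continuous fun p : Plane => v p.1 p.2)
    (hw : Continuous fun p : Plane => w p.1 p.2) :
    average T ω (fun t φ => v t φ + w t φ) = average T ω v + average T ω w := by
  have h1 : ∀ φ, ∫ t in (0 : ℝ)..T, (v t φ + w t φ)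
      = (∫ t in (0 : ℝ)..T, v t φ) + ∫ t in (0 : ℝ)..T, w t φ := fun φ =>
    intervalIntegral.integral_add
      ((hv.comp (by fun_prop : Continuous fun t : ℝ => (t, φ))).intervalIntegrable _ _)
      ((hw.comp (by fun_prop : Continuous fun t : ℝ => (t, φ))).intervalIntegrable _ _)
  simp only [_root_.average, h1]
  rw [intervalIntegral.integral_add ((continuous_integral_period hv).intervalIntegrable _ _)
    ((continuous_integral_period hw).intervalIntegrable _ _), mul_add]

lemma average_const_mul (c : ℝ) (v : ℝ → ℝ → ℝ) :
    average T ω (fun t φ => c * v t φ) = c * average T ω v := by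
  simp only [_root_.average, intervalIntegral.integral_const_mul]
  ring

lemma average_const (hT : 0 < T) (hω : 0 < ω) (c : ℝ) : average T ω (fun _ _ => c) = c := by
  simp only [_root_.average, intervalIntegral.integral_const, sub_zero, smul_eq_mul]
  field_simp

lemma average_sub (hv : Continuous fun p : Plane => v p.1 p.2)
    (hw : Continuous fun p : Plane => w p.1 p.2) :
    average T ω (fun t φ => v t φ - w t φ) = average T ω v - average T ω w := by
  have := average_add (T := T) (ω := ω) hv (w := fun t φ => -1 * w t φ) (continuous_const.mul hw)
  rw [average_const_mul] at this
  simpa [sub_eq_add_neg] using this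

lemma average_combination {a b r g f : ℝ → ℝ → ℝ} (ha : Continuous fun p : Plane => a p.1 p.2)
    (hb : Continuous fun p : Plane => b p.1 p.2) (hr : Continuous fun p : Plane => r p.1 p.2)
    (hg : Continuous fun p : Plane => g p.1 p.2) (hf : Continuous fun p : Plane => f p.1 p.2) :
    average T ω (fun t φ => a t φ + b t φ + r t φ - g t φ - f t φ) = average T ω a + average T ω b
      + average T ω r - average T ω g - average T ω f := by
  rw [average_sub (v := fun t φ => a t φ + b t φ + r t φ - g t φ) (((ha.add hb).add hr).sub hg) hf,
    average_sub (v := fun t φ => a t φ + b t φ + r t φ) ((ha.add hb).add hr) hg,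
    average_add (v := fun t φ => a t φ + b t φ) (ha.add hb) hr, average_add ha hb]

end Average

lemma HasPartials.param_mul {E : Type*} [TopologicalSpace E] {f fφ fw : E → ℝ → ℝ → ℝ → ℝ} {a : E → ℝ}
    (ha : Continuous a) (hf : HasPartials f fφ fw) : HasPartials (fun ε t φ w => a ε * f ε t φ w)
      (fun ε t φ w => a ε * fφ ε t φ w) (fun ε t φ w => a ε * fw ε t φ w) := by
  simpa using (HasPartials.of_param ha).mul hf

namespace AveragingSetup

variable {P : PerturbedSystem} {O : GeneratingOrbit P} {ν : ℕ} {A : Subalgebra ℝ (ℝ → ℝ → ℝ)}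
  (D : AveragingSetup O ν A)

/-! ### The invariant torus of the averaged system -/

/-- `Γ` is an invariant surface of the averaged system for `0 < ε < ε₁`, close to the constant `c`. -/
structure IsAveragedTorus (ε₁ N K c : ℝ) (χ : ℝ → ℝ)
    (Γ Γ₁ Γ₂ : ℝ → ℝ → ℝ → ℝ) : Prop where
  pos : 0 < ε₁
  le_half : ε₁ ≤ P.ε₀ / 2
  le_one : ε₁ ≤ 1
  cutoff : ∀ w, |w| ≤ N → χ w = w
  cont : Continuous fun q : Ioo 0 ε₁ × Plane => Γ q.1 q.2.1 q.2.2
  cont₁ : Continuous fun q : Ioo 0 ε₁ × Plane => Γ₁ q.1 q.2.1 q.2.2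
  cont₂ : Continuous fun q : Ioo 0 ε₁ × Plane => Γ₂ q.1 q.2.1 q.2.2
  deriv₁ : ∀ ε ∈ Ioo 0 ε₁, ∀ t ψ, HasDerivAt (fun t => Γ ε t ψ) (Γ₁ ε t ψ) t
  deriv₂ : ∀ ε ∈ Ioo 0 ε₁, ∀ t ψ, HasDerivAt (fun ψ => Γ ε t ψ) (Γ₂ ε t ψ) ψ
  periodic : ∀ ε ∈ Ioo 0 ε₁, ∀ t ψ, Γ ε (t + P.T) ψ = Γ ε t ψ ∧ Γ ε t (ψ + O.ω) = Γ ε t ψ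
  bound : ∀ ε t ψ, |Γ ε t ψ| ≤ N
  at_zero : ∀ t ψ, Γ 0 t ψ = c
  close : ∀ ε ∈ Ioo 0 ε₁, ∀ t ψ, |Γ ε t ψ - c| ≤ K * ε
  radius : ∀ ε ∈ Ioo 0 ε₁, ∀ t φ w, |ε * D.sf χ ε t φ w| < 1 ∧
    ∀ σ ∈ Icc (0 : ℝ) 1, (O.xPolar φ (σ * (ε * D.sf χ ε t φ w)),
      O.yPolar φ (σ * (ε * D.sf χ ε t φ w)), σ * ε) ∈ P.dom
  regular_β : ∀ ε ∈ Ioo 0 ε₁, ∀ t φ w, 1 + ε * (2 * O.β φ * D.zf χ ε t φ w) ≠ 0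
  regular_H : ∀ ε ∈ Ioo 0 ε₁, ∀ t φ, 1 + ε * D.Hf ε t φ ≠ 0
  regular_Δ : ∀ ε ∈ Ioo 0 ε₁, ∀ t φ, 1 / 2 ≤ 1 + ε * (D.Δ₀' t φ + D.Δ₁' t φ * ε)
  invariant : ∀ ε ∈ Ioo 0 ε₁, ∀ t₀ ψ₀, ∃ ψ : ℝ → ℝ, ψ t₀ = ψ₀ ∧ ∀ t,
    HasDerivAt ψ (ε ^ ν * (1 + ε * D.Θbar + ε ^ 2 * D.Vf χ ε t (ψ t) (Γ ε t (ψ t)))) t ∧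
    HasDerivAt (fun t => Γ ε t (ψ t)) (ε ^ (ν + 1) * (D.L * Γ ε t (ψ t)
      + D.Uf χ ε t (ψ t + ε * D.Δf ε t (ψ t)) (Γ ε t (ψ t)))) t

lemma isTame_cutoff {T ω N : ℝ} (hN : 0 < N) : ∃ χ : ℝ → ℝ,
    IsTame T ω (fun _ _ _ w => χ w) ∧ ∀ w, |w| ≤ N → χ w = w := by
  obtain ⟨χ, χ', M, h1, h2, h3, h4, h5⟩ := exists_cutoff N hN
  have hM : 0 ≤ M := (abs_nonneg _).trans (h3 0)
  exact ⟨χ, ⟨1, one_pos, M, fun _ _ _ _ => 0, fun _ _ _ w => χ' w, HasPartials.of_fiber h1 h2, hM, fun _ _ _ _ w => h3 w,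
    fun _ _ _ _ _ => by simpa using hM, fun _ _ _ _ w => h4 w, fun _ _ _ _ _ => rfl,
    fun _ _ _ _ _ => rfl⟩, h5⟩

lemma Uf_congr {χ₁ χ₂ : ℝ → ℝ} {ε t φ w : ℝ} (h : χ₁ w = χ₂ w) :
    D.Uf χ₁ ε t φ w = D.Uf χ₂ ε t φ w := by
  have hz : D.zf χ₁ ε t φ w = D.zf χ₂ ε t φ w := by rw [zf, zf, h]
  have hs : D.sf χ₁ ε t φ w = D.sf χ₂ ε t φ w := by rw [sf, sf, hz]
  have hT : ∀ f, O.taylorRemainder f (D.sf χ₁) ε t φ w = O.taylorRemainder f (D.sf χ₂) ε t φ w := by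
    intro f
    simp only [GeneratingOrbit.taylorRemainder, GeneratingOrbit.segmentMean, hs]
  have hX : ∀ f, D.X₁ f χ₁ ε t φ w = D.X₁ f χ₂ ε t φ w := fun f => by rw [X₁, X₁, hs, hT]
  have hΘ : D.Θs χ₁ ε t φ w = D.Θs χ₂ ε t φ w := by rw [Θs, Θs, hz]
  have hV : D.V₂ χ₁ ε t φ w = D.V₂ χ₂ ε t φ w := by rw [V₂, V₂, hs, hz, hX, hX, hΘ]
  have hR : D.Rm χ₁ ε t φ w = D.Rm χ₂ ε t φ w := by rw [Rm, Rm, hT, hT]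
  have hN : D.N₂ χ₁ ε t φ w = D.N₂ χ₂ ε t φ w := by simp only [N₂, hs, hz, hΘ, hV, hR]
  rw [Uf, Uf, h, hN, hΘ, hV]

/-- The limit of the perturbation in the equation for `Γ` does not depend on the cutoff. -/
lemma exists_limit_Uf : ∃ U₀ ∈ A, ∀ χ : ℝ → ℝ, χ 0 = 0 →
    IsTame P.T O.ω (fun _ _ _ w => χ w) → ∃ ε₁ > 0, ∃ K fφ fw, TameWith P.T O.ω ε₁ K
      (fun ε t ψ w => D.Uf χ ε t (ψ + ε * D.Δf ε t ψ) w) fφ fw ∧ ∀ ε ∈ Ioo 0 ε₁, ∀ t φ w,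
      |fw ε t φ w| ≤ K * ε ∧ |D.Uf χ ε t (φ + ε * D.Δf ε t φ) w - U₀ t φ| ≤ K * ε := by
  have key : ∀ χ : ℝ → ℝ, IsTame P.T O.ω (fun _ _ _ w => χ w) → _ := fun χ hχ =>
    (D.near_Uf hχ).comp_shift D.isClass D.near_Δf.isTame
  obtain ⟨χ₀, h0, h0'⟩ := isTame_cutoff (T := P.T) (ω := O.ω) one_pos
  obtain ⟨U₀, hU, e₀, he₀, K₀, _, _, -, b₀⟩ := key χ₀ h0
  refine ⟨U₀, hU, fun χ hχ0 hχ => ?_⟩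
  obtain ⟨U, hU', e, he, K, fφ, fw, hT, b⟩ := key χ hχ
  obtain rfl : U = U₀ := by
    funext t φ
    have hz : χ 0 = χ₀ 0 := by rw [hχ0, h0' 0 (by simp)]
    have hle : ∀ ε ∈ Ioo 0 (min e e₀), |U t φ - U₀ t φ| ≤ (K + K₀) * ε := by
      intro ε hε
      have h1 := (b ε ⟨hε.1, hε.2.trans_le (min_le_left _ _)⟩ t φ 0).2
      have h2 := (b₀ ε ⟨hε.1, hε.2.trans_le (min_le_right _ _)⟩ t φ 0).2
      dsimp only at h1 h2
      rw [D.Uf_congr hz] at h1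
      rw [abs_sub_comm] at h1
      have := abs_sub_le (U t φ) (D.Uf χ₀ ε t (φ + ε * D.Δf ε t φ) 0) (U₀ t φ)
      linarith
    have hlim : Tendsto (fun ε : ℝ => (K + K₀) * ε) (𝓝[>] 0) (𝓝 ((K + K₀) * 0)) :=
      ((continuous_const.mul continuous_id).tendsto 0).mono_left nhdsWithin_le_nhds
    have := ge_of_tendsto hlim (b := |U t φ - U₀ t φ|) (by
      filter_upwards [Ioo_mem_nhdsGT (lt_min he he₀)] with ε hε using hle ε hε)
    rw [mul_zero] at this
    exact sub_eq_zero.1 (abs_nonpos_iff.1 this)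
  exact ⟨e, he, K, fφ, fw, hT, b⟩

lemma exists_pos_le_and_mul_le {e M a : ℝ} (he : 0 < e) (hM : 0 ≤ M) (ha : 0 < a) :
    ∃ ε > 0, ε ≤ e ∧ ε * M ≤ a := by
  refine ⟨min e (a / (M + 1)), lt_min he (by positivity), min_le_left _ _, ?_⟩
  calc min e (a / (M + 1)) * M ≤ a / (M + 1) * (M + 1) :=
        mul_le_mul (min_le_right _ _) (by linarith) hM (by positivity)
    _ = a := by field_simp

/-- The invariant surface is close to the equilibrium of the averaged equation. -/
lemma abs_sub_le_of_invariant {U₀ : ℝ → ℝ → ℝ} (hU₀ : U₀ ∈ A)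
    {ε₁ N K KV : ℝ} (h1 : ε₁ ≤ 1) {Γ : ℝ → ℝ → ℝ → ℝ}
    {U V : ℝ → ℝ → ℝ → ℝ} (hU : ∀ ε ∈ Ioo 0 ε₁, ∀ t ψ, |U ε t ψ - U₀ t ψ| ≤ K * ε)
    (hV : ∀ ε ∈ Ioo 0 ε₁, ∀ t ψ, |V ε t ψ| ≤ KV) (hΓ : ∀ ε t ψ, |Γ ε t ψ| ≤ N)
    (hinv : ∀ ε ∈ Ioo 0 ε₁, ∀ t₀ ψ₀, ∃ ψ : ℝ → ℝ, ψ t₀ = ψ₀ ∧ ∀ t,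
      HasDerivAt ψ (ε ^ ν * (1 + ε * D.Θbar + ε ^ 2 * V ε t (ψ t))) t ∧
      HasDerivAt (fun t => Γ ε t (ψ t)) (ε ^ (ν + 1) * (D.L * Γ ε t (ψ t) + U ε t (ψ t))) t) :
    ∃ K', ∀ ε ∈ Ioo 0 ε₁, ∀ t ψ, |Γ ε t ψ - -(average P.T O.ω U₀ / D.L)| ≤ K' * ε := by
  have hcU := D.isClass.cont U₀ hU₀
  obtain ⟨b₀, b₁, e₀, e₁, Kb, hb, hbb⟩ := D.corrector (fun t φ => U₀ t φ - average P.T O.ω U₀)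
    (A.sub_mem hU₀ (A.algebraMap_mem (average P.T O.ω U₀))) (by
      rw [average_sub hcU continuous_const, average_const D.isClass.T_pos D.isClass.ω_pos, sub_self])
  generalize average P.T O.ω U₀ = a at *
  have hKb : 0 ≤ Kb := (abs_nonneg _).trans (hbb 0 0).1
  have hL := D.L_ne
  refine ⟨2 * Kb + |D.L⁻¹| * (K + Kb + 2 * Kb * (|D.Θbar| + KV)) + 2 * Kb, fun ε hε t₀ ψ₀ => ?_⟩
  obtain ⟨ψ, rfl, hψ⟩ := hinv ε hε t₀ ψ₀
  have hε0 := hε.1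
  have hε1 : ε ≤ 1 := hε.2.le.trans h1
  have hadd : ∀ {x y : ℝ}, |x| ≤ Kb → |y| ≤ Kb → |x + y * ε| ≤ 2 * Kb := by
    intro x y hx hy
    refine (abs_add_le _ _).trans ?_
    rw [abs_mul, abs_of_pos hε0]
    have := mul_le_mul hy hε1 hε0.le hKb
    linarith
  have hbε : ∀ t φ, |b₀ t φ + b₁ t φ * ε| ≤ 2 * Kb := fun t φ => hadd (hbb t φ).1 (hbb t φ).2.1
  let y : ℝ → ℝ := fun t => Γ ε t (ψ t) - -(a / D.L) - ε * (b₀ t (ψ t) + b₁ t (ψ t) * ε)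
  let f : ℝ → ℝ := fun t => ε * (b₀ t (ψ t) + b₁ t (ψ t) * ε) + D.L⁻¹ * (U ε t (ψ t) - U₀ t (ψ t)
    - ε * (e₁ t (ψ t) + (e₀ t (ψ t) + e₁ t (ψ t) * ε) * (D.Θbar + ε * V ε t (ψ t))))
  have hy : ∀ t, HasDerivAt y (ε ^ (ν + 1) * D.L * (y t + f t)) t := by
    intro t
    have hd := hb.hasDerivAt_along ε (hψ t).1
    refine (((hψ t).2.sub_const (-(a / D.L))).sub (hd.const_mul ε)).congr_deriv ?_
    simp only [y, f]
    have hLi : D.L * D.L⁻¹ = 1 := mul_inv_cancel₀ hL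
    rw [pow_succ, div_eq_mul_inv]
    linear_combination (-(ε ^ ν * ε * a) - ε ^ ν * ε * (U ε t (ψ t) - U₀ t (ψ t)
      - ε * (e₁ t (ψ t) + (e₀ t (ψ t) + e₁ t (ψ t) * ε) * (D.Θbar + ε * V ε t (ψ t))))) * hLi
  have hf : ∀ t, |f t| ≤ (2 * Kb + |D.L⁻¹| * (K + Kb + 2 * Kb * (|D.Θbar| + KV))) * ε := by
    intro t
    have q1 : |ε * (b₀ t (ψ t) + b₁ t (ψ t) * ε)| ≤ ε * (2 * Kb) := by
      rw [abs_mul, abs_of_pos hε0]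
      exact mul_le_mul_of_nonneg_left (hbε _ _) hε0.le
    have q2 : |D.Θbar + ε * V ε t (ψ t)| ≤ |D.Θbar| + KV := by
      refine (abs_add_le _ _).trans ?_
      rw [abs_mul, abs_of_pos hε0]
      have := mul_le_mul hε1 (hV ε hε t (ψ t)) (abs_nonneg _) zero_le_one
      linarith
    have q3 : |e₁ t (ψ t) + (e₀ t (ψ t) + e₁ t (ψ t) * ε) * (D.Θbar + ε * V ε t (ψ t))|
        ≤ Kb + 2 * Kb * (|D.Θbar| + KV) := by
      refine (abs_add_le _ _).trans (add_le_add (hbb t (ψ t)).2.2.2 ?_)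
      rw [abs_mul]
      exact mul_le_mul (hadd (hbb _ _).2.2.1 (hbb _ _).2.2.2) q2 (abs_nonneg _) (by positivity)
    have q4 : |U ε t (ψ t) - U₀ t (ψ t) - ε * (e₁ t (ψ t) + (e₀ t (ψ t) + e₁ t (ψ t) * ε)
        * (D.Θbar + ε * V ε t (ψ t)))| ≤ (K + Kb + 2 * Kb * (|D.Θbar| + KV)) * ε := by
      refine (abs_sub _ _).trans ?_
      rw [abs_mul, abs_of_pos hε0]
      have := mul_le_mul_of_nonneg_left q3 hε0.le
      linarith [hU ε hε t (ψ t)]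
    refine (abs_add_le _ _).trans ?_
    rw [abs_mul D.L⁻¹]
    have := mul_le_mul_of_nonneg_left q4 (abs_nonneg D.L⁻¹)
    linarith
  have hyB : ∀ t, |y t| ≤ N + |-(a / D.L)| + 2 * Kb := by
    intro t
    refine (abs_sub _ _).trans (add_le_add ((abs_sub _ _).trans (add_le_add_left (hΓ _ _ _) _)) ?_)
    rw [abs_mul, abs_of_pos hε0]
    have := mul_le_mul hε1 (hbε t (ψ t)) (abs_nonneg _) zero_le_one
    linarith
  have h := abs_le_of_bounded_of_hasDerivAt (mul_ne_zero (pow_ne_zero _ hε0.ne') hL) hy hyB hf t₀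
  have e : Γ ε t₀ (ψ t₀) - -(a / D.L) = y t₀ + ε * (b₀ t₀ (ψ t₀) + b₁ t₀ (ψ t₀) * ε) := by
    simp only [y]; ring
  rw [e]
  refine (abs_add_le _ _).trans ?_
  rw [abs_mul ε, abs_of_pos hε0]
  have := mul_le_mul_of_nonneg_left (hbε t₀ (ψ t₀)) hε0.le
  linarith

theorem exists_isAveragedTorus :
    ∃ ε₁ N K c χ Γ Γ₁ Γ₂, IsTame P.T O.ω (fun _ _ _ w => χ w) ∧ D.IsAveragedTorus ε₁ N K c χ Γ Γ₁ Γ₂ := by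
  have hL := D.L_ne
  obtain ⟨l, hl⟩ : ∃ l, D.L⁻¹ = l := ⟨_, rfl⟩
  have hLl : D.L * l = 1 := by rw [← hl, mul_inv_cancel₀ hL]
  have hl0 : 0 < |l| := by rw [← hl]; positivity
  obtain ⟨U₀, hU₀, hlim⟩ := D.exists_limit_Uf
  obtain ⟨B, -, -, hB, -, -⟩ := D.isClass.tameWith hU₀
  have hB0 : 0 ≤ B := (abs_nonneg _).trans (hB 0 0)
  let c : ℝ := -(average P.T O.ω U₀ / D.L)
  obtain ⟨N, hN⟩ : ∃ N, |l| * (B + 1) = N := ⟨_, rfl⟩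
  have hN0 : 0 < N := by rw [← hN]; positivity
  obtain ⟨χ, hχ, hχN⟩ := isTame_cutoff (T := P.T) (ω := O.ω) (N := N + |c|) (by positivity)
  obtain ⟨eU, heU, K, Uφ, Uw, hU, bU⟩ := hlim χ (hχN 0 (by rw [abs_zero]; positivity)) hχ
  obtain ⟨eV, heV, KV, Vφ, Vw, hV⟩ := D.isTame_Vf hχ
  obtain ⟨es, hes, Ks, _, _, hs⟩ := (D.near_sf hχ).isTame
  obtain ⟨ez, hez, Kz, _, _, hz⟩ := ((IsTame.const 2).mul
    (D.near_orbit (v := O.β) (by simp)).isTame).mul (D.near_zf hχ).isTame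
  obtain ⟨eH, heH, KH, _, _, hH⟩ := D.near_Hf.isTame
  obtain ⟨eΔ, heΔ, KΔ, _, _, hΔ⟩ := (D.near_function (v := D.Δ₀') (by simp)).isTame.add
    ((D.near_function (v := D.Δ₁') (by simp)).isTame.mul D.near_param.isTame)
  obtain ⟨ρ, hρ0, hρ1, S, -, hSdom, hS⟩ := O.exists_box D.gen
  have hK := hU.nonneg
  have hKV := hV.nonneg
  have hKs := hs.nonneg
  have hKz := hz.nonneg
  have hKH := hH.nonneg
  have hKΔ := hΔ.nonneg
  have hlK : 0 ≤ |l| * K := by positivity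
  have hlV : 0 ≤ |l| * KV := by positivity
  obtain ⟨κ, hκ⟩ : ∃ κ, 1 + |l| * K = κ := ⟨_, rfl⟩
  have hκ1 : 1 ≤ κ := by linarith
  obtain ⟨η, hη0, hη⟩ : ∃ η : ℝ, 0 < η ∧ η * (1 + 8 * κ) ≤ 1 / 8 :=
    ⟨1 / 8 / (1 + 8 * κ), by positivity, (div_mul_cancel₀ _ (by positivity)).le⟩
  obtain ⟨ε₁, hε₁, hle, hM⟩ := exists_pos_le_and_mul_le
    (e := min (min (min eU eV) (min es ez)) (min (min eH eΔ) (min (P.ε₀ / 2) 1)))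
    (M := K + |l| * K + |l| * KV + Ks + Kz + KH + KΔ) (a := min (min η N) (min ρ (1 / 2)))
    (by have := P.ε₀_pos; positivity) (by positivity) (by positivity)
  simp only [le_min_iff] at hle hM
  obtain ⟨⟨⟨l1, l2⟩, l3, l4⟩, ⟨l5, l6⟩, l7, l8⟩ := hle
  obtain ⟨⟨m1, m2⟩, m3, m4⟩ := hM
  have hmem : ∀ {e : ℝ}, ε₁ ≤ e → ∀ ε ∈ Ioo 0 ε₁, ε ∈ Ioo 0 e := fun h ε hε =>
    ⟨hε.1, hε.2.trans_le h⟩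
  obtain ⟨M, hM⟩ : ∃ M, K + |l| * K + |l| * KV + Ks + Kz + KH + KΔ = M := ⟨_, rfl⟩
  rw [hM] at m1 m2 m3 m4
  have small : ∀ {x a : ℝ}, 0 ≤ x → x ≤ M → ε₁ * M ≤ a → ∀ ε ∈ Ioo 0 ε₁, ε * x ≤ a :=
    fun hx h1 h2 ε hε => (mul_le_mul hε.2.le h1 hx hε₁.le).trans h2
  have low : ∀ {x k : ℝ}, |x| ≤ k → k ≤ M → ∀ ε ∈ Ioo 0 ε₁, -(1 / 2) ≤ ε * x := fun hx h1 ε hε => by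
    have := mul_le_mul_of_nonneg_left ((neg_le_abs _).trans hx) hε.1.le
    linarith [small ((abs_nonneg _).trans hx) h1 m4 ε hε]
  have bV : ∀ (ε : Ioo 0 ε₁) {x a : ℝ}, |x| ≤ KV → ε₁ * M ≤ a → |l * ε * x| ≤ a := fun ε x a hx ha => by
    rw [abs_mul, abs_mul, abs_of_pos ε.2.1]
    have := mul_le_mul_of_nonneg_left hx (mul_nonneg hl0.le ε.2.1.le)
    linarith [small hlV (by linarith) ha ε ε.2]
  let E := Ioo (0 : ℝ) ε₁
  have hcE : Continuous fun ε : E => (ε : ℝ) := continuous_subtype_val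
  have pU := ((hU.mono l1 le_rfl).partials).param_mul (a := fun _ => l) continuous_const
  have pV := ((hV.mono l2 le_rfl).partials).param_mul (a := fun ε : E => l * ε) (continuous_const.mul hcE)
  obtain ⟨s, s₁, s₂, hinv, hsN, hsp⟩ := exists_isInvariantTorus pU pV
    (μ := fun ε : E => D.L * (ε : ℝ) ^ (ν + 1)) (c := fun ε : E => (1 + ε * D.Θbar) * (l * (ε : ℝ)⁻¹))
    (continuous_const.mul (hcE.pow _)) (fun ε => mul_ne_zero hL (pow_ne_zero _ ε.2.1.ne'))
    ((continuous_const.add (hcE.mul continuous_const)).mul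
      (continuous_const.mul (hcE.inv₀ fun ε => ε.2.1.ne'))) hκ1 hη0.le hη (B := N) (T := P.T) (ω := O.ω)
    (fun ε t ψ w => by
      rw [abs_mul, ← hN]
      refine mul_le_mul_of_nonneg_left ?_ hl0.le
      have q1 := (bU ε (hmem l1 ε ε.2) t ψ w).2
      have q2 := small hK (by linarith) m4 ε ε.2
      have := abs_sub_abs_le_abs_sub (D.Uf χ ε t (ψ + ε * D.Δf ε t ψ) w) (U₀ t ψ)
      linarith [hB t ψ])
    (fun ε t ψ w => by
      rw [abs_mul, ← hκ]
      have := mul_le_mul_of_nonneg_left (hU.bound_φ ε (hmem l1 ε ε.2) t ψ w) hl0.le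
      linarith)
    (fun ε t ψ w => by
      rw [abs_mul]
      have := mul_le_mul_of_nonneg_left (bU ε (hmem l1 ε ε.2) t ψ w).1 hl0.le
      have q2 := small hlK (by linarith) m1 ε ε.2
      linarith)
    (fun ε t ψ w => bV ε (hV.bound ε (hmem l2 ε ε.2) t ψ w) m2)
    (fun ε t ψ w => bV ε (hV.bound_φ ε (hmem l2 ε ε.2) t ψ w) m1)
    (fun ε t ψ w => bV ε (hV.bound_w ε (hmem l2 ε ε.2) t ψ w) m1)
    (fun ε t ψ w => ⟨congrArg (l * ·) (hU.periodic_t ε (hmem l1 ε ε.2) t ψ w),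
        congrArg (l * ·) (hU.periodic_φ ε (hmem l1 ε ε.2) t ψ w)⟩)
    (fun ε t ψ w => ⟨congrArg (l * (ε : ℝ) * ·) (hV.periodic_t ε (hmem l2 ε ε.2) t ψ w),
        congrArg (l * (ε : ℝ) * ·) (hV.periodic_φ ε (hmem l2 ε ε.2) t ψ w)⟩)
  let ext : (E → ℝ → ℝ → ℝ) → ℝ → ℝ → ℝ → ℝ → ℝ := fun s c ε t ψ =>
    if h : ε ∈ E then s ⟨ε, h⟩ t ψ else c
  have hext : ∀ (s : E → ℝ → ℝ → ℝ) c (ε : ℝ) (h : ε ∈ E), ext s c ε = s ⟨ε, h⟩ := by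
    intro s c ε h
    funext t ψ
    simp only [ext, dif_pos h]
  have hext' : ∀ (s : E → ℝ → ℝ → ℝ) c (ε : E), ext s c ε = s ε := fun s c ε => hext s c ε ε.2
  have hΓb : ∀ ε t ψ, |ext s c ε t ψ| ≤ N + |c| := by
    intro ε t ψ
    by_cases h : ε ∈ E
    · rw [hext s c ε h]
      linarith [hsN ⟨ε, h⟩ t ψ, abs_nonneg c]
    · simp only [ext, dif_neg h]
      linarith
  have hI : ∀ ε ∈ Ioo 0 ε₁, ∀ t₀ ψ₀, ∃ ψ : ℝ → ℝ, ψ t₀ = ψ₀ ∧ ∀ t,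
      HasDerivAt ψ (ε ^ ν * (1 + ε * D.Θbar + ε ^ 2 * D.Vf χ ε t (ψ t) (ext s c ε t (ψ t)))) t ∧
      HasDerivAt (fun t => ext s c ε t (ψ t)) (ε ^ (ν + 1) * (D.L * ext s c ε t (ψ t)
        + D.Uf χ ε t (ψ t + ε * D.Δf ε t (ψ t)) (ext s c ε t (ψ t)))) t := by
    intro ε hε t₀ ψ₀
    obtain ⟨ψ, h0, h⟩ := hinv.invariant ⟨ε, hε⟩ t₀ ψ₀
    refine ⟨ψ, h0, fun t => ?_⟩
    rw [hext s c ε hε]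
    have hi : ε * ε⁻¹ = 1 := mul_inv_cancel₀ hε.1.ne'
    refine ⟨(h t).1.congr_deriv ?_, (h t).2.congr_deriv ?_⟩
    · dsimp only
      rw [pow_succ]
      linear_combination (ε ^ ν * ε ^ 2 * D.Vf χ ε t (ψ t) (s ⟨ε, hε⟩ t (ψ t))
        + ε ^ ν * (1 + ε * D.Θbar) * (ε * ε⁻¹)) * hLl + ε ^ ν * (1 + ε * D.Θbar) * hi
    · dsimp only
      linear_combination (ε ^ (ν + 1) * D.Uf χ ε t (ψ t + ε * D.Δf ε t (ψ t)) (s ⟨ε, hε⟩ t (ψ t))) * hLl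
  obtain ⟨K', hK'⟩ := D.abs_sub_le_of_invariant hU₀ l8 (Γ := ext s c)
    (U := fun ε t ψ => D.Uf χ ε t (ψ + ε * D.Δf ε t ψ) (ext s c ε t ψ))
    (V := fun ε t ψ => D.Vf χ ε t ψ (ext s c ε t ψ))
    (fun ε hε t ψ => (bU ε (hmem l1 ε hε) t ψ _).2) (fun ε hε t ψ => hV.bound ε (hmem l2 ε hε) t ψ _)
    hΓb hI
  refine ⟨ε₁, N + |c|, K', c, χ, ext s c, ext s₁ 0, ext s₂ 0, hχ, hε₁, l7, l8, hχN, ?_, ?_, ?_, ?_, ?_,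
    ?_, hΓb, ?_, hK', ?_, ?_, ?_, ?_, hI⟩
  · simpa only [hext'] using hinv.cont
  · simpa only [hext'] using hinv.cont₁
  · simpa only [hext'] using hinv.cont₂
  · intro ε hε t ψ
    rw [hext _ _ ε hε, hext _ _ ε hε]
    exact hinv.deriv₁ ⟨ε, hε⟩ t ψ
  · intro ε hε t ψ
    rw [hext _ _ ε hε, hext _ _ ε hε]
    exact hinv.deriv₂ ⟨ε, hε⟩ t ψ
  · intro ε hε t ψ
    rw [hext _ _ ε hε]
    exact hsp ⟨ε, hε⟩ t ψ
  · intro t ψ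
    exact dif_neg (fun h : (0 : ℝ) ∈ E => lt_irrefl _ h.1)
  · intro ε hε t φ w
    have q : |ε * D.sf χ ε t φ w| ≤ ρ := by
      rw [abs_mul, abs_of_pos hε.1]
      exact (mul_le_mul_of_nonneg_left (hs.bound ε (hmem l3 ε hε) t φ w) hε.1.le).trans
        (small hKs (by linarith) m3 ε hε)
    refine ⟨q.trans_lt hρ1, fun σ hσ => hSdom (hS φ _ _ ?_ ⟨mul_nonneg hσ.1 hε.1.le, ?_⟩)⟩
    · rw [abs_mul σ, abs_of_nonneg hσ.1]
      exact (mul_le_of_le_one_left (abs_nonneg _) hσ.2).trans q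
    · exact (mul_le_of_le_one_left hε.1.le hσ.2).trans (hε.2.le.trans l7)
  · intro ε hε t φ w
    apply ne_of_gt
    linarith [low (hz.bound ε (hmem l4 ε hε) t φ w) (by linarith) ε hε]
  · intro ε hε t φ
    apply ne_of_gt
    linarith [low (hH.bound ε (hmem l5 ε hε) t φ 0) (by linarith) ε hε]
  · intro ε hε t φ
    linarith [low (hΔ.bound ε (hmem l6 ε hε) t φ 0) (by linarith) ε hε]

end AveragingSetup

/-- The inverse of a family of increasing changes of a real variable. -/
lemma exists_inverse_of_fiberwise {h h₁ h₂ : ℝ → ℝ → ℝ}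
    (d₁ : ∀ t ψ, HasDerivAt (fun s => h s ψ) (h₁ t ψ) t) (d₂ : ∀ t ψ, HasDerivAt (h t) (h₂ t ψ) ψ)
    (c₁ : Continuous fun p : Plane => h₁ p.1 p.2) (c₂ : Continuous fun p : Plane => h₂ p.1 p.2)
    (hpos : ∀ t ψ, 0 < h₂ t ψ) {M : ℝ} (hM : ∀ t ψ, |h t ψ - ψ| ≤ M) :
    ∃ g : ℝ → ℝ → ℝ, ContDiff ℝ 1 (fun p : Plane => g p.1 p.2) ∧ (∀ t φ, h t (g t φ) = φ) ∧
      ∀ t ψ, g t (h t ψ) = ψ := by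
  have hmono : ∀ t, StrictMono (h t) := fun t =>
    strictMono_of_hasDerivAt_pos (d₂ t) (hpos t)
  have hsurj : ∀ t, Function.Surjective (h t) := by
    intro t
    refine (continuous_iff_continuousAt.2 fun ψ => (d₂ t ψ).continuousAt).surjective ?_ ?_
    · refine tendsto_atTop_mono (f := fun ψ => ψ - M) (fun ψ => ?_) (tendsto_atTop_add_const_right _ _ tendsto_id)
      have := (abs_le.1 (hM t ψ)).1
      linarith
    · refine tendsto_atBot_mono (f := fun ψ => ψ + M) (fun ψ => ?_) (tendsto_atBot_add_const_right _ _ tendsto_id)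
      have := (abs_le.1 (hM t ψ)).2
      linarith
  choose g hg using hsurj
  have hg' : ∀ t ψ, g t (h t ψ) = ψ := fun t ψ => (hmono t).injective (hg t _)
  refine ⟨g, ?_, hg, hg'⟩
  let e : Plane ≃ Plane := ⟨fun p => (p.1, h p.1 p.2), fun p => (p.1, g p.1 p.2),
    fun p => by simp [hg'], fun p => by simp [hg]⟩
  let eq : ∀ p : Plane, (Plane) ≃L[ℝ] Plane := fun p => ContinuousLinearEquiv.equivOfInverse
    ((ContinuousLinearMap.fst ℝ ℝ ℝ).prod (h₁ p.1 p.2 • ContinuousLinearMap.fst ℝ ℝ ℝ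
      + h₂ p.1 p.2 • ContinuousLinearMap.snd ℝ ℝ ℝ))
    ((ContinuousLinearMap.fst ℝ ℝ ℝ).prod ((h₂ p.1 p.2)⁻¹ • (ContinuousLinearMap.snd ℝ ℝ ℝ
      - h₁ p.1 p.2 • ContinuousLinearMap.fst ℝ ℝ ℝ)))
    (fun x => by
      have := (hpos p.1 p.2).ne'
      ext <;> simp [this])
    (fun x => by
      have := (hpos p.1 p.2).ne'
      ext <;> simp [this])
  have hstrict : ∀ p, HasStrictFDerivAt e (eq p : Plane →L[ℝ] Plane) p := by
    intro p
    have := hasStrictFDerivAt_fst.prodMk (hasStrictFDerivAt_of_hasDerivAt d₁ d₂ c₁ c₂ p)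
    refine this.congr_fderiv ?_
    ext <;> simp [eq]
  have hcd : ContDiff ℝ 1 e := contDiff_fst.prodMk (contDiff_one_of_hasDerivAt d₁ d₂ c₁ c₂)
  let H : Plane ≃ₜ Plane := e.toHomeomorphOfContinuousOpen hcd.continuous
    (isOpenMap_of_hasStrictFDerivAt_equiv hstrict)
  have := H.contDiff_symm (fun p => (hstrict p).hasFDerivAt) hcd
  exact contDiff_snd.comp this

namespace AveragingSetup

variable {P : PerturbedSystem} {O : GeneratingOrbit P} {ν : ℕ} {A : Subalgebra ℝ (ℝ → ℝ → ℝ)}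
  {D : AveragingSetup O ν A} {ε₁ N K c : ℝ} {χ : ℝ → ℝ} {Γ Γ₁ Γ₂ : ℝ → ℝ → ℝ → ℝ}

/-! ### The invariant surface in polar coordinates -/

namespace IsAveragedTorus

lemma radiusChange_eq (h : D.IsAveragedTorus ε₁ N K c χ Γ Γ₁ Γ₂) {ε : ℝ} (hε : ε ∈ Ioo 0 ε₁)
    (t ψ φ : ℝ) : O.radiusChange ν ε t (Γ ε t ψ * ε ^ (1 / 2 : ℝ)) φ = ε * D.sf χ ε t φ (Γ ε t ψ) := by
  have hp : (ε : ℝ) ^ (1 / 2 : ℝ) * ε ^ (3 / 2 : ℝ) = ε ^ 2 := by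
    rw [← Real.rpow_add hε.1, ← Real.rpow_natCast]
    norm_num
  simp only [GeneratingOrbit.radiusChange, sf, zf, h.cutoff _ (h.bound ε t ψ), D.eqG, D.eqH, D.eqF, Gf,
    Ff, Hf, mul_assoc (Γ ε t ψ), hp]
  ring

lemma isPolarSolution (h : D.IsAveragedTorus ε₁ N K c χ Γ Γ₁ Γ₂) {ε : ℝ} (hε : ε ∈ Ioo 0 ε₁) {ψ : ℝ → ℝ}
    (hψ : ∀ t, HasDerivAt ψ (ε ^ ν * (1 + ε * D.Θbar + ε ^ 2 * D.Vf χ ε t (ψ t) (Γ ε t (ψ t)))) t ∧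
      HasDerivAt (fun t => Γ ε t (ψ t)) (ε ^ (ν + 1) * (D.L * Γ ε t (ψ t)
        + D.Uf χ ε t (ψ t + ε * D.Δf ε t (ψ t)) (Γ ε t (ψ t)))) t) :
    O.IsPolarSolution ν ε (fun t => ε * D.sf χ ε t (ψ t + ε * D.Δf ε t (ψ t)) (Γ ε t (ψ t)))
      (fun t => ψ t + ε * D.Δf ε t (ψ t)) := by
  intro t
  have hφ := D.hasDerivAt_angle hε.1.ne' (by linarith [h.regular_Δ ε hε t (ψ t)] ) (hψ t).1
  have hz := D.hasDerivAt_zf (Γ := fun t => Γ ε t (ψ t)) (φ := fun t => ψ t + ε * D.Δf ε t (ψ t))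
    (fun s => h.cutoff _ (h.bound _ _ _)) (h.regular_H ε hε t _) hφ (hψ t).2
  obtain ⟨hr1, hmem⟩ := h.radius ε hε t (ψ t + ε * D.Δf ε t (ψ t)) (Γ ε t (ψ t))
  have hm1 := hmem 1 ⟨zero_le_one, le_rfl⟩
  rw [one_mul, one_mul] at hm1
  have hd := P.mem_dom.1 hm1
  refine ⟨hr1, hd.1, hd.2.1, ?_, ?_⟩
  · rw [D.rdot_sf (h.regular_β ε hε t _ _) hmem]
    have hα0 := O.α_ne_zero D.gen (ψ t + ε * D.Δf ε t (ψ t))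
    have hα : HasDerivAt O.α (deriv O.α (ψ t + ε * D.Δf ε t (ψ t))) (ψ t + ε * D.Δf ε t (ψ t)) :=
      ((O.contDiff_α 1).differentiable one_ne_zero _).hasDerivAt
    have h1 := (HasDerivAt.comp t (h := fun s => ψ s + ε * D.Δf ε s (ψ s)) hα hφ).inv hα0
    have h2 := HasDerivAt.comp t (h := fun s => ψ s + ε * D.Δf ε s (ψ s)) (O.β_hasDerivAt D.gen _) hφ
    have h3 := (h1.mul (hz.add ((h2.mul (hz.pow 2)).const_mul ε))).const_mul ε
    refine h3.congr_deriv ?_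
    simp only [Function.comp_apply, Pi.add_apply, Pi.mul_apply, Pi.pow_apply, Pi.inv_apply]
    have hs : D.sf χ ε t (ψ t + ε * D.Δf ε t (ψ t)) (Γ ε t (ψ t)) = (O.α (ψ t + ε * D.Δf ε t (ψ t)))⁻¹ *
      (D.zf χ ε t (ψ t + ε * D.Δf ε t (ψ t)) (Γ ε t (ψ t)) + ε * (O.β (ψ t + ε * D.Δf ε t (ψ t))
        * D.zf χ ε t (ψ t + ε * D.Δf ε t (ψ t)) (Γ ε t (ψ t)) ^ 2)) := rfl
    rw [hs]
    generalize D.zf χ ε t (ψ t + ε * D.Δf ε t (ψ t)) (Γ ε t (ψ t)) = z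
    generalize D.V₂ χ ε t (ψ t + ε * D.Δf ε t (ψ t)) (Γ ε t (ψ t)) = V
    generalize D.N₂ χ ε t (ψ t + ε * D.Δf ε t (ψ t)) (Γ ε t (ψ t)) = N'
    generalize D.Θs χ ε t (ψ t + ε * D.Δf ε t (ψ t)) (Γ ε t (ψ t)) = Θ
    generalize ψ t + ε * D.Δf ε t (ψ t) = θ at *
    push_cast
    rw [div_eq_mul_inv, ← inv_pow]
    ring
  · rw [D.φdot_sf (by linarith [(abs_lt.1 hr1).1]) hmem]
    exact hφ

end IsAveragedTorus

lemma exists_abs_le (D : AveragingSetup O ν A) {v : ℝ → ℝ → ℝ} (hv : v ∈ A) :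
    ∃ K, 0 ≤ K ∧ ∀ t φ, |v t φ| ≤ K :=
  exists_abs_le_of_two_periodic D.isClass.T_pos D.isClass.ω_pos (D.isClass.cont v hv)
    (D.isClass.periodic_t v hv) (D.isClass.periodic_φ v hv)

lemma periodic_function (D : AveragingSetup O ν A) {v : ℝ → ℝ → ℝ} (hv : v ∈ ({D.G₀, D.G₁, D.G₀', D.G₁',
    D.H₀, D.H₁, D.H₀', D.H₁', D.F₀, D.F₁, D.F₀', D.F₁', D.Δ₀, D.Δ₁, D.Δ₀', D.Δ₁',
    D.Θ'} : Set (ℝ → ℝ → ℝ))) (t φ : ℝ) : v (t + P.T) φ = v t φ ∧ v t (φ + O.ω) = v t φ :=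
  ⟨D.isClass.periodic_t v (D.mem_functions v hv) t φ, D.isClass.periodic_φ v (D.mem_functions v hv) t φ⟩

/-- The inverse of the change of the angle. -/
lemma IsAveragedTorus.exists_inverse (h : D.IsAveragedTorus ε₁ N K c χ Γ Γ₁ Γ₂) {ε : ℝ}
    (hε : ε ∈ Ioo 0 ε₁) : ∃ g : ℝ → ℝ → ℝ, ContDiff ℝ 1 (fun p : Plane => g p.1 p.2) ∧
      (∀ t φ, g t φ + ε * D.Δf ε t (g t φ) = φ) ∧ (∀ t ψ, g t (ψ + ε * D.Δf ε t ψ) = ψ) ∧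
      ∀ t φ, g (t + P.T) φ = g t φ ∧ g t (φ + O.ω) = g t φ + O.ω := by
  obtain ⟨M₀, hM₀, b₀⟩ := D.exists_abs_le (v := D.Δ₀) (D.mem_functions _ (by simp))
  obtain ⟨M₁, hM₁, b₁⟩ := D.exists_abs_le (v := D.Δ₁) (D.mem_functions _ (by simp))
  obtain ⟨g, hg, h1, h2⟩ := exists_inverse_of_fiberwise (h := fun t ψ => ψ + ε * D.Δf ε t ψ)
    (fun t ψ => ((D.avgΔ.deriv_t ε t ψ).const_mul ε).const_add ψ)
    (fun t ψ => (hasDerivAt_id ψ).add ((D.avgΔ.deriv_φ ε t ψ).const_mul ε))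
    (continuous_const.mul (D.avgΔ.cont_t ε)) (continuous_const.add (continuous_const.mul (D.avgΔ.cont_φ ε)))
    (fun t ψ => by linarith [h.regular_Δ ε hε t ψ]) (M := ε * (M₀ + M₁ * ε)) (fun t ψ => by
      rw [add_sub_cancel_left, abs_mul, abs_of_pos hε.1]
      refine mul_le_mul_of_nonneg_left ((abs_add_le _ _).trans ?_) hε.1.le
      rw [abs_mul, abs_of_pos hε.1]
      have := mul_le_mul_of_nonneg_right (b₁ t ψ) hε.1.le
      linarith [b₀ t ψ])
  refine ⟨g, hg, h1, h2, fun t φ => ⟨?_, ?_⟩⟩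
  · have e : D.Δf ε (t + P.T) (g t φ) = D.Δf ε t (g t φ) := by
      rw [Δf, Δf, (D.periodic_function (v := D.Δ₀) (by simp) _ _).1,
        (D.periodic_function (v := D.Δ₁) (by simp) _ _).1]
    have := h2 (t + P.T) (g t φ)
    rwa [e, h1] at this
  · have e : D.Δf ε t (g t φ + O.ω) = D.Δf ε t (g t φ) := by
      rw [Δf, Δf, (D.periodic_function (v := D.Δ₀) (by simp) _ _).2,
        (D.periodic_function (v := D.Δ₁) (by simp) _ _).2]
    have := h2 t (g t φ + O.ω)
    rwa [e, add_right_comm, h1] at this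

lemma IsAveragedTorus.continuousOn (h : D.IsAveragedTorus ε₁ N K c χ Γ Γ₁ Γ₂) :
    ContinuousOn (fun w : Space => Γ w.2.2 w.1 w.2.1) (univ ×ˢ univ ×ˢ Ico 0 ε₁) := by
  rintro ⟨t, ψ, ε⟩ ⟨-, -, hε⟩
  rcases hε.1.eq_or_lt with h0 | h0
  · obtain rfl : (0 : ℝ) = ε := h0
    rw [ContinuousWithinAt, h.at_zero, tendsto_iff_norm_sub_tendsto_zero]
    refine squeeze_zero' (g := fun w : Space => |K| * |w.2.2|) (Eventually.of_forall fun _ => norm_nonneg _) ?_ ?_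
    · filter_upwards [self_mem_nhdsWithin] with w hw
      rcases hw.2.2.1.eq_or_lt with h1 | h1
      · rw [← h1, h.at_zero]
        simp
      · rw [Real.norm_eq_abs, abs_of_pos h1]
        refine (h.close w.2.2 ⟨h1, hw.2.2.2⟩ _ _).trans ?_
        exact mul_le_mul_of_nonneg_right (le_abs_self K) h1.le
    · have : Continuous fun w : Space => |K| * |w.2.2| := by fun_prop
      simpa using (this.tendsto (t, ψ, 0)).mono_left nhdsWithin_le_nhds
  · apply ContinuousAt.continuousWithinAt
    have hopen : IsOpen ((univ : Set ℝ) ×ˢ (univ : Set ℝ) ×ˢ Ioo 0 ε₁) :=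
      isOpen_univ.prod (isOpen_univ.prod isOpen_Ioo)
    refine ContinuousOn.continuousAt (s := univ ×ˢ univ ×ˢ Ioo 0 ε₁) ?_
      (hopen.mem_nhds ⟨mem_univ _, mem_univ _, h0, hε.2⟩)
    rw [continuousOn_iff_continuous_domRestrict]
    exact h.cont.comp (f := fun w : ↥((univ : Set ℝ) ×ˢ (univ : Set ℝ) ×ˢ Ioo 0 ε₁) =>
      ((⟨w.1.2.2, w.2.2.2⟩ : Ioo 0 ε₁), w.1.1, w.1.2.1)) (by fun_prop)

lemma IsAveragedTorus.contDiff (h : D.IsAveragedTorus ε₁ N K c χ Γ Γ₁ Γ₂) {ε : ℝ}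
    (hε : ε ∈ Ioo 0 ε₁) : ContDiff ℝ 1 (fun p : Plane => Γ ε p.1 p.2) :=
  contDiff_one_of_hasDerivAt (v := Γ ε) (h.deriv₁ ε hε) (h.deriv₂ ε hε)
    (h.cont₁.comp (by fun_prop : Continuous fun p : Plane => ((⟨ε, hε⟩ : Ioo 0 ε₁), p)))
    (h.cont₂.comp (by fun_prop : Continuous fun p : Plane => ((⟨ε, hε⟩ : Ioo 0 ε₁), p)))

/-- The expansion of the invariant surface in powers of `ε`. -/
lemma IsAveragedTorus.expansion (h : D.IsAveragedTorus ε₁ N K c χ Γ Γ₁ Γ₂) :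
    ∃ K', ∀ ε ∈ Ioo 0 ε₁, ∀ t φ ψ, |ε * D.sf χ ε t φ (Γ ε t ψ) - (O.α φ)⁻¹ * (D.G₀ t φ * ε
      + (D.G₁ t φ + D.F₀ t φ + c + O.β φ * D.G₀ t φ ^ 2) * ε ^ 2)| ≤ K' * ε ^ 3 := by
  obtain ⟨MA, hMA, bA⟩ := D.exists_abs_le D.mem_inv_α
  obtain ⟨MB, hMB, bB⟩ := D.exists_abs_le D.mem_β
  obtain ⟨g0, hg0, bg0⟩ := D.exists_abs_le (v := D.G₀) (D.mem_functions _ (by simp))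
  obtain ⟨g1, hg1, bg1⟩ := D.exists_abs_le (v := D.G₁) (D.mem_functions _ (by simp))
  obtain ⟨f0, hf0, bf0⟩ := D.exists_abs_le (v := D.F₀) (D.mem_functions _ (by simp))
  obtain ⟨f1, hf1, bf1⟩ := D.exists_abs_le (v := D.F₁) (D.mem_functions _ (by simp))
  obtain ⟨h0, hh0, bh0⟩ := D.exists_abs_le (v := D.H₀) (D.mem_functions _ (by simp))
  obtain ⟨h1, hh1, bh1⟩ := D.exists_abs_le (v := D.H₁) (D.mem_functions _ (by simp))
  have hN : 0 ≤ N := (abs_nonneg _).trans (h.bound 0 0 0)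
  let W := g1 + f0 + f1 + N + N * (h0 + h1)
  refine ⟨MA * ((f1 + K + N * (h0 + h1)) + MB * (W * (2 * g0 + W))), fun ε hε t φ ψ => ?_⟩
  have hε0 := hε.1
  have hε1 : ε ≤ 1 := hε.2.le.trans h.le_one
  have hcl := h.close ε hε t ψ
  have hb := h.bound ε t ψ
  have hz : D.zf χ ε t φ (Γ ε t ψ) = D.G₀ t φ + ε * (D.G₁ t φ + D.F₀ t φ + ε * D.F₁ t φ
      + Γ ε t ψ + ε * (Γ ε t ψ * (D.H₀ t φ + ε * D.H₁ t φ))) := by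
    rw [zf, h.cutoff _ hb, Gf, Ff, Hf]
    ring
  rw [sf, hz]
  replace bA := bA t φ
  replace bB := bB t φ
  replace bg0 := bg0 t φ
  replace bg1 := bg1 t φ
  replace bf0 := bf0 t φ
  replace bf1 := bf1 t φ
  replace bh0 := bh0 t φ
  replace bh1 := bh1 t φ
  generalize (O.α φ)⁻¹ = i, O.β φ = b, Γ ε t ψ = g, D.G₀ t φ = G0, D.G₁ t φ = G1, D.F₀ t φ = F0 at *
  generalize D.F₁ t φ = F1, D.H₀ t φ = H0, D.H₁ t φ = H1 at *
  have q1 : |ε * F1| ≤ f1 := by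
    rw [abs_mul, abs_of_pos hε0]
    exact (mul_le_of_le_one_left (abs_nonneg _) hε1).trans bf1
  have q2 : |H0 + ε * H1| ≤ h0 + h1 := by
    refine (abs_add_le _ _).trans (add_le_add bh0 ?_)
    rw [abs_mul, abs_of_pos hε0]
    exact (mul_le_of_le_one_left (abs_nonneg _) hε1).trans bh1
  have q3 : |g * (H0 + ε * H1)| ≤ N * (h0 + h1) := by
    rw [abs_mul]
    exact mul_le_mul hb q2 (abs_nonneg _) hN
  have q4 : |ε * (g * (H0 + ε * H1))| ≤ N * (h0 + h1) := by
    rw [abs_mul ε, abs_of_pos hε0]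
    exact (mul_le_of_le_one_left (abs_nonneg _) hε1).trans q3
  obtain ⟨w, hw⟩ : ∃ w, G1 + F0 + ε * F1 + g + ε * (g * (H0 + ε * H1)) = w := ⟨_, rfl⟩
  have hwW : |w| ≤ W := by
    rw [← hw]
    refine (abs_add_le _ _).trans ?_
    have e1 := abs_add_le (G1 + F0 + ε * F1) g
    have e2 := abs_add_le (G1 + F0) (ε * F1)
    have e3 := abs_add_le G1 F0
    simp only [W]
    linarith
  have hW : 0 ≤ W := (abs_nonneg _).trans hwW
  have q5 : |w * (2 * G0 + ε * w)| ≤ W * (2 * g0 + W) := by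
    rw [abs_mul]
    refine mul_le_mul hwW ?_ (abs_nonneg _) hW
    refine (abs_add_le _ _).trans (add_le_add ?_ ?_)
    · rw [abs_mul, abs_two]
      linarith
    · rw [abs_mul, abs_of_pos hε0]
      exact (mul_le_of_le_one_left (abs_nonneg _) hε1).trans hwW
  have q6 : |ε * F1 + (g - c) + ε * (g * (H0 + ε * H1))| ≤ (f1 + K + N * (h0 + h1)) * ε := by
    have e1 := abs_add_le (ε * F1 + (g - c)) (ε * (g * (H0 + ε * H1)))
    have e2 := abs_add_le (ε * F1) (g - c)
    rw [abs_mul ε, abs_of_pos hε0] at e1 e2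
    have e3 := mul_le_mul_of_nonneg_left bf1 hε0.le
    have e4 := mul_le_mul_of_nonneg_left q3 hε0.le
    linarith
  have e : ε * (i * (G0 + ε * w + ε * (b * (G0 + ε * w) ^ 2)))
      - i * (G0 * ε + (G1 + F0 + c + b * G0 ^ 2) * ε ^ 2)
      = i * (ε ^ 2 * (ε * F1 + (g - c) + ε * (g * (H0 + ε * H1)))
        + b * (ε ^ 3 * (w * (2 * G0 + ε * w)))) := by
    linear_combination (-(i * ε ^ 2)) * hw
  rw [hw, e, abs_mul, mul_assoc]
  refine mul_le_mul bA ?_ (abs_nonneg _) hMA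
  refine (abs_add_le _ _).trans ?_
  rw [abs_mul, abs_mul b, abs_mul (ε ^ 3), abs_of_pos (pow_pos hε0 2), abs_of_pos (pow_pos hε0 3)]
  have e5 := mul_le_mul_of_nonneg_left q6 (pow_pos hε0 2).le
  have e6 := mul_le_mul bB (mul_le_mul_of_nonneg_left q5 (pow_pos hε0 3).le) (by positivity) hMB
  linarith

variable (D) in
theorem exists_invariantSurface :
    ∃ ε₁ : ℝ, 0 < ε₁ ∧ ε₁ ≤ P.ε₀ ∧ ∃ Γ Ω : ℝ → ℝ → ℝ → ℝ, O.IsAveragedFamily ν ε₁ Γ Ω ∧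
      (∀ ε ∈ Ioo 0 ε₁, O.IsC1TwoPeriodic (fun t φ => O.Υ ν Γ Ω t φ ε) ∧
        O.IsInvariantSurface ν ε (fun t φ => O.Υ ν Γ Ω t φ ε)) ∧
      ∃ K : ℝ, ∀ ε ∈ Ioo 0 ε₁, ∀ t φ : ℝ, |O.Υ ν Γ Ω t φ ε - (O.α φ)⁻¹ * (D.G₀ t φ * ε
        + (D.G₁ t φ + D.F₀ t φ + Γ t φ 0 + O.β φ * D.G₀ t φ ^ 2) * ε ^ 2)| ≤ K * ε ^ 3 := by
  obtain ⟨ε₁, N, K, c, χ, Γ, Γ₁, Γ₂, -, h⟩ := D.exists_isAveragedTorus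
  have hinv : ∀ ε, ∃ g : ℝ → ℝ → ℝ, ε ∈ Ioo 0 ε₁ → ContDiff ℝ 1 (fun p : Plane => g p.1 p.2) ∧
      (∀ t φ, g t φ + ε * D.Δf ε t (g t φ) = φ) ∧ (∀ t ψ, g t (ψ + ε * D.Δf ε t ψ) = ψ) ∧
      ∀ t φ, g (t + P.T) φ = g t φ ∧ g t (φ + O.ω) = g t φ + O.ω := by
    intro ε
    by_cases hε : ε ∈ Ioo 0 ε₁
    · obtain ⟨g, hg⟩ := h.exists_inverse hε
      exact ⟨g, fun _ => hg⟩
    · exact ⟨0, fun h => absurd h hε⟩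
  choose g hg using hinv
  let Ω : ℝ → ℝ → ℝ → ℝ := fun t φ ε => (g ε t φ - φ) / ε
  have hΩ : ∀ ε ∈ Ioo 0 ε₁, ∀ t φ, φ + Ω t φ ε * ε = g ε t φ := by
    intro ε hε t φ
    simp only [Ω]
    rw [div_mul_cancel₀ _ hε.1.ne']
    ring
  have hangle : ∀ ε t ψ, O.angleChange ν ε t ψ = ψ + ε * D.Δf ε t ψ := by
    intro ε t ψ
    rw [GeneratingOrbit.angleChange, D.eqΔ, Δf, mul_comm]
  have hΥ : ∀ ε ∈ Ioo 0 ε₁, ∀ t φ, O.Υ ν (fun t ψ ε => Γ ε t ψ) Ω t φ ε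
      = ε * D.sf χ ε t φ (Γ ε t (g ε t φ)) := by
    intro ε hε t φ
    rw [GeneratingOrbit.Υ, GeneratingOrbit.Q, hΩ ε hε, D.eqG, D.eqF, D.eqH, sf, zf,
      h.cutoff _ (h.bound _ _ _), Gf, Ff, Hf]
    ring
  obtain ⟨K', hK'⟩ := h.expansion
  refine ⟨ε₁, h.pos, h.le_half.trans (by linarith [P.ε₀_pos]), fun t ψ ε => Γ ε t ψ, Ω,
    ⟨?_, ?_, h.continuousOn, ?_, ?_⟩, ?_, K', ?_⟩
  · intro ε hε t ψ
    simp only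
    rw [hΩ ε hε, hangle, (hg ε hε).2.2.1]
  · intro ε hε t φ
    simp only
    rw [hΩ ε hε, hangle, (hg ε hε).2.1]
  · intro ε hε
    exact ⟨h.contDiff hε, fun t ψ => (h.periodic ε hε t ψ).1, fun t ψ => (h.periodic ε hε t ψ).2⟩
  · intro ε hε t₀ ψ₀
    obtain ⟨ψ, h0, hψ⟩ := h.invariant ε hε t₀ ψ₀
    refine ⟨ψ, h0, fun t => (hψ t).1.differentiableAt, ?_⟩
    simp only [hangle, h.radiusChange_eq hε]
    exact h.isPolarSolution hε hψ
  · intro ε hε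
    obtain ⟨g1, g2, g3, g4⟩ := hg ε hε
    refine ⟨⟨?_, ?_, ?_⟩, ?_⟩
    · simp only [hΥ ε hε, sf, zf, h.cutoff _ (h.bound _ _ _)]
      have c1 : ContDiff ℝ 1 (fun p : Plane => (O.α p.2)⁻¹) :=
        (O.contDiff_inv_α D.gen 1).comp contDiff_snd
      have c2 : ContDiff ℝ 1 (fun p : Plane => O.β p.2) := (O.contDiff_β D.gen 1).comp contDiff_snd
      have c3 : ContDiff ℝ 1 (fun p : Plane => D.Gf ε p.1 p.2) := D.avgG.contDiff ε
      have c4 : ContDiff ℝ 1 (fun p : Plane => D.Ff ε p.1 p.2) := D.avgF.contDiff ε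
      have c5 : ContDiff ℝ 1 (fun p : Plane => D.Hf ε p.1 p.2) := D.avgH.contDiff ε
      have c6 : ContDiff ℝ 1 (fun p : Plane => Γ ε p.1 (g ε p.1 p.2)) :=
        (h.contDiff hε).comp (contDiff_fst.prodMk g1)
      have cz : ContDiff ℝ 1 (fun p : Plane => D.Gf ε p.1 p.2 + ε * D.Ff ε p.1 p.2
          + ε * Γ ε p.1 (g ε p.1 p.2) * (1 + ε * D.Hf ε p.1 p.2)) :=
        (c3.add (contDiff_const.mul c4)).add
          ((contDiff_const.mul c6).mul (contDiff_const.add (contDiff_const.mul c5)))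
      exact contDiff_const.mul (c1.mul (cz.add (contDiff_const.mul (c2.mul (cz.pow 2)))))
    · intro t φ
      simp only [hΥ ε hε, sf, zf, (g4 t φ).1, Gf, Ff, Hf, (h.periodic ε hε t _).1,
        (D.periodic_function (v := D.G₀) (by simp) t φ).1, (D.periodic_function (v := D.G₁) (by simp) t φ).1,
        (D.periodic_function (v := D.F₀) (by simp) t φ).1, (D.periodic_function (v := D.F₁) (by simp) t φ).1,
        (D.periodic_function (v := D.H₀) (by simp) t φ).1, (D.periodic_function (v := D.H₁) (by simp) t φ).1]
    · intro t φ
      simp only [hΥ ε hε, sf, zf, (g4 t φ).2, Gf, Ff, Hf, (h.periodic ε hε t _).2, O.periodic_α φ,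
        O.periodic_β D.gen φ,
        (D.periodic_function (v := D.G₀) (by simp) t φ).2, (D.periodic_function (v := D.G₁) (by simp) t φ).2,
        (D.periodic_function (v := D.F₀) (by simp) t φ).2, (D.periodic_function (v := D.F₁) (by simp) t φ).2,
        (D.periodic_function (v := D.H₀) (by simp) t φ).2, (D.periodic_function (v := D.H₁) (by simp) t φ).2]
    · intro t₀ φ₀
      obtain ⟨ψ, h0, hψ⟩ := h.invariant ε hε t₀ (g ε t₀ φ₀)
      refine ⟨fun t => ψ t + ε * D.Δf ε t (ψ t), ?_, ?_⟩
      · simp only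
        rw [h0, g2]
      · simp only [hΥ ε hε, g3]
        exact h.isPolarSolution hε hψ
  · intro ε hε t φ
    simp only
    rw [hΥ ε hε, h.at_zero]
    exact hK' ε hε t φ _

end AveragingSetup

/-! ### Two-periodic functions of class `C^n` in the angle -/

/-- `v` is continuous, `T`-periodic in `t` and `ω`-periodic in `φ`. -/
structure IsTwoPeriodic (T ω : ℝ) (v : ℝ → ℝ → ℝ) : Prop where
  cont : Continuous fun p : Plane => v p.1 p.2
  periodic_t : ∀ t φ, v (t + T) φ = v t φ
  periodic_φ : ∀ t φ, v t (φ + ω) = v t φ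

/-- The two-periodic functions with `n` derivatives in `φ`, which are continuous. -/
def IsAngleCn (T ω : ℝ) : ℕ → (ℝ → ℝ → ℝ) → Prop
  | 0, v => IsTwoPeriodic T ω v
  | n + 1, v => IsTwoPeriodic T ω v ∧ ∃ d, IsAngleCn T ω n d ∧ ∀ t φ, HasDerivAt (v t) (d t φ) φ

section Angle

variable {T ω : ℝ} {n : ℕ} {v w : ℝ → ℝ → ℝ}

lemma IsTwoPeriodic.add (hv : IsTwoPeriodic T ω v) (hw : IsTwoPeriodic T ω w) :
    IsTwoPeriodic T ω (v + w) :=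
  ⟨hv.cont.add hw.cont, fun t φ => by simp only [Pi.add_apply, hv.periodic_t, hw.periodic_t],
    fun t φ => by simp only [Pi.add_apply, hv.periodic_φ, hw.periodic_φ]⟩

lemma IsTwoPeriodic.mul (hv : IsTwoPeriodic T ω v) (hw : IsTwoPeriodic T ω w) :
    IsTwoPeriodic T ω (v * w) :=
  ⟨hv.cont.mul hw.cont, fun t φ => by simp only [Pi.mul_apply, hv.periodic_t, hw.periodic_t],
    fun t φ => by simp only [Pi.mul_apply, hv.periodic_φ, hw.periodic_φ]⟩

lemma IsTwoPeriodic.const (c : ℝ) : IsTwoPeriodic T ω (fun _ _ => c) :=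
  ⟨continuous_const, fun _ _ => rfl, fun _ _ => rfl⟩

namespace IsAngleCn

lemma isTwoPeriodic (hv : IsAngleCn T ω n v) : IsTwoPeriodic T ω v := by
  cases n with
  | zero => exact hv
  | succ n => exact hv.1

lemma of_succ (hv : IsAngleCn T ω (n + 1) v) : IsAngleCn T ω n v := by
  induction n generalizing v with
  | zero => exact hv.1
  | succ n ih =>
    obtain ⟨h, d, hd, hvd⟩ := hv
    exact ⟨h, d, ih hd, hvd⟩

lemma add (hv : IsAngleCn T ω n v) (hw : IsAngleCn T ω n w) : IsAngleCn T ω n (v + w) := by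
  induction n generalizing v w with
  | zero => exact IsTwoPeriodic.add hv hw
  | succ n ih =>
    obtain ⟨h, d, hd, hvd⟩ := hv
    obtain ⟨h', d', hd', hvd'⟩ := hw
    exact ⟨h.add h', d + d', ih hd hd', fun t φ => (hvd t φ).add (hvd' t φ)⟩

lemma mul (hv : IsAngleCn T ω n v) (hw : IsAngleCn T ω n w) : IsAngleCn T ω n (v * w) := by
  induction n generalizing v w with
  | zero => exact IsTwoPeriodic.mul hv hw
  | succ n ih =>
    have h1 := hv.of_succ
    have h2 := hw.of_succ
    obtain ⟨h, d, hd, hvd⟩ := hv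
    obtain ⟨h', d', hd', hvd'⟩ := hw
    exact ⟨h.mul h', d * w + v * d', (ih hd h2).add (ih h1 hd'), fun t φ => (hvd t φ).mul (hvd' t φ)⟩

lemma const (c : ℝ) : IsAngleCn T ω n (fun _ _ => c) := by
  induction n generalizing c with
  | zero => exact IsTwoPeriodic.const c
  | succ n ih => exact ⟨IsTwoPeriodic.const c, _, ih 0, fun t φ => hasDerivAt_const φ c⟩

lemma of_contDiff {u : ℝ → ℝ} (hu : ContDiff ℝ n u) (hp : Function.Periodic u ω) :
    IsAngleCn T ω n (fun _ φ => u φ) := by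
  have h0 : ∀ {u : ℝ → ℝ}, Continuous u → Function.Periodic u ω → IsTwoPeriodic T ω (fun _ φ => u φ) :=
    fun hc hp => ⟨hc.comp continuous_snd, fun _ _ => rfl, fun _ φ => hp φ⟩
  induction n generalizing u with
  | zero => exact h0 hu.continuous hp
  | succ n ih =>
    have hd : ContDiff ℝ n (deriv u) := by
      have : ContDiff ℝ (n + 1) u := by exact_mod_cast hu
      exact (contDiff_succ_iff_deriv.1 this).2.2
    refine ⟨h0 hu.continuous hp, fun _ φ => deriv u φ, ih hd ?_, fun _ φ =>
      (hu.differentiable (by norm_cast) φ).hasDerivAt⟩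
    intro φ
    have : (fun φ => u (φ + ω)) = u := funext hp
    rw [← deriv_comp_add_const, this]

end IsAngleCn

/-- The algebra of two-periodic functions of class `C^n` in the angle. -/
def angleAlgebra (T ω : ℝ) (n : ℕ) : Subalgebra ℝ (ℝ → ℝ → ℝ) where
  carrier := {v | IsAngleCn T ω n v}
  mul_mem' := IsAngleCn.mul
  add_mem' := IsAngleCn.add
  algebraMap_mem' := IsAngleCn.const

lemma isCoefficientClass_angleAlgebra (hT : 0 < T) (hω : 0 < ω) :
    IsCoefficientClass T ω (angleAlgebra T ω (n + 1)) where
  T_pos := hT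
  ω_pos := hω
  cont v hv := hv.1.cont
  periodic_t v hv := hv.1.periodic_t
  periodic_φ v hv := hv.1.periodic_φ
  deriv v hv := by
    obtain ⟨-, d, hd, hvd⟩ := hv
    exact ⟨d, hd.isTwoPeriodic.cont, hvd⟩

namespace IsAngleCn

lemma integral_period (hv : IsAngleCn T ω n v) :
    IsAngleCn T ω n (fun _ φ => ∫ t in (0 : ℝ)..T, v t φ) := by
  have h0 : ∀ {v : ℝ → ℝ → ℝ}, IsTwoPeriodic T ω v →
      IsTwoPeriodic T ω (fun _ φ => ∫ t in (0 : ℝ)..T, v t φ) := fun hv =>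
    ⟨(continuous_integral_period hv.cont).comp continuous_snd, fun _ _ => rfl,
      fun _ φ => by simp only [hv.periodic_φ]⟩
  induction n generalizing v with
  | zero => exact h0 hv
  | succ n ih =>
    obtain ⟨h, d, hd, hvd⟩ := hv
    exact ⟨h0 h, _, ih hd, fun _ φ => hasDerivAt_integral_of_continuous (F := fun φ t => v t φ)
      (F' := fun φ t => d t φ) (fun φ => h.cont.comp (by fun_prop : Continuous fun t : ℝ => (t, φ)))
      (hd.isTwoPeriodic.cont.comp continuous_swap) (fun φ t => hvd t φ) 0 T φ⟩

lemma primitive_t (hv : IsAngleCn T ω n v) (hmean : ∀ φ, ∫ t in (0 : ℝ)..T, v t φ = 0) :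
    IsAngleCn T ω n (fun t φ => ∫ s in (0 : ℝ)..t, v s φ) := by
  have h0 : ∀ {v : ℝ → ℝ → ℝ}, IsTwoPeriodic T ω v → (∀ φ, ∫ t in (0 : ℝ)..T, v t φ = 0) →
      IsTwoPeriodic T ω (fun t φ => ∫ s in (0 : ℝ)..t, v s φ) := by
    intro v hv hmean
    have hi : ∀ φ a b, IntervalIntegrable (fun s => v s φ) volume a b := fun φ a b =>
      (hv.cont.comp (by fun_prop : Continuous fun t : ℝ => (t, φ))).intervalIntegrable _ _
    refine ⟨?_, fun t φ => ?_, fun t φ => by simp only [hv.periodic_φ]⟩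
    · have := intervalIntegral.continuous_parametric_intervalIntegral_of_continuous (a₀ := 0)
        (f := fun (p : Plane) s => v s p.2) (μ := volume) (s := fun p : Plane => p.1)
        (hv.cont.comp (by fun_prop : Continuous fun p : (Plane) × ℝ => (p.2, p.1.2))) continuous_fst
      exact this
    · have hp : Function.Periodic (fun s => v s φ) T := fun s => hv.periodic_t s φ
      have := hp.intervalIntegral_add_eq t 0
      rw [zero_add, hmean] at this
      rw [← intervalIntegral.integral_add_adjacent_intervals (hi φ 0 t) (hi φ t (t + T)), this, add_zero]
  induction n generalizing v with
  | zero => exact h0 hv hmean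
  | succ n ih =>
    have hI := hv.integral_period
    obtain ⟨h, d, hd, hvd⟩ := hv
    have key : ∀ a b φ, HasDerivAt (fun φ => ∫ t in a..b, v t φ) (∫ t in a..b, d t φ) φ := fun a b φ =>
      hasDerivAt_integral_of_continuous (F := fun φ t => v t φ)
      (F' := fun φ t => d t φ) (fun φ => h.cont.comp (by fun_prop : Continuous fun t : ℝ => (t, φ)))
      (hd.isTwoPeriodic.cont.comp continuous_swap) (fun φ t => hvd t φ) a b φ
    refine ⟨h0 h hmean, _, ih hd fun φ => ?_, fun t φ => key 0 t φ⟩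
    have := key 0 T φ
    simp only [hmean] at this
    exact this.unique (hasDerivAt_const φ 0)

lemma hatPart (hv : IsAngleCn T ω n v) : IsAngleCn T ω n (fun _ φ => hatPart T ω v φ) := by
  have := ((IsAngleCn.const (T := T) (ω := ω) (n := n) (1 / T)).mul hv.integral_period).add
    (IsAngleCn.const (-average T ω v))
  simpa [Pi.add_def, Pi.mul_def, _root_.hatPart, sub_eq_add_neg] using this

lemma tildePart (hv : IsAngleCn T ω n v) : IsAngleCn T ω n (tildePart T ω v) := by
  have := (hv.add (IsAngleCn.const (-average T ω v))).add ((IsAngleCn.const (-1)).mul hv.hatPart)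
  convert this using 1
  funext t φ
  simp [_root_.tildePart, sub_eq_add_neg]

lemma integral_tildePart (hT : 0 < T) (hv : IsAngleCn T ω n v) (φ : ℝ) :
    ∫ t in (0 : ℝ)..T, _root_.tildePart T ω v t φ = 0 := by
  have hi : IntervalIntegrable (fun s => v s φ) volume 0 T :=
    (hv.isTwoPeriodic.cont.comp (by fun_prop : Continuous fun t : ℝ => (t, φ))).intervalIntegrable _ _
  simp only [_root_.tildePart]
  rw [intervalIntegral.integral_sub (hi.sub intervalIntegrable_const) intervalIntegrable_const,
    intervalIntegral.integral_sub hi intervalIntegrable_const]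
  simp only [intervalIntegral.integral_const, smul_eq_mul, _root_.hatPart]
  field_simp
  ring

lemma primitiveT (hv : IsAngleCn T ω n v) (hmean : ∀ φ, ∫ t in (0 : ℝ)..T, v t φ = 0) :
    IsAngleCn T ω n (primitiveT T v) := by
  have h := hv.primitive_t hmean
  have := h.add ((IsAngleCn.const (-(1 / T))).mul h.integral_period)
  convert this using 1
  funext t φ
  simp [_root_.primitiveT, sub_eq_add_neg]

lemma integral_primitiveT (hT : 0 < T) (hv : IsAngleCn T ω n v)
    (hmean : ∀ φ, ∫ t in (0 : ℝ)..T, v t φ = 0) (φ : ℝ) :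
    ∫ t in (0 : ℝ)..T, _root_.primitiveT T v t φ = 0 := by
  have hi : IntervalIntegrable (fun t => ∫ s in (0 : ℝ)..t, v s φ) volume 0 T :=
    ((hv.primitive_t hmean).isTwoPeriodic.cont.comp
      (by fun_prop : Continuous fun t : ℝ => (t, φ))).intervalIntegrable _ _
  simp only [_root_.primitiveT]
  rw [intervalIntegral.integral_sub hi intervalIntegrable_const]
  simp only [intervalIntegral.integral_const, smul_eq_mul]
  field_simp
  ring

lemma integral_hatPart (hT : 0 < T) (hω : 0 < ω) (hv : IsAngleCn T ω n v) :
    ∫ φ in (0 : ℝ)..ω, _root_.hatPart T ω v φ = 0 := by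
  have hc := continuous_integral_period (T := T) hv.isTwoPeriodic.cont
  simp only [_root_.hatPart]
  rw [intervalIntegral.integral_sub ((hc.intervalIntegrable _ _).const_mul _) intervalIntegrable_const,
    intervalIntegral.integral_const_mul]
  simp only [intervalIntegral.integral_const, smul_eq_mul, _root_.average]
  field_simp
  ring

lemma continuous_hatPart (hv : IsAngleCn T ω n v) : Continuous (_root_.hatPart T ω v) :=
  hv.hatPart.isTwoPeriodic.cont.comp (by fun_prop : Continuous fun φ : ℝ => ((0 : ℝ), φ))

lemma hasDerivAt_primitiveφ {u : ℝ → ℝ} (hu : Continuous u) (φ : ℝ) :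
    HasDerivAt (primitiveφ ω u) (u φ) φ :=
  (intervalIntegral.integral_hasDerivAt_right (hu.intervalIntegrable _ _)
    (hu.stronglyMeasurableAtFilter _ _) hu.continuousAt).sub_const _

lemma primitiveφ (hT : 0 < T) (hω : 0 < ω) (hv : IsAngleCn T ω n v) :
    IsAngleCn T ω (n + 1) (fun _ φ => primitiveφ ω (_root_.hatPart T ω v) φ) := by
  have hc := hv.continuous_hatPart
  have hd := fun φ => hasDerivAt_primitiveφ (ω := ω) hc φ
  refine ⟨⟨(continuous_iff_continuousAt.2 fun φ => (hd φ).continuousAt).comp continuous_snd,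
    fun _ _ => rfl, fun _ φ => ?_⟩, _, hv.hatPart, fun _ φ => hd φ⟩
  have hp : Function.Periodic (_root_.hatPart T ω v) ω := fun φ => hv.hatPart.isTwoPeriodic.periodic_φ 0 φ
  have := hp.intervalIntegral_add_eq φ 0
  rw [zero_add, hv.integral_hatPart hT hω] at this
  simp only [_root_.primitiveφ]
  rw [← intervalIntegral.integral_add_adjacent_intervals (hc.intervalIntegrable 0 φ)
    (hc.intervalIntegrable φ (φ + ω)), this, add_zero]

/-- The two parts of the averaging change in the slow case. -/
lemma isAveraging (hT : 0 < T) (c : ℝ) (hv : IsAngleCn T ω (n + 1) v) :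
    IsAngleCn T ω n (fun t φ => deriv (fun θ => _root_.primitiveT T (_root_.tildePart T ω v) t θ) φ) ∧
    (∀ φ, ∫ t in (0 : ℝ)..T,
      deriv (fun θ => _root_.primitiveT T (_root_.tildePart T ω v) t θ) φ = 0) ∧
    IsAveraging 1 (fun t φ => v t φ - average T ω v)
      (fun _ φ => c + _root_.primitiveφ ω (_root_.hatPart T ω v) φ)
      (_root_.primitiveT T (_root_.tildePart T ω v)) (fun _ φ => _root_.hatPart T ω v φ)
      (fun t φ => deriv (fun θ => _root_.primitiveT T (_root_.tildePart T ω v) t θ) φ) := by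
  have hm := hv.integral_tildePart hT
  have hpr := hv.tildePart.primitiveT hm
  have hI := hv.tildePart.integral_primitiveT hT hm
  have hpr' := hpr
  obtain ⟨h, d, hd, hvd⟩ := hpr
  obtain rfl : d = fun t φ => deriv (fun θ => _root_.primitiveT T (_root_.tildePart T ω v) t θ) φ :=
    funext fun t => funext fun φ => (hvd t φ).deriv.symm
  refine ⟨hd, fun φ => ?_, ⟨hv.isTwoPeriodic.cont.sub continuous_const, hv.hatPart.isTwoPeriodic.cont,
    hd.isTwoPeriodic.cont, fun t φ => (hasDerivAt_primitiveφ hv.continuous_hatPart φ).const_add c, hvd,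
    fun ε t φ => ?_⟩⟩
  · have := hasDerivAt_integral_of_continuous (F := fun φ t => _root_.primitiveT T (_root_.tildePart T ω v) t φ)
      (F' := fun φ t => deriv (fun θ => _root_.primitiveT T (_root_.tildePart T ω v) t θ) φ)
      (fun φ => h.cont.comp (by fun_prop : Continuous fun t : ℝ => (t, φ)))
      (hd.isTwoPeriodic.cont.comp continuous_swap) (fun φ t => hvd t φ) 0 T φ
    simp only [hI] at this
    exact this.unique (hasDerivAt_const φ 0)
  · have hc : Continuous fun s => _root_.tildePart T ω v s φ :=
      hv.tildePart.isTwoPeriodic.cont.comp (by fun_prop : Continuous fun t : ℝ => (t, φ))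
    have h1 : HasDerivAt (fun s => _root_.primitiveT T (_root_.tildePart T ω v) s φ)
        (_root_.tildePart T ω v t φ) t :=
      (intervalIntegral.integral_hasDerivAt_right (hc.intervalIntegrable _ _)
        (hc.stronglyMeasurableAtFilter _ _) hc.continuousAt).sub_const _
    refine ((h1.mul_const ε).const_add _).congr_deriv ?_
    rw [_root_.tildePart]
    ring

end IsAngleCn

end Angle

namespace GeneratingOrbit

variable {P : PerturbedSystem} (O : GeneratingOrbit P)

/-! ### The averaging functions in the case `ν = 1` -/

lemma isAngleCn_onOrbit (hG : O.GeneratingCondition) {n : ℕ} {f : ℝ → Space → ℝ}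
    (hf : IsPeriodicCn n P.T P.dom f) : IsAngleCn P.T O.ω n (O.onOrbit f) := by
  have h0 : ∀ {n : ℕ} {f : ℝ → Space → ℝ}, IsPeriodicCn n P.T P.dom f →
      IsTwoPeriodic P.T O.ω (O.onOrbit f) := by
    intro n f hf
    refine ⟨?_, fun t φ => hf.periodic t _ (O.orbit_mem_dom hG φ), fun t φ => ?_⟩
    · refine hf.continuousOn_uncurry.comp_continuous
        (f := fun p : Plane => (p.1, O.C p.2, O.S p.2, (0 : ℝ))) ?_
        (fun p => ⟨mem_univ _, O.orbit_mem_dom hG p.2⟩)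
      exact continuous_fst.prodMk ((O.continuous_C.comp continuous_snd).prodMk
        ((O.continuous_S.comp continuous_snd).prodMk continuous_const))
    · rw [onOrbit, onOrbit, O.C_periodic, O.S_periodic]
  induction n generalizing f with
  | zero => exact h0 hf
  | succ n ih =>
    have hC : IsAngleCn P.T O.ω n (fun _ φ => deriv O.C φ) :=
      IsAngleCn.of_contDiff (O.contDiff_deriv_C n) O.periodic_deriv_C
    have hS : IsAngleCn P.T O.ω n (fun _ φ => deriv O.S φ) :=
      IsAngleCn.of_contDiff (O.contDiff_deriv_S n) O.periodic_deriv_S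
    refine ⟨h0 hf, _, ((ih (hf.partialDeriv P.uniqueDiffOn_dom (1, 0, 0))).mul hC).add
      ((ih (hf.partialDeriv P.uniqueDiffOn_dom (0, 1, 0))).mul hS), fun t φ => ?_⟩
    refine (hf.hasDerivAt_comp t (O.differentiable_C φ).hasDerivAt (O.differentiable_S φ).hasDerivAt
      (hasDerivAt_const φ (0 : ℝ)) (Eventually.of_forall fun θ => O.orbit_mem_dom hG θ)).congr_deriv ?_
    simp [onOrbit]

section

variable {n : ℕ}

lemma angle_C : (fun _ φ => O.C φ) ∈ angleAlgebra P.T O.ω n :=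
  IsAngleCn.of_contDiff (O.contDiff_C_S n).1 O.C_periodic

lemma angle_S : (fun _ φ => O.S φ) ∈ angleAlgebra P.T O.ω n :=
  IsAngleCn.of_contDiff (O.contDiff_C_S n).2 O.S_periodic

lemma angle_deriv_C : (fun _ φ => deriv O.C φ) ∈ angleAlgebra P.T O.ω n :=
  IsAngleCn.of_contDiff (O.contDiff_deriv_C n) O.periodic_deriv_C

lemma angle_deriv_S : (fun _ φ => deriv O.S φ) ∈ angleAlgebra P.T O.ω n :=
  IsAngleCn.of_contDiff (O.contDiff_deriv_S n) O.periodic_deriv_S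

lemma angle_inv_α (hG : O.GeneratingCondition) : (fun _ φ => (O.α φ)⁻¹) ∈ angleAlgebra P.T O.ω n :=
  IsAngleCn.of_contDiff (O.contDiff_inv_α hG n) fun φ => by rw [O.periodic_α]

lemma angle_β (hG : O.GeneratingCondition) : (fun _ φ => O.β φ) ∈ angleAlgebra P.T O.ω n :=
  IsAngleCn.of_contDiff (O.contDiff_β hG n) (O.periodic_β hG)

lemma angle_onOrbit_partialDeriv (hG : O.GeneratingCondition) {f : ℝ → Space → ℝ}
    (hf : IsPeriodicCn (n + 1) P.T P.dom f) (u : Space) :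
    O.onOrbit (partialDeriv P.dom u f) ∈ angleAlgebra P.T O.ω n :=
  O.isAngleCn_onOrbit hG (hf.partialDeriv P.uniqueDiffOn_dom u)

end

lemma angle_Ro (hG : O.GeneratingCondition) : O.Ro ∈ angleAlgebra P.T O.ω 3 := by
  rw [show O.Ro = (fun _ φ => deriv O.C φ) * O.onOrbit P.YY
    - (fun _ φ => deriv O.S φ) * O.onOrbit P.XX from funext fun t => funext fun φ => O.Ro_eq t φ]
  exact sub_mem (mul_mem O.angle_deriv_C (O.isAngleCn_onOrbit hG P.isPeriodicCn_YY))
    (mul_mem O.angle_deriv_S (O.isAngleCn_onOrbit hG P.isPeriodicCn_XX))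

lemma isFieldClass_angleAlgebra (hG : O.GeneratingCondition) {n : ℕ}
    (hf : ∀ f ∈ ({P.XX, P.YY} : Set (ℝ → Space → ℝ)), IsPeriodicCn (n + 2) P.T P.dom f) :
    IsFieldClass O (angleAlgebra P.T O.ω (n + 1)) where
  gen := hG
  isClass := isCoefficientClass_angleAlgebra P.T_pos O.ω_pos
  mem_orbit v hv := by
    simp only [mem_insert_iff, mem_singleton_iff] at hv
    rcases hv with rfl | rfl | rfl | rfl
    exacts [O.angle_C, O.angle_S, O.angle_inv_α hG, O.angle_β hG]
  mem_field f h := (O.isAngleCn_onOrbit hG (hf f h)).of_succ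
  mem_field' f h _ := O.angle_onOrbit_partialDeriv hG (hf f h) _

/-- The averaging functions of the case `ν = 1`. -/
lemma exists_averagingSetup_one (h : O.Admissible1) :
    ∃ D : AveragingSetup O 1 (angleAlgebra P.T O.ω 1),
      D.G₀ = (fun _ φ => O.gBar1 + O.gHat1 φ) ∧ D.G₁ = O.gTilde1 ∧ D.F₀ = fun _ φ => O.fHat1 φ := by
  obtain ⟨hG, hL⟩ := h
  have hT := P.T_pos
  have hω := O.ω_pos
  have c := fun {n : ℕ} (x : ℝ) => (IsAngleCn.const (n := n) x : (fun _ _ => x) ∈ angleAlgebra P.T O.ω n)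
  have hRo := O.angle_Ro hG
  have hC3 : ∀ f ∈ ({P.XX, P.YY} : Set (ℝ → Space → ℝ)), IsPeriodicCn 3 P.T P.dom f := by
    rintro f (rfl | rfl)
    exacts [P.isPeriodicCn_XX, P.isPeriodicCn_YY]
  have hFC := O.isFieldClass_angleAlgebra hG (n := 1) hC3
  have hΦ := hFC.mem_Φo
  have hZ := hFC.mem_Z
  have hRε := hFC.mem_RεO
  have hq := hFC.mem_q
  have hRH3 : (fun _ φ => O.RHat φ) ∈ angleAlgebra P.T O.ω 3 := IsAngleCn.hatPart hRo
  have hRH : (fun _ φ => O.RHat φ) ∈ angleAlgebra P.T O.ω 2 := IsAngleCn.of_succ hRH3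
  have hgH : (fun _ φ => O.gHat1 φ) ∈ angleAlgebra P.T O.ω 2 :=
    (IsAngleCn.primitiveφ hT hω hRo).of_succ.of_succ
  have hG0 : (fun _ φ => O.gBar1 + O.gHat1 φ) ∈ angleAlgebra P.T O.ω 2 := add_mem (c O.gBar1) hgH
  obtain ⟨hG1', hG1m, avgG⟩ := IsAngleCn.isAveraging hT O.gBar1 hRo
  have hG1 : O.gTilde1 ∈ angleAlgebra P.T O.ω 3 :=
    IsAngleCn.primitiveT (IsAngleCn.tildePart hRo) (IsAngleCn.integral_tildePart hT hRo)
  have hrH : O.rhsH1 ∈ angleAlgebra P.T O.ω 2 := sub_mem hZ (mul_mem hRH hq)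
  obtain ⟨hH1', -, avgH⟩ := IsAngleCn.isAveraging hT 0 hrH
  have hrF : O.rhsF1 ∈ angleAlgebra P.T O.ω 2 :=
    sub_mem (sub_mem (add_mem (mul_mem hG0 hZ) hRε) hG1') (mul_mem hRH (add_mem hΦ (mul_mem hG0 hq)))
  obtain ⟨hF1', -, avgF⟩ := IsAngleCn.isAveraging hT 0 hrF
  have hΘ : O.Θ1 ∈ angleAlgebra P.T O.ω 2 := add_mem hΦ (mul_mem hq hG0)
  obtain ⟨hΔ1', -, avgΔ⟩ := IsAngleCn.isAveraging hT 0 hΘ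
  have low : ∀ {v : ℝ → ℝ → ℝ}, v ∈ angleAlgebra P.T O.ω 2 → v ∈ angleAlgebra P.T O.ω 1 :=
    fun h => IsAngleCn.of_succ h
  have low3 : ∀ {v : ℝ → ℝ → ℝ}, v ∈ angleAlgebra P.T O.ω 3 → v ∈ angleAlgebra P.T O.ω 1 :=
    fun h => low (IsAngleCn.of_succ h)
  have cont : ∀ {n : ℕ} {v : ℝ → ℝ → ℝ}, v ∈ angleAlgebra P.T O.ω n →
      Continuous fun p : Plane => v p.1 p.2 := fun h => (IsAngleCn.isTwoPeriodic h).cont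
  have eL : average P.T O.ω O.rhsH1 = O.L1 :=
    average_sub (cont hZ) (w := fun _ φ => O.RHat φ * O.q φ) (cont (mul_mem hRH hq))
  have eF : average P.T O.ω O.rhsF1 = 0 := by
    have e1 : O.rhsF1 = fun t φ => ((O.gBar1 * O.rhsH1 t φ + O.gHat1 φ * (O.Z t φ - O.RHat φ * O.q φ))
        + O.RεO t φ) - deriv (fun θ => O.gTilde1 t θ) φ - O.RHat φ * O.Φo t φ := by
      funext t φ
      simp only [rhsF1, rhsH1]
      ring
    have e2 : average P.T O.ω (fun t φ => deriv (fun θ => O.gTilde1 t θ) φ) = 0 := by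
      have : ∀ φ, ∫ t in (0 : ℝ)..P.T, deriv (fun θ => O.gTilde1 t θ) φ = 0 := hG1m
      simp only [_root_.average, this, intervalIntegral.integral_zero, mul_zero]
    have e3 := average_combination (T := P.T) (ω := O.ω) (a := fun t φ => O.gBar1 * O.rhsH1 t φ)
      (b := fun t φ => O.gHat1 φ * (O.Z t φ - O.RHat φ * O.q φ)) (r := O.RεO)
      (g := fun t φ => deriv (fun θ => O.gTilde1 t θ) φ) (f := fun t φ => O.RHat φ * O.Φo t φ)
      (cont (mul_mem (c (n := 2) O.gBar1) hrH)) (cont (mul_mem hgH (sub_mem hZ (mul_mem hRH hq))))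
      (cont hRε) hG1'.isTwoPeriodic.cont (cont (mul_mem hRH hΦ))
    rw [e1, e3, average_const_mul, eL, e2]
    have : O.gBar1 * O.L1 = O.avg (fun t φ => O.RHat φ * O.Φo t φ) - O.avg O.RεO
        - O.avg (fun t φ => O.gHat1 φ * (O.Z t φ - O.RHat φ * O.q φ)) := div_mul_cancel₀ _ hL
    rw [this, avg, avg, avg]
    ring
  obtain ⟨-, Θ', hΘ', hΘd⟩ := hΘ
  refine ⟨{ toIsFieldClass := O.isFieldClass_angleAlgebra hG (n := 0) fun f h => (hC3 f h).of_succ,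
            L := O.L1, Θbar := average P.T O.ω O.Θ1, G₀ := fun _ φ => O.gBar1 + O.gHat1 φ, G₁ := O.gTilde1,
            G₀' := fun _ φ => O.RHat φ, G₁' := fun t φ => deriv (fun θ => O.gTilde1 t θ) φ,
            H₀ := fun _ φ => O.hHat1 φ, H₁ := O.hTilde1,
            H₀' := fun _ φ => O.hat O.rhsH1 φ, H₁' := fun t φ => deriv (fun θ => O.hTilde1 t θ) φ,
            F₀ := fun _ φ => O.fHat1 φ, F₁ := O.fTilde1,
            F₀' := fun _ φ => O.hat O.rhsF1 φ, F₁' := fun t φ => deriv (fun θ => O.fTilde1 t θ) φ,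
            Δ₀ := fun _ φ => O.δHat1 φ, Δ₁ := O.δTilde1,
            Δ₀' := fun _ φ => O.hat O.Θ1 φ, Δ₁' := fun t φ => deriv (fun θ => O.δTilde1 t θ) φ,
            Θ' := Θ', L_ne := hL, mem_functions := ?_, mem_field'' := ?_,
            avgG := ?_, avgH := ?_, avgF := ?_, avgΔ := ?_, deriv_Θ := hΘd,
            eqG := fun t φ ε => rfl, eqH := fun t φ ε => rfl, eqF := fun t φ ε => rfl,
            eqΔ := fun t φ ε => rfl, corrector := ?_ }, rfl, rfl, rfl⟩
  · intro v hv
    have pT := fun {v : ℝ → ℝ → ℝ} (hv : v ∈ angleAlgebra P.T O.ω 2) =>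
      (IsAngleCn.primitiveT (IsAngleCn.tildePart hv) (IsAngleCn.integral_tildePart hT hv) :
        primitiveT P.T (tildePart P.T O.ω v) ∈ angleAlgebra P.T O.ω 2)
    have pφ := fun {v : ℝ → ℝ → ℝ} (hv : v ∈ angleAlgebra P.T O.ω 2) =>
      ((IsAngleCn.primitiveφ hT hω hv).of_succ :
        (fun _ φ => primitiveφ O.ω (hatPart P.T O.ω v) φ) ∈ angleAlgebra P.T O.ω 2)
    have hΘ2 : O.Θ1 ∈ angleAlgebra P.T O.ω 2 := add_mem hΦ (mul_mem hq hG0)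
    simp only [mem_insert_iff, mem_singleton_iff] at hv
    rcases hv with rfl | rfl | rfl | rfl | rfl | rfl | rfl | rfl | rfl | rfl | rfl | rfl | rfl | rfl |
      rfl | rfl | rfl
    exacts [low hG0, low3 hG1, low hRH, low hG1', low (pφ hrH), low (pT hrH), low (IsAngleCn.hatPart hrH),
      hH1', low (pφ hrF), low (pT hrF), low (IsAngleCn.hatPart hrF), hF1', low (pφ hΘ2), low (pT hΘ2),
      low (IsAngleCn.hatPart hΘ2), hΔ1', hΘ']
  · exact fun f h i j => O.angle_onOrbit_partialDeriv hG ((hC3 f h).partialDeriv P.uniqueDiffOn_dom _) _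
  · have e : average P.T O.ω O.Ro = 0 := hG.1
    simp only [e, sub_zero] at avgG
    exact avgG
  · simp only [eL, zero_add] at avgH
    exact avgH
  · simp only [eF, zero_add, sub_zero] at avgF
    exact avgF
  · simp only [zero_add] at avgΔ
    exact avgΔ
  · intro v hv hav
    obtain ⟨h1, -, h2⟩ := IsAngleCn.isAveraging hT 0 hv
    simp only [hav, sub_zero] at h2
    have bd : ∀ {v : ℝ → ℝ → ℝ}, v ∈ angleAlgebra P.T O.ω 0 → ∃ K, 0 ≤ K ∧ ∀ t φ, |v t φ| ≤ K := fun h =>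
      exists_abs_le_of_two_periodic hT hω h.cont h.periodic_t h.periodic_φ
    obtain ⟨K0, hK0, b0⟩ := bd (add_mem (c 0) (IsAngleCn.primitiveφ hT hω hv).of_succ.of_succ)
    obtain ⟨K1, hK1, b1⟩ := bd (IsAngleCn.primitiveT (IsAngleCn.tildePart hv)
      (IsAngleCn.integral_tildePart hT hv)).of_succ
    obtain ⟨K2, hK2, b2⟩ := bd (IsAngleCn.hatPart hv).of_succ
    obtain ⟨K3, hK3, b3⟩ := bd h1
    exact ⟨_, _, _, _, K0 + K1 + K2 + K3, h2, fun t φ => ⟨(b0 t φ).trans (by linarith),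
      (b1 t φ).trans (by linarith), (b2 t φ).trans (by linarith), (b3 t φ).trans (by linarith)⟩⟩

theorem exists_invariantSurface_one (h : O.Admissible1) :
    ∃ ε₁ : ℝ, 0 < ε₁ ∧ ε₁ ≤ P.ε₀ ∧ ∃ Γ Ω : ℝ → ℝ → ℝ → ℝ,
      O.IsAveragedFamily 1 ε₁ Γ Ω ∧
      (∀ ε ∈ Set.Ioo 0 ε₁, O.IsC1TwoPeriodic (fun t φ => O.Υ 1 Γ Ω t φ ε) ∧
        O.IsInvariantSurface 1 ε (fun t φ => O.Υ 1 Γ Ω t φ ε)) ∧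
      ∃ K : ℝ, ∀ ε ∈ Set.Ioo 0 ε₁, ∀ t φ : ℝ,
        |O.Υ 1 Γ Ω t φ ε - (O.α φ)⁻¹ * ((O.gBar1 + O.gHat1 φ) * ε +
          (O.gTilde1 t φ + O.fHat1 φ + Γ t φ 0 + O.β φ * (O.gBar1 + O.gHat1 φ) ^ 2) * ε ^ 2)|
          ≤ K * ε ^ 3 := by
  obtain ⟨D, h1, h2, h3⟩ := O.exists_averagingSetup_one h
  have := D.exists_invariantSurface
  rwa [h1, h2, h3] at this

end GeneratingOrbit

/-! ### Holomorphic extensions to discs -/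

/-- Near `a` the function `u` extends to a holomorphic function, bounded by `B`, on the disc of
radius `δ`. -/
def ExtendsToDisc (δ B : ℝ) (u : ℝ → ℝ) (a : ℝ) : Prop :=
  ∃ F : ℂ → ℂ, DifferentiableOn ℂ F (Metric.ball a δ) ∧ (∀ z ∈ Metric.ball (a : ℂ) δ, ‖F z‖ ≤ B) ∧
    ∀ x : ℝ, (x : ℂ) ∈ Metric.ball (a : ℂ) δ → F x = u x

lemma Complex.norm_dslope_le {g : ℂ → ℂ} {c z : ℂ} {δ B : ℝ} (hg : DifferentiableOn ℂ g (Metric.ball c δ))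
    (hB : ∀ z ∈ Metric.ball c δ, ‖g z‖ ≤ B) (hz : z ∈ Metric.ball c δ) :
    ‖dslope g c z‖ ≤ (2 * B + 1) / δ := by
  have hδ : 0 < δ := dist_nonneg.trans_lt hz
  refine Complex.norm_dslope_le_div_of_mapsTo_ball hg (fun w hw => ?_) hz
  rw [Metric.mem_closedBall, dist_eq_norm]
  have h1 := hB w hw
  have h2 := hB c (Metric.mem_ball_self hδ)
  exact (norm_sub_le _ _).trans (by linarith)

/-- The first-order Taylor formula for bounded holomorphic functions. -/
lemma Complex.norm_sub_sub_mul_deriv_le {g : ℂ → ℂ} {c z : ℂ} {δ B : ℝ}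
    (hg : DifferentiableOn ℂ g (Metric.ball c δ)) (hB : ∀ z ∈ Metric.ball c δ, ‖g z‖ ≤ B)
    (hz : z ∈ Metric.ball c δ) :
    ‖g z - g c - (z - c) * deriv g c‖ ≤ (2 * ((2 * B + 1) / δ) + 1) / δ * ‖z - c‖ ^ 2 := by
  have hδ : 0 < δ := dist_nonneg.trans_lt hz
  have h1 : DifferentiableOn ℂ (dslope g c) (Metric.ball c δ) :=
    (Complex.differentiableOn_dslope (Metric.ball_mem_nhds c hδ)).2 hg
  have h2 := Complex.norm_dslope_le h1 (fun w hw => Complex.norm_dslope_le hg hB hw) hz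
  have e1 := sub_smul_dslope g c z
  have e2 := sub_smul_dslope (dslope g c) c z
  rw [smul_eq_mul] at e1 e2
  rw [dslope_same] at e2
  have : g z - g c - (z - c) * deriv g c = (z - c) ^ 2 * dslope (dslope g c) c z := by
    rw [← e1]
    linear_combination (-(z - c)) * e2
  rw [this, norm_mul, norm_pow, mul_comm]
  gcongr

lemma Complex.norm_deriv_le_of_ball {g : ℂ → ℂ} {c : ℂ} {δ B : ℝ} (hδ : 0 < δ)
    (hg : DifferentiableOn ℂ g (Metric.ball c δ)) (hB : ∀ z ∈ Metric.ball c δ, ‖g z‖ ≤ B) :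
    ‖deriv g c‖ ≤ (2 * B + 1) / δ := by
  rw [← dslope_same]
  exact Complex.norm_dslope_le hg hB (Metric.mem_ball_self hδ)

lemma Complex.ofReal_mem_ball {a x δ : ℝ} : (x : ℂ) ∈ Metric.ball (a : ℂ) δ ↔ |x - a| < δ := by
  rw [Metric.mem_ball, Complex.dist_eq, ← Complex.ofReal_sub, Complex.norm_real, Real.norm_eq_abs]

namespace ExtendsToDisc

variable {δ B δ' B' a : ℝ} {u w : ℝ → ℝ}

lemma mono (h : ExtendsToDisc δ B u a) (hδ : δ' ≤ δ) (hB : B ≤ B') : ExtendsToDisc δ' B' u a := by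
  obtain ⟨F, h1, h2, h3⟩ := h
  have hs := Metric.ball_subset_ball (x := (a : ℂ)) hδ
  exact ⟨F, h1.mono hs, fun z hz => (h2 z (hs hz)).trans hB, fun x hx => h3 x (hs hx)⟩

lemma add (h : ExtendsToDisc δ B u a) (h' : ExtendsToDisc δ B' w a) :
    ExtendsToDisc δ (B + B') (u + w) a := by
  obtain ⟨F, h1, h2, h3⟩ := h
  obtain ⟨F', h1', h2', h3'⟩ := h'
  exact ⟨F + F', h1.add h1', fun z hz => (norm_add_le _ _).trans (add_le_add (h2 z hz) (h2' z hz)),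
    fun x hx => by simp [h3 x hx, h3' x hx]⟩

lemma mul (hB : 0 ≤ B) (h : ExtendsToDisc δ B u a) (h' : ExtendsToDisc δ B' w a) :
    ExtendsToDisc δ (B * B') (u * w) a := by
  obtain ⟨F, h1, h2, h3⟩ := h
  obtain ⟨F', h1', h2', h3'⟩ := h'
  refine ⟨F * F', h1.mul h1', fun z hz => ?_, fun x hx => by simp [h3 x hx, h3' x hx]⟩
  rw [Pi.mul_apply, norm_mul]
  exact mul_le_mul (h2 z hz) (h2' z hz) (norm_nonneg _) hB

lemma inv {c : ℝ} (hδ : 0 < δ) (hB : 0 ≤ B) (hc : 0 < c) (h : ExtendsToDisc δ B u a) (ha : c ≤ |u a|) :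
    ExtendsToDisc (min δ (c / 2 / ((2 * B + 1) / δ))) (c / 2)⁻¹ (fun φ => (u φ)⁻¹) a := by
  obtain ⟨F, h1, h2, h3⟩ := h
  have hs := Metric.ball_subset_ball (x := (a : ℂ)) (min_le_left δ (c / 2 / ((2 * B + 1) / δ)))
  have hK : 0 < (2 * B + 1) / δ := by positivity
  have hF : ∀ z ∈ Metric.ball (a : ℂ) (min δ (c / 2 / ((2 * B + 1) / δ))), c / 2 ≤ ‖F z‖ := by
    intro z hz
    have e := sub_smul_dslope F a z
    have h4 := Complex.norm_dslope_le h1 h2 (hs hz)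
    have h5 : ‖z - a‖ ≤ c / 2 / ((2 * B + 1) / δ) := by
      rw [← dist_eq_norm]
      exact (Metric.mem_ball.1 hz).le.trans (min_le_right _ _)
    have h6 : ‖F z - F a‖ ≤ c / 2 := by
      rw [← e, norm_smul]
      calc _ ≤ c / 2 / ((2 * B + 1) / δ) * ((2 * B + 1) / δ) := by gcongr
        _ = c / 2 := div_mul_cancel₀ _ hK.ne'
    have h7 : c ≤ ‖F a‖ := by
      rw [h3 a (Metric.mem_ball_self hδ), Complex.norm_real]
      exact ha
    have h8 := norm_sub_norm_le (F a) (F a - F z)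
    rw [sub_sub_cancel, norm_sub_rev] at h8
    linarith
  refine ⟨fun z => (F z)⁻¹, (h1.mono hs).inv fun z hz => ?_, fun z hz => ?_, fun x hx => ?_⟩
  · intro h0
    have := hF z hz
    rw [h0, norm_zero] at this
    linarith
  · rw [norm_inv]
    exact inv_anti₀ (by positivity) (hF z hz)
  · simp only [h3 x (hs hx), Complex.ofReal_inv]

lemma hasDerivAt_of_eq {F : ℂ → ℂ} (h1 : DifferentiableOn ℂ F (Metric.ball a δ))
    (h3 : ∀ x : ℝ, (x : ℂ) ∈ Metric.ball (a : ℂ) δ → F x = u x) {x : ℝ}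
    (hx : (x : ℂ) ∈ Metric.ball (a : ℂ) δ) : HasDerivAt u (deriv u x) x ∧ deriv F x = deriv u x := by
  have hF := (h1.differentiableAt (Metric.isOpen_ball.mem_nhds hx)).hasDerivAt
  have hev : ∀ᶠ y : ℝ in 𝓝 x, F y = u y := by
    have : ∀ᶠ y : ℝ in 𝓝 x, (y : ℂ) ∈ Metric.ball (a : ℂ) δ :=
      Complex.continuous_ofReal.continuousAt.eventually (Metric.isOpen_ball.mem_nhds hx)
    exact this.mono h3
  have hu : HasDerivAt u (deriv F x).re x :=
    hF.real_of_complex.congr_of_eventuallyEq (hev.mono fun y hy => by simp [hy])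
  refine ⟨hu.differentiableAt.hasDerivAt, ?_⟩
  exact (hF.comp_ofReal.congr_of_eventuallyEq (hev.mono fun y hy => hy.symm)).unique
    hu.differentiableAt.hasDerivAt.ofReal_comp

lemma hasDerivAt (hδ : 0 < δ) (h : ExtendsToDisc δ B u a) : HasDerivAt u (deriv u a) a := by
  obtain ⟨F, h1, -, h3⟩ := h
  exact (hasDerivAt_of_eq h1 h3 (Metric.mem_ball_self hδ)).1

lemma deriv (hδ : 0 < δ) (h : ExtendsToDisc δ B u a) :
    ExtendsToDisc (δ / 2) ((2 * B + 1) / (δ / 2)) (deriv u) a := by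
  obtain ⟨F, h1, h2, h3⟩ := h
  have hs := Metric.ball_subset_ball (x := (a : ℂ)) (by linarith : δ / 2 ≤ δ)
  refine ⟨_root_.deriv F, (h1.deriv Metric.isOpen_ball).mono hs, fun z hz => ?_, fun x hx =>
    (hasDerivAt_of_eq h1 h3 (hs hx)).2⟩
  have hz' : Metric.ball z (δ / 2) ⊆ Metric.ball (a : ℂ) δ := by
    refine Metric.ball_subset_ball' ?_
    have := Metric.mem_ball.1 hz
    linarith
  exact Complex.norm_deriv_le_of_ball (by linarith) (h1.mono hz') fun w hw => h2 w (hz' hw)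

lemma abs_sub_sub_le (hδ : 0 < δ) (h : ExtendsToDisc δ B u a) {x : ℝ} (hx : |x - a| < δ) :
    |u x - u a - (x - a) * _root_.deriv u a| ≤ (2 * ((2 * B + 1) / δ) + 1) / δ * |x - a| ^ 2 := by
  obtain ⟨F, h1, h2, h3⟩ := h
  have hx' := Complex.ofReal_mem_ball.2 hx
  have ha : (a : ℂ) ∈ Metric.ball (a : ℂ) δ := Metric.mem_ball_self hδ
  have := Complex.norm_sub_sub_mul_deriv_le h1 h2 hx'
  rw [h3 x hx', h3 a ha, (hasDerivAt_of_eq h1 h3 ha).2] at this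
  exact_mod_cast this

lemma abs_iteratedDeriv_le (hδ : 0 < δ) (h : ExtendsToDisc δ B u a) (n : ℕ) :
    |iteratedDeriv n u a| ≤ n.factorial * B / (δ / 2) ^ n := by
  obtain ⟨F, h1, h2, h3⟩ := h
  have key : ∀ n, DifferentiableOn ℂ (iteratedDeriv n F) (Metric.ball a δ) ∧
      ∀ x : ℝ, (x : ℂ) ∈ Metric.ball (a : ℂ) δ → iteratedDeriv n F x = (iteratedDeriv n u x : ℝ) := by
    intro n
    induction n with
    | zero => simpa using ⟨h1, h3⟩
    | succ n ih =>
      rw [iteratedDeriv_succ, iteratedDeriv_succ]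
      exact ⟨ih.1.deriv Metric.isOpen_ball, fun x hx => (hasDerivAt_of_eq ih.1 ih.2 hx).2⟩
  have hs : Metric.closedBall (a : ℂ) (δ / 2) ⊆ Metric.ball (a : ℂ) δ :=
    Metric.closedBall_subset_ball (by linarith)
  have := Complex.norm_iteratedDeriv_le_of_forall_mem_sphere_norm_le (f := F) (c := a) (C := B) n
    (half_pos hδ) ((h1.mono hs).diffContOnCl_ball subset_rfl)
    fun z hz => h2 z (hs (Metric.sphere_subset_closedBall hz))
  rwa [(key n).2 a (Metric.mem_ball_self hδ), Complex.norm_real, Real.norm_eq_abs] at this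

/-- A function whose derivatives grow like those of an analytic function extends to discs. -/
lemma of_bounds {A R : ℝ} (hR : 0 < R) {d : ℕ → ℝ → ℝ} (hd : ∀ n φ, HasDerivAt (d n) (d (n + 1) φ) φ)
    (hb : ∀ n φ, |d n φ| ≤ A * R ^ n * n.factorial) (a : ℝ) :
    ExtendsToDisc (1 / (2 * R)) (2 * A) (d 0) a := by
  have hb' : ∀ n φ, ‖(d n φ / n.factorial : ℂ)‖ ≤ A * R ^ n := by
    intro n φ
    rw [norm_div, Complex.norm_real, Complex.norm_natCast, Real.norm_eq_abs,
      div_le_iff₀ (by positivity)]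
    exact hb n φ
  have hA : 0 ≤ A := by simpa using (abs_nonneg _).trans (hb 0 a)
  have hterm : ∀ n, ∀ z ∈ Metric.ball (a : ℂ) (1 / (2 * R)),
      ‖(d n a / n.factorial : ℂ) * (z - a) ^ n‖ ≤ A * (1 / 2) ^ n := by
    intro n z hz
    have h1 : ‖z - a‖ ≤ 1 / (2 * R) := by
      rw [← dist_eq_norm]
      exact (Metric.mem_ball.1 hz).le
    rw [norm_mul, norm_pow]
    calc _ ≤ A * R ^ n * (1 / (2 * R)) ^ n := by
          gcongr
          exact hb' n a
      _ = A * (1 / 2) ^ n := by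
          rw [mul_assoc, ← mul_pow]
          congr 2
          field_simp
  have hsum : Summable fun n : ℕ => A * (1 / 2 : ℝ) ^ n := summable_geometric_two.mul_left A
  refine ⟨fun z => ∑' n, (d n a / n.factorial : ℂ) * (z - a) ^ n,
    Complex.differentiableOn_tsum_of_summable_norm hsum (fun n => by fun_prop) Metric.isOpen_ball hterm,
    fun z hz => ?_, fun x hx => ?_⟩
  · refine (tsum_of_norm_bounded (hsum.hasSum) fun n => hterm n z hz).trans ?_
    rw [tsum_mul_left, tsum_geometric_two, mul_comm]
  · have hs : Summable fun n => (d n a / n.factorial : ℂ) * ((x : ℂ) - a) ^ n :=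
      .of_norm_bounded hsum fun n => hterm n x hx
    have hiter : ∀ n, iteratedDeriv n (d 0) = d n := by
      intro n
      induction n with
      | zero => simp
      | succ n ih => rw [iteratedDeriv_succ, ih]; exact funext fun φ => (hd n φ).deriv
    have hcd : ∀ n : ℕ, ContDiff ℝ n (d 0) := fun n =>
      contDiff_of_differentiable_iteratedDeriv fun m _ => by
        rw [hiter]; exact fun φ => (hd m φ).differentiableAt
    have hlim : Tendsto (fun n => ∑ k ∈ Finset.range (n + 1), (d k a / k.factorial : ℂ) * ((x : ℂ) - a) ^ k)
        atTop (𝓝 (d 0 x)) := by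
      rw [tendsto_iff_norm_sub_tendsto_zero]
      refine squeeze_zero (g := fun n : ℕ => A * (1 / 2 : ℝ) ^ n) (fun _ => norm_nonneg _) (fun n => ?_)
        hsum.tendsto_atTop_zero
      rcases eq_or_ne a x with rfl | hax
      · rw [Finset.sum_eq_single 0 (fun k _ hk => by simp [hk]) (by simp)]
        simp
        positivity
      obtain ⟨x', hx', h⟩ := taylor_mean_remainder_lagrange_iteratedDeriv (n := n) hax
        ((hcd (n + 1)).contDiffOn)
      have hT : taylorWithinEval (d 0) n (uIcc a x) a x
          = ∑ k ∈ Finset.range (n + 1), d k a / k.factorial * (x - a) ^ k := by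
        rw [taylor_within_apply]
        refine Finset.sum_congr rfl fun k _ => ?_
        rw [iteratedDerivWithin_eq_iteratedDeriv (uniqueDiffOn_uIcc hax)
          ((hcd k).contDiffAt) left_mem_uIcc, hiter, smul_eq_mul]
        ring
      rw [hT, hiter] at h
      have e : (∑ k ∈ Finset.range (n + 1), (d k a / k.factorial : ℂ) * ((x : ℂ) - a) ^ k) - d 0 x
          = ((-(d (n + 1) x' * (x - a) ^ (n + 1) / (n + 1).factorial) : ℝ) : ℂ) := by
        rw [← h]
        push_cast
        ring
      rw [e, Complex.norm_real, norm_neg, Real.norm_eq_abs, abs_div, abs_mul, abs_pow, Nat.abs_cast,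
        div_le_iff₀ (by positivity)]
      have h4 := Complex.ofReal_mem_ball.1 hx
      calc _ ≤ (A * R ^ (n + 1) * (n + 1).factorial) * (1 / (2 * R)) ^ (n + 1) := by
            gcongr
            exact hb _ _
        _ = A * (1 / 2) ^ (n + 1) * (n + 1).factorial := by
            rw [show (1 / 2 : ℝ) = R * (1 / (2 * R)) by field_simp, mul_pow]
            ring
        _ ≤ A * (1 / 2) ^ n * (n + 1).factorial := by
            have : (1 / 2 : ℝ) ^ (n + 1) ≤ (1 / 2) ^ n :=
              pow_le_pow_of_le_one (by norm_num) (by norm_num) (by omega)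
            gcongr
    exact tendsto_nhds_unique ((tendsto_add_atTop_iff_nat 1).2 hs.hasSum.tendsto_sum_nat) hlim

end ExtendsToDisc

/-! ### Two-periodic functions analytic in the angle -/

/-- `v` is continuous, two-periodic, and analytic in `φ` uniformly in `(t, φ)`. -/
def IsAngleAnalytic (T ω : ℝ) (v : ℝ → ℝ → ℝ) : Prop :=
  IsTwoPeriodic T ω v ∧ ∃ δ B : ℝ, 0 < δ ∧ 0 ≤ B ∧ ∀ t a, ExtendsToDisc δ B (v t) a

namespace IsAngleAnalytic

variable {T ω : ℝ} {v w : ℝ → ℝ → ℝ}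

lemma add (hv : IsAngleAnalytic T ω v) (hw : IsAngleAnalytic T ω w) : IsAngleAnalytic T ω (v + w) := by
  obtain ⟨h, δ, B, hδ, hB, hF⟩ := hv
  obtain ⟨h', δ', B', hδ', hB', hF'⟩ := hw
  exact ⟨h.add h', min δ δ', B + B', lt_min hδ hδ', add_nonneg hB hB', fun t a =>
    ((hF t a).mono (min_le_left _ _) le_rfl).add ((hF' t a).mono (min_le_right _ _) le_rfl)⟩

lemma mul (hv : IsAngleAnalytic T ω v) (hw : IsAngleAnalytic T ω w) : IsAngleAnalytic T ω (v * w) := by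
  obtain ⟨h, δ, B, hδ, hB, hF⟩ := hv
  obtain ⟨h', δ', B', hδ', hB', hF'⟩ := hw
  exact ⟨h.mul h', min δ δ', B * B', lt_min hδ hδ', mul_nonneg hB hB', fun t a =>
    ((hF t a).mono (min_le_left _ _) le_rfl).mul hB ((hF' t a).mono (min_le_right _ _) le_rfl)⟩

lemma const (c : ℝ) : IsAngleAnalytic T ω (fun _ _ => c) :=
  ⟨IsTwoPeriodic.const c, 1, |c|, one_pos, abs_nonneg c, fun _ _ => ⟨fun _ => c,
    differentiableOn_const _, fun _ _ => by rw [Complex.norm_real, Real.norm_eq_abs], fun _ _ => rfl⟩⟩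

lemma inv {u : ℝ → ℝ} (hω : 0 < ω) (hu : IsAngleAnalytic T ω (fun _ φ => u φ)) (h0 : ∀ φ, u φ ≠ 0) :
    IsAngleAnalytic T ω (fun _ φ => (u φ)⁻¹) := by
  obtain ⟨h, δ, B, hδ, hB, hF⟩ := hu
  have hc : Continuous u := h.cont.comp (by fun_prop : Continuous fun φ : ℝ => ((0 : ℝ), φ))
  have hp : Function.Periodic u ω := fun φ => h.periodic_φ 0 φ
  have hci : Continuous fun φ => (u φ)⁻¹ := hc.inv₀ h0
  obtain ⟨K, hK⟩ := isCompact_Icc.exists_bound_of_continuousOn (hci.continuousOn (s := Icc 0 ω))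
  have hK' : ∀ φ, |u φ|⁻¹ ≤ max K 1 := by
    intro φ
    obtain ⟨θ, hθ, e⟩ := hp.exists_mem_Ico₀ hω φ
    have := hK θ ⟨hθ.1, hθ.2.le⟩
    rw [e, ← abs_inv]
    exact this.trans (le_max_left _ _)
  have hm : 0 < max K 1 := lt_max_of_lt_right one_pos
  refine ⟨⟨hci.comp continuous_snd, fun _ _ => rfl, fun _ φ => by rw [hp φ]⟩, _, _, ?_, ?_, fun t a =>
    (hF t a).inv (c := (max K 1)⁻¹) hδ hB (inv_pos.2 hm) (inv_le_of_inv_le₀ (abs_pos.2 (h0 a)) (hK' a))⟩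
  · exact lt_min hδ (by positivity)
  · positivity

lemma hasDerivAt (hv : IsAngleAnalytic T ω v) (t φ : ℝ) : HasDerivAt (v t) (deriv (v t) φ) φ := by
  obtain ⟨-, δ, B, hδ, -, hF⟩ := hv
  exact (hF t φ).hasDerivAt hδ

lemma deriv (hv : IsAngleAnalytic T ω v) : IsAngleAnalytic T ω (fun t φ => deriv (v t) φ) := by
  have hd := hv.hasDerivAt
  obtain ⟨h, δ, B, hδ, hB, hF⟩ := hv
  obtain ⟨pt, pφ⟩ := periodic_deriv_of_hasDerivAt h.periodic_t h.periodic_φ hd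
  refine ⟨⟨?_, pt, pφ⟩, δ / 2, _, half_pos hδ, ?_, fun t a => (hF t a).deriv hδ⟩
  swap
  · positivity
  obtain ⟨K, hK⟩ : ∃ K, (2 * ((2 * B + 1) / δ) + 1) / δ = K := ⟨_, rfl⟩
  have hlim : TendstoUniformly (fun (n : ℕ) (p : Plane) =>
      ((n : ℝ) + 1) * (v p.1 (p.2 + 1 / ((n : ℝ) + 1)) - v p.1 p.2))
      (fun p => _root_.deriv (v p.1) p.2) atTop := by
    rw [Metric.tendstoUniformly_iff]
    intro e he
    have h1 : Tendsto (fun n : ℕ => K * (1 / ((n : ℝ) + 1))) atTop (𝓝 0) := by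
      simpa using tendsto_one_div_add_atTop_nhds_zero_nat.const_mul K
    filter_upwards [h1.eventually_lt_const he,
      tendsto_one_div_add_atTop_nhds_zero_nat.eventually_lt_const hδ] with n hn hn' p
    have hpos : (0 : ℝ) < 1 / ((n : ℝ) + 1) := by positivity
    have := (hF p.1 p.2).abs_sub_sub_le hδ (x := p.2 + 1 / ((n : ℝ) + 1)) (by
      rwa [add_sub_cancel_left, abs_of_pos hpos])
    rw [add_sub_cancel_left, abs_of_pos hpos, hK] at this
    rw [dist_comm, Real.dist_eq]
    have e1 : ((n : ℝ) + 1) * (v p.1 (p.2 + 1 / ((n : ℝ) + 1)) - v p.1 p.2) - _root_.deriv (v p.1) p.2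
        = ((n : ℝ) + 1) * (v p.1 (p.2 + 1 / ((n : ℝ) + 1)) - v p.1 p.2
          - 1 / ((n : ℝ) + 1) * _root_.deriv (v p.1) p.2) := by
      field_simp
    rw [e1, abs_mul, abs_of_pos (by positivity : (0 : ℝ) < n + 1)]
    calc _ ≤ ((n : ℝ) + 1) * (K * (1 / ((n : ℝ) + 1)) ^ 2) := by gcongr
      _ = K * (1 / ((n : ℝ) + 1)) := by field_simp
      _ < e := hn
  refine hlim.continuous (Eventually.of_forall fun n => ?_).frequently
  exact continuous_const.mul ((h.cont.comp (by fun_prop : Continuous fun p : Plane =>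
    (p.1, p.2 + 1 / ((n : ℝ) + 1)))).sub h.cont)

/-- The derivatives in the angle, and their bounds. -/
lemma exists_bounds (hv : IsAngleAnalytic T ω v) : ∃ A R : ℝ, 0 ≤ A ∧ 0 < R ∧
    (∀ n, IsTwoPeriodic T ω fun t φ => iteratedDeriv n (v t) φ) ∧
    (∀ n t φ, HasDerivAt (iteratedDeriv n (v t)) (iteratedDeriv (n + 1) (v t) φ) φ) ∧
    ∀ n t φ, |iteratedDeriv n (v t) φ| ≤ A * R ^ n * n.factorial := by
  have key : ∀ n, IsAngleAnalytic T ω fun t φ => iteratedDeriv n (v t) φ := by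
    intro n
    induction n with
    | zero => simpa using hv
    | succ n ih =>
      simp only [iteratedDeriv_succ]
      exact ih.deriv
  obtain ⟨-, δ, B, hδ, hB, hF⟩ := hv
  refine ⟨B, (δ / 2)⁻¹, hB, by positivity, fun n => (key n).1, fun n t φ => ?_, fun n t φ => ?_⟩
  · have := (key n).hasDerivAt t φ
    rwa [iteratedDeriv_succ]
  · refine ((hF t φ).abs_iteratedDeriv_le hδ n).trans_eq ?_
    rw [inv_pow]
    ring

lemma of_bounds {A R : ℝ} (hR : 0 < R) {d : ℕ → ℝ → ℝ → ℝ} (h : IsTwoPeriodic T ω (d 0))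
    (hd : ∀ n t φ, HasDerivAt (d n t) (d (n + 1) t φ) φ)
    (hb : ∀ n t φ, |d n t φ| ≤ A * R ^ n * n.factorial) : IsAngleAnalytic T ω (d 0) := by
  have hA : 0 ≤ A := by simpa using (abs_nonneg _).trans (hb 0 0 0)
  exact ⟨h, 1 / (2 * R), 2 * A, by positivity, by positivity, fun t a =>
    ExtendsToDisc.of_bounds hR (d := fun n => d n t) (fun n φ => hd n t φ) (fun n φ => hb n t φ) a⟩

lemma analyticOnNhd (hv : IsAngleAnalytic T ω v) (t : ℝ) : AnalyticOnNhd ℝ (v t) univ := by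
  obtain ⟨-, δ, B, hδ, -, hF⟩ := hv
  intro a _
  obtain ⟨F, h1, -, h3⟩ := hF t a
  have ha : (a : ℂ) ∈ Metric.ball (a : ℂ) δ := Metric.mem_ball_self hδ
  have h4 : AnalyticAt ℝ F a :=
    (h1.analyticAt (Metric.isOpen_ball.mem_nhds ha)).restrictScalars
  have h5 : AnalyticAt ℝ (fun x : ℝ => (F x).re) a :=
    (Complex.reCLM.analyticAt (F a)).fun_comp (f := fun x : ℝ => F x)
      (h4.fun_comp (Complex.ofRealCLM.analyticAt a))
  refine h5.congr ?_
  have : ∀ᶠ y : ℝ in 𝓝 a, (y : ℂ) ∈ Metric.ball (a : ℂ) δ :=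
    Complex.continuous_ofReal.continuousAt.eventually (Metric.isOpen_ball.mem_nhds ha)
  filter_upwards [this] with y hy
  rw [h3 y hy, Complex.ofReal_re]

end IsAngleAnalytic

/-- The algebra of two-periodic functions analytic in the angle. -/
def analyticAlgebra (T ω : ℝ) : Subalgebra ℝ (ℝ → ℝ → ℝ) where
  carrier := {v | IsAngleAnalytic T ω v}
  mul_mem' := IsAngleAnalytic.mul
  add_mem' := IsAngleAnalytic.add
  algebraMap_mem' := IsAngleAnalytic.const

lemma isCoefficientClass_analyticAlgebra {T ω : ℝ} (hT : 0 < T) (hω : 0 < ω) :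
    IsCoefficientClass T ω (analyticAlgebra T ω) where
  T_pos := hT
  ω_pos := hω
  cont _ hv := hv.1.cont
  periodic_t _ hv := hv.1.periodic_t
  periodic_φ _ hv := hv.1.periodic_φ
  deriv _ hv := ⟨_, hv.deriv.1.cont, hv.hasDerivAt⟩

/-! ### Small divisors -/

/-- The Siegel condition in terms of the divisors `1 - exp (-2πi k T / ω)`. -/
lemma SiegelCondition.exists_le_norm {T ω : ℝ} (hT : 0 < T) (hω : 0 < ω) (h : SiegelCondition T ω) :
    ∃ (c : ℝ) (N : ℕ), 0 < c ∧ ∀ k : ℤ, k ≠ 0 →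
      c ≤ ‖1 - Complex.exp (-(2 * Real.pi * Complex.I * k * T / ω))‖ * |(k : ℝ)| ^ N := by
  obtain ⟨K, τ, hK, hτ, hS⟩ := h
  have hD : 0 < T / ω + 2 := by positivity
  refine ⟨min (T / ω) (K / ω / (T / ω + 2) ^ ⌈τ⌉₊), ⌈τ⌉₊, by positivity, fun k hk => ?_⟩
  have e : ‖1 - Complex.exp (-(2 * Real.pi * Complex.I * k * T / ω))‖
      = 2 * |Real.sin (Real.pi * (k.natAbs * T / ω))| := by
    have h1 : (-(2 * Real.pi * Complex.I * k * T / ω) : ℂ)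
        = Complex.I * ((-(2 * (Real.pi * (k * T / ω))) : ℝ) : ℂ) := by
      push_cast
      ring
    rw [h1, norm_sub_rev, Complex.norm_exp_I_mul_ofReal_sub_one, neg_div,
      mul_div_cancel_left₀ _ (two_ne_zero' ℝ), Real.sin_neg, norm_mul, norm_neg, Real.norm_eq_abs,
      Real.norm_eq_abs, abs_two]
    rcases Int.natAbs_eq k with h2 | h2
    · rw [h2]
      simp
    · rw [h2]
      simp [neg_mul, neg_div, mul_neg]
  have hk' : 0 < k.natAbs := Int.natAbs_pos.2 hk
  have hkabs : |(k : ℝ)| = k.natAbs := by rw [Nat.cast_natAbs, Int.cast_abs]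
  rw [e, hkabs]
  generalize k.natAbs = p at hk'
  have hp1 : (1 : ℝ) ≤ p := by exact_mod_cast hk'
  have hy : 0 < p * T / ω := by positivity
  obtain ⟨q, hq⟩ : ∃ q : ℕ, |p * T / ω - q| ≤ 1 / 2 := by
    refine ⟨(round (p * T / ω)).toNat, ?_⟩
    have h0 : 0 ≤ round (p * T / ω) := by
      rw [round_eq]
      exact Int.floor_nonneg.2 (by positivity)
    have := abs_sub_round (p * T / ω)
    rwa [show (((round (p * T / ω)).toNat : ℕ) : ℝ) = (round (p * T / ω) : ℝ) by
      exact_mod_cast Int.toNat_of_nonneg h0]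
  have hs : |Real.sin (Real.pi * (p * T / ω))| = |Real.sin (Real.pi * (p * T / ω - q))| := by
    rw [mul_sub, mul_comm Real.pi (q : ℝ), Real.sin_sub_nat_mul_pi, abs_mul, abs_pow, abs_neg, abs_one,
      one_pow, one_mul]
  have hs' : 2 * |p * T / ω - q| ≤ |Real.sin (Real.pi * (p * T / ω - q))| := by
    have := Real.mul_abs_le_abs_sin (x := Real.pi * (p * T / ω - q)) (by
      rw [abs_mul, abs_of_pos Real.pi_pos]
      nlinarith [Real.pi_pos])
    rw [abs_mul, abs_of_pos Real.pi_pos] at this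
    refine le_trans (le_of_eq ?_) this
    field_simp
  rw [hs]
  have hpN : (1 : ℝ) ≤ (p : ℝ) ^ ⌈τ⌉₊ := one_le_pow₀ hp1
  have main : min (T / ω) (K / ω / (T / ω + 2) ^ ⌈τ⌉₊) ≤ |p * T / ω - q| * (p : ℝ) ^ ⌈τ⌉₊ := by
    rcases Nat.eq_zero_or_pos q with rfl | hq0
    · refine (min_le_left _ _).trans ?_
      rw [Nat.cast_zero, sub_zero, abs_of_pos hy]
      have : T / ω ≤ p * T / ω := by
        gcongr
        nlinarith
      nlinarith [div_pos hT hω]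
    · refine (min_le_right _ _).trans ?_
      have h1 := (hS p q hk' hq0).le
      have hpq : (1 : ℝ) ≤ p + q := by
        have : (0 : ℝ) ≤ q := Nat.cast_nonneg q
        linarith
      have h2 : ((p : ℝ) + q) ≤ (T / ω + 2) * p := by
        have h3 := (abs_le.1 hq).1
        have : p * T / ω = T / ω * p := by ring
        nlinarith
      have h4 : (((p : ℝ) + q) ^ ⌈τ⌉₊)⁻¹ ≤ ((p : ℝ) + q) ^ (-τ) := by
        rw [Real.rpow_neg (by positivity), ← Real.rpow_natCast]
        exact inv_anti₀ (by positivity) (Real.rpow_le_rpow_of_exponent_le hpq (Nat.le_ceil τ))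
      have h5 : |p * T / ω - q| = |p * T - q * ω| / ω := by
        rw [← abs_of_pos hω, ← abs_div, abs_of_pos hω]
        congr 1
        field_simp
      have h6 : (((T / ω + 2) * p) ^ ⌈τ⌉₊)⁻¹ ≤ (((p : ℝ) + q) ^ ⌈τ⌉₊)⁻¹ := by gcongr
      rw [h5]
      calc K / ω / (T / ω + 2) ^ ⌈τ⌉₊ = K * (((T / ω + 2) * p) ^ ⌈τ⌉₊)⁻¹ / ω * (p : ℝ) ^ ⌈τ⌉₊ := by
            rw [mul_pow]
            field_simp
        _ ≤ |p * T - q * ω| / ω * (p : ℝ) ^ ⌈τ⌉₊ := by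
            gcongr
            exact (mul_le_mul_of_nonneg_left (h6.trans h4) hK.le).trans h1
  refine main.trans (mul_le_mul_of_nonneg_right ?_ (by positivity))
  have := abs_nonneg (p * T / ω - q)
  linarith

/-- The equation `ζ(x) - ζ(x - T) = W(x)` for `ω`-periodic analytic functions. -/
lemma exists_sub_shift_eq {T ω : ℝ} (hT : 0 < T) (hω : 0 < ω) (hS : SiegelCondition T ω) {A R : ℝ}
    (hR : 0 < R) {W : ℕ → ℝ → ℝ} (hd : ∀ n x, HasDerivAt (W n) (W (n + 1) x) x)
    (hp : ∀ n, Function.Periodic (W n) ω) (hb : ∀ n x, |W n x| ≤ A * R ^ n * n.factorial)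
    (hmean : ∫ x in (0 : ℝ)..ω, W 0 x = 0) :
    ∃ (ζ : ℕ → ℝ → ℝ) (A' R' : ℝ), 0 < R' ∧ (∀ n x, HasDerivAt (ζ n) (ζ (n + 1) x) x) ∧
      Function.Periodic (ζ 0) ω ∧ (∀ n x, |ζ n x| ≤ A' * R' ^ n * n.factorial) ∧
      ∀ x, ζ 0 x - ζ 0 (x - T) = W 0 x := by
  have : Fact (0 < ω) := ⟨hω⟩
  obtain ⟨c₀, N, hc₀, hdiv⟩ := hS.exists_le_norm hT hω
  have hA : 0 ≤ A := by simpa using (abs_nonneg _).trans (hb 0 0)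
  have hWc : ∀ n, Continuous (W n) := fun n => continuous_iff_continuousAt.2 fun x => (hd n x).continuousAt
  have hp0 : Function.Periodic (fun x => (W 0 x : ℂ)) ω := fun x => by simp only [hp 0 x]
  have hfc : Continuous (hp0.lift : AddCircle ω → ℂ) :=
    continuous_coinduced_dom.2 (Complex.continuous_ofReal.comp (hWc 0))
  obtain ⟨f, hf⟩ : ∃ f : C(AddCircle ω, ℂ), ∀ x : ℝ, f x = W 0 x := ⟨⟨hp0.lift, hfc⟩, fun x => rfl⟩
  -- the frequencies
  obtain ⟨μ, hμ⟩ : ∃ μ : ℤ → ℂ, ∀ k, μ k = 2 * Real.pi * Complex.I * k / ω := ⟨_, fun _ => rfl⟩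
  have hμω : ∀ k, Complex.exp (μ k * ω) = 1 := fun k => by
    have : (ω : ℂ) ≠ 0 := by exact_mod_cast hω.ne'
    rw [hμ, div_mul_cancel₀ _ this, show (2 * Real.pi * Complex.I * k : ℂ) = k * (2 * Real.pi * Complex.I) by ring]
    exact Complex.exp_int_mul_two_pi_mul_I k
  obtain ⟨κ, hκ, hκ0⟩ : ∃ κ : ℝ, κ = 2 * Real.pi / ω ∧ 0 < κ := ⟨_, rfl, by positivity⟩
  have hμn : ∀ k, ‖μ k‖ = κ * |(k : ℝ)| := fun k => by
    rw [hμ, hκ]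
    simp [abs_of_pos hω, abs_of_pos Real.pi_pos]
    ring
  have hexp : ∀ k (x : ℝ), ‖Complex.exp (μ k * x)‖ = 1 := fun k x => by
    rw [hμ, show (2 * Real.pi * Complex.I * k / ω * x : ℂ) = ((2 * Real.pi * k / ω * x : ℝ) : ℂ) * Complex.I by
      push_cast; ring]
    exact Complex.norm_exp_ofReal_mul_I _
  have hexpd : ∀ k (x : ℝ), HasDerivAt (fun x : ℝ => Complex.exp (μ k * x)) (μ k * Complex.exp (μ k * x)) x :=
    fun k x => by
      have h1 : HasDerivAt (fun z : ℂ => Complex.exp (μ k * z)) (Complex.exp (μ k * x) * (μ k * 1)) x :=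
        ((hasDerivAt_id (x : ℂ)).const_mul (μ k)).cexp
      exact h1.comp_ofReal.congr_deriv (by ring)
  have hμneg : ∀ k, μ (-k) = -μ k := fun k => by rw [hμ, hμ]; push_cast; ring
  -- the Fourier coefficients
  have hcoef : ∀ n k, (μ k) ^ n * fourierCoeff f k
      = (1 / ω : ℝ) • ∫ x in (0 : ℝ)..ω, Complex.exp (μ (-k) * x) * W n x := by
    intro n k
    induction n with
    | zero =>
      rw [fourierCoeff_eq_intervalIntegral f k 0, zero_add, pow_zero, one_mul]
      congr 2
      funext x
      rw [fourier_coe_apply, hf, smul_eq_mul, hμ]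
      congr 2
      ring
    | succ n ih =>
      have h1 : ∀ x ∈ uIcc 0 ω, HasDerivAt (fun x : ℝ => Complex.exp (μ (-k) * x) * W n x)
          (μ (-k) * (Complex.exp (μ (-k) * x) * W n x) + Complex.exp (μ (-k) * x) * W (n + 1) x) x :=
        fun x _ => ((hexpd (-k) x).mul (hd n x).ofReal_comp).congr_deriv (by ring)
      have hci : ∀ n, IntervalIntegrable (fun x : ℝ => Complex.exp (μ (-k) * x) * W n x) volume 0 ω :=
        fun n => Continuous.intervalIntegrable (by have := hWc n; fun_prop) _ _
      have h2 := intervalIntegral.integral_eq_sub_of_hasDerivAt h1 (((hci n).const_mul _).add (hci (n + 1)))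
      rw [intervalIntegral.integral_add ((hci n).const_mul _) (hci (n + 1)),
        intervalIntegral.integral_const_mul, hμω, Complex.ofReal_zero, mul_zero, Complex.exp_zero,
        (hp n).eq, sub_self, hμneg] at h2
      rw [pow_succ', mul_assoc, ih, mul_smul_comm]
      congr 1
      rw [hμneg]
      linear_combination -h2
  have hcb : ∀ n k, ‖μ k‖ ^ n * ‖fourierCoeff f k‖ ≤ A * R ^ n * n.factorial := by
    intro n k
    rw [← norm_pow, ← norm_mul, hcoef, norm_smul, Real.norm_eq_abs, abs_of_pos (by positivity)]
    have := intervalIntegral.norm_integral_le_of_norm_le_const (a := 0) (b := ω)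
      (f := fun x : ℝ => Complex.exp (μ (-k) * x) * W n x) (C := A * R ^ n * n.factorial) fun x _ => by
        rw [norm_mul, hexp, one_mul, Complex.norm_real]
        exact hb n x
    rw [sub_zero, abs_of_pos hω] at this
    calc _ ≤ 1 / ω * (A * R ^ n * n.factorial * ω) := by gcongr
      _ = _ := by field_simp
  have hc0 : fourierCoeff f 0 = 0 := by
    have := hcoef 0 0
    have h1 : μ (-0) = 0 := by rw [hμ]; simp
    rw [h1] at this
    simp only [zero_mul, Complex.exp_zero, one_mul, pow_zero, intervalIntegral.integral_ofReal, hmean] at this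
    simpa using this
  -- division by the small divisors
  obtain ⟨b, hbdef⟩ : ∃ b : ℤ → ℂ, ∀ k, b k = fourierCoeff f k / (1 - Complex.exp (-(μ k * T))) :=
    ⟨_, fun _ => rfl⟩
  have hdiv' : ∀ k : ℤ, k ≠ 0 → c₀ ≤ ‖1 - Complex.exp (-(μ k * T))‖ * |(k : ℝ)| ^ N := fun k hk => by
    have := hdiv k hk
    rwa [show (2 * Real.pi * Complex.I * k * T / ω : ℂ) = μ k * T by rw [hμ]; ring] at this
  obtain ⟨A₁, hA₁⟩ : ∃ A₁, A₁ = c₀⁻¹ * (κ⁻¹) ^ (N + 2) * (A * R ^ (N + 2)) * (2 ^ (N + 2) * (N + 2).factorial) :=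
    ⟨_, rfl⟩
  have hA₁0 : 0 ≤ A₁ := by rw [hA₁]; positivity
  have hbb : ∀ n k, ‖b k * μ k ^ n‖ ≤ A₁ * (2 * R) ^ n * n.factorial * (1 / (k : ℝ) ^ 2) := by
    intro n k
    rcases eq_or_ne k 0 with rfl | hk
    · rw [hbdef, hc0]
      simp
    have hkp : 0 < |(k : ℝ)| := abs_pos.2 (by exact_mod_cast hk)
    have h1 := hdiv' k hk
    have hdp : 0 < ‖1 - Complex.exp (-(μ k * T))‖ := by
      by_contra h
      have : ‖1 - Complex.exp (-(μ k * T))‖ = 0 := le_antisymm (not_lt.1 h) (norm_nonneg _)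
      rw [this, zero_mul] at h1
      linarith
    have h2 : ‖1 - Complex.exp (-(μ k * T))‖⁻¹ ≤ c₀⁻¹ * |(k : ℝ)| ^ N := by
      rw [inv_mul_eq_div, inv_eq_one_div, div_le_div_iff₀ hdp hc₀]
      linarith
    have h3 := hcb (n + (N + 2)) k
    have h4 : ((n + (N + 2)).factorial : ℝ)
        ≤ 2 ^ (n + (N + 2)) * n.factorial * (N + 2).factorial := by
      rw [← Nat.add_choose_mul_factorial_mul_factorial]
      push_cast
      gcongr
      exact_mod_cast Nat.choose_le_two_pow _ _
    have h5 : ‖b k * μ k ^ n‖ = ‖1 - Complex.exp (-(μ k * T))‖⁻¹ * (‖μ k‖ ^ n * ‖fourierCoeff f k‖) := by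
      rw [hbdef, norm_mul, norm_div, norm_pow]
      ring
    rw [h5]
    calc _ ≤ c₀⁻¹ * |(k : ℝ)| ^ N * (‖μ k‖ ^ n * ‖fourierCoeff f k‖) := by gcongr
      _ = c₀⁻¹ * (κ⁻¹) ^ (N + 2) * (‖μ k‖ ^ (n + (N + 2)) * ‖fourierCoeff f k‖) * (1 / (k : ℝ) ^ 2) := by
          rw [inv_pow, pow_add ‖μ k‖, hμn, mul_pow κ _ (N + 2), pow_add |(k : ℝ)| N 2, ← sq_abs (k : ℝ)]
          field_simp
      _ ≤ c₀⁻¹ * (κ⁻¹) ^ (N + 2) * (A * R ^ (n + (N + 2)) *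
            (2 ^ (n + (N + 2)) * n.factorial * (N + 2).factorial)) * (1 / (k : ℝ) ^ 2) := by
          refine mul_le_mul_of_nonneg_right (mul_le_mul_of_nonneg_left (h3.trans ?_) (by positivity))
            (by positivity)
          gcongr
      _ = _ := by
          rw [hA₁, mul_pow, pow_add R, pow_add 2 n]
          ring
  have hsum : Summable fun k : ℤ => 1 / (k : ℝ) ^ 2 := Real.summable_one_div_int_pow.2 one_lt_two
  have hg : ∀ n k (x : ℝ), ‖b k * μ k ^ n * Complex.exp (μ k * x)‖
      ≤ A₁ * (2 * R) ^ n * n.factorial * (1 / (k : ℝ) ^ 2) := fun n k x => by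
    rw [norm_mul, hexp, mul_one]
    exact hbb n k
  have hgs : ∀ n (x : ℝ), Summable fun k => b k * μ k ^ n * Complex.exp (μ k * x) := fun n x =>
    .of_norm_bounded (hsum.mul_left _) fun k => hg n k x
  have hder : ∀ n (x : ℝ), HasDerivAt (fun x : ℝ => ∑' k, b k * μ k ^ n * Complex.exp (μ k * x))
      (∑' k, b k * μ k ^ (n + 1) * Complex.exp (μ k * x)) x := fun n x =>
    hasDerivAt_tsum (hsum.mul_left _) (fun k y => ((hexpd k y).const_mul (b k * μ k ^ n)).congr_deriv (by ring))
      (fun k y => hg (n + 1) k y) (hgs n 0) x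
  refine ⟨fun n x => (∑' k, b k * μ k ^ n * Complex.exp (μ k * x)).re, A₁ * ∑' k : ℤ, 1 / (k : ℝ) ^ 2,
    2 * R, by positivity, fun n x => ?_, fun x => ?_, fun n x => ?_, fun x => ?_⟩
  · exact Complex.reCLM.hasFDerivAt.comp_hasDerivAt x (hder n x)
  · have : ∀ k, Complex.exp (μ k * ((x + ω : ℝ) : ℂ)) = Complex.exp (μ k * x) := fun k => by
      rw [Complex.ofReal_add, mul_add, Complex.exp_add, hμω, mul_one]
    simp only [this]
  · refine (Complex.abs_re_le_norm _).trans ((tsum_of_norm_bounded (hsum.mul_left _).hasSum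
      fun k => hg n k x).trans_eq ?_)
    rw [tsum_mul_left]
    ring
  · rw [← Complex.sub_re, ← (hgs 0 x).tsum_sub (hgs 0 (x - T))]
    have hfs : Summable (fourierCoeff f) := by
      refine .of_norm_bounded (hsum.mul_left (A * R ^ 2 * 2 * κ⁻¹ ^ 2)) fun k => ?_
      rcases eq_or_ne k 0 with rfl | hk
      · rw [hc0]; simp
      have hkp : 0 < |(k : ℝ)| := abs_pos.2 (by exact_mod_cast hk)
      have := hcb 2 k
      rw [hμn, mul_pow, sq_abs] at this
      rw [← sq_abs (k : ℝ)] at this ⊢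
      rw [mul_one_div, le_div_iff₀ (by positivity)]
      calc ‖fourierCoeff f k‖ * |(k : ℝ)| ^ 2
          = κ⁻¹ ^ 2 * (κ ^ 2 * |(k : ℝ)| ^ 2 * ‖fourierCoeff f k‖) := by field_simp
        _ ≤ κ⁻¹ ^ 2 * (A * R ^ 2 * (2 : ℕ).factorial) := by gcongr
        _ = _ := by
          rw [Nat.factorial_two]
          push_cast
          ring
    have h1 := (has_pointwise_sum_fourier_series_of_summable hfs (x : AddCircle ω)).tsum_eq
    rw [hf] at h1
    have h2 : ∀ k, b k * μ k ^ 0 * Complex.exp (μ k * x) - b k * μ k ^ 0 * Complex.exp (μ k * ((x - T : ℝ) : ℂ))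
        = fourierCoeff f k • fourier k (x : AddCircle ω) := by
      intro k
      rw [fourier_coe_apply, smul_eq_mul, show (2 * Real.pi * Complex.I * k * x / ω : ℂ) = μ k * x by rw [hμ]; ring]
      rcases eq_or_ne k 0 with rfl | hk
      · rw [hbdef, hc0]
        simp
      have hne : 1 - Complex.exp (-(μ k * T)) ≠ 0 := by
        intro h0
        have h1 := hdiv' k hk
        rw [h0, norm_zero, zero_mul] at h1
        linarith
      rw [hbdef, Complex.ofReal_sub, mul_sub, sub_eq_add_neg (μ k * x : ℂ), Complex.exp_add, pow_zero, mul_one]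
      field_simp
    simp only [h2, h1, Complex.ofReal_re]

/-! ### The transport equation on the torus -/

section

variable {T ω : ℝ} {v : ℝ → ℝ → ℝ}

lemma SiegelCondition.irrational (hT : 0 < T) (hω : 0 < ω) (h : SiegelCondition T ω) :
    Irrational (T / ω) := by
  rintro ⟨r, hr⟩
  obtain ⟨K, τ, hK, -, hS⟩ := h
  have hr0 : 0 < r := by
    have : (0 : ℝ) < r := hr ▸ div_pos hT hω
    exact_mod_cast this
  have hnum : 0 < r.num := Rat.num_pos.2 hr0
  have h1 := hS r.den r.num.toNat r.den_pos (by omega)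
  have e : ((r.num.toNat : ℕ) : ℝ) = (r.num : ℝ) := by
    exact_mod_cast Int.toNat_of_nonneg hnum.le
  have e2 : (r : ℝ) = r.num / r.den := by exact_mod_cast (Rat.num_div_den r).symm
  have hd : (r.den : ℝ) ≠ 0 := by exact_mod_cast r.den_ne_zero
  rw [e2] at hr
  have e3 : r.den * T - (r.num : ℝ) * ω = 0 := by
    field_simp at hr
    linarith
  rw [e, e3, abs_zero] at h1
  have : (0 : ℝ) < (r.den : ℝ) + r.num := by
    have := r.den_pos
    positivity
  exact absurd h1 (not_lt.2 (by positivity))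

lemma IsTransportSolution.unique (hT : 0 < T) (hω : 0 < ω) (hS : SiegelCondition T ω) {ζ ζ' : ℝ → ℝ → ℝ}
    (h : IsTransportSolution T ω v ζ) (h' : IsTransportSolution T ω v ζ') : ζ = ζ' := by
  have along : ∀ {ζ : ℝ → ℝ → ℝ}, IsTransportSolution T ω v ζ → ∀ φ s,
      HasDerivAt (fun s => ζ s (φ + s)) (v s (φ + s)) s := by
    intro ζ h φ s
    have hf := ((h.contDiff.differentiable one_ne_zero) (s, φ + s)).hasFDerivAt
    have h1 := hf.comp_hasDerivAt s ((hasDerivAt_id s).prodMk ((hasDerivAt_id s).const_add φ))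
    have h2 := hf.comp_hasDerivAt s ((hasDerivAt_id s).prodMk (hasDerivAt_const s (φ + s)))
    have h3 := HasFDerivAt.comp_hasDerivAt (φ + s) (f := fun θ => (s, θ)) hf
      ((hasDerivAt_const (φ + s) s).prodMk (hasDerivAt_id (φ + s)))
    refine h1.congr_deriv ?_
    rw [← h.equation]
    have e2 := h2.deriv
    have e3 := h3.deriv
    simp only [Function.comp_def, id] at e2 e3
    rw [e2, e3, ← map_add]
    simp
  have hc : Continuous fun p : Plane => ζ p.1 p.2 - ζ' p.1 p.2 :=
    h.contDiff.continuous.sub h'.contDiff.continuous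
  have hconst : ∀ t φ, ζ t φ - ζ' t φ = ζ 0 (φ - t) - ζ' 0 (φ - t) := by
    intro t φ
    have hd : ∀ s, HasDerivAt (fun s => ζ s (φ - t + s) - ζ' s (φ - t + s)) 0 s := fun s =>
      ((along h (φ - t) s).sub (along h' (φ - t) s)).congr_deriv (sub_self _)
    have := is_const_of_deriv_eq_zero (fun s => (hd s).differentiableAt) (fun s => (hd s).deriv) t 0
    simpa using this
  obtain ⟨g, hg⟩ : ∃ g : ℝ → ℝ, ∀ φ, g φ = ζ 0 φ - ζ' 0 φ := ⟨_, fun _ => rfl⟩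
  have hgc : Continuous g := by
    rw [show g = fun φ => ζ 0 φ - ζ' 0 φ from funext hg]
    exact hc.comp (by fun_prop : Continuous fun φ : ℝ => ((0 : ℝ), φ))
  have hper : ∀ x ∈ AddSubgroup.closure {T, ω}, ∀ y, g (y + x) = g y := by
    intro x hx
    induction hx using AddSubgroup.closure_induction with
    | mem x hx =>
      intro y
      rcases hx with rfl | rfl
      · have := hconst x (y + x)
        rw [add_sub_cancel_right, ← hg, ← zero_add x, h.periodic_t, h'.periodic_t, zero_add, ← hg] at this
        exact this
      · rw [hg, hg, h.periodic_φ, h'.periodic_φ]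
    | zero => simp
    | add x z _ _ hx hz => intro y; rw [← add_assoc, hz, hx]
    | neg x _ hx => intro y; rw [← hx (y + -x), neg_add_cancel_right]
  have hg0 : g = fun _ => g 0 :=
    hgc.ext_on (dense_addSubgroupClosure_pair_iff.2 (hS.irrational hT hω)) continuous_const fun x hx => by
      have := hper x hx 0
      rwa [zero_add] at this
  have hD : ∀ t φ, ζ t φ - ζ' t φ = g 0 := fun t φ => by rw [hconst, ← hg, hg0]
  have h0 := average_sub (T := T) (ω := ω) h.contDiff.continuous h'.contDiff.continuous
  rw [h.average_zero, h'.average_zero, sub_zero] at h0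
  simp only [hD] at h0
  rw [average_const hT hω] at h0
  funext t φ
  linarith [hD t φ]

lemma IsAngleAnalytic.exists_transport (hT : 0 < T) (hω : 0 < ω) (hS : SiegelCondition T ω)
    (hv : IsAngleAnalytic T ω v) (hav : average T ω v = 0) :
    ∃ ζ : ℝ → ℝ → ℝ, IsAngleAnalytic T ω ζ ∧ average T ω ζ = 0 ∧
      ∀ t φ, HasDerivAt (fun s => ζ s φ) (v t φ - _root_.deriv (ζ t) φ) t := by
  obtain ⟨A, R, hA, hR, h2p, hder, hbd⟩ := hv.exists_bounds
  obtain ⟨d, hdd⟩ : ∃ d : ℕ → ℝ → ℝ → ℝ, ∀ n t φ, d n t φ = iteratedDeriv n (v t) φ :=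
    ⟨_, fun _ _ _ => rfl⟩
  have hd0 : ∀ t φ, d 0 t φ = v t φ := fun t φ => by rw [hdd, iteratedDeriv_zero]
  replace h2p : ∀ n, IsTwoPeriodic T ω (d n) := fun n => by
    rw [show d n = fun t φ => iteratedDeriv n (v t) φ from funext fun t => funext fun φ => hdd n t φ]
    exact h2p n
  replace hder : ∀ n t φ, HasDerivAt (d n t) (d (n + 1) t φ) φ := fun n t φ => by
    rw [hdd, show d n t = iteratedDeriv n (v t) from funext fun φ => hdd n t φ]
    exact hder n t φ
  replace hbd : ∀ n t φ, |d n t φ| ≤ A * R ^ n * n.factorial := fun n t φ => by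
    rw [hdd]
    exact hbd n t φ
  -- integration along the characteristics
  have hI : ∀ n a b x, HasDerivAt (fun x => ∫ s in a..b, d n s (x + s)) (∫ s in a..b, d (n + 1) s (x + s)) x :=
    fun n a b x => hasDerivAt_integral_of_continuous (F := fun x s => d n s (x + s))
      (F' := fun x s => d (n + 1) s (x + s))
      (fun x => (h2p n).cont.comp (by fun_prop : Continuous fun s : ℝ => (s, x + s)))
      ((h2p (n + 1)).cont.comp (by fun_prop : Continuous fun p : Plane => (p.2, p.1 + p.2)))
      (fun x s => (hder n s (x + s)).comp_add_const x s) a b x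
  have hIb : ∀ n t x, t ∈ Icc 0 T → |∫ s in (0 : ℝ)..t, d n s (x + s)| ≤ T * A * R ^ n * n.factorial := by
    intro n t x ht
    have := intervalIntegral.norm_integral_le_of_norm_le_const (a := 0) (b := t)
      (f := fun s => d n s (x + s)) (C := A * R ^ n * n.factorial) fun s _ => hbd n s _
    rw [sub_zero, abs_of_nonneg ht.1] at this
    calc _ ≤ A * R ^ n * n.factorial * t := this
      _ ≤ A * R ^ n * n.factorial * T := by gcongr; exact ht.2
      _ = _ := by ring
  have hii : ∀ x a b, IntervalIntegrable (fun s => d 0 s (x + s)) volume a b := fun x a b =>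
    ((h2p 0).cont.comp (by fun_prop : Continuous fun s : ℝ => (s, x + s))).intervalIntegrable _ _
  have hmean : ∫ x in (0 : ℝ)..ω, ∫ s in (0 : ℝ)..T, d 0 s (x - T + s) = 0 := by
    have hc : Continuous (fun p : Plane => d 0 p.2 (p.1 - T + p.2)) :=
      (h2p 0).cont.comp (by fun_prop : Continuous fun p : Plane => (p.2, p.1 - T + p.2))
    have hc' : Continuous (fun p : Plane => d 0 p.2 p.1) := (h2p 0).cont.comp continuous_swap
    have hii : ∀ {F : Plane → ℝ}, Continuous F → IntegrableOn F (uIoc 0 ω ×ˢ uIoc 0 T) := fun hF =>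
      (hF.continuousOn.integrableOn_compact (isCompact_uIcc.prod isCompact_uIcc)).mono_set
        (prod_mono uIoc_subset_uIcc uIoc_subset_uIcc)
    rw [intervalIntegral_intervalIntegral_swap (F := fun x s => d 0 s (x - T + s)) (hii hc)]
    have h1 : ∀ s, ∫ x in (0 : ℝ)..ω, d 0 s (x - T + s) = ∫ x in (0 : ℝ)..ω, d 0 s x := by
      intro s
      have hp : Function.Periodic (d 0 s) ω := fun φ => (h2p 0).periodic_φ s φ
      have := hp.intervalIntegral_add_eq (-T + s) 0
      rw [zero_add] at this
      rw [← this, show (fun x => d 0 s (x - T + s)) = fun x => d 0 s (x + (-T + s)) by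
        funext x; congr 1; ring, intervalIntegral.integral_comp_add_right, zero_add, add_comm ω]
    simp only [h1]
    rw [← intervalIntegral_intervalIntegral_swap (F := fun x s => d 0 s x) (hii hc')]
    simp only [hd0]
    rw [_root_.average] at hav
    exact (mul_eq_zero.1 hav).resolve_left (by positivity)
  obtain ⟨ζ, A', R', hR', hζ, hζp, hζb, hζe⟩ := exists_sub_shift_eq hT hω hS hR (A := T * A)
    (W := fun n x => ∫ s in (0 : ℝ)..T, d n s (x - T + s))
    (fun n x => (hI n 0 T (x - T)).comp_sub_const x T)
    (fun n x => by simp only [show ∀ s, x + ω - T + s = x - T + s + ω by intro s; ring, (h2p n).periodic_φ])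
    (fun n x => hIb n T (x - T) ⟨hT.le, le_rfl⟩) hmean
  have hA' : 0 ≤ A' := by simpa using (abs_nonneg _).trans (hζb 0 0)
  -- the solution and its derivatives in the angle
  obtain ⟨E, hE⟩ : ∃ E : ℕ → ℝ → ℝ → ℝ, ∀ n t φ,
      E n t φ = ζ n (φ - t) + ∫ s in (0 : ℝ)..t, d n s (φ - t + s) := ⟨_, fun _ _ _ => rfl⟩
  have hEd : ∀ n t φ, HasDerivAt (E n t) (E (n + 1) t φ) φ := by
    intro n t φ
    rw [show E n t = fun φ => ζ n (φ - t) + ∫ s in (0 : ℝ)..t, d n s (φ - t + s) from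
      funext fun φ => hE n t φ, hE]
    exact ((hζ n (φ - t)).comp_sub_const φ t).add ((hI n 0 t (φ - t)).comp_sub_const φ t)
  have hζc : ∀ n, Continuous (ζ n) := fun n => continuous_iff_continuousAt.2 fun x => (hζ n x).continuousAt
  have hJc : ∀ n, Continuous fun p : Plane => ∫ s in (0 : ℝ)..p.1, d n s (p.2 + s) := fun n =>
    intervalIntegral.continuous_parametric_intervalIntegral_of_continuous (a₀ := 0)
      (f := fun (p : Plane) s => d n s (p.2 + s)) (μ := volume) (s := fun p : Plane => p.1)
      ((h2p n).cont.comp (by fun_prop : Continuous fun p : (Plane) × ℝ => (p.2, p.1.2 + p.2))) continuous_fst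
  have hEc : ∀ n, Continuous fun p : Plane => E n p.1 p.2 := fun n => by
    simp only [hE]
    exact ((hζc n).comp (by fun_prop : Continuous fun p : Plane => p.2 - p.1)).add
      ((hJc n).comp (by fun_prop : Continuous fun p : Plane => (p.1, p.2 - p.1)))
  have hEt : ∀ n t φ, E n (t + T) φ = E n t φ := by
    intro n
    induction n with
    | zero =>
      intro t φ
      have h1 := hζe (φ - t)
      have h2 : ∫ s in T..(t + T), d 0 s (φ - t - T + s) = ∫ s in (0 : ℝ)..t, d 0 s (φ - t + s) := by
        have := intervalIntegral.integral_comp_add_right (a := 0) (b := t)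
          (fun s => d 0 s (φ - t - T + s)) T
        rw [zero_add] at this
        rw [← this]
        simp only [(h2p 0).periodic_t, show ∀ s, φ - t - T + (s + T) = φ - t + s by intro s; ring]
      rw [hE, hE, ← h2, show φ - (t + T) = φ - t - T by ring,
        ← intervalIntegral.integral_add_adjacent_intervals (hii (φ - t - T) 0 T) (hii (φ - t - T) T (t + T))]
      linarith
    | succ n ih =>
      intro t φ
      have h1 := hEd n (t + T) φ
      rw [show E n (t + T) = E n t from funext fun φ => ih t φ] at h1
      exact h1.unique (hEd n t φ)
  have hEφ : ∀ t φ, E 0 t (φ + ω) = E 0 t φ := fun t φ => by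
    rw [hE, hE, show φ + ω - t = φ - t + ω by ring, hζp]
    simp only [show ∀ s, φ - t + ω + s = φ - t + s + ω by intro s; ring, (h2p 0).periodic_φ]
  have hEa : IsAngleAnalytic T ω (E 0) := by
    refine IsAngleAnalytic.of_bounds (A := A' + T * A) (R := R' + R) (d := E) (by positivity)
      ⟨hEc 0, hEt 0, hEφ⟩ hEd fun n t φ => ?_
    obtain ⟨s, hs, e⟩ := Function.Periodic.exists_mem_Ico₀ (f := fun t => E n t φ) (fun t => hEt n t φ) hT t
    rw [show E n t φ = E n s φ from e, hE]
    refine (abs_add_le _ _).trans ((add_le_add (hζb n _) (hIb n s _ ⟨hs.1, hs.2.le⟩)).trans ?_)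
    have h1 : R' ^ n ≤ (R' + R) ^ n := by gcongr; linarith
    have h2 : R ^ n ≤ (R' + R) ^ n := by gcongr; linarith
    calc _ ≤ A' * (R' + R) ^ n * n.factorial + T * A * (R' + R) ^ n * n.factorial := by gcongr
      _ = _ := by ring
  have hEdt : ∀ t φ, HasDerivAt (fun s => E 0 s φ) (v t φ - E 1 t φ) t := by
    intro t φ
    have h1 : ∀ t y, HasDerivAt (fun t => ζ 0 y + ∫ s in (0 : ℝ)..t, d 0 s (y + s)) (d 0 t (y + t)) t :=
      fun t y => by
        have hc : Continuous fun s => d 0 s (y + s) :=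
          (h2p 0).cont.comp (by fun_prop : Continuous fun s : ℝ => (s, y + s))
        exact (intervalIntegral.integral_hasDerivAt_right (hc.intervalIntegrable _ _)
          (hc.stronglyMeasurableAtFilter _ _) hc.continuousAt).const_add _
    have h2 := hasDerivAt_along (v := fun t y => ζ 0 y + ∫ s in (0 : ℝ)..t, d 0 s (y + s)) h1
      (fun t y => (hζ 0 y).add (hI 0 0 t y))
      ((h2p 0).cont.comp (by fun_prop : Continuous fun p : Plane => (p.1, p.2 + p.1)))
      (((hζc 1).comp continuous_snd).add (hJc 1)) ((hasDerivAt_id t).const_sub φ)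
    simp only [hE]
    refine h2.congr_deriv ?_
    simp only [hd0, id, sub_add_cancel]
    ring
  refine ⟨fun t φ => E 0 t φ - average T ω (E 0), ?_, ?_, fun t φ => ?_⟩
  · have := hEa.add (IsAngleAnalytic.const (-average T ω (E 0)))
    simpa only [Pi.add_def, ← sub_eq_add_neg] using this
  · rw [average_sub (hEc 0) continuous_const, average_const hT hω, sub_self]
  · rw [deriv_sub_const_fun, (hEd 0 t φ).deriv]
    exact (hEdt t φ).sub_const _

/-- The solution of the transport equation with an analytic right-hand side. -/
lemma IsAngleAnalytic.transportSolution (hT : 0 < T) (hω : 0 < ω) (hS : SiegelCondition T ω)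
    (hv : IsAngleAnalytic T ω v) (hav : average T ω v = 0) :
    IsTransportSolution T ω v (transportSolution T ω v) ∧
      IsAngleAnalytic T ω (_root_.transportSolution T ω v) ∧
      ∀ t φ, HasDerivAt (fun s => _root_.transportSolution T ω v s φ)
        (v t φ - _root_.deriv (_root_.transportSolution T ω v t) φ) t := by
  obtain ⟨ζ, h1, h2, h3⟩ := hv.exists_transport hT hω hS hav
  have hζ : IsTransportSolution T ω v ζ :=
    ⟨contDiff_one_of_hasDerivAt h3 h1.hasDerivAt (hv.1.cont.sub h1.deriv.1.cont) h1.deriv.1.cont,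
      h1.analyticOnNhd, h1.1.periodic_t, h1.1.periodic_φ, h2, fun t φ => by
        rw [(h3 t φ).deriv, sub_add_cancel]⟩
  have hs : IsTransportSolution T ω v (_root_.transportSolution T ω v) := Classical.epsilon_spec ⟨ζ, hζ⟩
  obtain rfl := hs.unique hT hω hS hζ
  exact ⟨hs, h1, h3⟩

end

/-! ### Analyticity of the generating orbit -/

/-- The function `u` has `n` derivatives, the last of which is bounded by `K`. -/
def HasDerivBound : ℕ → ℝ → (ℝ → ℝ) → Prop
  | 0, K, u => ∀ φ, |u φ| ≤ K
  | n + 1, K, u => ∃ d, (∀ φ, HasDerivAt u (d φ) φ) ∧ HasDerivBound n K d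

namespace HasDerivBound

variable {n : ℕ} {K K' : ℝ} {u w : ℝ → ℝ}

lemma add (hu : HasDerivBound n K u) (hw : HasDerivBound n K' w) :
    HasDerivBound n (K + K') (fun φ => u φ + w φ) := by
  induction n generalizing u w with
  | zero => exact fun φ => (abs_add_le _ _).trans (add_le_add (hu φ) (hw φ))
  | succ n ih =>
    obtain ⟨d, hd, h⟩ := hu
    obtain ⟨d', hd', h'⟩ := hw
    exact ⟨_, fun φ => (hd φ).add (hd' φ), ih h h'⟩

lemma const_mul {c M : ℝ} (hc : |c| ≤ M) (hu : HasDerivBound n K u) :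
    HasDerivBound n (M * K) (fun φ => c * u φ) := by
  induction n generalizing u with
  | zero =>
    intro φ
    rw [abs_mul]
    exact mul_le_mul hc (hu φ) (abs_nonneg _) ((abs_nonneg _).trans hc)
  | succ n ih =>
    obtain ⟨d, hd, h⟩ := hu
    exact ⟨_, fun φ => (hd φ).const_mul c, ih h⟩

lemma mono (hu : HasDerivBound n K u) (h : K ≤ K') : HasDerivBound n K' u := by
  induction n generalizing u with
  | zero => exact fun φ => (hu φ).trans h
  | succ n ih =>
    obtain ⟨d, hd, h'⟩ := hu
    exact ⟨d, hd, ih h'⟩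

lemma abs_iteratedDeriv_le (hu : HasDerivBound n K u) (φ : ℝ) : |iteratedDeriv n u φ| ≤ K := by
  induction n generalizing u with
  | zero => simpa using hu φ
  | succ n ih =>
    obtain ⟨d, hd, h⟩ := hu
    rw [iteratedDeriv_succ', show deriv u = d from funext fun φ => (hd φ).deriv]
    exact ih h

end HasDerivBound

namespace GeneratingOrbit

variable {P : PerturbedSystem} (O : GeneratingOrbit P)

/-- Bounds for the derivatives of monomials in `C` and `S`. -/
lemma hasDerivBound_monomial {M : ℝ} (hM : 1 ≤ M) (hC : ∀ φ, |O.C φ| ≤ M) (hS : ∀ φ, |O.S φ| ≤ M)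
    (n N i j : ℕ) (hN : i + j ≤ N) : HasDerivBound n
      (M ^ (N + 2 * n) * 2 ^ n * ∏ k ∈ Finset.range n, ((N : ℝ) + 2 * k)) (fun φ => O.C φ ^ i * O.S φ ^ j) := by
  induction n generalizing N i j with
  | zero =>
    intro φ
    simp only [mul_zero, add_zero, pow_zero, mul_one, Finset.range_zero, Finset.prod_empty, abs_mul, abs_pow]
    calc |O.C φ| ^ i * |O.S φ| ^ j ≤ M ^ i * M ^ j := by
          gcongr
          exacts [hC φ, hS φ]
      _ = M ^ (i + j) := (pow_add _ _ _).symm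
      _ ≤ M ^ N := pow_le_pow_right₀ hM hN
  | succ n ih =>
    obtain ⟨B, hB⟩ : ∃ B, M ^ (N + 2 + 2 * n) * 2 ^ n * ∏ k ∈ Finset.range n, (((N + 2 : ℕ) : ℝ) + 2 * k) = B :=
      ⟨_, rfl⟩
    have hB0 : 0 ≤ B := by
      rw [← hB]
      have : 0 ≤ ∏ k ∈ Finset.range n, (((N + 2 : ℕ) : ℝ) + 2 * k) :=
        Finset.prod_nonneg fun k _ => by positivity
      positivity
    have hm : ∀ {i' j' m : ℕ} {c : ℝ}, (m ≠ 0 → i' + j' ≤ N + 2) → |c| ≤ m →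
        HasDerivBound n (m * B) (fun φ => c * (O.C φ ^ i' * O.S φ ^ j')) := by
      intro i' j' m c hij hc
      rcases eq_or_ne m 0 with rfl | hm
      · have : c = 0 := by simpa using hc
        simp only [this, zero_mul, Nat.cast_zero]
        clear * -
        induction n with
        | zero => intro φ; simp
        | succ n ih => exact ⟨_, fun φ => hasDerivAt_const φ 0, ih⟩
      · exact (hB ▸ ih (N + 2) i' j' (hij hm)).const_mul hc
    have hγ := abs_le.2 ⟨by linarith [P.γ_pos], P.γ_le_one⟩
    have hi : |(i : ℝ) * P.γ| ≤ i := by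
      rw [abs_mul, Nat.abs_cast]
      exact mul_le_of_le_one_right (Nat.cast_nonneg i) hγ
    refine ⟨_, fun φ => ((O.C_deriv φ).pow i).mul ((O.S_deriv φ).pow j), ?_⟩
    have h := (((hm (i' := i - 1) (j' := j + 3) (fun _ => by omega) hi).add
      (hm (i' := i - 1) (j' := j + 1) (fun _ => by omega) ((abs_neg _).trans_le hi))).add
      (hm (i' := i + 3) (j' := j - 1) (m := j) (c := -j) (fun _ => by omega) (by simp))).add
      (hm (i' := i + 1) (j' := j - 1) (m := j) (c := j) (fun _ => by omega) (by simp))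
    convert h.mono (K' := _) ?_ using 1
    · funext φ
      simp only [Pi.pow_apply]
      ring
    · have hp : ∏ k ∈ Finset.range (n + 1), ((N : ℝ) + 2 * k)
          = N * ∏ k ∈ Finset.range n, (((N + 2 : ℕ) : ℝ) + 2 * k) := by
        rw [Finset.prod_range_succ', Nat.cast_zero, mul_zero, add_zero, mul_comm]
        congr 1
        refine Finset.prod_congr rfl fun k _ => ?_
        push_cast
        ring
      have hij : (i : ℝ) + j ≤ N := by exact_mod_cast hN
      have e : M ^ (N + 2 * (n + 1)) * 2 ^ (n + 1) * (N * ∏ k ∈ Finset.range n, (((N + 2 : ℕ) : ℝ) + 2 * k))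
          = 2 * N * B := by
        rw [← hB, pow_succ, show N + 2 * (n + 1) = N + 2 + 2 * n by ring]
        ring
      rw [hp, e]
      nlinarith

lemma isAngleAnalytic_C_S : IsAngleAnalytic P.T O.ω (fun _ φ => O.C φ) ∧
    IsAngleAnalytic P.T O.ω (fun _ φ => O.S φ) := by
  obtain ⟨c, -, hc, -⟩ := O.C_periodic.exists_abs_le O.ω_pos O.continuous_C
  obtain ⟨s, -, hs, -⟩ := O.S_periodic.exists_abs_le O.ω_pos O.continuous_S
  obtain ⟨M, hM1, hMC, hMS⟩ : ∃ M, 1 ≤ M ∧ (∀ φ, |O.C φ| ≤ M) ∧ ∀ φ, |O.S φ| ≤ M :=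
    ⟨max 1 (max c s), le_max_left _ _,
      fun φ => (hc φ).trans ((le_max_left _ _).trans (le_max_right _ _)),
      fun φ => (hs φ).trans ((le_max_right _ _).trans (le_max_right _ _))⟩
  have key : ∀ {u : ℝ → ℝ}, Function.Periodic u O.ω → (∀ n : ℕ, ContDiff ℝ n u) →
      (∀ n : ℕ, HasDerivBound n (M ^ (1 + 2 * n) * 2 ^ n * ∏ k ∈ Finset.range n, (((1 : ℕ) : ℝ) + 2 * k)) u) →
      IsAngleAnalytic P.T O.ω (fun _ φ => u φ) := by
    intro u hu hcd hb
    have := IsAngleAnalytic.of_bounds (T := P.T) (ω := O.ω) (A := M) (R := M ^ 2 * 4)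
      (d := fun n _ φ => iteratedDeriv n u φ) (by positivity)
      ⟨by simpa [Function.comp_def] using (hcd 0).continuous.comp continuous_snd, fun _ _ => rfl, fun _ φ => by simpa using hu φ⟩
      (fun n t φ => by
        simp only [iteratedDeriv_succ]
        have := (hcd (n + 1)).differentiable_iteratedDeriv n (by exact_mod_cast n.lt_succ_self)
        exact (this φ).hasDerivAt) fun n t φ => by
        refine ((hb n).abs_iteratedDeriv_le φ).trans ?_
        have hp : ∏ k ∈ Finset.range n, (((1 : ℕ) : ℝ) + 2 * k) ≤ 2 ^ n * n.factorial := by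
          induction n with
          | zero => simp
          | succ n ih =>
            rw [Finset.prod_range_succ, Nat.factorial_succ]
            push_cast at ih ⊢
            calc _ ≤ (2 ^ n * (n.factorial : ℝ)) * (2 * (n + 1)) := by
                  gcongr
                  linarith
              _ = _ := by ring
        calc _ ≤ M ^ (1 + 2 * n) * 2 ^ n * (2 ^ n * n.factorial) := by gcongr
          _ = _ := by
            rw [pow_add, pow_mul, mul_pow, show (4 : ℝ) = 2 * 2 by norm_num, mul_pow]
            ring
    simpa using this
  refine ⟨key O.C_periodic (fun n => (O.contDiff_C_S n).1) fun n => ?_,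
    key O.S_periodic (fun n => (O.contDiff_C_S n).2) fun n => ?_⟩
  · simpa using O.hasDerivBound_monomial hM1 hMC hMS n 1 1 0 (by norm_num)
  · simpa using O.hasDerivBound_monomial hM1 hMC hMS n 1 0 1 (by norm_num)

/-! ### Analyticity of the perturbation along the generating orbit -/

/-- The generating orbit as a set in `ℂ²`. -/
def complexOrbit : Set (ℂ × ℂ) := range fun φ => ((O.C φ : ℂ), (O.S φ : ℂ))

/-- At `ε = 0`, the function `f` extends to a complex neighbourhood of the generating orbit; the
extension is bounded and holomorphic along holomorphic curves. -/
def ExtendsNearOrbit (f : ℝ → Space → ℝ) : Prop :=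
  ∃ (η B : ℝ) (F : ℝ → ℂ × ℂ → ℂ), 0 < η ∧ 0 ≤ B ∧
    (∀ t, ∀ p ∈ Metric.thickening η O.complexOrbit, ‖F t p‖ ≤ B) ∧
    (∀ t (c : ℂ → ℂ × ℂ) (a : ℂ) (r : ℝ), DifferentiableOn ℂ c (Metric.ball a r) →
      MapsTo c (Metric.ball a r) (Metric.thickening η O.complexOrbit) →
      DifferentiableOn ℂ (fun z => F t (c z)) (Metric.ball a r)) ∧
    ∀ x y : ℝ, ((x : ℂ), (y : ℂ)) ∈ Metric.thickening η O.complexOrbit →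
      (x, y, (0 : ℝ)) ∈ P.dom ∧ ∀ t, F t (x, y) = f t (x, y, 0)

variable {O} {f : ℝ → Space → ℝ}

lemma extendsNearOrbit_of_isAnalyticInXY (hG : O.GeneratingCondition) {n : ℕ}
    (hf : IsPeriodicCn n P.T P.dom f) {g : ℝ → ℝ → ℝ → ℝ} (hg : IsAnalyticInXY P.Mx P.My g)
    (hgf : ∀ t x y, |x| < P.Mx → |y| < P.My → g t x y = f t (x, y, 0)) : O.ExtendsNearOrbit f := by
  obtain ⟨U, F, hU, hFc, hFd, hF⟩ := hg
  have hK : IsCompact O.complexOrbit := by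
    have e : O.complexOrbit = (fun φ => ((O.C φ : ℂ), (O.S φ : ℂ))) '' Icc 0 O.ω := by
      refine Subset.antisymm ?_ (image_subset_range _ _)
      rintro _ ⟨φ, rfl⟩
      obtain ⟨θ, hθ, h⟩ := Function.Periodic.exists_mem_Ico₀
        (f := fun φ => ((O.C φ : ℂ), (O.S φ : ℂ))) (fun φ => by simp only [O.C_periodic φ, O.S_periodic φ])
        O.ω_pos φ
      exact ⟨θ, ⟨hθ.1, hθ.2.le⟩, h.symm⟩
    rw [e]
    exact isCompact_Icc.image ((Complex.continuous_ofReal.comp O.continuous_C).prodMk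
      (Complex.continuous_ofReal.comp O.continuous_S))
  have hV : IsOpen {p : ℂ × ℂ | |p.1.re| < P.Mx ∧ |p.2.re| < P.My} :=
    (isOpen_lt (f := fun p : ℂ × ℂ => |p.1.re|) (by fun_prop) continuous_const).inter
      (isOpen_lt (f := fun p : ℂ × ℂ => |p.2.re|) (by fun_prop) continuous_const)
  obtain ⟨η, hη, hs⟩ := hK.exists_cthickening_subset_open (hU.inter hV) (by
    rintro _ ⟨φ, rfl⟩
    have h := O.mem_rectangle hG φ
    exact ⟨(hF _ (abs_lt.1 h.1) _ (abs_lt.1 h.2)).1, by simpa using h⟩)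
  obtain ⟨B, hB⟩ := (isCompact_Icc.prod (hK.cthickening (r := η))).exists_bound_of_continuousOn
    (hFc.mono (prod_mono (subset_univ (Icc 0 P.T)) fun p hp => (hs hp).1))
  have hsub := Metric.thickening_subset_cthickening η O.complexOrbit
  refine ⟨η, max B 0, fun t => F (toIcoMod P.T_pos 0 t), hη, le_max_right _ _, fun t p hp => ?_,
    fun t c a r hc hm => ?_, fun x y hxy => ?_⟩
  · have h := toIcoMod_mem_Ico P.T_pos 0 t
    rw [zero_add] at h
    exact (hB (_, p) ⟨⟨h.1, h.2.le⟩, hsub hp⟩).trans (le_max_left _ _)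
  · exact (hFd _).comp hc fun z hz => (hs (hsub (hm hz))).1
  · have h := (hs (hsub hxy)).2
    simp only [mem_ofPred_eq, Complex.ofReal_re] at h
    have hd : (x, y, (0 : ℝ)) ∈ P.dom := P.mem_dom.2 ⟨h.1, h.2, le_rfl, P.ε₀_pos⟩
    refine ⟨hd, fun t => ?_⟩
    have hp : Function.Periodic (fun t => f t (x, y, 0)) P.T := fun t => hf.periodic t _ hd
    refine ((hF x (abs_lt.1 h.1) y (abs_lt.1 h.2)).2 _).trans ?_
    rw [hgf _ _ _ h.1 h.2, toIcoMod]
    exact congrArg _ (hp.sub_zsmul_eq _)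

lemma ExtendsNearOrbit.partialDeriv {n : ℕ} (hf : IsPeriodicCn (n + 1) P.T P.dom f)
    (h : O.ExtendsNearOrbit f) {e : Plane} (he : ‖e‖ ≤ 1) :
    O.ExtendsNearOrbit (partialDeriv P.dom (e.1, e.2, 0) f) := by
  obtain ⟨η, B, F, hη, hB, hFb, hFd, hF⟩ := h
  obtain ⟨E, hE⟩ : ∃ E : ℂ × ℂ, E = ((e.1 : ℂ), (e.2 : ℂ)) := ⟨_, rfl⟩
  have hE1 : ‖E‖ ≤ 1 := by
    rw [hE, Prod.norm_def, Complex.norm_real, Complex.norm_real]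
    exact he
  have hmem : ∀ p ∈ Metric.thickening (η / 2) O.complexOrbit, ∀ w ∈ Metric.ball (0 : ℂ) (η / 2),
      p + w • E ∈ Metric.thickening η O.complexOrbit := by
    intro p hp w hw
    obtain ⟨k, hk, hpk⟩ := Metric.mem_thickening_iff.1 hp
    refine Metric.mem_thickening_iff.2 ⟨k, hk, ?_⟩
    have h1 : dist (p + w • E) p ≤ ‖w‖ := by
      rw [dist_eq_norm, add_sub_cancel_left, norm_smul]
      exact mul_le_of_le_one_right (norm_nonneg _) hE1
    have h2 := mem_ball_zero_iff.1 hw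
    linarith [dist_triangle (p + w • E) p k]
  have hd : ∀ t, ∀ p ∈ Metric.thickening (η / 2) O.complexOrbit,
      DifferentiableOn ℂ (fun w : ℂ => F t (p + w • E)) (Metric.ball 0 (η / 2)) := fun t p hp =>
    hFd t (fun w => p + w • E) 0 (η / 2) (by fun_prop) fun w hw => hmem p hp w hw
  have hb : ∀ t, ∀ p ∈ Metric.thickening (η / 2) O.complexOrbit, ∀ w ∈ Metric.ball (0 : ℂ) (η / 2),
      ‖F t (p + w • E)‖ ≤ B := fun t p hp w hw => hFb t _ (hmem p hp w hw)
  have hsub := Metric.thickening_mono (by linarith : η / 2 ≤ η) O.complexOrbit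
  refine ⟨η / 2, (2 * B + 1) / (η / 2), fun t p => deriv (fun w : ℂ => F t (p + w • E)) 0, half_pos hη,
    by positivity, fun t p hp => Complex.norm_deriv_le_of_ball (half_pos hη) (hd t p hp) (hb t p hp),
    fun t c a r hc hm => ?_, fun x y hxy => ⟨(hF x y (hsub hxy)).1, fun t => ?_⟩⟩
  · obtain ⟨K, hK⟩ : ∃ K, (2 * ((2 * B + 1) / (η / 2)) + 1) / (η / 2) = K := ⟨_, rfl⟩
    have hsmall : ∀ᶠ m : ℕ in atTop, (((1 / ((m : ℝ) + 1) : ℝ)) : ℂ) ∈ Metric.ball (0 : ℂ) (η / 2) := by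
      filter_upwards [tendsto_one_div_add_atTop_nhds_zero_nat.eventually_lt_const (half_pos hη)] with m hm
      rw [mem_ball_zero_iff, Complex.norm_real, Real.norm_eq_abs, abs_of_pos (by positivity)]
      exact hm
    have hlim : TendstoUniformlyOn (fun (m : ℕ) z => (((m : ℝ) + 1 : ℝ) : ℂ) *
        (F t (c z + (((1 / ((m : ℝ) + 1) : ℝ)) : ℂ) • E) - F t (c z)))
        (fun z => deriv (fun w : ℂ => F t (c z + w • E)) 0) atTop (Metric.ball a r) := by
      rw [Metric.tendstoUniformlyOn_iff]
      intro d hd0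
      have h1 : Tendsto (fun n : ℕ => K * (1 / ((n : ℝ) + 1))) atTop (𝓝 0) := by
        simpa using tendsto_one_div_add_atTop_nhds_zero_nat.const_mul K
      filter_upwards [h1.eventually_lt_const hd0, hsmall] with m hm1 hm2 z hz
      have := Complex.norm_sub_sub_mul_deriv_le (hd t _ (hm hz)) (hb t _ (hm hz)) hm2
      rw [hK, sub_zero, zero_smul, add_zero, Complex.norm_real, Real.norm_eq_abs, sq_abs] at this
      rw [dist_comm, dist_eq_norm]
      have hm0 : (((m : ℝ) + 1 : ℝ) : ℂ) * ((1 / ((m : ℝ) + 1) : ℝ) : ℂ) = 1 := by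
        rw [← Complex.ofReal_mul, mul_one_div_cancel (by positivity), Complex.ofReal_one]
      have e1 : ∀ u v w : ℂ, (((m : ℝ) + 1 : ℝ) : ℂ) * (u - v) - w
          = (((m : ℝ) + 1 : ℝ) : ℂ) * (u - v - ((1 / ((m : ℝ) + 1) : ℝ) : ℂ) * w) := fun u v w => by
        linear_combination w * hm0
      rw [e1, norm_mul, Complex.norm_real, Real.norm_eq_abs, abs_of_pos (by positivity : (0 : ℝ) < m + 1)]
      calc _ ≤ ((m : ℝ) + 1) * (K * (1 / ((m : ℝ) + 1)) ^ 2) := by gcongr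
        _ = K * (1 / ((m : ℝ) + 1)) := by field_simp
        _ < d := hm1
    refine hlim.tendstoLocallyUniformlyOn.differentiableOn (hsmall.mono fun m hm2 => ?_) Metric.isOpen_ball
    exact ((hFd t (fun z => c z + (((1 / ((m : ℝ) + 1) : ℝ)) : ℂ) • E) a r (hc.add_const _)
      fun z hz => hmem _ (hm hz) _ hm2).sub (hFd t c a r hc fun z hz => hsub (hm hz))).const_mul _
  · have h0 : ((0 : ℝ) : ℂ) ∈ Metric.ball ((0 : ℝ) : ℂ) (η / 2) := Metric.mem_ball_self (half_pos hη)
    have hreal : ∀ s : ℝ, ((x : ℂ), (y : ℂ)) + (s : ℂ) • E = (((x + s * e.1 : ℝ) : ℂ), ((y + s * e.2 : ℝ) : ℂ)) :=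
      fun s => by simp [hE]
    have hev : ∀ s : ℝ, (s : ℂ) ∈ Metric.ball ((0 : ℝ) : ℂ) (η / 2) →
        (x + s * e.1, y + s * e.2, (0 : ℝ)) ∈ P.dom ∧
        ∀ t, F t (((x : ℂ), (y : ℂ)) + (s : ℂ) • E) = f t (x + s * e.1, y + s * e.2, 0) := fun s hs => by
      rw [Complex.ofReal_zero] at hs
      have := hmem _ hxy _ hs
      rw [hreal] at this ⊢
      exact hF _ _ this
    have h1 := ExtendsToDisc.hasDerivAt_of_eq (a := 0) (δ := η / 2) (x := 0)
      (u := fun s => f t (x + s * e.1, y + s * e.2, 0)) (by simpa using hd t _ hxy)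
      (fun s hs => (hev s hs).2 t) h0
    have hl : ∀ x e : ℝ, HasDerivAt (fun s => x + s * e) e 0 := fun x e => by
      simpa using ((hasDerivAt_id (0 : ℝ)).mul_const e).const_add x
    have h2 := hf.hasDerivAt_comp t (hl x e.1) (hl y e.2) (hasDerivAt_const (0 : ℝ) (0 : ℝ)) (by
      filter_upwards [Complex.continuous_ofReal.continuousAt.eventually
        (Metric.isOpen_ball.mem_nhds h0)] with s hs using (hev s hs).1)
    rw [← IsPeriodicCn.fderivWithin_apply, zero_mul, zero_mul, add_zero, add_zero] at h2
    have h3 := h1.2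
    rw [h2.deriv, Complex.ofReal_zero] at h3
    exact h3

lemma ExtendsNearOrbit.isAngleAnalytic (hG : O.GeneratingCondition) {n : ℕ}
    (hf : IsPeriodicCn n P.T P.dom f) (h : O.ExtendsNearOrbit f) :
    IsAngleAnalytic P.T O.ω (O.onOrbit f) := by
  obtain ⟨η, B, F, hη, hB, hFb, hFd, hF⟩ := h
  obtain ⟨⟨-, δ, B₁, hδ, hB₁, hC⟩, ⟨-, δ', B₂, hδ', hB₂, hS⟩⟩ := O.isAngleAnalytic_C_S
  have hd : 0 < min δ δ' := lt_min hδ hδ'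
  refine ⟨(O.isAngleCn_onOrbit hG hf).isTwoPeriodic,
    min (min δ δ') (η / ((2 * (B₁ + B₂) + 1) / min δ δ')), B, by positivity, hB, fun t a => ?_⟩
  obtain ⟨c, hc1, hc2, hc3⟩ := (hC 0 a).mono (min_le_left δ δ') (by linarith : B₁ ≤ B₁ + B₂)
  obtain ⟨s, hs1, hs2, hs3⟩ := (hS 0 a).mono (min_le_right δ δ') (by linarith : B₂ ≤ B₁ + B₂)
  have ha : (a : ℂ) ∈ Metric.ball (a : ℂ) (min δ δ') := Metric.mem_ball_self hd
  have hsub := Metric.ball_subset_ball (x := (a : ℂ))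
    (min_le_left (min δ δ') (η / ((2 * (B₁ + B₂) + 1) / min δ δ')))
  have hK : 0 < (2 * (B₁ + B₂) + 1) / min δ δ' := by positivity
  have close : ∀ {g : ℂ → ℂ}, DifferentiableOn ℂ g (Metric.ball (a : ℂ) (min δ δ')) →
      (∀ z ∈ Metric.ball (a : ℂ) (min δ δ'), ‖g z‖ ≤ B₁ + B₂) →
      ∀ z ∈ Metric.ball (a : ℂ) (min (min δ δ') (η / ((2 * (B₁ + B₂) + 1) / min δ δ'))),
        dist (g z) (g a) < η := by
    intro g h1 h2 z hz
    have h3 := Complex.norm_dslope_le h1 h2 (hsub hz)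
    have h4 : ‖z - a‖ < η / ((2 * (B₁ + B₂) + 1) / min δ δ') := by
      rw [← dist_eq_norm]
      exact (Metric.mem_ball.1 hz).trans_le (min_le_right _ _)
    rw [dist_eq_norm, ← sub_smul_dslope, norm_smul]
    calc _ ≤ ‖z - a‖ * ((2 * (B₁ + B₂) + 1) / min δ δ') := by gcongr
      _ < η := (lt_div_iff₀ hK).1 h4
  have hm : ∀ z ∈ Metric.ball (a : ℂ) (min (min δ δ') (η / ((2 * (B₁ + B₂) + 1) / min δ δ'))),
      (c z, s z) ∈ Metric.thickening η O.complexOrbit := by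
    intro z hz
    refine Metric.mem_thickening_iff.2 ⟨_, ⟨a, rfl⟩, ?_⟩
    have e1 : c a = O.C a := hc3 a ha
    have e2 : s a = O.S a := hs3 a ha
    simp only [← e1, ← e2, Prod.dist_eq]
    exact max_lt (close hc1 hc2 z hz) (close hs1 hs2 z hz)
  refine ⟨fun z => F t (c z, s z), hFd t (fun z => (c z, s z)) _ _
    ((hc1.mono hsub).prodMk (hs1.mono hsub)) hm, fun z hz => hFb t _ (hm z hz), fun x hx => ?_⟩
  have h1 := hm x hx
  have e : (c x, s x) = (((O.C x : ℝ) : ℂ), ((O.S x : ℝ) : ℂ)) :=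
    Prod.ext (hc3 x (hsub hx)) (hs3 x (hsub hx))
  exact (congrArg (F t) e).trans ((hF _ _ (e ▸ h1)).2 t)

/-- The perturbation and its derivatives up to the second order along the generating orbit. -/
lemma isAngleAnalytic_onOrbit (hG : O.GeneratingCondition) (hf : IsPeriodicCn 3 P.T P.dom f)
    (hA : ∀ j ≤ 2, IsAnalyticInXY P.Mx P.My
      (fun t x y => iteratedDerivWithin j (fun ε => f t (x, y, ε)) (Ici 0) 0)) :
    O.onOrbit f ∈ analyticAlgebra P.T O.ω ∧
    (∀ i, O.onOrbit (partialDeriv P.dom (phaseDirection i) f) ∈ analyticAlgebra P.T O.ω) ∧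
    ∀ i j, O.onOrbit (partialDeriv P.dom (phaseDirection j) (partialDeriv P.dom (phaseDirection i) f))
      ∈ analyticAlgebra P.T O.ω := by
  have hu := P.uniqueDiffOn_dom
  have d1 := fun i => hf.partialDeriv hu (phaseDirection i)
  have d2 := fun i j => (d1 i).partialDeriv hu (phaseDirection j)
  have hw : ∀ {n : ℕ} {g : ℝ → Space → ℝ}, IsPeriodicCn (n + 1) P.T P.dom g → ∀ t x y, |x| < P.Mx →
      |y| < P.My → ∀ ε ∈ Ico 0 P.ε₀, derivWithin (fun ε => g t (x, y, ε)) (Ici 0) ε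
        = partialDeriv P.dom (phaseDirection 2) g t (x, y, ε) := fun hg t x y hx hy ε hε =>
    (hasDerivWithinAt_parameter hg t hx hy hε).derivWithin (uniqueDiffOn_Ici 0 ε hε.1)
  have h0 : (0 : ℝ) ∈ Ico 0 P.ε₀ := ⟨le_rfl, P.ε₀_pos⟩
  have e0 : O.ExtendsNearOrbit f := extendsNearOrbit_of_isAnalyticInXY hG hf (hA 0 (by norm_num))
    fun t x y _ _ => by rw [iteratedDerivWithin_zero]
  have e1 : O.ExtendsNearOrbit (partialDeriv P.dom (phaseDirection 2) f) :=
    extendsNearOrbit_of_isAnalyticInXY hG (d1 2) (hA 1 (by norm_num)) fun t x y hx hy => by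
      rw [iteratedDerivWithin_one]
      exact hw hf t x y hx hy 0 h0
  have e2 : O.ExtendsNearOrbit (partialDeriv P.dom (phaseDirection 2) (partialDeriv P.dom (phaseDirection 2) f)) :=
    extendsNearOrbit_of_isAnalyticInXY hG (d2 2 2) (hA 2 le_rfl) fun t x y hx hy => by
      rw [iteratedDerivWithin_succ, show iteratedDerivWithin 1 (fun ε => f t (x, y, ε)) (Ici 0)
        = derivWithin (fun ε => f t (x, y, ε)) (Ici 0) from iteratedDerivWithin_one, ← hw (d1 2) t x y hx hy 0 h0]
      have : ∀ᶠ ε in 𝓝[Ici 0] (0 : ℝ), ε ∈ Ico 0 P.ε₀ := by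
        filter_upwards [self_mem_nhdsWithin, nhdsWithin_le_nhds (Iio_mem_nhds P.ε₀_pos)] with ε h1 h2
        exact ⟨h1, h2⟩
      exact Filter.EventuallyEq.derivWithin_eq (this.mono fun ε hε => hw hf t x y hx hy ε hε)
        (hw hf t x y hx hy 0 h0)
  have hdir : ∀ {n : ℕ} {g : ℝ → Space → ℝ}, IsPeriodicCn (n + 1) P.T P.dom g → O.ExtendsNearOrbit g →
      ∀ i : Fin 3, i ≠ 2 → O.ExtendsNearOrbit (partialDeriv P.dom (phaseDirection i) g) := by
    intro n g hg h i hi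
    fin_cases i
    · exact h.partialDeriv hg (e := (1, 0)) (by simp)
    · exact h.partialDeriv hg (e := (0, 1)) (by simp)
    · exact absurd rfl hi
  have e1' : ∀ i, O.ExtendsNearOrbit (partialDeriv P.dom (phaseDirection i) f) := fun i => by
    rcases eq_or_ne i 2 with rfl | hi
    exacts [e1, hdir hf e0 i hi]
  refine ⟨e0.isAngleAnalytic hG hf, fun i => (e1' i).isAngleAnalytic hG (d1 i), fun i j => ?_⟩
  rcases ne_or_eq j 2 with hj | rfl
  · exact (hdir (d1 i) (e1' i) j hj).isAngleAnalytic hG (d2 i j)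
  rcases eq_or_ne i 2 with rfl | hi
  · exact e2.isAngleAnalytic hG (d2 2 2)
  · have e : O.onOrbit (partialDeriv P.dom (phaseDirection 2) (partialDeriv P.dom (phaseDirection i) f))
        = O.onOrbit (partialDeriv P.dom (phaseDirection i) (partialDeriv P.dom (phaseDirection 2) f)) := by
      funext t φ
      have hp := O.orbit_mem_dom hG φ
      have hcd : ContDiffOn ℝ 2 (fderivWithin ℝ (f t) P.dom) P.dom :=
        (hf.contDiffOn t).fderivWithin hu (by norm_num)
      have hval : ∀ u w, partialDeriv P.dom u (partialDeriv P.dom w f) t (O.C φ, O.S φ, 0)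
          = fderivWithin ℝ (fderivWithin ℝ (f t) P.dom) P.dom (O.C φ, O.S φ, 0) u w := fun u w => by
        have h1 := ((hcd.differentiableOn (by norm_num)) _ hp).hasFDerivWithinAt.clm_apply
          (hasFDerivWithinAt_const w _ P.dom)
        exact (DFunLike.congr_fun (h1.fderivWithin (hu _ hp)) u).trans (by simp)
      have hcl : ((O.C φ, O.S φ, (0 : ℝ)) : Space) ∈ closure (interior P.dom) := by
        have h1 := P.mem_dom.1 hp
        rw [PerturbedSystem.dom, phaseDomain, interior_prod_eq, interior_prod_eq, interior_Ioo, interior_Ioo,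
          interior_Ico, closure_prod_eq, closure_prod_eq, closure_Ioo P.ε₀_pos.ne]
        exact ⟨subset_closure (abs_lt.1 h1.1), subset_closure (abs_lt.1 h1.2.1), ⟨le_rfl, P.ε₀_pos.le⟩⟩
      have hsymm := ((hf.contDiffOn t).contDiffWithinAt hp).isSymmSndFDerivWithinAt (by simp; norm_num) hu hcl hp
      rw [onOrbit, onOrbit, hval, hval]
      exact hsymm _ _
    rw [e]
    exact (hdir (d1 2) e1 i hi).isAngleAnalytic hG (d2 2 i)

end GeneratingOrbit

/-! ### The averaging functions in the case `ν = 0` -/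

lemma IsAngleAnalytic.isAveraging {T ω : ℝ} {v ζ : ℝ → ℝ → ℝ} (hv : IsAngleAnalytic T ω v)
    (hζ : IsAngleAnalytic T ω ζ)
    (hd : ∀ t φ, HasDerivAt (fun s => ζ s φ) (v t φ - _root_.deriv (ζ t) φ) t) :
    IsAveraging 0 v ζ (fun _ _ => 0) (fun t φ => _root_.deriv (ζ t) φ) (fun _ _ => 0) :=
  ⟨hv.1.cont, hζ.deriv.1.cont, continuous_const, hζ.hasDerivAt, fun _ φ => hasDerivAt_const φ 0,
    fun ε t φ => by simpa using hd t φ⟩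

namespace GeneratingOrbit

variable {P : PerturbedSystem} (O : GeneratingOrbit P)

lemma field_analytic (hG : O.GeneratingCondition) (hA : P.AnalyticInPhase) {f : ℝ → Space → ℝ}
    (hf : f ∈ ({P.XX, P.YY} : Set (ℝ → Space → ℝ))) :
    O.onOrbit f ∈ analyticAlgebra P.T O.ω ∧
    (∀ i, O.onOrbit (partialDeriv P.dom (phaseDirection i) f) ∈ analyticAlgebra P.T O.ω) ∧
    ∀ i j, O.onOrbit (partialDeriv P.dom (phaseDirection j) (partialDeriv P.dom (phaseDirection i) f))
      ∈ analyticAlgebra P.T O.ω := by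
  rcases hf with rfl | rfl
  exacts [isAngleAnalytic_onOrbit hG P.isPeriodicCn_XX fun j hj => (hA j hj).1,
    isAngleAnalytic_onOrbit hG P.isPeriodicCn_YY fun j hj => (hA j hj).2]

lemma isFieldClass_analyticAlgebra (hG : O.GeneratingCondition) (hA : P.AnalyticInPhase) :
    IsFieldClass O (analyticAlgebra P.T O.ω) where
  gen := hG
  isClass := isCoefficientClass_analyticAlgebra P.T_pos O.ω_pos
  mem_orbit v hv := by
    have c := fun x : ℝ => (analyticAlgebra P.T O.ω).algebraMap_mem x
    have hC : (fun _ φ => O.C φ) ∈ analyticAlgebra P.T O.ω := O.isAngleAnalytic_C_S.1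
    have hS : (fun _ φ => O.S φ) ∈ analyticAlgebra P.T O.ω := O.isAngleAnalytic_C_S.2
    have hα : (fun _ φ => O.α φ) ∈ analyticAlgebra P.T O.ω := by
      simp only [O.α_eq]
      exact add_mem (mul_mem (mul_mem (c P.γ) (sub_mem (pow_mem hS 3) hS)) (sub_mem hS (c O.l)))
        (mul_mem (sub_mem hC (c O.k)) (sub_mem (pow_mem hC 3) hC))
    have hi : (fun _ φ => (O.α φ)⁻¹) ∈ analyticAlgebra P.T O.ω :=
      IsAngleAnalytic.inv O.ω_pos hα (O.α_ne_zero hG)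
    have hβ : (fun _ φ => O.β φ) ∈ analyticAlgebra P.T O.ω := by
      simp only [O.β_eq hG, ρ, Ck, Sl, div_eq_mul_inv]
      exact mul_mem (sub_mem (c _) (mul_mem (add_mem
        (mul_mem (sub_mem (mul_mem (c 3) (pow_mem hC 2)) (c 1)) (pow_mem (sub_mem hC (c O.k)) 2))
        (mul_mem (mul_mem (c P.γ) (sub_mem (mul_mem (c 3) (pow_mem hS 2)) (c 1)))
          (pow_mem (sub_mem hS (c O.l)) 2))) (pow_mem hi 2))) (c 2⁻¹)
    simp only [mem_insert_iff, mem_singleton_iff] at hv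
    rcases hv with rfl | rfl | rfl | rfl
    exacts [hC, hS, hi, hβ]
  mem_field _ h := (O.field_analytic hG hA h).1
  mem_field' _ h := (O.field_analytic hG hA h).2.1

/-- The averaging functions of the case `ν = 0`. -/
lemma exists_averagingSetup_zero (hA : P.AnalyticInPhase) (h : O.Admissible0) :
    IsTransportSolution P.T O.ω O.rhsG0 O.gTilde0 ∧ IsTransportSolution P.T O.ω O.rhsH0 O.hTilde0 ∧
    IsTransportSolution P.T O.ω O.rhsF0 O.fTilde0 ∧ IsTransportSolution P.T O.ω O.rhsδ0 O.δTilde0 ∧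
    ∃ D : AveragingSetup O 0 (analyticAlgebra P.T O.ω),
      D.G₀ = O.g0 ∧ D.G₁ = (fun _ _ => 0) ∧ D.F₀ = O.fTilde0 := by
  obtain ⟨hG, hS, hL⟩ := h
  have hT := P.T_pos
  have hω := O.ω_pos
  have c := fun x : ℝ => (analyticAlgebra P.T O.ω).algebraMap_mem x
  have hFC := O.isFieldClass_analyticAlgebra hG hA
  have hRo := hFC.mem_Ro
  have hΦ := hFC.mem_Φo
  have hZ := hFC.mem_Z
  have hRε := hFC.mem_RεO
  have hq := hFC.mem_q
  have cont : ∀ {v : ℝ → ℝ → ℝ}, v ∈ analyticAlgebra P.T O.ω → Continuous fun p : Plane => v p.1 p.2 :=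
    fun h => h.1.cont
  have sol : ∀ {v : ℝ → ℝ → ℝ}, v ∈ analyticAlgebra P.T O.ω → average P.T O.ω v = 0 → _ := fun hv h0 =>
    IsAngleAnalytic.transportSolution hT hω hS hv h0
  have eG : O.rhsG0 = O.Ro := by
    funext t φ
    rw [rhsG0, hG.1, sub_zero]
  obtain ⟨sG, aG, dG⟩ := sol (eG ▸ hRo : O.rhsG0 ∈ _) (eG ▸ hG.1)
  have hg : O.gTilde0 ∈ analyticAlgebra P.T O.ω := aG
  have hg' : O.gPrime0 ∈ analyticAlgebra P.T O.ω := aG.deriv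
  have hG0 : O.g0 ∈ analyticAlgebra P.T O.ω := add_mem (c O.gBar0) hg
  have dG0 : ∀ t φ, HasDerivAt (fun s => O.g0 s φ) (O.Ro t φ - deriv (O.g0 t) φ) t := fun t φ => by
    have e : deriv (O.g0 t) φ = deriv (O.gTilde0 t) φ := deriv_const_add O.gBar0
    rw [e, ← eG]
    exact (dG t φ).const_add O.gBar0
  have hgp : (fun t φ => deriv (O.g0 t) φ) = O.gPrime0 :=
    funext fun t => funext fun φ => deriv_const_add O.gBar0
  have hgq : (fun t φ => O.gPrime0 t φ * O.q φ) ∈ analyticAlgebra P.T O.ω := mul_mem hg' hq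
  have hw : (fun t φ => O.Z t φ - O.gPrime0 t φ * O.q φ) ∈ analyticAlgebra P.T O.ω := sub_mem hZ hgq
  have eL : average P.T O.ω (fun t φ => O.Z t φ - O.gPrime0 t φ * O.q φ) = O.L0 :=
    average_sub (cont hZ) (cont hgq)
  have hH : O.rhsH0 ∈ analyticAlgebra P.T O.ω := sub_mem hw (c O.L0)
  have hF : O.rhsF0 ∈ analyticAlgebra P.T O.ω :=
    sub_mem (add_mem (mul_mem hG0 hZ) hRε) (mul_mem hg' (add_mem hΦ (mul_mem hG0 hq)))
  have hΘ : O.Θ0 ∈ analyticAlgebra P.T O.ω := add_mem hΦ (mul_mem hq hG0)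
  have hδ : O.rhsδ0 ∈ analyticAlgebra P.T O.ω := sub_mem hΘ (c _)
  have zH : average P.T O.ω O.rhsH0 = 0 := by
    refine (average_sub (cont hw) continuous_const).trans ?_
    rw [eL, average_const hT hω, sub_self]
  have zδ : average P.T O.ω O.rhsδ0 = 0 := by
    refine (average_sub (cont hΘ) continuous_const).trans ?_
    rw [average_const hT hω, avg, sub_self]
  have zF : average P.T O.ω O.rhsF0 = 0 := by
    have e1 : O.rhsF0 = fun t φ => ((O.gBar0 * (O.Z t φ - O.gPrime0 t φ * O.q φ)
        + O.gTilde0 t φ * (O.Z t φ - O.gPrime0 t φ * O.q φ)) + O.RεO t φ) - 0 - O.gPrime0 t φ * O.Φo t φ := by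
      funext t φ
      simp only [rhsF0, g0]
      ring
    have e3 := average_combination (T := P.T) (ω := O.ω)
      (a := fun t φ => O.gBar0 * (O.Z t φ - O.gPrime0 t φ * O.q φ))
      (b := fun t φ => O.gTilde0 t φ * (O.Z t φ - O.gPrime0 t φ * O.q φ)) (r := O.RεO) (g := fun _ _ => 0)
      (f := fun t φ => O.gPrime0 t φ * O.Φo t φ) (cont (mul_mem (c O.gBar0) hw)) (cont (mul_mem hg hw))
      (cont hRε) continuous_const (cont (mul_mem hg' hΦ))
    rw [e1, e3, average_const_mul, eL, average_const hT hω]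
    have : O.gBar0 * O.L0 = O.avg (fun t φ => O.gPrime0 t φ * O.Φo t φ) - O.avg O.RεO
        - O.avg (fun t φ => O.gTilde0 t φ * (O.Z t φ - O.gPrime0 t φ * O.q φ)) := div_mul_cancel₀ _ hL
    rw [this, avg, avg, avg]
    ring
  obtain ⟨sH, aH, dH⟩ := sol hH zH
  obtain ⟨sF, aF, dF⟩ := sol hF zF
  obtain ⟨sδ, aδ, dδ⟩ := sol hδ zδ
  refine ⟨sG, sH, sF, sδ,
    { toIsFieldClass := hFC, L := O.L0, Θbar := O.avg O.Θ0,
      G₀ := O.g0, G₁ := fun _ _ => 0, G₀' := O.gPrime0, G₁' := fun _ _ => 0,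
      H₀ := O.hTilde0, H₁ := fun _ _ => 0, H₀' := fun t φ => deriv (O.hTilde0 t) φ, H₁' := fun _ _ => 0,
      F₀ := O.fTilde0, F₁ := fun _ _ => 0, F₀' := fun t φ => deriv (O.fTilde0 t) φ, F₁' := fun _ _ => 0,
      Δ₀ := O.δTilde0, Δ₁ := fun _ _ => 0, Δ₀' := fun t φ => deriv (O.δTilde0 t) φ, Δ₁' := fun _ _ => 0,
      Θ' := fun t φ => deriv (O.Θ0 t) φ, L_ne := hL, mem_functions := ?_,
      mem_field'' := fun f h => (O.field_analytic hG hA h).2.2,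
      avgG := hgp ▸ IsAngleAnalytic.isAveraging hRo hG0 dG0, avgH := IsAngleAnalytic.isAveraging hH aH dH,
      avgF := ?_, avgΔ := IsAngleAnalytic.isAveraging hδ aδ dδ, deriv_Θ := IsAngleAnalytic.hasDerivAt hΘ,
      eqG := fun t φ ε => by simp [G], eqH := fun t φ ε => by simp [H], eqF := fun t φ ε => by simp [F],
      eqΔ := fun t φ ε => by simp [Δ], corrector := ?_ }, rfl, rfl, rfl⟩
  · intro v hv
    simp only [mem_insert_iff, mem_singleton_iff] at hv
    rcases hv with rfl | rfl | rfl | rfl | rfl | rfl | rfl | rfl | rfl | rfl | rfl | rfl | rfl | rfl |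
      rfl | rfl | rfl
    exacts [hG0, c 0, hg', c 0, aH, c 0, aH.deriv, c 0, aF, c 0, aF.deriv, c 0, aδ, c 0, aδ.deriv, c 0,
      IsAngleAnalytic.deriv hΘ]
  · simp only [sub_zero]
    exact IsAngleAnalytic.isAveraging hF aF dF
  · intro v hv hav
    obtain ⟨-, a, d⟩ := sol hv hav
    have bd : ∀ {v : ℝ → ℝ → ℝ}, v ∈ analyticAlgebra P.T O.ω → ∃ K, 0 ≤ K ∧ ∀ t φ, |v t φ| ≤ K := fun h =>
      exists_abs_le_of_two_periodic hT hω h.1.cont h.1.periodic_t h.1.periodic_φ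
    obtain ⟨K₀, hK₀, b₀⟩ := bd a
    obtain ⟨K₁, hK₁, b₁⟩ := bd a.deriv
    have h0 : |(0 : ℝ)| ≤ K₀ + K₁ := by rw [abs_zero]; positivity
    exact ⟨_, _, _, _, K₀ + K₁, IsAngleAnalytic.isAveraging hv a d, fun t φ =>
      ⟨(b₀ t φ).trans (by linarith), h0, (b₁ t φ).trans (by linarith), h0⟩⟩

end GeneratingOrbit

end

theorem corollary2 (P : PerturbedSystem) (O : GeneratingOrbit P) :
    (P.AnalyticInPhase → O.Admissible0 →
      IsTransportSolution P.T O.ω O.rhsG0 O.gTilde0 ∧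
      IsTransportSolution P.T O.ω O.rhsH0 O.hTilde0 ∧
      IsTransportSolution P.T O.ω O.rhsF0 O.fTilde0 ∧
      IsTransportSolution P.T O.ω O.rhsδ0 O.δTilde0 ∧
      ∃ ε₁ : ℝ, 0 < ε₁ ∧ ε₁ ≤ P.ε₀ ∧ ∃ Γ Ω : ℝ → ℝ → ℝ → ℝ,
        O.IsAveragedFamily 0 ε₁ Γ Ω ∧
        (∀ ε ∈ Set.Ioo 0 ε₁, O.IsC1TwoPeriodic (fun t φ => O.Υ 0 Γ Ω t φ ε) ∧
          O.IsInvariantSurface 0 ε (fun t φ => O.Υ 0 Γ Ω t φ ε)) ∧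
        ∃ K : ℝ, ∀ ε ∈ Set.Ioo 0 ε₁, ∀ t φ : ℝ,
          |O.Υ 0 Γ Ω t φ ε - (O.α φ)⁻¹ * (O.g0 t φ * ε +
            (O.fTilde0 t φ + Γ t φ 0 + O.β φ * O.g0 t φ ^ 2) * ε ^ 2)| ≤ K * ε ^ 3) ∧
    (O.Admissible1 →
      ∃ ε₁ : ℝ, 0 < ε₁ ∧ ε₁ ≤ P.ε₀ ∧ ∃ Γ Ω : ℝ → ℝ → ℝ → ℝ,
        O.IsAveragedFamily 1 ε₁ Γ Ω ∧
        (∀ ε ∈ Set.Ioo 0 ε₁, O.IsC1TwoPeriodic (fun t φ => O.Υ 1 Γ Ω t φ ε) ∧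
          O.IsInvariantSurface 1 ε (fun t φ => O.Υ 1 Γ Ω t φ ε)) ∧
        ∃ K : ℝ, ∀ ε ∈ Set.Ioo 0 ε₁, ∀ t φ : ℝ,
          |O.Υ 1 Γ Ω t φ ε - (O.α φ)⁻¹ * ((O.gBar1 + O.gHat1 φ) * ε +
            (O.gTilde1 t φ + O.fHat1 φ + Γ t φ 0 + O.β φ * (O.gBar1 + O.gHat1 φ) ^ 2) * ε ^ 2)|
            ≤ K * ε ^ 3) := by
  refine ⟨fun hA h => ?_, fun h => O.exists_invariantSurface_one h⟩
  obtain ⟨hg, hh, hf, hδ, D, h1, h2, h3⟩ := O.exists_averagingSetup_zero hA h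
  have := D.exists_invariantSurface
  simp only [h1, h2, h3, zero_add] at this
  exact ⟨hg, hh, hf, hδ, this⟩
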